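/- **Setting.** Let $F$ be a non-archimedean local field of characteristic $0$ and odd residual characteristic $p$, with ring of integers $\mathcal O$, maximal ideal $\mathfrak p$, residue field of order $q$, a fixed prime element $\varpi$, absolute value normalized by $|\varpi|=q^{-1}$, Haar measure $dx$ with $\int_{\mathcal O}dx=1$, and a fixed $\xi\in\mathcal O^\times\setminus\mathcal O^{\times 2}$. Let $(\cdot,\cdot)_2$ be the quadratic Hilbert symbol and $\chi_a(x)=(x,a)_2$. Characters are continuous homomorphisms to $\mathbb C^\times$. The conductor $c(\psi)$ of a nontrivial additive character $\psi$ of $F$ is the least integer $c$ with $\psi|_{\mathfrak p^c}=1$; put $\psi_a(x)=\psi(ax)$. The conductor $c(\eta)$ of a character $\eta$ of $\mathcal O^\times$ is $0$ if $\eta=1$ and otherwise the least $c\ge1$ with $\eta|_{1+\mathfrak p^c}=1$; for a character $\mu$ of $F^\times$ put $c(\mu)=c(\mu|_{\mathcal O^\times})$, and write $\eta\mu^{\pm1}$ for $\eta\cdot\mu^{\pm1}|_{\mathcal O^\times}$. Let $\gamma_F(\psi)$ be the Weil index of $x\mapsto\psi(x^2)$ and $\gamma_F(a,\psi)=\gamma_F(\psi_a)/\gamma_F(\psi)$.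 Let $\widetilde G=\mathrm{SL}_2(F)\times\{\pm1\}$ be the metaplectic double cover, with product $(g_1,\epsilon_1)(g_2,\epsilon_2)=(g_1g_2,\epsilon_1\epsilon_2\,\boldsymbol c(g_1,g_2))$, where $\boldsymbol c(g_1,g_2)=\big(\tfrac{\boldsymbol x(g_1)}{\boldsymbol x(g_1g_2)},\tfrac{\boldsymbol x(g_2)}{\boldsymbol x(g_1g_2)}\big)_2$ and $\boldsymbol x\begin{pmatrix}a&b\\c&d\end{pmatrix}=c$ if $c\ne0$, $=d$ if $c=0$. Put $t(a)=\mathrm{diag}(a,a^{-1})$, $n(b)=\begin{pmatrix}1&b\\&1\end{pmatrix}$, $n^{\mathrm{op}}(b)=\begin{pmatrix}1&\\b&1\end{pmatrix}$, $w=\begin{pmatrix}&1\\-1&\end{pmatrix}$, and let $\widetilde B$ be the preimage in $\widetilde G$ of the group of upper triangular matrices. Fix $\varepsilon\in\{0,1\}$ and an additive character $\psi$ of $F$ with $c(\psi)=-\varepsilon$. For $m\ge0$ let $$K_m=\Big\{\begin{pmatrix}a&b\\c&d\end{pmatrix}\in\mathrm{SL}_2(F)\;:\;a,d\in\mathcal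 O,\ b\in\mathfrak p^{-\varepsilon},\ c\in\mathfrak p^{m+\varepsilon}\Big\},$$ regarded as a subgroup of $\widetilde G$ by the unique splitting of the cover over $K_0$. For a character $\mu$ of $F^\times$, $\pi_\psi(\mu)$ is the space of locally constant $f:\widetilde G\to\mathbb C$ with $f((t(a),\epsilon)(n(b),1)g)=\epsilon\,|a|\,\mu(a)\,\gamma_F(a,\psi)^{-1}f(g)$, on which $\widetilde G$ acts by right translation. For a character $\eta$ of $\mathcal O^\times$, $\pi_\psi(\mu)^{K_m}_\eta$ is the space of $f\in\pi_\psi(\mu)$ on which every $\begin{pmatrix}a&b\\c&d\end{pmatrix}\in K_m$ acts by $\eta(d)$ (interpreted as $1$ if $\eta=1$) if $m\ge c(\eta)$, and is $0$ if $m<c(\eta)$. Let $M=c^\varepsilon_\eta(\pi_\psi(\mu))\in\{0,1,2,\dots,\infty\}$ be the least $m$ with $\pi_\psi(\mu)^{K_m}_\eta\neq0$. For nontrivial additive $\Psi$ put $$\lambda_\Psi(f)=\lim_{r\to\infty}\int_{\mathfrak p^{-r}}f((w\,n(x),1))\,\overline{\Psi(x)}\,dx ,\qquad f\in\pi_\psi(\mu).$$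 **Statement.** Let $\mu$ be a character of $F^\times$ and $\eta$ a character of $\mathcal O^\times$ with $\eta(-1)=\mu(-1)$. The limits $\lambda_\Psi(f)$ exist. Let $f^m_w$ (resp. $f^m_1$, $f^m_{i,2}$, $f^m_{i,\xi}$) denote any nonzero vector of $\pi_\psi(\mu)^{K_m}_\eta$ supported on $\widetilde B(x,1)K_m$ with $x=w$ (resp. $1$, $n^{\mathrm{op}}(\varpi^{c(\eta\mu^{-1})+i+\varepsilon})$, $n^{\mathrm{op}}(\xi\varpi^{c(\eta\mu^{-1})+i+\varepsilon})$). Below, each decomposition includes the assertion that vectors of the types that occur in it exist, and it and the nonvanishing assertions hold for every choice of them. For two vectors $f,f'$ and characters $\Psi,\Psi'$, say that $(f,f';\Psi,\Psi')$ is *cross-nonvanishing* if at least one member of each of the pairs $\{\lambda_\Psi(f),\lambda_\Psi(f')\}$, $\{\lambda_\Psi(f),\lambda_{\Psi'}(f)\}$, $\{\lambda_\Psi(f'),\lambda_{\Psi'}(f')\}$, $\{\lambda_{\Psi'}(f),\lambda_{\Psi'}(f')\}$ is nonzero. 1. If $c(\mu)=c(\eta)=0$, then $M=0$ and $\pi_\psi(\mu)^{K_0}_1=\mathbb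 Cf^0_w$, $\ \pi_\psi(\mu)^{K_1}_1=\mathbb Cf^1_w\oplus\mathbb Cf^1_1$, $\ \pi_\psi(\mu)^{K_2}_1=\mathbb Cf^2_w\oplus\mathbb Cf^2_1\oplus\mathbb Cf^2_{1,2}\oplus\mathbb Cf^2_{1,\xi}$. Moreover $\lambda_\psi(f^0_w)\ne0$ if and only if $\mu\neq\chi_\xi|\cdot|^{-1/2}$; $\lambda_{\psi_\xi}(f^0_w)\neq0$ if and only if $\mu\ne|\cdot|^{-1/2}$; the numbers $\lambda_\psi(f^1_w)$, $\lambda_\psi(f^1_1)$, $\lambda_{\psi_\xi}(f^1_w)$, $\lambda_{\psi_\xi}(f^1_1)$ are all nonzero; and $(f^2_{1,2},f^2_{1,\xi};\psi_\varpi,\psi_{\xi\varpi})$ is cross-nonvanishing. 2. If $\mu|_{\mathcal O^\times}$ is nontrivial quadratic and $\eta=\mu|_{\mathcal O^\times}$, then $M=1$ and $\pi_\psi(\mu)^{K_1}_\eta=\mathbb Cf^1_w\oplus\mathbb Cf^1_1$, $\ \pi_\psi(\mu)^{K_2}_\eta=\mathbb Cf^2_w\oplus\mathbb Cf^1_1\oplus\mathbb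 Cf^2_{1,2}\oplus\mathbb Cf^2_{1,\xi}=\mathbb Cf^2_w\oplus\mathbb Cf^2_1\oplus\mathbb Cf^2_{1,2}\oplus\mathbb Cf^2_{1,\xi}$. Moreover $\lambda_\psi(f^1_w)$, $\lambda_\psi(f^1_1)$, $\lambda_{\psi_\xi}(f^1_w)$, $\lambda_{\psi_\xi}(f^1_1)$ are all nonzero, and $(f^2_{1,2},f^2_{1,\xi};\psi_\varpi,\psi_{\xi\varpi})$ is cross-nonvanishing. 3. If $\eta=\mu|_{\mathcal O^\times}\ne\mu^{-1}|_{\mathcal O^\times}$, then $M=c(\mu)$ and $\pi_\psi(\mu)^{K_M}_\eta=\mathbb Cf^M_w$, $\ \pi_\psi(\mu)^{K_{M+1}}_\eta=\mathbb Cf^{M+1}_w\oplus\mathbb Cf^{M+1}_{1,2}\oplus\mathbb Cf^{M+1}_{1,\xi}$. Moreover $\lambda_\psi(f^M_w)\ne0$, $\lambda_{\psi_\xi}(f^M_w)\neq0$, and $(f^{M+1}_{1,2},f^{M+1}_{1,\xi};\psi_\varpi,\psi_{\xi\varpi})$ is cross-nonvanishing. 4. If $0<c(\eta\mu^{-1})\le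 c(\eta\mu)$, then $M$ is finite and $\pi_\psi(\mu)^{K_M}_\eta=\mathbb Cf^M_{0,2}\oplus\mathbb Cf^M_{0,\xi}$, $\ \pi_\psi(\mu)^{K_{M+1}}_\eta=\mathbb Cf^{M+1}_{0,2}\oplus\mathbb Cf^{M+1}_{0,\xi}\oplus\mathbb Cf^{M+1}_{1,2}\oplus\mathbb Cf^{M+1}_{1,\xi}$. Moreover, for $i=0,1$, $(f^{M+i}_{i,2},f^{M+i}_{i,\xi};\psi_{\varpi^i},\psi_{\xi\varpi^i})$ is cross-nonvanishing. -/

import Mathlib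

open Filter Topology MeasureTheory
open scoped MatrixGroups NNReal

namespace MetaplecticSL2

noncomputable section

/-! ## The local field, its characters and its Haar measure

`F` is a locally compact ultrametric normed field; in the theorem its norm is the normalized
absolute value and its characteristic is zero. -/

/-- The ring of integers `{x | ‖x‖ ≤ 1}` as a valuation subring of `F`. -/
def ringInt (F : Type*) [NontriviallyNormedField F] [IsUltrametricDist F] : ValuationSubring F :=
  (NormedField.valuation (K := F)).valuationSubring

/-- The number of elements of the residue field. -/
def resCard (F : Type*) [NontriviallyNormedField F] [IsUltrametricDist F] : ℕ :=
  Nat.card (IsLocalRing.ResidueField (ringInt F))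

/-- The group of units of the ring of integers, as a subgroup of `Fˣ`. -/
def unitsInt (F : Type*) [NontriviallyNormedField F] : Subgroup Fˣ where
  carrier := {u | ‖(u : F)‖ = 1}
  mul_mem' := by
    intro a b ha hb
    have ha' : ‖(a : F)‖ = 1 := ha
    have hb' : ‖(b : F)‖ = 1 := hb
    simp [ha', hb']
  one_mem' := by simp
  inv_mem' := by
    intro a ha
    have ha' : ‖(a : F)‖ = 1 := ha
    simp [ha']

/-- The element `-1` of the unit group. -/
def negOneUnit (F : Type*) [NontriviallyNormedField F] : unitsInt F :=
  ⟨-1, by show ‖((-1 : Fˣ) : F)‖ = 1; simp⟩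

/-- The fractional ideal `𝔭 ^ n`, for `n : ℤ`. -/
def primePow (F : Type*) [NontriviallyNormedField F] [IsUltrametricDist F] (n : ℤ) : Set F :=
  {x | ‖x‖ ≤ (resCard F : ℝ) ^ (-n)}

/-- The Haar measure `dx` on `F` giving volume one to the ring of integers. -/
def haarF (F : Type*) [NontriviallyNormedField F] [IsUltrametricDist F] [ProperSpace F]
    [MeasurableSpace F] [BorelSpace F] : Measure F :=
  Measure.addHaarMeasure
    { carrier := Metric.closedBall (0 : F) 1
      isCompact' := isCompact_closedBall 0 1
      interior_nonempty' :=
        ⟨0, Metric.ball_subset_interior_closedBall (Metric.mem_ball_self one_pos)⟩ }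

/-- The conductor `c(ψ)` of a nontrivial additive character: the least integer `c` such that
`ψ` is trivial on `𝔭 ^ c`. -/
def addCond {F : Type*} [NontriviallyNormedField F] [IsUltrametricDist F]
    (ψ : AddChar F ℂ) : ℤ :=
  sInf {c : ℤ | ∀ x ∈ primePow F c, ψ x = 1}

/-- The conductor `c(η)` of a character of the unit group: `0` if `η` is trivial, and otherwise
the least positive `c` such that `η` is trivial on `1 + 𝔭 ^ c`. (For `c = 0` the condition
on `u` below holds for every unit `u`.) -/
def unitCond {F : Type*} [NontriviallyNormedField F] [IsUltrametricDist F]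
    (η : unitsInt F →* ℂˣ) : ℕ :=
  sInf {c : ℕ | ∀ u : unitsInt F, ((u : Fˣ) : F) - 1 ∈ primePow F c → η u = 1}

/-- The restriction of a character of `Fˣ` to the units of the ring of integers. -/
def resUnits {F : Type*} [NontriviallyNormedField F] (μ : Fˣ →* ℂˣ) : unitsInt F →* ℂˣ :=
  μ.comp (unitsInt F).subtype

open Classical in
/-- The quadratic Hilbert symbol `(a, b)₂` of nonzero elements `a`, `b`. -/
def hilbert {F : Type*} [Field F] (a b : F) : ℤˣ :=
  if ∃ x y z : F, (x, y, z) ≠ (0, 0, 0) ∧ z ^ 2 = a * x ^ 2 + b * y ^ 2 then 1 else -1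

/-- The (unnormalized) Weil index of `x ↦ ψ (x ^ 2)`: the Fresnel integral
`lim_r ∫_{𝔭 ^ (-r)} ψ (x ^ 2) dx`, taken for the measure `q ^ (c(ψ) / 2) dx`, which is self-dual
for the pairing `(x, y) ↦ ψ (2 x y)`. (The integrals are constant for large `r`.) -/
def weilIndex {F : Type*} [NontriviallyNormedField F] [IsUltrametricDist F] [ProperSpace F]
    [MeasurableSpace F] [BorelSpace F] (ψ : AddChar F ℂ) : ℂ :=
  (((resCard F : ℝ) ^ ((addCond ψ : ℝ) / 2) : ℝ) : ℂ) *
    limUnder atTop (fun r : ℕ => ∫ x in primePow F (-(r : ℤ)), ψ (x ^ 2) ∂(haarF F))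

/-- The normalized Weil index `γ_F(a, ψ) = γ_F(ψ_a) / γ_F(ψ)`, where `ψ_a x = ψ (a x)`. -/
def weilRatio {F : Type*} [NontriviallyNormedField F] [IsUltrametricDist F] [ProperSpace F]
    [MeasurableSpace F] [BorelSpace F] (a : F) (ψ : AddChar F ℂ) : ℂ :=
  weilIndex (ψ.mulShift a) / weilIndex ψ

/-! ## The metaplectic group -/

section Group

variable {F : Type*} [Field F]

def tMat (a : Fˣ) : SL(2, F) := ⟨!![(a : F), 0; 0, ((a⁻¹ : Fˣ) : F)], by simp⟩

def nMat (b : F) : SL(2, F) := ⟨!![1, b; 0, 1], by simp⟩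

def nOp (c : F) : SL(2, F) := ⟨!![1, 0; c, 1], by simp⟩

def wMat : SL(2, F) := ⟨!![0, 1; -1, 0], by simp⟩

open Classical in
/-- The lower left entry if it is nonzero, and otherwise the lower right entry. -/
def kubotaX (g : SL(2, F)) : F := if g.1 1 0 ≠ 0 then g.1 1 0 else g.1 1 1

/-- The Kubota cocycle. -/
def kubota (g h : SL(2, F)) : ℤˣ :=
  hilbert (kubotaX g / kubotaX (g * h)) (kubotaX h / kubotaX (g * h))

end Group

/-- The metaplectic double cover of `SL₂(F)`, as the set `SL₂(F) × {±1}`. -/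
@[ext]
structure Mp (F : Type*) [Field F] where
  mat : SL(2, F)
  sgn : ℤˣ

instance instMulMp (F : Type*) [Field F] : Mul (Mp F) :=
  ⟨fun g h => ⟨g.mat * h.mat, g.sgn * h.sgn * kubota g.mat h.mat⟩⟩

/-- The topology of the metaplectic group: the sets `{g * (k, 1) | k ∈ U}`, where `U` is a
neighbourhood of `1` in `SL₂(F)`, form a neighbourhood basis at `g` (the map `k ↦ (k, 1)` is a
homomorphism on a small open subgroup). This is not the product topology on `SL₂(F) × {±1}`. -/
instance instTopMp (F : Type*) [NontriviallyNormedField F] : TopologicalSpace (Mp F) where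
  IsOpen S := ∀ g ∈ S, ∀ᶠ k in 𝓝 (1 : SL(2, F)), g * (⟨k, 1⟩ : Mp F) ∈ S
  isOpen_univ := fun _ _ => Eventually.of_forall fun _ => trivial
  isOpen_inter := fun _ _ hS hT g hg => (hS g hg.1).and (hT g hg.2)
  isOpen_sUnion := fun _ h g ⟨S, hS, hg⟩ =>
    (h S hS g hg).mono fun _ hk => ⟨S, hS, hk⟩

/-- The group `K^ε_m`, as a subset of `SL₂(F)`: the matrices with diagonal entries in `𝒪`, upper
right entry in `𝔭 ^ (-ε)` and lower left entry in `𝔭 ^ (m + ε)`. -/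
def levelSet (F : Type*) [NontriviallyNormedField F] [IsUltrametricDist F] (ε m : ℕ) :
    Set SL(2, F) :=
  {k | k.1 0 0 ∈ primePow F 0 ∧ k.1 1 1 ∈ primePow F 0 ∧
    k.1 0 1 ∈ primePow F (-(ε : ℤ)) ∧ k.1 1 0 ∈ primePow F ((m : ℤ) + ε)}

/-- The splitting `s^ε` over `K^ε_0`: the unique function on `K^ε_0` such that `k ↦ (k, s^ε(k))` is
multiplicative (its values off `K^ε_0` are arbitrary and never used). -/
def splitting (F : Type*) [NontriviallyNormedField F] [IsUltrametricDist F] (ε : ℕ) :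
    SL(2, F) → ℤˣ :=
  Classical.epsilon fun s : SL(2, F) → ℤˣ => ∀ k ∈ levelSet F ε 0, ∀ l ∈ levelSet F ε 0,
    (⟨k, s k⟩ : Mp F) * ⟨l, s l⟩ = ⟨k * l, s (k * l)⟩

/-- An element of `K^ε_0` regarded as an element of the metaplectic group. -/
def liftK {F : Type*} [NontriviallyNormedField F] [IsUltrametricDist F] (ε : ℕ)
    (k : SL(2, F)) : Mp F :=
  ⟨k, splitting F ε k⟩

/-- The double coset `B̃ (x, 1) K^ε_m`, where `B̃` is the preimage of the upper triangular
subgroup. -/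
def doubleCoset {F : Type*} [NontriviallyNormedField F] [IsUltrametricDist F] (ε m : ℕ)
    (x : SL(2, F)) : Set (Mp F) :=
  {g | ∃ (a : Fˣ) (b : F) (e : ℤˣ), ∃ k ∈ levelSet F ε m,
    g = (⟨tMat a * nMat b, e⟩ : Mp F) * ⟨x, 1⟩ * liftK ε k}

/-! ## Principal series, the spaces of `(K_m, η)`-equivariant vectors, Whittaker functionals -/

section Rep

variable {F : Type*} [NontriviallyNormedField F] [IsUltrametricDist F] [ProperSpace F]
  [MeasurableSpace F] [BorelSpace F]

/-- The genuine character `χ_ψ((t(a), e)) = e γ_F(a, ψ)⁻¹` of the preimage of the torus. -/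
def chiPsi (ψ : AddChar F ℂ) (a : Fˣ) (e : ℤˣ) : ℂ :=
  ((e : ℤ) : ℂ) * (weilRatio (a : F) ψ)⁻¹

/-- The space of the principal series representation `π_ψ(μ)`, on which the metaplectic group acts
by right translation. -/
def principalSeries (ψ : AddChar F ℂ) (μ : Fˣ →* ℂˣ) : Submodule ℂ (Mp F → ℂ) where
  carrier := {f | IsLocallyConstant f ∧ ∀ (a : Fˣ) (e : ℤˣ) (b : F) (g : Mp F),
    f ((⟨tMat a, e⟩ : Mp F) * ⟨nMat b, 1⟩ * g) =
      ((‖(a : F)‖ : ℝ) : ℂ) * (μ a : ℂ) * chiPsi ψ a e * f g}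
  add_mem' := by
    rintro f g ⟨hf, hf'⟩ ⟨hg, hg'⟩
    refine ⟨hf.add hg, fun a e b x => ?_⟩
    simp only [Pi.add_apply, hf' a e b x, hg' a e b x]
    ring
  zero_mem' := ⟨IsLocallyConstant.const 0, fun a e b x => by simp⟩
  smul_mem' := by
    rintro c f ⟨hf, hf'⟩
    refine ⟨hf.comp (fun z => c * z), fun a e b x => ?_⟩
    simp only [Pi.smul_apply, smul_eq_mul, hf' a e b x]
    ring

open Classical in
/-- The character `(a, b; c, d) ↦ η(d)` of `K^ε_m`, for `m ≥ c(η)`. (If `d` is not a unit then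
`m = 0`, so `η` is trivial, and the value is `1`.) -/
def etaK (η : unitsInt F →* ℂˣ) (k : SL(2, F)) : ℂ :=
  if h : ∃ u : unitsInt F, ((u : Fˣ) : F) = k.1 1 1 then (η h.choose : ℂ) else 1

open Classical in
/-- The space `π_ψ(μ)^{K^ε_m}_η`. It is zero by definition if `m < c(η)`. -/
def eqSpace (ψ : AddChar F ℂ) (μ : Fˣ →* ℂˣ) (η : unitsInt F →* ℂˣ) (ε m : ℕ) :
    Submodule ℂ (Mp F → ℂ) :=
  if unitCond η ≤ m then
    { carrier := {f | f ∈ principalSeries ψ μ ∧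
        ∀ k ∈ levelSet F ε m, ∀ x : Mp F, f (x * liftK ε k) = etaK η k * f x}
      add_mem' := by
        rintro f g ⟨hf, hf'⟩ ⟨hg, hg'⟩
        refine ⟨add_mem hf hg, fun k hk x => ?_⟩
        simp only [Pi.add_apply, hf' k hk x, hg' k hk x]
        ring
      zero_mem' := ⟨zero_mem _, fun k hk x => by simp⟩
      smul_mem' := by
        rintro c f ⟨hf, hf'⟩
        refine ⟨Submodule.smul_mem _ c hf, fun k hk x => ?_⟩
        simp only [Pi.smul_apply, smul_eq_mul, hf' k hk x]
        ring }
  else ⊥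

/-- The conductor `c^ε_η(π_ψ(μ))`: the least `m` with `π_ψ(μ)^{K^ε_m}_η ≠ 0`, and `+∞` if there is
none. -/
def etaConductor (ψ : AddChar F ℂ) (μ : Fˣ →* ℂˣ) (η : unitsInt F →* ℂˣ) (ε : ℕ) : ℕ∞ :=
  ⨅ m ∈ {m : ℕ | eqSpace ψ μ η ε m ≠ ⊥}, (m : ℕ∞)

/-- `f` is a nonzero vector of `π_ψ(μ)^{K^ε_m}_η` supported on `B̃ (x, 1) K^ε_m`. -/
def IsCosetVector (ψ : AddChar F ℂ) (μ : Fˣ →* ℂˣ) (η : unitsInt F →* ℂˣ) (ε m : ℕ)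
    (x : SL(2, F)) (f : Mp F → ℂ) : Prop :=
  f ∈ eqSpace ψ μ η ε m ∧ f ≠ 0 ∧ Function.support f ⊆ doubleCoset ε m x

/-- The matrix `n^op(z ϖ ^ (c(η μ⁻¹) + i + ε))`; the cases `z = 1` and `z = ξ` are used. -/
def opRep (μ : Fˣ →* ℂˣ) (η : unitsInt F →* ℂˣ) (ε : ℕ) (ϖ : ringInt F) (z : unitsInt F)
    (i : ℕ) : SL(2, F) :=
  nOp (((z : Fˣ) : F) * (ϖ : F) ^ (unitCond (η * (resUnits μ)⁻¹) + i + ε))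

/-- `V = ℂ f₁ ⊕ ⋯ ⊕ ℂ f_n` for vectors `f_j` characterized by `P j`: such vectors exist, and any
choice of them is a basis of `V`. -/
def IsBasisFor {n : ℕ} (V : Submodule ℂ (Mp F → ℂ)) (P : Fin n → (Mp F → ℂ) → Prop) : Prop :=
  (∀ j, ∃ f, P j f) ∧
    ∀ f : Fin n → (Mp F → ℂ), (∀ j, P j (f j)) →
      LinearIndependent ℂ f ∧ Submodule.span ℂ (Set.range f) = V

/-- The integrals `∫_{𝔭 ^ (-r)} f((w n(x), 1)) conj(Ψ(x)) dx`. -/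
def whittakerPartial (Ψ : AddChar F ℂ) (f : Mp F → ℂ) (r : ℕ) : ℂ :=
  ∫ x in primePow F (-(r : ℤ)), f ⟨wMat * nMat x, 1⟩ * starRingEnd ℂ (Ψ x) ∂(haarF F)

/-- The functional `λ_Ψ(f) = lim_r ∫_{𝔭 ^ (-r)} f((w n(x), 1)) conj(Ψ(x)) dx`. -/
def whittaker (Ψ : AddChar F ℂ) (f : Mp F → ℂ) : ℂ :=
  limUnder atTop (whittakerPartial Ψ f)

/-- The equality of characters `μ = χ_a · |·| ^ (-1/2)` of `Fˣ`, where `χ_a x = (x, a)₂`. -/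
def IsHalfTwist (μ : Fˣ →* ℂˣ) (a : F) : Prop :=
  ∀ x : Fˣ, (μ x : ℂ) =
    ((hilbert (x : F) a : ℤ) : ℂ) * ((‖(x : F)‖ ^ (-(1 / 2) : ℝ) : ℝ) : ℂ)

/-- In each row and in each column of the `2 × 2` table with entries `λ_{Ψ₁}(f₁)`, `λ_{Ψ₁}(f₂)`;
`λ_{Ψ₂}(f₁)`, `λ_{Ψ₂}(f₂)` at least one entry is nonzero. -/
def CrossNonvanishing (Ψ₁ Ψ₂ : AddChar F ℂ) (f₁ f₂ : Mp F → ℂ) : Prop :=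
  (whittaker Ψ₁ f₁ ≠ 0 ∨ whittaker Ψ₁ f₂ ≠ 0) ∧
  (whittaker Ψ₁ f₁ ≠ 0 ∨ whittaker Ψ₂ f₁ ≠ 0) ∧
  (whittaker Ψ₁ f₂ ≠ 0 ∨ whittaker Ψ₂ f₂ ≠ 0) ∧
  (whittaker Ψ₂ f₁ ≠ 0 ∨ whittaker Ψ₂ f₂ ≠ 0)

end Rep

end

end MetaplecticSL2

open MetaplecticSL2

/-! Write q for `resCard F`, α = ημ⁻¹ and β = ημ on units, and χ(a) = |a| μ(a) γ(a, ψ)⁻¹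
(`torusChar`). A function with the transformation law of the principal series lives on the
projective line B\SL₂(F). It is given by its values in two charts, φ(y) = f(`rOp y`), where `rOp y`
has lower row (1, y), and Φ(t) = f(`nOp t`), glued by Φ(t) = χ(t⁻¹) φ(t⁻¹) (`genuine_nOp`). The
group K_m is generated by the elements n(b), t(u), nᵒᵖ(z) that it contains, and on these the lift
and the cocycle are explicit. Equivariance under (K_m, η) therefore becomes four elementary
conditions (`mem_eqSpace_iff`): φ is invariant under 𝔭^(-ε), φ(u²y) = α(u) φ(y), β(u) f(1) = f(1),
and Φ is invariant under 𝔭^(m+ε).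

For m > 0 the orbits of K_m on the line are |y| ≤ q^ε (the coset of w), |t| ≤ q^(-m-ε) (the coset of
1), and the sets of t₀u² with u a unit and ord t₀ = j + ε, 0 < j < m, two for each j. Homogeneity
under unit squares has to agree with the translation invariances. For m ≥ c(η), this allows a vector
on the first orbit exactly when α = 1, on the second exactly when β = 1, and on those of index j
exactly when c(α) ≤ j ≤ m - c(β). Sufficiency is the content of the `exists_cosetVector_*` lemmas
and necessity that of `level_eq_zero`; `isBasisFor_of_eval` turns both into bases. The conductor M
and all the decompositions are then read off from c(α) and c(β).

In the first chart λ_Ψ(f) = χ(-1) ∫ φ(y) Ψ(-y) dy. For the vector on the coset of w at positive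
level this is a constant times the volume of a ball. For the vector on the coset of 1 at level one a
single shell contributes, and Fourier inversion (`eq_zero_of_fourier`) shows that it does not
vanish. For the spherical vector a ball and a shell contribute; the shell is the Fourier transform
of the Weil index (`integral_weilIndex`), and the sum is a nonzero multiple of μ(ϖ) ± √q. The two
vectors of index j are dilates of each other, so that their table of Whittaker values is, up to
nonzero factors, (A B; B A), with A and B the Fourier coefficients of φ at -ϖ^i and -ξϖ^i. These
cannot both vanish (`fourier_ne_zero`).

The foundations are the tame formula for the Hilbert symbol, from which follow bilinearity, the
Kubota cocycle identity and the splitting over K_0, and the evaluation of Weil indices by quadratic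
Gauss sums, which gives γ(ab) = γ(a) γ(b) (a, b) and so makes χ compatible with the cocycle. -/

namespace MetaplecticSL2

set_option linter.unusedSectionVars false
set_option linter.unusedSimpArgs false

/-! ## Elementary facts on the local field -/

section Field

variable {F : Type*} [NontriviallyNormedField F] [IsUltrametricDist F]

/-- `ϖ` generates the maximal ideal of the ring of integers of `F`, the norm of `F` is
normalized and discrete, the residue field is finite, and `2` is a unit. -/
structure IsOddUniformizer (ϖ : F) : Prop where
  two_le_card : 2 ≤ resCard F
  norm_eq : ‖ϖ‖ = (resCard F : ℝ)⁻¹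
  norm_le : ∀ x : F, ‖x‖ < 1 → ‖x‖ ≤ (resCard F : ℝ)⁻¹
  norm_two : ‖(2 : F)‖ = 1

lemma mem_ringInt {x : F} : x ∈ ringInt F ↔ ‖x‖ ≤ 1 := by
  rw [ringInt, Valuation.mem_valuationSubring_iff]
  exact Iff.rfl

lemma norm_ringInt_le (x : ringInt F) : ‖(x : F)‖ ≤ 1 := mem_ringInt.1 x.2

lemma isUnit_ringInt {x : ringInt F} : IsUnit x ↔ ‖(x : F)‖ = 1 := by
  constructor
  · rintro ⟨u, rfl⟩
    refine le_antisymm (norm_ringInt_le _) ?_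
    have h : ((u : ringInt F) : F) * ((u⁻¹ : (ringInt F)ˣ) : ringInt F) = 1 := by
      have := u.mul_inv
      exact_mod_cast congrArg (fun z : ringInt F => (z : F)) this
    have h2 := congrArg norm h
    rw [norm_mul, norm_one] at h2
    nlinarith [norm_ringInt_le ((u⁻¹ : (ringInt F)ˣ) : ringInt F),
      norm_nonneg ((u : ringInt F) : F)]
  · intro h
    have h0 : (x : F) ≠ 0 := by
      intro h0; rw [h0, norm_zero] at h; exact zero_ne_one h
    refine IsUnit.of_mul_eq_one ⟨(x : F)⁻¹, mem_ringInt.2 (by rw [norm_inv, h, inv_one])⟩ ?_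
    exact Subtype.ext (mul_inv_cancel₀ h0)

lemma norm_sub_le_max' (x y : F) : ‖x - y‖ ≤ max ‖x‖ ‖y‖ := by
  rw [sub_eq_add_neg, ← norm_neg y]
  exact IsUltrametricDist.norm_add_le_max _ _

/-- If |ϖ| < |x| < 1, then ϖ = x · (ϖ/x) would factor the irreducible ϖ into two nonunits. If |2| <
1, then 1 = p - 2k would have norm less than 1. -/
lemma isOddUniformizer_of_irreducible (p : ℕ) (hp_odd : Odd p) (hp_res : ‖(p : F)‖ < 1)
    (ϖ : ringInt F) (hϖ : Irreducible ϖ) (hnorm : ‖(ϖ : F)‖ = (resCard F : ℝ)⁻¹) :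
    IsOddUniformizer (ϖ : F) := by
  have h0 : (ϖ : F) ≠ 0 := fun h => hϖ.ne_zero (Subtype.ext h)
  have hc : resCard F ≠ 0 := by
    intro h
    rw [h, Nat.cast_zero, inv_zero, norm_eq_zero] at hnorm
    exact h0 hnorm
  have hlt : ‖(ϖ : F)‖ < 1 := lt_of_le_of_ne (norm_ringInt_le ϖ) fun h =>
    hϖ.not_isUnit (isUnit_ringInt.2 h)
  refine ⟨?_, hnorm, fun x hx => ?_, ?_⟩
  · by_contra hlt2
    have : resCard F = 1 := by omega
    rw [this] at hnorm
    norm_num at hnorm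
    linarith
  · rw [← hnorm]
    by_contra hlt2
    push Not at hlt2
    have hx0 : x ≠ 0 := by
      rintro rfl
      rw [norm_zero] at hlt2
      linarith [norm_nonneg (ϖ : F)]
    have hdiv : ‖(ϖ : F) / x‖ < 1 := by
      rw [norm_div]; exact (div_lt_one (norm_pos_iff.2 hx0)).2 hlt2
    have hmul : ϖ = (⟨x, mem_ringInt.2 hx.le⟩ : ringInt F) *
        ⟨(ϖ : F) / x, mem_ringInt.2 hdiv.le⟩ := Subtype.ext (mul_div_cancel₀ _ hx0).symm
    rcases hϖ.isUnit_or_isUnit hmul with h | h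
    · exact hx.ne (isUnit_ringInt.1 h)
    · exact hdiv.ne (isUnit_ringInt.1 h)
  · refine le_antisymm (by exact_mod_cast IsUltrametricDist.norm_natCast_le_one F 2) ?_
    obtain ⟨k, hk⟩ := hp_odd
    by_contra hlt2
    push Not at hlt2
    have h1 : (1 : F) = (p : F) - 2 * (k : F) := by rw [hk]; push_cast; ring
    have h2 : ‖(2 : F) * k‖ < 1 := by
      rw [norm_mul]
      exact mul_lt_one_of_nonneg_of_lt_one_left (norm_nonneg _) hlt2 (IsUltrametricDist.norm_natCast_le_one F k)
    have h3 : ‖(1 : F)‖ < 1 := by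
      calc ‖(1 : F)‖ = ‖(p : F) - 2 * (k : F)‖ := congrArg norm h1
        _ ≤ max ‖(p : F)‖ ‖(2 : F) * k‖ := norm_sub_le_max' _ _
        _ < 1 := max_lt hp_res h2
    rw [norm_one] at h3
    exact lt_irrefl _ h3

/-- The normalized valuation. -/
noncomputable def ord (x : F) : ℤ := -Int.log (resCard F) ‖x‖

lemma norm_add_eq_left {x y : F} (h : ‖y‖ < ‖x‖) : ‖x + y‖ = ‖x‖ := by
  rw [IsUltrametricDist.norm_add_eq_max_of_norm_ne_norm h.ne']
  exact max_eq_left h.le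

lemma norm_add_le_of {x y : F} {r : ℝ} (hx : ‖x‖ ≤ r) (hy : ‖y‖ ≤ r) : ‖x + y‖ ≤ r :=
  (IsUltrametricDist.norm_add_le_max x y).trans (max_le hx hy)

lemma norm_sub_le_of {x y : F} {r : ℝ} (hx : ‖x‖ ≤ r) (hy : ‖y‖ ≤ r) : ‖x - y‖ ≤ r :=
  (norm_sub_le_max' x y).trans (max_le hx hy)

lemma norm_add_lt_of {x y : F} {r : ℝ} (hx : ‖x‖ < r) (hy : ‖y‖ < r) : ‖x + y‖ < r :=
  (IsUltrametricDist.norm_add_le_max x y).trans_lt (max_lt hx hy)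

lemma norm_one_add_eq_one {x : F} (h : ‖x‖ < 1) : ‖1 + x‖ = 1 := by
  rw [norm_add_eq_left (by rwa [norm_one]), norm_one]

lemma norm_eq_one_of_sub_one_lt {x : F} (h : ‖x - 1‖ < 1) : ‖x‖ = 1 := by
  simpa using norm_one_add_eq_one h

namespace IsOddUniformizer

variable {ϖ : F} (hU : IsOddUniformizer ϖ)

include hU

lemma one_lt_card : 1 < resCard F := hU.two_le_card

lemma one_lt : (1 : ℝ) < (resCard F : ℝ) := by exact_mod_cast hU.one_lt_card

lemma card_pos : (0 : ℝ) < (resCard F : ℝ) := one_pos.trans hU.one_lt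

lemma ne_zero : ϖ ≠ 0 := by
  intro h
  have := hU.norm_eq
  rw [h, norm_zero] at this
  exact (inv_pos.2 hU.card_pos).ne this

lemma norm_zpow (n : ℤ) : ‖ϖ ^ n‖ = (resCard F : ℝ) ^ (-n) := by
  rw [_root_.norm_zpow, hU.norm_eq, inv_zpow, zpow_neg]

/-- Discreteness of the norm: if |x| lay strictly between q^n and q^(n+1), then (ϖ^n x)⁻¹ would have
norm strictly between q⁻¹ and 1, which `norm_le` excludes. -/
lemma norm_eq_ord {x : F} (hx : x ≠ 0) : ‖x‖ = (resCard F : ℝ) ^ (-ord x) := by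
  obtain ⟨n, hn⟩ := exists_mem_Ico_zpow (norm_pos_iff.2 hx) hU.one_lt
  have key : ‖x‖ = (resCard F : ℝ) ^ n := by
    by_contra hne
    have h1 : (resCard F : ℝ) ^ n < ‖x‖ := lt_of_le_of_ne hn.1 (Ne.symm hne)
    have hq : (0:ℝ) < (resCard F : ℝ) ^ n := zpow_pos hU.card_pos _
    have h2 : ‖(ϖ ^ n * x)⁻¹‖ < 1 := by
      rw [norm_inv, norm_mul, hU.norm_zpow, zpow_neg]
      apply inv_lt_one_of_one_lt₀
      rw [← div_eq_inv_mul]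
      exact (one_lt_div hq).2 h1
    have h3 := hU.norm_le _ h2
    rw [norm_inv, norm_mul, hU.norm_zpow, zpow_neg] at h3
    have h4 := (inv_le_inv₀ (by positivity) hU.card_pos).1 h3
    rw [← div_eq_inv_mul, le_div_iff₀ hq] at h4
    have h5 := hn.2
    rw [zpow_add_one₀ hU.card_pos.ne'] at h5
    linarith [mul_comm (resCard F : ℝ) ((resCard F : ℝ) ^ n)]
  rw [ord, neg_neg, key, Int.log_zpow hU.one_lt_card]

lemma zpow_inj {m n : ℤ} : (resCard F : ℝ) ^ m = (resCard F : ℝ) ^ n ↔ m = n :=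
  zpow_right_inj₀ hU.card_pos hU.one_lt.ne'

lemma zpow_le {m n : ℤ} : (resCard F : ℝ) ^ m ≤ (resCard F : ℝ) ^ n ↔ m ≤ n :=
  zpow_le_zpow_iff_right₀ hU.one_lt

lemma zpow_lt {m n : ℤ} : (resCard F : ℝ) ^ m < (resCard F : ℝ) ^ n ↔ m < n :=
  zpow_lt_zpow_iff_right₀ hU.one_lt

lemma ord_eq {x : F} {n : ℤ} (h : ‖x‖ = (resCard F : ℝ) ^ (-n)) : ord x = n := by
  rw [ord, h, Int.log_zpow hU.one_lt_card, neg_neg]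

lemma ord_mul {x y : F} (hx : x ≠ 0) (hy : y ≠ 0) : ord (x * y) = ord x + ord y := by
  apply hU.ord_eq
  rw [norm_mul, hU.norm_eq_ord hx, hU.norm_eq_ord hy, ← zpow_add₀ hU.card_pos.ne']
  congr 1; ring

lemma ord_zpow (n : ℤ) : ord (ϖ ^ n) = n := hU.ord_eq (hU.norm_zpow n)

lemma ord_of_norm_one {x : F} (h : ‖x‖ = 1) : ord x = 0 := hU.ord_eq (by rw [h]; simp)

/-- A norm which is less than `q ^ n` is at most `q ^ (n - 1)`. -/
lemma norm_lt_zpow {x : F} {n : ℤ} : ‖x‖ < (resCard F : ℝ) ^ n ↔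
    ‖x‖ ≤ (resCard F : ℝ) ^ (n - 1) := by
  rcases eq_or_ne x 0 with rfl | hx
  · simp only [norm_zero]
    exact iff_of_true (zpow_pos hU.card_pos _) (zpow_pos hU.card_pos _).le
  · rw [hU.norm_eq_ord hx, hU.zpow_lt, hU.zpow_le]; omega

/-- The unit part of a nonzero element. -/
lemma norm_unit_part {x : F} (hx : x ≠ 0) : ‖x * ϖ ^ (-ord x)‖ = 1 := by
  rw [norm_mul, hU.norm_zpow, hU.norm_eq_ord hx, ← zpow_add₀ hU.card_pos.ne']
  simp

lemma finite_residueField : Finite (IsLocalRing.ResidueField (ringInt F)) := by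
  apply Nat.finite_of_card_ne_zero
  have := hU.two_le_card
  unfold resCard at this
  omega

end IsOddUniformizer

open Classical in
/-- Reduction modulo the maximal ideal (and `0` off the ring of integers). -/
noncomputable def red (x : F) : IsLocalRing.ResidueField (ringInt F) :=
  if h : x ∈ ringInt F then IsLocalRing.residue _ ⟨x, h⟩ else 0

lemma red_coe (x : ringInt F) : red (x : F) = IsLocalRing.residue _ x := dif_pos x.2

lemma red_add {x y : F} (hx : ‖x‖ ≤ 1) (hy : ‖y‖ ≤ 1) : red (x + y) = red x + red y := by
  lift x to ringInt F using mem_ringInt.2 hx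
  lift y to ringInt F using mem_ringInt.2 hy
  rw [red_coe, red_coe, ← map_add, ← red_coe]; rfl

lemma red_mul {x y : F} (hx : ‖x‖ ≤ 1) (hy : ‖y‖ ≤ 1) : red (x * y) = red x * red y := by
  lift x to ringInt F using mem_ringInt.2 hx
  lift y to ringInt F using mem_ringInt.2 hy
  rw [red_coe, red_coe, ← map_mul, ← red_coe]; rfl

lemma red_one : red (1 : F) = 1 := by
  rw [← map_one (IsLocalRing.residue (ringInt F)), ← red_coe]; rfl

lemma red_eq_zero_iff {x : F} (hx : ‖x‖ ≤ 1) : red x = 0 ↔ ‖x‖ < 1 := by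
  lift x to ringInt F using mem_ringInt.2 hx
  rw [red_coe, IsLocalRing.residue_eq_zero_iff, IsLocalRing.mem_maximalIdeal, mem_nonunits_iff,
    isUnit_ringInt]
  exact ⟨fun h => lt_of_le_of_ne hx h, fun h => h.ne⟩

lemma red_eq_iff {x y : F} (hx : ‖x‖ ≤ 1) (hy : ‖y‖ ≤ 1) : red x = red y ↔ ‖x - y‖ < 1 := by
  have h1 : red x = red (x - y) + red y := by
    rw [← red_add (norm_sub_le_of hx hy) hy, sub_add_cancel]
  rw [h1, add_eq_right, red_eq_zero_iff (norm_sub_le_of hx hy)]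

lemma exists_red_eq (a : IsLocalRing.ResidueField (ringInt F)) : ∃ x : F, ‖x‖ ≤ 1 ∧ red x = a := by
  obtain ⟨x, rfl⟩ := IsLocalRing.residue_surjective a
  exact ⟨x, norm_ringInt_le x, red_coe x⟩

/-- The principal units are squares of principal units of the same depth. -/
lemma exists_sq_eq [CompleteSpace F] (h2 : ‖(2 : F)‖ = 1) {x : F} (hx : ‖x - 1‖ < 1) :
    ∃ y : F, y ^ 2 = x ∧ ‖y - 1‖ ≤ ‖x - 1‖ := by
  set z := x - 1 with hz
  have h20 : (2 : F) ≠ 0 := by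
    intro h; rw [h, norm_zero] at h2; exact zero_ne_one h2
  -- A fixed point y satisfies y² + 2y = z, that is (1 + y)² = x. On the ball of radius |z| < 1 the
  -- map is a contraction with ratio |z|, because 2 is a unit.
  let f : F → F := fun y => (z - y ^ 2) / 2
  have hmaps : Set.MapsTo f (Metric.closedBall 0 ‖z‖) (Metric.closedBall 0 ‖z‖) := by
    intro y hy
    rw [mem_closedBall_zero_iff] at hy ⊢
    simp only [f]
    rw [norm_div, h2, div_one]
    refine norm_sub_le_of le_rfl ?_
    rw [norm_pow]
    nlinarith [norm_nonneg y]
  have hlip : ContractingWith ‖z‖₊ (hmaps.restrict f _ _) := by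
    refine ⟨by exact_mod_cast hx, LipschitzWith.of_dist_le_mul ?_⟩
    rintro ⟨a, ha⟩ ⟨b, hb⟩
    rw [mem_closedBall_zero_iff] at ha hb
    rw [Subtype.dist_eq, Subtype.dist_eq, Set.MapsTo.val_restrict_apply,
      Set.MapsTo.val_restrict_apply, dist_eq_norm, dist_eq_norm]
    simp only [f, coe_nnnorm]
    have : (z - a ^ 2) / 2 - (z - b ^ 2) / 2 = -((a + b) * (a - b) / 2) := by ring
    rw [this, norm_neg, norm_div, h2, div_one, norm_mul]
    exact mul_le_mul_of_nonneg_right (norm_add_le_of ha hb) (norm_nonneg _)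
  obtain ⟨y, hy, hfix, -⟩ := hlip.exists_fixedPoint' (s := Metric.closedBall 0 ‖z‖)
    Metric.isClosed_closedBall.isComplete hmaps (x := 0) (by simp) (edist_ne_top _ _)
  refine ⟨1 + y, ?_, ?_⟩
  · have : (z - y ^ 2) / 2 = y := hfix
    rw [div_eq_iff h20] at this
    linear_combination -this + hz
  · rw [add_sub_cancel_left]; exact mem_closedBall_zero_iff.1 hy

lemma isSquare_of_sub_one_lt [CompleteSpace F] (h2 : ‖(2 : F)‖ = 1) {x : F} (hx : ‖x - 1‖ < 1) :
    IsSquare x := by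
  obtain ⟨y, hy, -⟩ := exists_sq_eq h2 hx
  exact ⟨y, by rw [← hy, sq]⟩

/-- If x and y² have the same nonzero residue, then x / y² is a principal unit and hence a square.
-/
lemma isSquare_iff_red [CompleteSpace F] (h2 : ‖(2 : F)‖ = 1) {x : F} (hx : ‖x‖ = 1) :
    IsSquare x ↔ IsSquare (red x) := by
  constructor
  · rintro ⟨y, rfl⟩
    have hy : ‖y‖ ≤ 1 := by
      rw [norm_mul] at hx
      nlinarith [norm_nonneg y]
    exact ⟨red y, red_mul hy hy⟩
  · rintro ⟨a, ha⟩
    obtain ⟨y, hy, rfl⟩ := exists_red_eq a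
    rw [← red_mul hy hy, red_eq_iff hx.le (by rw [norm_mul]; nlinarith [norm_nonneg y])] at ha
    have hyy : ‖y * y‖ = 1 := by
      have := norm_add_eq_left (x := x) (y := -(x - y * y)) (by rwa [norm_neg, hx])
      rw [← hx, ← this]; congr 1; ring
    have h0 : y * y ≠ 0 := norm_ne_zero_iff.1 (by rw [hyy]; exact one_ne_zero)
    have : IsSquare (x / (y * y)) := by
      apply isSquare_of_sub_one_lt h2
      rw [div_sub_one h0, norm_div, hyy, div_one]; exact ha
    obtain ⟨w, hw⟩ := this
    refine ⟨w * y, ?_⟩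
    rw [div_eq_iff h0] at hw
    rw [hw]; ring

end Field

/-! ## The quadratic Hilbert symbol -/

section HilbertAlgebra

variable {F : Type*} [Field F]

lemma hilbert_eq_one_iff {a b : F} : hilbert a b = 1 ↔
    ∃ x y z : F, (x, y, z) ≠ (0, 0, 0) ∧ z ^ 2 = a * x ^ 2 + b * y ^ 2 := by
  unfold hilbert
  split_ifs with h
  · exact iff_of_true rfl h
  · exact iff_of_false (by decide) h

/-- A sign is determined by whether it is 1, so identities between Hilbert symbols reduce to
equivalent solvability of two conics. -/
lemma int_units_eq_of_iff {x y : ℤˣ} (h : x = 1 ↔ y = 1) : x = y := by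
  revert x y; decide

lemma hilbert_comm (a b : F) : hilbert a b = hilbert b a := by
  apply int_units_eq_of_iff
  rw [hilbert_eq_one_iff, hilbert_eq_one_iff]
  constructor <;>
  · rintro ⟨x, y, z, h, e⟩
    refine ⟨y, x, z, ?_, by rw [e, add_comm]⟩
    simp only [ne_eq, Prod.mk.injEq] at h ⊢
    tauto

lemma hilbert_of_add_eq_one {a b : F} (h : a + b = 1) : hilbert a b = 1 :=
  hilbert_eq_one_iff.2 ⟨1, 1, 1, by simp, by linear_combination -h⟩

lemma hilbert_self_neg (a : F) : hilbert a (-a) = 1 :=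
  hilbert_eq_one_iff.2 ⟨1, 1, 0, by simp, by ring⟩

lemma hilbert_sq_left (a b : F) : hilbert (a ^ 2) b = 1 :=
  hilbert_eq_one_iff.2 ⟨1, 0, a, by simp, by ring⟩

lemma hilbert_one_left (b : F) : hilbert 1 b = 1 := by
  simpa using hilbert_sq_left (1 : F) b

lemma hilbert_one_right (b : F) : hilbert b 1 = 1 := by
  rw [hilbert_comm, hilbert_one_left]

lemma hilbert_mul_sq_left (a b : F) {s : F} (hs : s ≠ 0) : hilbert (a * s ^ 2) b = hilbert a b := by
  apply int_units_eq_of_iff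
  rw [hilbert_eq_one_iff, hilbert_eq_one_iff]
  constructor
  · rintro ⟨x, y, z, h, e⟩
    refine ⟨s * x, y, z, ?_, by rw [e]; ring⟩
    simp only [ne_eq, Prod.mk.injEq, mul_eq_zero, hs, false_or] at h ⊢
    exact h
  · rintro ⟨x, y, z, h, e⟩
    refine ⟨s⁻¹ * x, y, z, ?_, by rw [e]; field_simp⟩
    simp only [ne_eq, Prod.mk.injEq, mul_eq_zero, inv_eq_zero, hs, false_or] at h ⊢
    exact h

/-- Multiplying z² = ax² - aby² by a gives (ax)² = az² + b(ay)², which exchanges the roles of x and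
z. -/
lemma hilbert_mul_neg_right {a : F} (ha : a ≠ 0) (b : F) : hilbert a (-a * b) = hilbert a b := by
  apply int_units_eq_of_iff
  rw [hilbert_eq_one_iff, hilbert_eq_one_iff]
  constructor
  · rintro ⟨x, y, z, h, e⟩
    refine ⟨z, a * y, a * x, ?_, by rw [e]; ring⟩
    simp only [ne_eq, Prod.mk.injEq, mul_eq_zero, ha, false_or] at h ⊢
    tauto
  · rintro ⟨x, y, z, h, e⟩
    refine ⟨z, y, a * x, ?_, by rw [e]; ring⟩
    simp only [ne_eq, Prod.mk.injEq, mul_eq_zero, ha, false_or] at h ⊢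
    tauto

end HilbertAlgebra

/-! ### The tame formula and bilinearity of the Hilbert symbol over a local field -/

section HilbertLocal


variable {F : Type*} [NontriviallyNormedField F] [IsUltrametricDist F]

open Classical in
/-- The quadratic residue symbol of the unit part of `x`. -/
noncomputable def leg (ϖ x : F) : ℤˣ := if IsSquare (x * ϖ ^ (-ord x)) then 1 else -1

namespace IsOddUniformizer

variable {ϖ : F} (hU : IsOddUniformizer ϖ)

include hU

lemma residue_two_ne_zero : (2 : IsLocalRing.ResidueField (ringInt F)) ≠ 0 := by
  have h : red (2 : F) = 2 := by
    rw [← one_add_one_eq_two, red_add (by simp) (by simp), red_one, one_add_one_eq_two]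
  rw [← h, ne_eq, red_eq_zero_iff hU.norm_two.le, hU.norm_two]
  exact lt_irrefl _

lemma ringChar_residueField_ne_two : ringChar (IsLocalRing.ResidueField (ringInt F)) ≠ 2 := by
  intro h
  apply hU.residue_two_ne_zero
  have := ringChar.Nat.cast_ringChar (R := IsLocalRing.ResidueField (ringInt F))
  rw [h] at this
  exact_mod_cast this

lemma two_ne_zero : (2 : F) ≠ 0 := norm_ne_zero_iff.1 (by rw [hU.norm_two]; exact one_ne_zero)

variable [ProperSpace F]

/-- The unit squares have index two in the units: being a square is detected by the quadratic
character of the finite residue field. -/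
lemma isSquare_mul_iff {x y : F} (hx : ‖x‖ = 1) (hy : ‖y‖ = 1) :
    IsSquare (x * y) ↔ (IsSquare x ↔ IsSquare y) := by
  classical
  have := hU.finite_residueField
  let _ := Fintype.ofFinite (IsLocalRing.ResidueField (ringInt F))
  have hxy : ‖x * y‖ = 1 := by rw [norm_mul, hx, hy, one_mul]
  rw [isSquare_iff_red hU.norm_two hxy, isSquare_iff_red hU.norm_two hx,
    isSquare_iff_red hU.norm_two hy]
  have h0 : ∀ z : F, ‖z‖ = 1 → red z ≠ 0 := fun z hz => by
    rw [ne_eq, red_eq_zero_iff hz.le, hz]; exact lt_irrefl _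
  rw [← quadraticChar_one_iff_isSquare (h0 _ hxy), ← quadraticChar_one_iff_isSquare (h0 _ hx),
    ← quadraticChar_one_iff_isSquare (h0 _ hy), red_mul hx.le hy.le, map_mul]
  rcases quadraticChar_dichotomy (h0 _ hx) with h1 | h1 <;>
  rcases quadraticChar_dichotomy (h0 _ hy) with h2 | h2 <;> rw [h1, h2] <;> decide

omit hU [ProperSpace F] in
lemma leg_eq_one_iff {x : F} : leg ϖ x = 1 ↔ IsSquare (x * ϖ ^ (-ord x)) := by
  unfold leg
  split_ifs with h
  · exact iff_of_true rfl h
  · exact iff_of_false (by decide) h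

lemma leg_mul {x y : F} (hx : x ≠ 0) (hy : y ≠ 0) : leg ϖ (x * y) = leg ϖ x * leg ϖ y := by
  have key := hU.isSquare_mul_iff (hU.norm_unit_part hx) (hU.norm_unit_part hy)
  have e : x * ϖ ^ (-ord x) * (y * ϖ ^ (-ord y)) = x * y * ϖ ^ (-ord (x * y)) := by
    rw [hU.ord_mul hx hy, neg_add, zpow_add₀ hU.ne_zero]; ring
  rw [e] at key
  unfold leg
  generalize IsSquare (x * ϖ ^ (-ord x)) = P at *
  generalize IsSquare (y * ϖ ^ (-ord y)) = Q at *
  generalize IsSquare (x * y * ϖ ^ (-ord (x * y))) = R at *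
  by_cases h1 : P <;> by_cases h2 : Q <;> simp [h1, h2, key]

lemma leg_of_isSquare {x : F} (hx : x ≠ 0) (h : IsSquare x) : leg ϖ x = 1 := by
  obtain ⟨y, rfl⟩ := h
  have hy : y ≠ 0 := left_ne_zero_of_mul hx
  rw [hU.leg_mul hy hy]
  exact Int.units_mul_self _

lemma leg_unit {x : F} (hx : ‖x‖ = 1) : leg ϖ x = 1 ↔ IsSquare x := by
  rw [leg_eq_one_iff, hU.ord_of_norm_one hx]; simp

lemma leg_one : leg ϖ (1 : F) = 1 := hU.leg_of_isSquare one_ne_zero ⟨1, by simp⟩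

lemma leg_zpow (n : ℤ) : leg ϖ (ϖ ^ n) = 1 := by
  rw [leg_eq_one_iff, hU.ord_zpow, ← zpow_add₀ hU.ne_zero]
  exact ⟨1, by simp⟩

lemma isSquare_iff {x : F} (hx : x ≠ 0) : IsSquare x ↔ Even (ord x) ∧ leg ϖ x = 1 := by
  constructor
  · intro h
    refine ⟨?_, hU.leg_of_isSquare hx h⟩
    obtain ⟨y, rfl⟩ := h
    have hy : y ≠ 0 := left_ne_zero_of_mul hx
    exact ⟨ord y, hU.ord_mul hy hy⟩
  · rintro ⟨⟨k, hk⟩, h⟩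
    obtain ⟨y, hy⟩ := leg_eq_one_iff.1 h
    refine ⟨y * ϖ ^ k, ?_⟩
    have : x = x * ϖ ^ (-ord x) * ϖ ^ ord x := by
      rw [mul_assoc, ← zpow_add₀ hU.ne_zero]; simp
    rw [this, hy, hk, zpow_add₀ hU.ne_zero]; ring

/-- Counting squares in the residue field gives a solution of ax² + b = z² modulo 𝔭. If ax² + b is a
unit, it is a square by Hensel lifting. Otherwise -b/(ax²) is a principal unit, hence a square, and
the conic has a point with z = 0. -/
lemma hilbert_unit_unit {a b : F} (ha : ‖a‖ = 1) (hb : ‖b‖ = 1) : hilbert a b = 1 := by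
  classical
  have := hU.finite_residueField
  let _ := Fintype.ofFinite (IsLocalRing.ResidueField (ringInt F))
  have ha0 : red a ≠ 0 := by rw [ne_eq, red_eq_zero_iff ha.le, ha]; exact lt_irrefl _
  have hb0 : red b ≠ 0 := by rw [ne_eq, red_eq_zero_iff hb.le, hb]; exact lt_irrefl _
  have hodd := FiniteField.odd_card_of_char_ne_two hU.ringChar_residueField_ne_two
  obtain ⟨s, t, hst⟩ := FiniteField.exists_root_sum_quadratic
    (f := Polynomial.C (red a) * Polynomial.X ^ 2 + Polynomial.C (red b))
    (g := Polynomial.C (-1) * Polynomial.X ^ 2)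
    (by compute_degree!) (by compute_degree!) hodd
  obtain ⟨x, hx, rfl⟩ := exists_red_eq s
  obtain ⟨z, hz, rfl⟩ := exists_red_eq t
  simp only [Polynomial.eval_add, Polynomial.eval_mul, Polynomial.eval_C, Polynomial.eval_pow,
    Polynomial.eval_X] at hst
  have hx2 : ‖a * x ^ 2‖ ≤ 1 := by
    rw [norm_mul, norm_pow, ha, one_mul]; exact pow_le_one₀ (norm_nonneg _) hx
  have hz2 : ‖z ^ 2‖ ≤ 1 := by rw [norm_pow]; exact pow_le_one₀ (norm_nonneg _) hz
  have hw : ‖a * x ^ 2 + b‖ ≤ 1 := norm_add_le_of hx2 hb.le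
  have key : ‖a * x ^ 2 + b - z ^ 2‖ < 1 := by
    rw [← red_eq_iff hw hz2, red_add hx2 hb.le, red_mul ha.le (by
      rw [norm_pow]; exact pow_le_one₀ (norm_nonneg _) hx), sq x, sq z, red_mul hx hx, red_mul hz hz]
    linear_combination hst
  rw [hilbert_eq_one_iff]
  by_cases h1 : ‖a * x ^ 2 + b‖ = 1
  · have h0 : a * x ^ 2 + b ≠ 0 := norm_ne_zero_iff.1 (by rw [h1]; exact one_ne_zero)
    have hsq : IsSquare (a * x ^ 2 + b) := by
      rw [isSquare_iff_red hU.norm_two h1]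
      exact ⟨red z, by rw [← red_mul hz hz, ← sq, red_eq_iff hw hz2]; exact key⟩
    obtain ⟨w, hw'⟩ := hsq
    exact ⟨x, 1, w, by simp, by rw [sq w, ← hw']; ring⟩
  · have h1' : ‖a * x ^ 2 + b‖ < 1 := lt_of_le_of_ne hw h1
    have hax : ‖a * x ^ 2‖ = 1 := by
      have := norm_add_eq_left (x := b) (y := -(a * x ^ 2 + b)) (by rwa [norm_neg, hb])
      rw [← hb, ← this, ← norm_neg]; congr 1; ring
    have hax0 : a * x ^ 2 ≠ 0 := norm_ne_zero_iff.1 (by rw [hax]; exact one_ne_zero)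
    have hx0 : x ≠ 0 := by rintro rfl; simp at hax0
    have ha0' : a ≠ 0 := left_ne_zero_of_mul hax0
    have hsq : IsSquare (-b / (a * x ^ 2)) := by
      apply isSquare_of_sub_one_lt hU.norm_two
      rw [div_sub_one hax0, norm_div, hax, div_one,
        show -b - a * x ^ 2 = -(a * x ^ 2 + b) by ring, norm_neg]
      exact h1'
    obtain ⟨w, hw'⟩ := hsq
    rw [div_eq_iff hax0] at hw'
    exact ⟨w * x, 1, 0, by simp, by linear_combination hw'⟩

lemma hilbert_even_even {a b : F} (ha : a ≠ 0) (hb : b ≠ 0) (hae : Even (ord a))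
    (hbe : Even (ord b)) : hilbert a b = 1 := by
  obtain ⟨k, hk⟩ := hae
  obtain ⟨l, hl⟩ := hbe
  have ha' : a = a * ϖ ^ (-ord a) * (ϖ ^ k) ^ 2 := by
    rw [mul_assoc, sq, ← zpow_add₀ hU.ne_zero, ← zpow_add₀ hU.ne_zero, hk]; simp
  have hb' : b = b * ϖ ^ (-ord b) * (ϖ ^ l) ^ 2 := by
    rw [mul_assoc, sq, ← zpow_add₀ hU.ne_zero, ← zpow_add₀ hU.ne_zero, hl]; simp
  rw [ha', hb', hilbert_mul_sq_left _ _ (zpow_ne_zero _ hU.ne_zero), hilbert_comm,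
    hilbert_mul_sq_left _ _ (zpow_ne_zero _ hU.ne_zero), hilbert_comm]
  exact hU.hilbert_unit_unit (hU.norm_unit_part ha) (hU.norm_unit_part hb)

/-- In z² = ax² + by² the terms z² and ax² have even valuation and by² has odd valuation, so by² can
neither dominate nor balance another term. Hence ax² dominates, and z² / (ax²) is a principal unit,
which makes a a square. -/
lemma hilbert_even_odd {a b : F} (ha : a ≠ 0) (hb : b ≠ 0) (hae : Even (ord a))
    (hbo : Odd (ord b)) : hilbert a b = leg ϖ a := by
  apply int_units_eq_of_iff
  have hiff : leg ϖ a = 1 ↔ IsSquare a := by rw [hU.isSquare_iff ha]; tauto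
  rw [hiff]
  constructor
  · rw [hilbert_eq_one_iff]
    rintro ⟨x, y, z, h, e⟩
    have hpar : ∀ {s t : F}, s ≠ 0 → t ≠ 0 → Even (ord s) → Odd (ord t) → ‖s‖ ≠ ‖t‖ := by
      intro s t hs ht hse hto hst
      rw [hU.norm_eq_ord hs, hU.norm_eq_ord ht, hU.zpow_inj, neg_inj] at hst
      rw [hst] at hse
      exact Int.not_even_iff_odd.2 hto hse
    have hsqe : ∀ {s : F}, s ≠ 0 → Even (ord (s ^ 2)) := fun {s} hs => by
      rw [sq, hU.ord_mul hs hs]; exact ⟨_, rfl⟩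
    have hby : y ≠ 0 → Odd (ord (b * y ^ 2)) := fun hy => by
      rw [hU.ord_mul hb (pow_ne_zero 2 hy)]; exact hbo.add_even (hsqe hy)
    have hax : x ≠ 0 → Even (ord (a * x ^ 2)) := fun hx => by
      rw [hU.ord_mul ha (pow_ne_zero 2 hx)]; exact hae.add (hsqe hx)
    have hb2 : y ≠ 0 → b * y ^ 2 ≠ 0 := fun hy => mul_ne_zero hb (pow_ne_zero 2 hy)
    have ha2 : x ≠ 0 → a * x ^ 2 ≠ 0 := fun hx => mul_ne_zero ha (pow_ne_zero 2 hx)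
    by_cases hx : x = 0
    · exfalso
      subst hx
      have e' : z ^ 2 = b * y ^ 2 := by rw [e]; ring
      by_cases hy : y = 0
      · subst hy; simp_all
      · have hz : z ≠ 0 := by
          rintro rfl; exact hb2 hy (by rw [← e']; simp)
        exact hpar (pow_ne_zero 2 hz) (hb2 hy) (hsqe hz) (hby hy) (by rw [e'])
    · have hsq : IsSquare (a * x ^ 2) := by
        by_cases hy : y = 0
        · subst hy; exact ⟨z, by rw [← sq, e]; ring⟩
        · have hne := hpar (ha2 hx) (hb2 hy) (hax hx) (hby hy)
          rcases hne.lt_or_gt with hlt | hlt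
          · exfalso
            have hz : ‖z ^ 2‖ = ‖b * y ^ 2‖ := by rw [e, add_comm]; exact norm_add_eq_left hlt
            have hz0 : z ≠ 0 := by
              rintro rfl
              exact hb2 hy (norm_eq_zero.1 (by rw [← hz]; simp))
            exact hpar (pow_ne_zero 2 hz0) (hb2 hy) (hsqe hz0) (hby hy) hz
          · have hpos : 0 < ‖a * x ^ 2‖ := norm_pos_iff.2 (ha2 hx)
            obtain ⟨w, hw⟩ : IsSquare (1 + b * y ^ 2 / (a * x ^ 2)) := by
              apply isSquare_of_sub_one_lt hU.norm_two
              rw [add_sub_cancel_left, norm_div]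
              exact (div_lt_one hpos).2 hlt
            have hw2 : z ^ 2 = a * x ^ 2 * (w * w) := by
              rw [← hw, e, mul_add, mul_div_cancel₀ _ (ha2 hx), mul_one]
            have hw0 : w ≠ 0 := by
              rintro rfl
              rw [mul_zero, mul_zero] at hw2
              have h3 : ‖z ^ 2‖ = ‖a * x ^ 2‖ := by rw [e]; exact norm_add_eq_left hlt
              rw [hw2, norm_zero] at h3
              exact hpos.ne h3
            exact ⟨z / w, by field_simp; rw [hw2]; ring⟩
      obtain ⟨w, hw⟩ := hsq
      exact ⟨w / x, by field_simp; linear_combination hw⟩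
  · rintro ⟨w, rfl⟩
    rw [← sq, hilbert_sq_left]

/-- The tame formula for the quadratic Hilbert symbol. -/
lemma hilbert_eq {a b : F} (ha : a ≠ 0) (hb : b ≠ 0) :
    hilbert a b = leg ϖ (-1) ^ (ord a * ord b) * leg ϖ a ^ ord b * leg ϖ b ^ ord a := by
  have he : ∀ (x : ℤˣ) (n : ℤ), Even n → x ^ n = 1 := fun x n hn => by
    obtain ⟨k, rfl⟩ := hn
    rw [zpow_add, ← mul_zpow, Int.units_mul_self, one_zpow]
  have ho : ∀ (x : ℤˣ) (n : ℤ), Odd n → x ^ n = x := fun x n hn => by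
    obtain ⟨k, rfl⟩ := hn
    rw [zpow_add_one, he x (2 * k) (even_two_mul k), one_mul]
  rcases Int.even_or_odd (ord a) with h1 | h1 <;> rcases Int.even_or_odd (ord b) with h2 | h2
  · rw [hU.hilbert_even_even ha hb h1 h2, he _ _ (h1.mul_right _), he _ _ h2, he _ _ h1]; simp
  · rw [hU.hilbert_even_odd ha hb h1 h2, he _ _ (h1.mul_right _), ho _ _ h2, he _ _ h1]; simp
  · rw [hilbert_comm, hU.hilbert_even_odd hb ha h2 h1, he _ _ (h2.mul_left _), he _ _ h2,
      ho _ _ h1]; simp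
  · have hm1 : (-1 : F) ≠ 0 := neg_ne_zero.2 one_ne_zero
    have hna : -a = -1 * a := by ring
    have hord : ord (-1 : F) = 0 := hU.ord_of_norm_one (by simp)
    have hab : -a * b ≠ 0 := mul_ne_zero (neg_ne_zero.2 ha) hb
    -- When both valuations are odd, (a, b) = (a, -ab), and -ab has even valuation, which leads back
    -- to the mixed case.
    have h3 : Even (ord (-a * b)) := by
      rw [hna, hU.ord_mul (mul_ne_zero hm1 ha) hb, hU.ord_mul hm1 ha, hord, zero_add]
      exact h1.add_odd h2
    rw [← hilbert_mul_neg_right ha, hilbert_comm, hU.hilbert_even_odd hab ha h3 h1,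
      ho _ _ (h1.mul h2), ho _ _ h2, ho _ _ h1, hna, hU.leg_mul (mul_ne_zero hm1 ha) hb,
      hU.leg_mul hm1 ha]

/-- In the tame formula `leg` is multiplicative and `ord` is additive; bilinearity is then formal.
-/
lemma hilbert_mul_left {a b c : F} (ha : a ≠ 0) (hb : b ≠ 0) (hc : c ≠ 0) :
    hilbert (a * b) c = hilbert a c * hilbert b c := by
  rw [hU.hilbert_eq (mul_ne_zero ha hb) hc, hU.hilbert_eq ha hc, hU.hilbert_eq hb hc,
    hU.leg_mul ha hb, hU.ord_mul ha hb, add_mul, zpow_add, zpow_add, mul_zpow]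
  simp only [mul_assoc, mul_left_comm]

lemma hilbert_mul_right {a b c : F} (ha : a ≠ 0) (hb : b ≠ 0) (hc : c ≠ 0) :
    hilbert a (b * c) = hilbert a b * hilbert a c := by
  rw [hilbert_comm, hU.hilbert_mul_left hb hc ha, hilbert_comm b, hilbert_comm c]

omit [IsUltrametricDist F] hU [ProperSpace F] in
lemma hilbert_inv_left {a b : F} (ha : a ≠ 0) : hilbert a⁻¹ b = hilbert a b := by
  rw [← hilbert_mul_sq_left a⁻¹ b ha]
  congr 1
  field_simp

omit [IsUltrametricDist F] hU [ProperSpace F] in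
lemma hilbert_inv_right {a b : F} (hb : b ≠ 0) : hilbert a b⁻¹ = hilbert a b := by
  rw [hilbert_comm, hilbert_inv_left hb, hilbert_comm]

lemma hilbert_self {a : F} (ha : a ≠ 0) : hilbert a a = hilbert a (-1) := by
  have h := hilbert_self_neg a
  rw [show -a = -1 * a by ring, hU.hilbert_mul_right ha (neg_ne_zero.2 one_ne_zero) ha] at h
  generalize hilbert a a = x at *
  generalize hilbert a (-1) = y at *
  revert x y; decide

lemma hilbert_of_sub_one_lt {a b : F} (ha : ‖a - 1‖ < 1) : hilbert a b = 1 := by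
  obtain ⟨w, hw⟩ := isSquare_of_sub_one_lt hU.norm_two ha
  rw [hw, ← sq, hilbert_sq_left]

end IsOddUniformizer

end HilbertLocal

/-! ## The Kubota cocycle and the metaplectic group -/

section GroupField

variable {F : Type*} [Field F]

@[simp] lemma tMat_00 (a : Fˣ) : (tMat a).1 0 0 = (a : F) := rfl
@[simp] lemma tMat_01 (a : Fˣ) : (tMat a).1 0 1 = (0 : F) := rfl
@[simp] lemma tMat_10 (a : Fˣ) : (tMat a).1 1 0 = (0 : F) := rfl
@[simp] lemma tMat_11 (a : Fˣ) : (tMat a).1 1 1 = (a : F)⁻¹ := by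
  show ((a⁻¹ : Fˣ) : F) = _
  simp
@[simp] lemma nMat_00 (b : F) : (nMat b).1 0 0 = 1 := rfl
@[simp] lemma nMat_01 (b : F) : (nMat b).1 0 1 = b := rfl
@[simp] lemma nMat_10 (b : F) : (nMat b).1 1 0 = 0 := rfl
@[simp] lemma nMat_11 (b : F) : (nMat b).1 1 1 = 1 := rfl
@[simp] lemma nOp_00 (b : F) : (nOp b).1 0 0 = 1 := rfl
@[simp] lemma nOp_01 (b : F) : (nOp b).1 0 1 = 0 := rfl
@[simp] lemma nOp_10 (b : F) : (nOp b).1 1 0 = b := rfl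
@[simp] lemma nOp_11 (b : F) : (nOp b).1 1 1 = 1 := rfl
@[simp] lemma wMat_00 : (wMat : SL(2, F)).1 0 0 = 0 := rfl
@[simp] lemma wMat_01 : (wMat : SL(2, F)).1 0 1 = 1 := rfl
@[simp] lemma wMat_10 : (wMat : SL(2, F)).1 1 0 = -1 := rfl
@[simp] lemma wMat_11 : (wMat : SL(2, F)).1 1 1 = 0 := rfl
@[simp] lemma one_00 : (1 : SL(2, F)).1 0 0 = 1 := rfl
@[simp] lemma one_01 : (1 : SL(2, F)).1 0 1 = 0 := rfl
@[simp] lemma one_10 : (1 : SL(2, F)).1 1 0 = 0 := rfl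
@[simp] lemma one_11 : (1 : SL(2, F)).1 1 1 = 1 := rfl

@[simp] lemma mul_entry (g h : SL(2, F)) (i j : Fin 2) :
    (g * h).1 i j = g.1 i 0 * h.1 0 j + g.1 i 1 * h.1 1 j := by
  rw [Matrix.SpecialLinearGroup.coe_mul, Matrix.mul_apply, Fin.sum_univ_two]

lemma det_entries (g : SL(2, F)) : g.1 0 0 * g.1 1 1 - g.1 0 1 * g.1 1 0 = 1 := by
  rw [← Matrix.det_fin_two, g.2]

lemma sl2_ext {g h : SL(2, F)} (h00 : g.1 0 0 = h.1 0 0) (h01 : g.1 0 1 = h.1 0 1)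
    (h10 : g.1 1 0 = h.1 1 0) (h11 : g.1 1 1 = h.1 1 1) : g = h := by
  apply Subtype.ext
  ext i j
  fin_cases i <;> fin_cases j
  exacts [h00, h01, h10, h11]

lemma tMat_mul (a b : Fˣ) : tMat a * tMat b = tMat (a * b) := by
  apply sl2_ext <;> simp [mul_comm]

lemma nMat_mul (a b : F) : nMat a * nMat b = nMat (a + b) := by
  apply sl2_ext <;> simp [add_comm]

lemma nOp_mul (a b : F) : nOp a * nOp b = nOp (a + b) := by
  apply sl2_ext <;> simp [add_comm]

lemma nMat_zero : nMat (0 : F) = 1 := by apply sl2_ext <;> simp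
lemma nOp_zero : nOp (0 : F) = 1 := by apply sl2_ext <;> simp
lemma tMat_one : tMat (1 : Fˣ) = 1 := by apply sl2_ext <;> simp

/-- Matrices with the same bottom row differ by an upper unipotent factor on the left. -/
lemma eq_nMat_mul_of_row {g h : SL(2, F)} (h10 : g.1 1 0 = h.1 1 0) (h11 : g.1 1 1 = h.1 1 1) :
    g = nMat (g.1 0 1 * h.1 0 0 - g.1 0 0 * h.1 0 1) * h := by
  have hg := det_entries g
  have hh := det_entries h
  apply sl2_ext
  · simp; rw [← h10] at hh ⊢; rw [← h11] at hh
    linear_combination h.1 0 0 * hg - g.1 0 0 * hh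
  · simp; rw [← h10] at hh; rw [← h11] at hh ⊢
    linear_combination h.1 0 1 * hg - g.1 0 1 * hh
  · simp [h10]
  · simp [h11]

lemma eq_bruhat {g : SL(2, F)} (hc : g.1 1 0 ≠ 0) :
    g = nMat (g.1 0 0 / g.1 1 0) * tMat (Units.mk0 (-(g.1 1 0)⁻¹) (by simpa using hc)) * wMat *
      nMat (g.1 1 1 / g.1 1 0) := by
  have hg := det_entries g
  apply sl2_ext
  · simp; field_simp
  · simp; field_simp; linear_combination -hg
  · simp
  · simp; field_simp

lemma eq_borel {g : SL(2, F)} (hc : g.1 1 0 = 0) : ∃ (a : Fˣ) (b : F), g = nMat b * tMat a := by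
  have hg := det_entries g
  rw [hc, mul_zero, sub_zero] at hg
  have h0 : g.1 0 0 ≠ 0 := left_ne_zero_of_mul_eq_one hg
  refine ⟨Units.mk0 _ h0, g.1 0 1 * g.1 0 0, ?_⟩
  have h11 : g.1 1 1 = (g.1 0 0)⁻¹ := (inv_eq_of_mul_eq_one_right hg).symm
  apply sl2_ext
  · simp
  · simp; field_simp
  · simp [hc]
  · simp [h11]

open Classical in
/-- The first nonzero entry of a row. -/
noncomputable def rowX (c d : F) : F := if c ≠ 0 then c else d

lemma kubotaX_eq (g : SL(2, F)) : kubotaX g = rowX (g.1 1 0) (g.1 1 1) := rfl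

lemma rowX_of_ne {c : F} (d : F) (hc : c ≠ 0) : rowX c d = c := if_pos hc
lemma rowX_zero (d : F) : rowX 0 d = d := if_neg (by simp)

lemma kubotaX_ne_zero (g : SL(2, F)) : kubotaX g ≠ 0 := by
  rw [kubotaX_eq]
  by_cases hc : g.1 1 0 = 0
  · rw [hc, rowX_zero]
    intro hd
    have := det_entries g
    rw [hc, hd] at this
    simp at this
  · rwa [rowX_of_ne _ hc]

@[simp] lemma kubotaX_tMat (a : Fˣ) : kubotaX (tMat a) = (a : F)⁻¹ := by
  rw [kubotaX_eq]; simp [rowX_zero]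

@[simp] lemma kubotaX_one : kubotaX (1 : SL(2, F)) = 1 := by
  rw [kubotaX_eq]; simp [rowX_zero]

@[simp] lemma kubotaX_wMat : kubotaX (wMat : SL(2, F)) = -1 := by
  rw [kubotaX_eq]; simp [rowX_of_ne]

lemma kubotaX_mul_nMat (g : SL(2, F)) (b : F) : kubotaX (g * nMat b) = kubotaX g := by
  rw [kubotaX_eq, kubotaX_eq]
  by_cases hc : g.1 1 0 = 0
  · simp [hc, rowX_zero]
  · simp [rowX_of_ne _ hc]

lemma kubotaX_nMat_mul (g : SL(2, F)) (b : F) : kubotaX (nMat b * g) = kubotaX g := by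
  rw [kubotaX_eq, kubotaX_eq]; simp

lemma kubotaX_tMat_mul (g : SL(2, F)) (a : Fˣ) : kubotaX (tMat a * g) = (a : F)⁻¹ * kubotaX g := by
  rw [kubotaX_eq, kubotaX_eq]
  by_cases hc : g.1 1 0 = 0
  · simp [hc, rowX_zero]
  · rw [rowX_of_ne _ hc, rowX_of_ne _ (by simpa using hc)]; simp

lemma kubotaX_mul_tMat (g : SL(2, F)) (a : Fˣ) : kubotaX (g * tMat a) = kubotaX g * (a : F) ∨
    kubotaX (g * tMat a) = kubotaX g * (a : F)⁻¹ := by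
  rw [kubotaX_eq, kubotaX_eq]
  by_cases hc : g.1 1 0 = 0
  · right; simp [hc, rowX_zero]
  · left; rw [rowX_of_ne _ hc, rowX_of_ne _ (by simpa using hc)]; simp

lemma kubota_mul_nMat (g : SL(2, F)) (b : F) : kubota g (nMat b) = 1 := by
  rw [kubota, kubotaX_mul_nMat, div_self (kubotaX_ne_zero g), hilbert_one_left]

lemma kubota_nMat_mul (g : SL(2, F)) (b : F) : kubota (nMat b) g = 1 := by
  rw [kubota, kubotaX_nMat_mul, div_self (kubotaX_ne_zero g), hilbert_one_right]

lemma kubota_one_left (g : SL(2, F)) : kubota 1 g = 1 := by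
  rw [← nMat_zero, kubota_nMat_mul]

@[simp] lemma Mp.mul_mat (x y : Mp F) : (x * y).mat = x.mat * y.mat := rfl
@[simp] lemma Mp.mul_sgn (x y : Mp F) : (x * y).sgn = x.sgn * y.sgn * kubota x.mat y.mat := rfl

end GroupField

/-! ### The cocycle identity and associativity of the metaplectic product -/

section GroupLocal

variable {F : Type*} [NontriviallyNormedField F] [IsUltrametricDist F] [ProperSpace F]

lemma int_units_cancel (x y : ℤˣ) : x * (x * y) = y := by revert x y; decide

namespace IsOddUniformizer

variable {ϖ : F} (hU : IsOddUniformizer ϖ)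

include hU

lemma hilbert_neg_one_neg_one : hilbert (-1 : F) (-1) = 1 :=
  hU.hilbert_unit_unit (by simp) (by simp)

lemma kubota_tMat_mul (g : SL(2, F)) (a : Fˣ) : kubota (tMat a) g = hilbert (kubotaX g) (a : F) := by
  have hg := kubotaX_ne_zero g
  rw [kubota, kubotaX_tMat_mul, kubotaX_tMat]
  have h1 : (a : F)⁻¹ / ((a : F)⁻¹ * kubotaX g) = (kubotaX g)⁻¹ := by field_simp
  have h2 : kubotaX g / ((a : F)⁻¹ * kubotaX g) = a := by field_simp
  rw [h1, h2, hilbert_inv_left hg]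

lemma kubota_mul_tMat (g : SL(2, F)) (a : Fˣ) : kubota g (tMat a) = hilbert (kubotaX g) (a : F) := by
  have hg := kubotaX_ne_zero g
  have ha : (a : F) ≠ 0 := a.ne_zero
  rw [kubota, kubotaX_tMat]
  rcases kubotaX_mul_tMat g a with h | h <;> rw [h]
  · have h1 : kubotaX g / (kubotaX g * a) = (a : F)⁻¹ := by field_simp
    have h2 : (a : F)⁻¹ / (kubotaX g * a) = (kubotaX g)⁻¹ * ((a : F)⁻¹) ^ 2 := by field_simp
    rw [h1, h2, hilbert_comm, hilbert_mul_sq_left _ _ (inv_ne_zero ha), hilbert_inv_left hg,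
      hilbert_inv_right ha]
  · have h1 : kubotaX g / (kubotaX g * (a : F)⁻¹) = a := by field_simp
    have h2 : (a : F)⁻¹ / (kubotaX g * (a : F)⁻¹) = (kubotaX g)⁻¹ := by field_simp
    rw [h1, h2, hilbert_comm, hilbert_inv_left hg]

/-- Everything depends only on lower rows. When one of the entries involved vanishes, the identity
follows from bilinearity and (a, a) = (a, -1). In the generic case one relation of Steinberg type is
needed in addition. -/
lemma kubota_cocycle_wMat (g h : SL(2, F)) :
    kubota (g * h) wMat * kubota g h = kubota g (h * wMat) * kubota h wMat := by
  have hn1 : (-1 : F) ≠ 0 := neg_ne_zero.2 one_ne_zero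
  have h11 := hU.hilbert_neg_one_neg_one
  -- Here (c1, d1) is the lower row of g, (a, b; c2, d2) is h, and (c, d) is the lower row of gh;
  -- right multiplication by w turns a row (c, d) into (-d, c).
  have key : ∀ c1 d1 a b c2 d2 : F, a * d2 - b * c2 = 1 → (c1 ≠ 0 ∨ d1 ≠ 0) →
      ∀ c d, c = c1 * a + d1 * c2 → d = c1 * b + d1 * d2 →
      hilbert (rowX c d / rowX (-d) c) (-1 / rowX (-d) c) *
        hilbert (rowX c1 d1 / rowX c d) (rowX c2 d2 / rowX c d) =
      hilbert (rowX c1 d1 / rowX (-d) c) (rowX (-d2) c2 / rowX (-d) c) *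
        hilbert (rowX c2 d2 / rowX (-d2) c2) (-1 / rowX (-d2) c2) := by
    -- The relation `hc1` recovers the first entry of the lower row of g from g = (gh)h⁻¹. It is the
    -- only trace of the determinant condition used once c1 is known to be nonzero.
    intro c1 d1 a b c2 d2 hdet hne c d hc hd
    have hc1 : c1 = c * d2 - d * c2 := by rw [hc, hd]; linear_combination (-c1) * hdet
    by_cases h1 : c1 = 0
    · have hd1 : d1 ≠ 0 := by tauto
      have hcc : c = d1 * c2 := by rw [hc, h1]; ring
      have hdd : d = d1 * d2 := by rw [hd, h1]; ring
      subst hcc hdd h1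
      by_cases h2 : c2 = 0
      · have hd2 : d2 ≠ 0 := by rintro rfl; simp [h2] at hdet
        subst h2
        simp only [mul_zero, rowX_zero, rowX_of_ne _ (neg_ne_zero.2 (mul_ne_zero hd1 hd2)),
          rowX_of_ne _ (neg_ne_zero.2 hd2)]
        simp only [← neg_one_mul (d1 * d2), ← neg_one_mul d2, div_eq_mul_inv, mul_inv,
          hU.hilbert_mul_left, hU.hilbert_mul_right, hilbert_inv_left, hilbert_inv_right,
          hU.hilbert_self, ne_eq, hd1, hd2, hn1, mul_eq_zero, inv_eq_zero, or_self,
          not_false_eq_true, h11, hilbert_comm, mul_comm, mul_left_comm, mul_assoc, int_units_cancel,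
          Int.units_mul_self, mul_one, one_mul]
      · by_cases h3 : d2 = 0
        · subst h3
          simp only [mul_zero, neg_zero, rowX_zero, rowX_of_ne _ (mul_ne_zero hd1 h2),
            rowX_of_ne _ h2]
          simp only [div_eq_mul_inv, mul_inv,
            hU.hilbert_mul_left, hU.hilbert_mul_right, hilbert_inv_left, hilbert_inv_right,
            hU.hilbert_self, ne_eq, hd1, h2, hn1, mul_eq_zero, inv_eq_zero, or_self,
            not_false_eq_true, h11, hilbert_comm, mul_comm, mul_left_comm, mul_assoc, int_units_cancel,
            Int.units_mul_self, mul_one, one_mul]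
        · simp only [rowX_zero, rowX_of_ne _ (mul_ne_zero hd1 h2), rowX_of_ne _ h2,
            rowX_of_ne _ (neg_ne_zero.2 (mul_ne_zero hd1 h3)), rowX_of_ne _ (neg_ne_zero.2 h3)]
          simp only [← neg_one_mul (d1 * d2), ← neg_one_mul d2, div_eq_mul_inv, mul_inv,
            hU.hilbert_mul_left, hU.hilbert_mul_right, hilbert_inv_left, hilbert_inv_right,
            hU.hilbert_self, ne_eq, hd1, h2, h3, hn1, mul_eq_zero, inv_eq_zero, or_self,
            not_false_eq_true, h11, hilbert_comm, mul_comm, mul_left_comm, mul_assoc, int_units_cancel,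
            Int.units_mul_self, mul_one, one_mul]
    · rw [rowX_of_ne d1 h1]
      clear hc hd hdet hne
      by_cases hc0 : c = 0
      · subst hc0
        have e : c1 = -1 * d * c2 := by rw [hc1]; ring
        have hd0 : d ≠ 0 := by rintro rfl; simp [e] at h1
        have hc2 : c2 ≠ 0 := by rintro rfl; simp [e] at h1
        subst e
        by_cases h3 : d2 = 0
        · subst h3
          simp only [neg_zero, rowX_zero, rowX_of_ne _ hc2, rowX_of_ne _ (neg_ne_zero.2 hd0)]
          simp only [← neg_one_mul d, div_eq_mul_inv, mul_inv,
            hU.hilbert_mul_left, hU.hilbert_mul_right, hilbert_inv_left, hilbert_inv_right,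
            hU.hilbert_self, ne_eq, hd0, hc2, hn1, mul_eq_zero, inv_eq_zero, or_self,
            not_false_eq_true, h11, hilbert_comm, mul_comm, mul_left_comm, mul_assoc, int_units_cancel,
            Int.units_mul_self, mul_one, one_mul]
        · simp only [rowX_zero, rowX_of_ne _ hc2, rowX_of_ne _ (neg_ne_zero.2 hd0),
            rowX_of_ne _ (neg_ne_zero.2 h3)]
          simp only [← neg_one_mul d, ← neg_one_mul d2, div_eq_mul_inv, mul_inv,
            hU.hilbert_mul_left, hU.hilbert_mul_right, hilbert_inv_left, hilbert_inv_right,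
            hU.hilbert_self, ne_eq, hd0, hc2, h3, hn1, mul_eq_zero, inv_eq_zero, or_self,
            not_false_eq_true, h11, hilbert_comm, mul_comm, mul_left_comm, mul_assoc, int_units_cancel,
            Int.units_mul_self, mul_one, one_mul]
      · by_cases hd0 : d = 0
        · subst hd0
          have e : c1 = c * d2 := by rw [hc1]; ring
          have hd2 : d2 ≠ 0 := by rintro rfl; simp [e] at h1
          subst e
          by_cases h3 : c2 = 0
          · subst h3
            simp only [neg_zero, rowX_zero, rowX_of_ne _ hc0, rowX_of_ne _ (neg_ne_zero.2 hd2)]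
            simp only [← neg_one_mul d2, div_eq_mul_inv, mul_inv,
              hU.hilbert_mul_left, hU.hilbert_mul_right, hilbert_inv_left, hilbert_inv_right,
              hU.hilbert_self, ne_eq, hd2, hc0, hn1, mul_eq_zero, inv_eq_zero, or_self,
              not_false_eq_true, h11, hilbert_comm, mul_comm, mul_left_comm, mul_assoc, int_units_cancel,
              Int.units_mul_self, mul_one, one_mul]
          · simp only [neg_zero, rowX_zero, rowX_of_ne _ hc0, rowX_of_ne _ (neg_ne_zero.2 hd2),
              rowX_of_ne _ h3]
            simp only [← neg_one_mul d2, div_eq_mul_inv, mul_inv,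
              hU.hilbert_mul_left, hU.hilbert_mul_right, hilbert_inv_left, hilbert_inv_right,
              hU.hilbert_self, ne_eq, hd2, hc0, h3, hn1, mul_eq_zero, inv_eq_zero, or_self,
              not_false_eq_true, h11, hilbert_comm, mul_comm, mul_left_comm, mul_assoc, int_units_cancel,
              Int.units_mul_self, mul_one, one_mul]
        · rw [rowX_of_ne _ hc0, rowX_of_ne _ (neg_ne_zero.2 hd0)]
          by_cases h2 : c2 = 0
          · subst h2
            have e : c1 = c * d2 := by rw [hc1]; ring
            have hd2 : d2 ≠ 0 := by rintro rfl; simp [e] at h1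
            subst e
            simp only [rowX_zero, rowX_of_ne _ (neg_ne_zero.2 hd2)]
            simp only [← neg_one_mul d, ← neg_one_mul d2, div_eq_mul_inv, mul_inv,
              hU.hilbert_mul_left, hU.hilbert_mul_right, hilbert_inv_left, hilbert_inv_right,
              hU.hilbert_self, ne_eq, hd0, hc0, hd2, hn1, mul_eq_zero, inv_eq_zero, or_self,
              not_false_eq_true, h11, hilbert_comm, mul_comm, mul_left_comm, mul_assoc, int_units_cancel,
              Int.units_mul_self, mul_one, one_mul]
          · by_cases h3 : d2 = 0
            · subst h3
              have e : c1 = -1 * d * c2 := by rw [hc1]; ring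
              subst e
              simp only [neg_zero, rowX_zero, rowX_of_ne _ h2]
              simp only [← neg_one_mul d, div_eq_mul_inv, mul_inv,
                hU.hilbert_mul_left, hU.hilbert_mul_right, hilbert_inv_left, hilbert_inv_right,
                hU.hilbert_self, ne_eq, hd0, hc0, h2, hn1, mul_eq_zero, inv_eq_zero, or_self,
                not_false_eq_true, h11, hilbert_comm, mul_comm, mul_left_comm, mul_assoc, int_units_cancel,
                Int.units_mul_self, mul_one, one_mul]
            · rw [rowX_of_ne _ h2, rowX_of_ne _ (neg_ne_zero.2 h3)]
              -- The two arguments add up to 1, by `hc1` divided by c1.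
              have rel : hilbert (c * d2 * c1⁻¹) (-1 * d * c2 * c1⁻¹) = 1 := by
                apply hilbert_of_add_eq_one
                field_simp
                rw [hc1]; ring
              clear hc1
              revert rel
              simp only [← neg_one_mul d, ← neg_one_mul d2, div_eq_mul_inv, mul_inv,
                hU.hilbert_mul_left, hU.hilbert_mul_right, hilbert_inv_left, hilbert_inv_right,
                hU.hilbert_self, ne_eq, hd0, hc0, h2, h1, h3, hn1, mul_eq_zero, inv_eq_zero, or_self,
                not_false_eq_true, h11, hilbert_comm, mul_comm, mul_left_comm, mul_assoc, int_units_cancel,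
                Int.units_mul_self, mul_one, one_mul]
              intro rel
              refine (mul_one _).symm.trans ?_
              rw [← rel]
              simp only [mul_comm, mul_left_comm, mul_assoc, int_units_cancel, Int.units_mul_self,
                mul_one]
  have := key (g.1 1 0) (g.1 1 1) (h.1 0 0) (h.1 0 1) (h.1 1 0) (h.1 1 1) (det_entries h)
    (by
      by_contra hcon
      push Not at hcon
      have := det_entries g
      rw [hcon.1, hcon.2] at this
      simp at this) ((g * h).1 1 0) ((g * h).1 1 1) (mul_entry _ _ _ _) (mul_entry _ _ _ _)
  have hw10 : ∀ g : SL(2, F), (g * wMat).1 1 0 = -g.1 1 1 := fun g => by simp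
  have hw11 : ∀ g : SL(2, F), (g * wMat).1 1 1 = g.1 1 0 := fun g => by simp
  have hX : ∀ g : SL(2, F), kubotaX (g * wMat) = rowX (-g.1 1 1) (g.1 1 0) := fun g => by
    rw [kubotaX_eq, hw10, hw11]
  rw [kubota, kubota, kubota, kubota, ← mul_assoc, kubotaX_wMat, hX, hX, kubotaX_eq, kubotaX_eq,
    kubotaX_eq]
  exact this

lemma kubota_cocycle_nMat (g h : SL(2, F)) (b : F) :
    kubota (g * h) (nMat b) * kubota g h = kubota g (h * nMat b) * kubota h (nMat b) := by
  rw [kubota_mul_nMat, kubota_mul_nMat, one_mul, mul_one, kubota, kubota, ← mul_assoc,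
    kubotaX_mul_nMat, kubotaX_mul_nMat]

lemma kubota_cocycle_tMat (g h : SL(2, F)) (a : Fˣ) :
    kubota (g * h) (tMat a) * kubota g h = kubota g (h * tMat a) * kubota h (tMat a) := by
  have ha : (a : F) ≠ 0 := a.ne_zero
  have hg := kubotaX_ne_zero g
  have hh := kubotaX_ne_zero h
  have hgh := kubotaX_ne_zero (g * h)
  have hn1 : (-1 : F) ≠ 0 := neg_ne_zero.2 one_ne_zero
  rw [hU.kubota_mul_tMat, hU.kubota_mul_tMat, kubota, kubota, ← mul_assoc]
  rcases kubotaX_mul_tMat (g * h) a with h1 | h1 <;> rcases kubotaX_mul_tMat h a with h2 | h2 <;>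
  · rw [h1, h2]
    simp only [div_eq_mul_inv, mul_inv, inv_inv,
      hU.hilbert_mul_left, hU.hilbert_mul_right, hilbert_inv_left, hilbert_inv_right,
      hU.hilbert_self, ne_eq, hg, hh, hgh, ha, hn1, mul_eq_zero, inv_eq_zero, or_self,
      not_false_eq_true, hilbert_comm, mul_comm, mul_left_comm, mul_assoc, int_units_cancel,
      Int.units_mul_self, mul_one, one_mul]

/-- The cocycle identity for the Kubota cocycle. -/
lemma kubota_cocycle (g h k : SL(2, F)) :
    kubota (g * h) k * kubota g h = kubota g (h * k) * kubota h k := by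
  -- For fixed third argument the identity, quantified over g and h, is stable under products of
  -- third arguments. By the Bruhat decomposition it suffices to treat n(b), t(a) and w.
  have hmul : ∀ k₁ k₂ : SL(2, F),
      (∀ g h, kubota (g * h) k₁ * kubota g h = kubota g (h * k₁) * kubota h k₁) →
      (∀ g h, kubota (g * h) k₂ * kubota g h = kubota g (h * k₂) * kubota h k₂) →
      ∀ g h, kubota (g * h) (k₁ * k₂) * kubota g h =
        kubota g (h * (k₁ * k₂)) * kubota h (k₁ * k₂) := by
    intro k₁ k₂ h1 h2 g h
    have e1 := h2 (g * h) k₁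
    have e2 := h1 g h
    have e3 := h2 g (h * k₁)
    have e4 := h2 h k₁
    rw [mul_assoc] at e3
    rw [mul_assoc] at e1
    have aux : ∀ a b c d : ℤˣ, a * b = c * d → c = a * b * d := by decide
    have f1 := aux _ _ _ _ e1
    have f3 := aux _ _ _ _ e3
    have f4 := aux _ _ _ _ e4
    have f2 : kubota g h = kubota (g * h) k₁ * (kubota g (h * k₁) * kubota h k₁) := by
      rw [← e2, int_units_cancel]
    rw [f1, f3, f4, f2]
    simp only [mul_assoc, mul_comm, mul_left_comm, int_units_cancel]
  by_cases hc : k.1 1 0 = 0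
  · obtain ⟨a, b, rfl⟩ := eq_borel hc
    exact hmul _ _ (fun g h => hU.kubota_cocycle_nMat g h b)
      (fun g h => hU.kubota_cocycle_tMat g h a) g h
  · rw [eq_bruhat hc]
    exact hmul _ _ (hmul _ _ (hmul _ _ (fun g h => hU.kubota_cocycle_nMat g h _)
      (fun g h => hU.kubota_cocycle_tMat g h _)) hU.kubota_cocycle_wMat)
      (fun g h => hU.kubota_cocycle_nMat g h _) g h

lemma mp_mul_assoc (x y z : Mp F) : x * y * z = x * (y * z) := by
  ext1
  · simp only [Mp.mul_mat, mul_assoc]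
  · simp only [Mp.mul_mat, Mp.mul_sgn]
    have := hU.kubota_cocycle x.mat y.mat z.mat
    calc _ = x.sgn * y.sgn * z.sgn * (kubota (x.mat * y.mat) z.mat * kubota x.mat y.mat) := by
          simp only [mul_assoc, mul_comm, mul_left_comm]
      _ = _ := by rw [this]; simp only [mul_assoc, mul_comm, mul_left_comm]

end IsOddUniformizer

end GroupLocal

/-! ## The splitting over the maximal compact subgroup -/

section Splitting

variable {F : Type*} [NontriviallyNormedField F] [IsUltrametricDist F]

open Classical in
/-- The explicit splitting, in terms of the bottom row; `π` is a generator of `𝔭 ^ ε`. -/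
noncomputable def splitVal (π c d : F) : ℤˣ :=
  if c = 0 then hilbert π d else if ‖c‖ < ‖π‖ then hilbert (c * π) d else 1

lemma splitVal_zero (π d : F) : splitVal π 0 d = hilbert π d := if_pos rfl

lemma splitVal_of_lt {π c : F} (d : F) (hc : c ≠ 0) (h : ‖c‖ < ‖π‖) :
    splitVal π c d = hilbert (c * π) d := by rw [splitVal, if_neg hc, if_pos h]

lemma splitVal_of_eq {π c : F} (d : F) (hπ : π ≠ 0) (h : ‖c‖ = ‖π‖) : splitVal π c d = 1 := by
  have hc : c ≠ 0 := norm_ne_zero_iff.1 (by rw [h]; exact norm_ne_zero_iff.2 hπ)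
  rw [splitVal, if_neg hc, if_neg h.not_lt]

lemma mem_primePow {n : ℤ} {x : F} : x ∈ primePow F n ↔ ‖x‖ ≤ (resCard F : ℝ) ^ (-n) := Iff.rfl

lemma mem_levelSet {ε m : ℕ} {k : SL(2, F)} : k ∈ levelSet F ε m ↔
    ‖k.1 0 0‖ ≤ 1 ∧ ‖k.1 1 1‖ ≤ 1 ∧ ‖k.1 0 1‖ ≤ (resCard F : ℝ) ^ (ε : ℤ) ∧
      ‖k.1 1 0‖ ≤ (resCard F : ℝ) ^ (-((m : ℤ) + ε)) := by
  simp [levelSet, mem_primePow]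

namespace IsOddUniformizer

variable {ϖ : F} (hU : IsOddUniformizer ϖ)

include hU

lemma norm_pow_eq (ε : ℕ) : ‖ϖ ^ ε‖ = (resCard F : ℝ) ^ (-(ε : ℤ)) := by
  rw [← zpow_natCast, hU.norm_zpow]

lemma levelSet_mul {ε m : ℕ} {k l : SL(2, F)} (hk : k ∈ levelSet F ε m)
    (hl : l ∈ levelSet F ε m) : k * l ∈ levelSet F ε m := by
  rw [mem_levelSet] at *
  obtain ⟨k1, k2, k3, k4⟩ := hk
  obtain ⟨l1, l2, l3, l4⟩ := hl
  have hm : (resCard F : ℝ) ^ (ε : ℤ) * (resCard F : ℝ) ^ (-((m : ℤ) + ε)) ≤ 1 := by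
    rw [← zpow_add₀ hU.card_pos.ne', ← zpow_zero (resCard F : ℝ), hU.zpow_le]; omega
  have hε : (0 : ℝ) ≤ (resCard F : ℝ) ^ (ε : ℤ) := zpow_nonneg hU.card_pos.le _
  have hε' : (0 : ℝ) ≤ (resCard F : ℝ) ^ (-((m : ℤ) + ε)) := zpow_nonneg hU.card_pos.le _
  simp only [mul_entry]
  refine ⟨norm_add_le_of ?_ ?_, norm_add_le_of ?_ ?_, norm_add_le_of ?_ ?_,
    norm_add_le_of ?_ ?_⟩ <;> rw [norm_mul]
  · exact mul_le_one₀ k1 (norm_nonneg _) l1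
  · exact (mul_le_mul k3 l4 (norm_nonneg _) hε).trans hm
  · rw [mul_comm]; exact (mul_le_mul l3 k4 (norm_nonneg _) hε).trans hm
  · exact mul_le_one₀ k2 (norm_nonneg _) l2
  · simpa using mul_le_mul k1 l3 (norm_nonneg _) zero_le_one
  · simpa using mul_le_mul k3 l2 (norm_nonneg _) hε
  · simpa using mul_le_mul k4 l1 (norm_nonneg _) hε'
  · simpa using mul_le_mul k2 l4 (norm_nonneg _) zero_le_one

lemma levelSet_antitone {ε m m' : ℕ} (h : m ≤ m') : levelSet F ε m' ⊆ levelSet F ε m := by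
  intro k hk
  rw [mem_levelSet] at *
  refine ⟨hk.1, hk.2.1, hk.2.2.1, hk.2.2.2.trans ?_⟩
  rw [hU.zpow_le]; omega

lemma nMat_mem_levelSet {ε m : ℕ} {b : F} (hb : ‖b‖ ≤ (resCard F : ℝ) ^ (ε : ℤ)) :
    nMat b ∈ levelSet F ε m := by
  rw [mem_levelSet]
  simp only [nMat_00, nMat_11, nMat_01, nMat_10, norm_zero, norm_one, le_refl, true_and]
  exact ⟨hb, zpow_nonneg hU.card_pos.le _⟩

lemma tMat_mem_levelSet {ε m : ℕ} {a : Fˣ} (ha : ‖(a : F)‖ = 1) : tMat a ∈ levelSet F ε m := by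
  rw [mem_levelSet]
  simp only [tMat_00, tMat_11, tMat_01, tMat_10, norm_zero, norm_inv, ha, inv_one, le_refl,
    true_and]
  exact ⟨zpow_nonneg hU.card_pos.le _, zpow_nonneg hU.card_pos.le _⟩

lemma nOp_mem_levelSet {ε m : ℕ} {c : F} (hc : ‖c‖ ≤ (resCard F : ℝ) ^ (-((m : ℤ) + ε))) :
    nOp c ∈ levelSet F ε m := by
  rw [mem_levelSet]
  simp only [nOp_00, nOp_11, nOp_01, nOp_10, norm_zero, norm_one, le_refl, true_and]
  exact ⟨zpow_nonneg hU.card_pos.le _, hc⟩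

/-- The lower right entry is a unit or the lower left entry generates `𝔭 ^ ε`. -/
lemma primitive_row {ε m : ℕ} {k : SL(2, F)} (hk : k ∈ levelSet F ε m) (hd : ‖k.1 1 1‖ < 1) :
    m = 0 ∧ ‖k.1 1 0‖ = (resCard F : ℝ) ^ (-(ε : ℤ)) := by
  obtain ⟨h1, h2, h3, h4⟩ := mem_levelSet.1 hk
  have hdet := det_entries k
  have had : ‖k.1 0 0 * k.1 1 1‖ < 1 := by
    rw [norm_mul]; exact mul_lt_one_of_nonneg_of_lt_one_right h1 (norm_nonneg _) hd
  have hbc : ‖k.1 0 1 * k.1 1 0‖ = 1 := by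
    have := norm_one_add_eq_one (x := -(k.1 0 0 * k.1 1 1)) (by rwa [norm_neg])
    rw [← this, ← norm_neg]; congr 1; linear_combination hdet
  rw [norm_mul] at hbc
  have hq := hU.card_pos
  have hge : (resCard F : ℝ) ^ (-(ε : ℤ)) ≤ ‖k.1 1 0‖ := by
    rw [zpow_neg, inv_le_iff_one_le_mul₀' (zpow_pos hq _), ← hbc]
    exact mul_le_mul_of_nonneg_right h3 (norm_nonneg _)
  have hm := hU.zpow_le.1 (hge.trans h4)
  have hm0 : m = 0 := by omega
  refine ⟨hm0, le_antisymm ?_ hge⟩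
  rw [hm0] at h4
  simpa using h4

section

variable [ProperSpace F]

/-- When |c| < |π|, cb + d = d(1 + cb/d), and the second factor is a principal unit, invisible to
the Hilbert symbol. -/
lemma splitVal_nMat {π b c d : F} (hπ : π ≠ 0) (hb : ‖b‖ ≤ ‖π‖⁻¹) (hc : ‖c‖ ≤ ‖π‖)
    (hd : ‖c‖ < ‖π‖ → ‖d‖ = 1) : splitVal π c (c * b + d) = splitVal π c d := by
  have hπ' := norm_pos_iff.2 hπ
  by_cases hc0 : c = 0
  · rw [hc0]; simp
  rcases hc.lt_or_eq with h | h
  · rw [splitVal_of_lt _ hc0 h, splitVal_of_lt _ hc0 h]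
    have hd1 := hd h
    have hd0 : d ≠ 0 := norm_ne_zero_iff.1 (by rw [hd1]; exact one_ne_zero)
    have hcb : ‖c * b / d‖ < 1 := by
      rw [norm_div, hd1, div_one, norm_mul]
      calc ‖c‖ * ‖b‖ ≤ ‖c‖ * ‖π‖⁻¹ := mul_le_mul_of_nonneg_left hb (norm_nonneg _)
        _ < ‖π‖ * ‖π‖⁻¹ := mul_lt_mul_of_pos_right h (inv_pos.2 hπ')
        _ = 1 := mul_inv_cancel₀ hπ'.ne'
    have h10 : 1 + c * b / d ≠ 0 := norm_ne_zero_iff.1 (by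
      rw [norm_one_add_eq_one hcb]; exact one_ne_zero)
    have e : c * b + d = d * (1 + c * b / d) := by field_simp; ring
    rw [e, hU.hilbert_mul_right (mul_ne_zero hc0 hπ) hd0 h10,
      hilbert_comm _ (1 + c * b / d), hU.hilbert_of_sub_one_lt (a := 1 + c * b / d)
      (by rwa [add_sub_cancel_left]), mul_one]
  · rw [splitVal_of_eq _ hπ h, splitVal_of_eq _ hπ h]

/-- The cocycle of k and t(u) is (x(k), u). Symbols between units vanish, so only the symbols of π
and c against u remain to be matched. -/
lemma splitVal_tMat {π u c d : F} (hπ : π ≠ 0) (hu : ‖u‖ = 1) (hc : ‖c‖ ≤ ‖π‖)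
    (hd : ‖c‖ < ‖π‖ → ‖d‖ = 1) :
    splitVal π c d * splitVal π 0 u⁻¹ * hilbert (rowX c d) u = splitVal π (c * u) (d * u⁻¹) := by
  have hu0 : u ≠ 0 := norm_ne_zero_iff.1 (by rw [hu]; exact one_ne_zero)
  have hcu : ‖c * u‖ = ‖c‖ := by rw [norm_mul, hu, mul_one]
  rw [splitVal_zero]
  rcases hc.lt_or_eq with h | h
  · have hd1 := hd h
    have hd0 : d ≠ 0 := norm_ne_zero_iff.1 (by rw [hd1]; exact one_ne_zero)
    have hdu := hU.hilbert_unit_unit hd1 hu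
    have huu := hU.hilbert_unit_unit hu hu
    by_cases hc0 : c = 0
    · rw [hc0, zero_mul, splitVal_zero, splitVal_zero, rowX_zero, hdu,
        hU.hilbert_mul_right hπ hd0 (inv_ne_zero hu0), mul_one]
    · rw [splitVal_of_lt _ hc0 h, splitVal_of_lt _ (mul_ne_zero hc0 hu0) (by rwa [hcu]),
        rowX_of_ne _ hc0]
      have hud : hilbert u d = 1 := by rw [hilbert_comm]; exact hdu
      simp only [hU.hilbert_mul_left, hU.hilbert_mul_right, hilbert_inv_left, hilbert_inv_right,
        ne_eq, hc0, hu0, hd0, hπ, mul_eq_zero, inv_eq_zero, or_self, not_false_eq_true, hud, huu,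
        mul_comm, mul_left_comm, mul_assoc, int_units_cancel, mul_one, one_mul]
  · have hc0 : c ≠ 0 := norm_ne_zero_iff.1 (by rw [h]; exact norm_ne_zero_iff.2 hπ)
    rw [splitVal_of_eq _ hπ h, splitVal_of_eq _ hπ (hcu.trans h), rowX_of_ne _ hc0,
      hilbert_inv_right hu0]
    have e : c = π * (c / π) := by field_simp
    rw [e, hU.hilbert_mul_left hπ (div_ne_zero hc0 hπ) hu0, hU.hilbert_unit_unit (a := c / π) _ hu,
      one_mul, mul_one, Int.units_mul_self]
    rw [norm_div, h, div_self (norm_ne_zero_iff.2 hπ)]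

/-- The Weyl element of K_0 is t(π)⁻¹w, which sends the row (c, d) to (-dπ, c/π). It exchanges the
regimes |c| < |π| and |c| = |π| of the definition of `splitVal`. -/
lemma splitVal_wMat {π c d : F} (hπ : π ≠ 0) (hc : ‖c‖ ≤ ‖π‖) (hd' : ‖d‖ ≤ 1)
    (hd : ‖c‖ < ‖π‖ → ‖d‖ = 1) :
    splitVal π c d * splitVal π (-π) 0 *
      hilbert (rowX c d / rowX (-d * π) (c / π)) (-π / rowX (-d * π) (c / π)) =
      splitVal π (-d * π) (c / π) := by
  have hπ' := norm_pos_iff.2 hπ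
  have hn1 : (-1 : F) ≠ 0 := neg_ne_zero.2 one_ne_zero
  have h11 := hU.hilbert_neg_one_neg_one
  rw [splitVal_of_eq (c := -π) _ hπ (norm_neg _), mul_one]
  have hdn : ‖-d * π‖ = ‖d‖ * ‖π‖ := by rw [norm_mul, norm_neg]
  rcases hc.lt_or_eq with h | h
  · have hd1 := hd h
    have hd0 : d ≠ 0 := norm_ne_zero_iff.1 (by rw [hd1]; exact one_ne_zero)
    have hdπ : -d * π ≠ 0 := mul_ne_zero (neg_ne_zero.2 hd0) hπ
    have hd11 := hU.hilbert_unit_unit (a := -1) (by simp) hd1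
    rw [splitVal_of_eq (c := -d * π) _ hπ (by rw [hdn, hd1, one_mul]), rowX_of_ne _ hdπ]
    have e : -π / (-d * π) = d⁻¹ := by field_simp
    rw [e]
    by_cases hc0 : c = 0
    · rw [hc0, rowX_zero, splitVal_zero]
      have e2 : d / (-d * π) = -1 * π⁻¹ := by field_simp
      rw [e2]
      simp only [hU.hilbert_mul_left, hilbert_inv_left, hilbert_inv_right,
        ne_eq, hd0, hπ, hn1, inv_eq_zero, not_false_eq_true, hd11, Int.units_mul_self, one_mul]
    · rw [splitVal_of_lt _ hc0 h, rowX_of_ne _ hc0]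
      have e2 : c / (-d * π) = -1 * (c * d⁻¹ * π⁻¹) := by field_simp
      have hdd : hilbert d d = 1 := hU.hilbert_unit_unit hd1 hd1
      rw [e2]
      simp only [hU.hilbert_mul_left, hilbert_inv_left, hilbert_inv_right,
        ne_eq, hc0, hd0, hπ, hn1, mul_eq_zero, or_self, inv_eq_zero, not_false_eq_true, hd11, hdd,
        mul_comm, mul_left_comm, mul_assoc, int_units_cancel, Int.units_mul_self, mul_one, one_mul]
  · have hc0 : c ≠ 0 := norm_ne_zero_iff.1 (by rw [h]; exact norm_ne_zero_iff.2 hπ)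
    have hcπ : ‖c / π‖ = 1 := by rw [norm_div, h, div_self hπ'.ne']
    have hcπ0 : c / π ≠ 0 := div_ne_zero hc0 hπ
    rw [splitVal_of_eq (c := c) _ hπ h, rowX_of_ne _ hc0, one_mul]
    by_cases hd0 : d = 0
    · rw [hd0, neg_zero, zero_mul, rowX_zero, splitVal_zero]
      have e : c / (c / π) = π := by field_simp
      have e2 : -π / (c / π) = -π * (c / π)⁻¹ := by field_simp
      rw [e, e2, hU.hilbert_mul_right hπ (neg_ne_zero.2 hπ) (inv_ne_zero hcπ0),
        hilbert_self_neg, one_mul, hilbert_inv_right hcπ0]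
    · have hdπ : -d * π ≠ 0 := mul_ne_zero (neg_ne_zero.2 hd0) hπ
      rw [rowX_of_ne _ hdπ]
      have e : -π / (-d * π) = d⁻¹ := by field_simp
      have e2 : c / (-d * π) = -d⁻¹ * (c / π) := by field_simp
      have key : hilbert (c / (-d * π)) (-π / (-d * π)) = hilbert (c / π) d := by
        rw [e, e2, hU.hilbert_mul_left (neg_ne_zero.2 (inv_ne_zero hd0)) hcπ0 (inv_ne_zero hd0),
          hilbert_comm (-d⁻¹), hilbert_self_neg, one_mul, hilbert_inv_right hd0]
      rw [key]
      rcases hd'.lt_or_eq with h' | h'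
      · rw [splitVal_of_lt _ hdπ (by rw [hdn]; nlinarith), hilbert_comm]
        have e3 : -d * π * π = -1 * d * π ^ 2 := by ring
        rw [e3, hilbert_mul_sq_left _ _ hπ, hU.hilbert_mul_left hn1 hd0 hcπ0,
          hU.hilbert_unit_unit (a := -1) (by simp) hcπ, one_mul]
      · rw [splitVal_of_eq (c := -d * π) _ hπ (by rw [hdn, h', one_mul]),
          hU.hilbert_unit_unit hcπ h']

/-- The lift to the metaplectic group given by `splitVal`. -/
lemma splitVal_mul {ε : ℕ} {k l : SL(2, F)} (hk : k ∈ levelSet F ε 0) (hl : l ∈ levelSet F ε 0) :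
    (⟨k, splitVal (ϖ ^ ε) (k.1 1 0) (k.1 1 1)⟩ : Mp F) *
      ⟨l, splitVal (ϖ ^ ε) (l.1 1 0) (l.1 1 1)⟩ =
      ⟨k * l, splitVal (ϖ ^ ε) ((k * l).1 1 0) ((k * l).1 1 1)⟩ := by
  set π := ϖ ^ ε with hπdef
  have hπ : π ≠ 0 := pow_ne_zero _ hU.ne_zero
  have hπn : ‖π‖ = (resCard F : ℝ) ^ (-(ε : ℤ)) := hU.norm_pow_eq ε
  have hπn' : ‖π‖⁻¹ = (resCard F : ℝ) ^ (ε : ℤ) := by rw [hπn, ← zpow_neg, neg_neg]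
  have hrow : ∀ k ∈ levelSet F ε 0, ‖k.1 1 0‖ ≤ ‖π‖ ∧ ‖k.1 1 1‖ ≤ 1 ∧
      (‖k.1 1 0‖ < ‖π‖ → ‖k.1 1 1‖ = 1) := by
    intro k hk
    have hk' := mem_levelSet.1 hk
    refine ⟨by rw [hπn]; simpa using hk'.2.2.2, hk'.2.1, fun hlt => ?_⟩
    by_contra hne
    have := (hU.primitive_row hk (lt_of_le_of_ne hk'.2.1 hne)).2
    rw [hπn, this] at hlt
    exact lt_irrefl _ hlt
  let S : SL(2, F) → Mp F := fun k => ⟨k, splitVal π (k.1 1 0) (k.1 1 1)⟩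
  -- Multiplicativity against every left factor k is stable under products of right factors, so it
  -- need only be verified on generators of K_0.
  let G : SL(2, F) → Prop := fun l => l ∈ levelSet F ε 0 ∧
    ∀ k ∈ levelSet F ε 0, S k * S l = S (k * l)
  have hmul : ∀ l l', G l → G l' → G (l * l') := by
    rintro l l' ⟨h1, h2⟩ ⟨h3, h4⟩
    refine ⟨hU.levelSet_mul h1 h3, fun k hk => ?_⟩
    rw [← h4 l h1, ← hU.mp_mul_assoc, h2 k hk, h4 _ (hU.levelSet_mul hk h1), mul_assoc]
  have hn : ∀ b : F, ‖b‖ ≤ (resCard F : ℝ) ^ (ε : ℤ) → G (nMat b) := by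
    intro b hb
    refine ⟨hU.nMat_mem_levelSet hb, fun k hk => ?_⟩
    obtain ⟨h1, h2, h3⟩ := hrow k hk
    refine Mp.ext rfl ?_
    simp only [S, Mp.mul_sgn, mul_entry, nMat_00, nMat_01, nMat_10, nMat_11, mul_one, mul_zero,
      add_zero, splitVal_zero, hilbert_one_right, kubota_mul_nMat]
    exact (hU.splitVal_nMat hπ (by rwa [hπn']) h1 h3).symm
  have ht : ∀ u : Fˣ, ‖(u : F)‖ = 1 → G (tMat u) := by
    intro u hu
    refine ⟨hU.tMat_mem_levelSet hu, fun k hk => ?_⟩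
    obtain ⟨h1, h2, h3⟩ := hrow k hk
    refine Mp.ext rfl ?_
    simp only [S, Mp.mul_sgn, mul_entry, tMat_00, tMat_01, tMat_10, tMat_11, mul_zero, add_zero,
      zero_add, hU.kubota_mul_tMat, kubotaX_eq]
    exact hU.splitVal_tMat hπ hu h1 h3
  have hw : G (tMat (Units.mk0 π hπ)⁻¹ * wMat) := by
    refine ⟨?_, fun k hk => ?_⟩
    · rw [mem_levelSet]
      simp only [mul_entry, tMat_00, tMat_01, tMat_10, tMat_11, wMat_00, wMat_01, wMat_10, wMat_11]
      simp only [Units.val_inv_eq_inv_val, Units.val_mk0, inv_inv, mul_zero, zero_mul, add_zero,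
        zero_add, mul_one, norm_zero, zero_le_one, norm_inv, hπn', mul_neg, norm_neg, hπn]
      simp
    · obtain ⟨h1, h2, h3⟩ := hrow k hk
      have e10 : (k * (tMat (Units.mk0 π hπ)⁻¹ * wMat)).1 1 0 = -k.1 1 1 * π := by simp
      have e11 : (k * (tMat (Units.mk0 π hπ)⁻¹ * wMat)).1 1 1 = k.1 1 0 / π := by
        simp [div_eq_mul_inv]
      have e20 : (tMat (Units.mk0 π hπ)⁻¹ * wMat).1 1 0 = -π := by simp
      have e21 : (tMat (Units.mk0 π hπ)⁻¹ * wMat).1 1 1 = 0 := by simp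
      refine Mp.ext rfl ?_
      simp only [S, Mp.mul_sgn, kubota, kubotaX_eq]
      rw [e10, e11, e20, e21, rowX_of_ne (c := -π) 0 (neg_ne_zero.2 hπ)]
      exact hU.splitVal_wMat hπ h1 h2 h3
  have hlow : ∀ k ∈ levelSet F ε 0, ‖k.1 1 0‖ = ‖π‖ → G k := by
    intro k hk hc
    have hc0 : k.1 1 0 ≠ 0 := norm_ne_zero_iff.1 (by rw [hc]; exact norm_ne_zero_iff.2 hπ)
    have hk' := mem_levelSet.1 hk
    have hinv : ∀ x : F, ‖x‖ ≤ 1 → ‖x / k.1 1 0‖ ≤ (resCard F : ℝ) ^ (ε : ℤ) := by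
      intro x hx
      rw [norm_div, hc, div_eq_mul_inv, hπn']
      exact mul_le_of_le_one_left (zpow_nonneg hU.card_pos.le _) hx
    have e : k = nMat (k.1 0 0 / k.1 1 0) *
        (tMat (Units.mk0 (-(k.1 1 0)⁻¹) (by simpa using hc0) * Units.mk0 π hπ) *
        (tMat (Units.mk0 π hπ)⁻¹ * wMat)) * nMat (k.1 1 1 / k.1 1 0) := by
      conv_lhs => rw [eq_bruhat hc0]
      rw [← mul_assoc (tMat _), tMat_mul, mul_inv_cancel_right, mul_assoc (nMat _)]
    rw [e]
    refine hmul _ _ (hmul _ _ (hn _ (hinv _ hk'.1)) (hmul _ _ (ht _ ?_) hw)) (hn _ (hinv _ hk'.2.1))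
    rw [Units.val_mul, Units.val_mk0, Units.val_mk0, norm_mul, norm_neg, norm_inv, hc,
      inv_mul_cancel₀ (norm_ne_zero_iff.2 hπ)]
  have hall : G l := by
    by_cases hc : ‖l.1 1 0‖ = ‖π‖
    · exact hlow l hl hc
    · have hlr := hrow l hl
      have hd := hlr.2.2 (lt_of_le_of_ne hlr.1 hc)
      have hinv : ‖-((ϖ ^ ε)⁻¹)‖ ≤ (resCard F : ℝ) ^ (ε : ℤ) := by
        rw [norm_neg, norm_inv, ← hπdef, hπn']
      -- The element t(π)⁻¹w has order dividing four, so l is (l times its cube) times itself. The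
      -- product in brackets has lower left entry dπ, and d is a unit, so `hlow` applies to it.
      have hwm := hmul _ _ hw (hmul _ _ hw hw)
      have e : l = (l * (tMat (Units.mk0 π hπ)⁻¹ * wMat * ((tMat (Units.mk0 π hπ)⁻¹ * wMat) *
          (tMat (Units.mk0 π hπ)⁻¹ * wMat)))) * (tMat (Units.mk0 π hπ)⁻¹ * wMat) := by
        apply sl2_ext <;> simp [hπ]
      rw [e]
      refine hmul _ _ (hlow _ (hU.levelSet_mul hl hwm.1) ?_) hw
      simp [hπ, hd]
  exact hall.2 k hk

/-- The splitting is unique. -/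
lemma splitting_eq {ε : ℕ} {k : SL(2, F)} (hk : k ∈ levelSet F ε 0) :
    splitting F ε k = splitVal (ϖ ^ ε) (k.1 1 0) (k.1 1 1) := by
  have hspec : ∀ k ∈ levelSet F ε 0, ∀ l ∈ levelSet F ε 0,
      (⟨k, splitting F ε k⟩ : Mp F) * ⟨l, splitting F ε l⟩ = ⟨k * l, splitting F ε (k * l)⟩ :=
    Classical.epsilon_spec (p := fun s : SL(2, F) → ℤˣ => ∀ k ∈ levelSet F ε 0,
      ∀ l ∈ levelSet F ε 0, (⟨k, s k⟩ : Mp F) * ⟨l, s l⟩ = ⟨k * l, s (k * l)⟩)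
      ⟨fun k => splitVal (ϖ ^ ε) (k.1 1 0) (k.1 1 1), fun k hk l hl => hU.splitVal_mul hk hl⟩
  -- The quotient of two splittings is a homomorphism from K_0 to the signs, to be shown trivial.
  set r : SL(2, F) → ℤˣ := fun k => splitting F ε k * splitVal (ϖ ^ ε) (k.1 1 0) (k.1 1 1)
    with hr
  have hrmul : ∀ k ∈ levelSet F ε 0, ∀ l ∈ levelSet F ε 0, r (k * l) = r k * r l := by
    intro k hk l hl
    have h1 := congrArg Mp.sgn (hspec k hk l hl)
    have h2 := congrArg Mp.sgn (hU.splitVal_mul hk hl)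
    simp only [Mp.mul_sgn] at h1 h2
    simp only [hr]
    rw [← h1, ← h2]
    simp only [mul_comm, mul_left_comm, mul_assoc, int_units_cancel]
  -- Since 2 is a unit, every unipotent element of K_0, upper or lower, is the square of another
  -- one; a sign character is trivial on it.
  have h2n : ∀ x : F, x / 2 + x / 2 = x := fun x => by
    rw [← add_div, ← two_mul, mul_div_cancel_left₀ _ hU.two_ne_zero]
  have hn : ∀ b : F, ‖b‖ ≤ (resCard F : ℝ) ^ (ε : ℤ) → r (nMat b) = 1 := by
    intro b hb
    have hb2 : ‖b / 2‖ ≤ (resCard F : ℝ) ^ (ε : ℤ) := by rwa [norm_div, hU.norm_two, div_one]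
    have e : nMat b = nMat (b / 2) * nMat (b / 2) := by rw [nMat_mul, h2n]
    rw [e, hrmul _ (hU.nMat_mem_levelSet hb2) _ (hU.nMat_mem_levelSet hb2), Int.units_mul_self]
  have ho : ∀ c : F, ‖c‖ ≤ (resCard F : ℝ) ^ (-(((0 : ℕ) : ℤ) + (ε : ℤ))) → r (nOp c) = 1 := by
    intro c hc
    have hc2 : ‖c / 2‖ ≤ (resCard F : ℝ) ^ (-(((0 : ℕ) : ℤ) + (ε : ℤ))) := by
      rwa [norm_div, hU.norm_two, div_one]
    have e : nOp c = nOp (c / 2) * nOp (c / 2) := by rw [nOp_mul, h2n]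
    rw [e, hrmul _ (hU.nOp_mem_levelSet hc2) _ (hU.nOp_mem_levelSet hc2), Int.units_mul_self]
  have hlow : ∀ k ∈ levelSet F ε 0, ‖k.1 1 0‖ = (resCard F : ℝ) ^ (-(ε : ℤ)) → r k = 1 := by
    intro k hk hc
    have hc0 : k.1 1 0 ≠ 0 := norm_ne_zero_iff.1 (by rw [hc]; exact (zpow_pos hU.card_pos _).ne')
    obtain ⟨h1, h2, h3, h4⟩ := mem_levelSet.1 hk
    have hinv : ∀ x : F, ‖x‖ ≤ 1 → ‖x / k.1 1 0‖ ≤ (resCard F : ℝ) ^ (ε : ℤ) := by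
      intro x hx
      rw [norm_div, hc, div_eq_mul_inv, ← zpow_neg, neg_neg]
      exact mul_le_of_le_one_left (zpow_nonneg hU.card_pos.le _) hx
    have ha := hinv _ (norm_sub_le_of h1 (norm_one (α := F)).le)
    have hd := hinv _ (norm_sub_le_of h2 (norm_one (α := F)).le)
    have e : k = nMat ((k.1 0 0 - 1) / k.1 1 0) * nOp (k.1 1 0) *
        nMat ((k.1 1 1 - 1) / k.1 1 0) := by
      have hdet := det_entries k
      apply sl2_ext
      · simp; field_simp; ring
      · simp; field_simp; linear_combination -hdet
      · simp
      · simp; field_simp; ring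
    have m1 := hU.nMat_mem_levelSet (m := 0) ha
    have m2 := hU.nOp_mem_levelSet h4
    rw [e, hrmul _ (hU.levelSet_mul m1 m2) _ (hU.nMat_mem_levelSet hd), hrmul _ m1 _ m2,
      hn _ ha, hn _ hd, ho _ h4, one_mul, one_mul]
  have hall : r k = 1 := by
    by_cases hd : ‖k.1 1 1‖ < 1
    · exact hlow k hk (hU.primitive_row hk hd).2
    · obtain ⟨h1, h2, h3, h4⟩ := mem_levelSet.1 hk
      have hd1 : ‖k.1 1 1‖ = 1 := le_antisymm h2 (not_lt.1 hd)
      rcases h4.lt_or_eq with h | h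
      · have hπ : ‖ϖ ^ ε‖ = (resCard F : ℝ) ^ (-(((0 : ℕ) : ℤ) + (ε : ℤ))) := by
          rw [hU.norm_pow_eq]; simp
        -- If d is a unit and |c| < |π|, multiplication by nᵒᵖ(π) makes the lower left entry c + dπ
        -- of norm |π|, the case already settled.
        have mo := hU.nOp_mem_levelSet (ε := ε) (m := 0) hπ.le
        have mk := hU.levelSet_mul hk mo
        have h5 : r (k * nOp (ϖ ^ ε)) = 1 := by
          apply hlow _ mk
          simp only [mul_entry, nOp_00, nOp_10, mul_one]
          rw [add_comm, norm_add_eq_left, norm_mul, hd1, one_mul, hU.norm_pow_eq]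
          rwa [norm_mul, hd1, one_mul, hπ]
        rw [hrmul _ hk _ mo, ho _ hπ.le, mul_one] at h5
        exact h5
      · exact hlow k hk (by simpa using h)
  simp only [hr] at hall
  generalize splitting F ε k = x at *
  generalize splitVal (ϖ ^ ε) (k.1 1 0) (k.1 1 1) = y at *
  clear * - hall
  revert x y; decide

lemma liftK_mul {ε : ℕ} {k l : SL(2, F)} (hk : k ∈ levelSet F ε 0) (hl : l ∈ levelSet F ε 0) :
    liftK ε k * liftK ε l = liftK ε (k * l) := by
  rw [liftK, liftK, liftK, hU.splitting_eq hk, hU.splitting_eq hl,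
    hU.splitting_eq (hU.levelSet_mul hk hl)]
  exact hU.splitVal_mul hk hl

end

end IsOddUniformizer

end Splitting

/-! ## Characters and conductors -/

/-- The multiplicative group of ℂ has no small subgroups: z² - 1 = (z - 1)(2 + (z - 1)), and near 1
the last factor has norm at least 3/2, so the distance to 1 would grow geometrically under repeated
squaring. -/
lemma eq_one_of_forall_pow_near {z : ℂ} (h : ∀ n : ℕ, ‖z ^ (2 ^ n) - 1‖ ≤ 1 / 2) : z = 1 := by
  by_contra hz
  have hpos : 0 < ‖z - 1‖ := norm_pos_iff.2 (sub_ne_zero.2 hz)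
  have hgrow : ∀ n : ℕ, (3 / 2 : ℝ) ^ n * ‖z - 1‖ ≤ ‖z ^ (2 ^ n) - 1‖ := by
    intro n
    induction n with
    | zero => simp
    | succ n ih =>
      have e : z ^ (2 ^ (n + 1)) - 1 = (z ^ (2 ^ n) - 1) * (2 + (z ^ (2 ^ n) - 1)) := by
        rw [pow_succ, pow_mul]; ring
      have h3 : (3 / 2 : ℝ) ≤ ‖2 + (z ^ (2 ^ n) - 1)‖ := by
        have h4 := norm_sub_norm_le (2 : ℂ) (-(z ^ (2 ^ n) - 1))
        rw [norm_neg, sub_neg_eq_add, Complex.norm_ofNat] at h4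
        linarith [h n]
      rw [e, norm_mul, pow_succ]
      nlinarith [norm_nonneg (z ^ (2 ^ n) - 1)]
  obtain ⟨n, hn⟩ := ((tendsto_pow_atTop_atTop_of_one_lt (by norm_num : (1 : ℝ) < 3 / 2)).eventually
    (eventually_gt_atTop (1 / 2 / ‖z - 1‖))).exists
  have h5 := hgrow n
  rw [div_lt_iff₀ hpos] at hn
  linarith [h n]

section Char

variable {F : Type*} [NontriviallyNormedField F]

open Classical in
/-- A character of `Fˣ`, extended by zero. -/
noncomputable def mulExt (μ : Fˣ →* ℂˣ) (x : F) : ℂ :=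
  if h : x = 0 then 0 else (μ (Units.mk0 x h) : ℂ)

open Classical in
/-- A character of the unit group of the ring of integers, extended by zero. -/
noncomputable def unitExt (η : unitsInt F →* ℂˣ) (x : F) : ℂ :=
  if h : ‖x‖ = 1 then (η ⟨Units.mk0 x (norm_ne_zero_iff.1 (h.trans_ne one_ne_zero)), h⟩ : ℂ) else 0

lemma ne_zero_of_norm_one {x : F} (h : ‖x‖ = 1) : x ≠ 0 :=
  norm_ne_zero_iff.1 (h.trans_ne one_ne_zero)

section mulExt

variable (μ : Fˣ →* ℂˣ)

lemma mulExt_coe (a : Fˣ) : mulExt μ (a : F) = μ a := by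
  rw [mulExt, dif_neg a.ne_zero]; simp

lemma mulExt_zero : mulExt μ (0 : F) = 0 := dif_pos rfl

lemma mulExt_ne_zero {x : F} (hx : x ≠ 0) : mulExt μ x ≠ 0 := by
  rw [mulExt, dif_neg hx]; exact Units.ne_zero _

lemma mulExt_mul (x y : F) : mulExt μ (x * y) = mulExt μ x * mulExt μ y := by
  by_cases hx : x = 0
  · simp [hx, mulExt_zero]
  by_cases hy : y = 0
  · simp [hy, mulExt_zero]
  rw [mulExt, mulExt, mulExt, dif_neg hx, dif_neg hy, dif_neg (mul_ne_zero hx hy), Units.mk0_mul,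
    map_mul, Units.val_mul]

lemma mulExt_one : mulExt μ (1 : F) = 1 := by
  have := mulExt_coe μ 1
  simpa using this

lemma mulExt_inv (x : F) : mulExt μ x⁻¹ = (mulExt μ x)⁻¹ := by
  by_cases hx : x = 0
  · simp [hx, mulExt_zero]
  apply eq_inv_of_mul_eq_one_left
  rw [← mulExt_mul, inv_mul_cancel₀ hx, mulExt_one]

lemma mulExt_zpow (x : F) (n : ℤ) : mulExt μ (x ^ n) = mulExt μ x ^ n := by
  let f : F →*₀ ℂ :=
    { toFun := mulExt μ, map_zero' := mulExt_zero μ, map_one' := mulExt_one μ,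
      map_mul' := mulExt_mul μ }
  exact map_zpow₀ f x n

end mulExt

section unitExt

variable (η θ : unitsInt F →* ℂˣ)

lemma unitExt_coe (u : unitsInt F) : unitExt η ((u : Fˣ) : F) = η u := by
  have hu : ‖((u : Fˣ) : F)‖ = 1 := u.2
  rw [unitExt, dif_pos hu]
  congr 2
  exact Subtype.ext (Units.ext rfl)

lemma unitExt_ne_zero {x : F} (hx : ‖x‖ = 1) : unitExt η x ≠ 0 := by
  rw [unitExt, dif_pos hx]; exact Units.ne_zero _

lemma exists_unit {x : F} (hx : ‖x‖ = 1) : ∃ u : unitsInt F, ((u : Fˣ) : F) = x :=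
  ⟨⟨Units.mk0 x (ne_zero_of_norm_one hx), hx⟩, rfl⟩

lemma unitExt_mul {x y : F} (hx : ‖x‖ = 1) (hy : ‖y‖ = 1) :
    unitExt η (x * y) = unitExt η x * unitExt η y := by
  obtain ⟨u, rfl⟩ := exists_unit hx
  obtain ⟨v, rfl⟩ := exists_unit hy
  rw [unitExt_coe, unitExt_coe, ← Units.val_mul, ← Subgroup.coe_mul, unitExt_coe, map_mul,
    Units.val_mul]

lemma unitExt_one : unitExt η (1 : F) = 1 := by
  have := unitExt_coe η 1
  simpa using this

lemma unitExt_inv {x : F} (hx : ‖x‖ = 1) : unitExt η x⁻¹ = (unitExt η x)⁻¹ := by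
  apply eq_inv_of_mul_eq_one_left
  rw [← unitExt_mul η _ hx,
    inv_mul_cancel₀ (ne_zero_of_norm_one hx), unitExt_one]
  rw [norm_inv, hx, inv_one]

lemma mul_unitExt {x : F} (hx : ‖x‖ = 1) : unitExt (η * θ) x = unitExt η x * unitExt θ x := by
  obtain ⟨u, rfl⟩ := exists_unit hx
  simp [unitExt_coe]

lemma inv_unitExt {x : F} (hx : ‖x‖ = 1) : unitExt η⁻¹ x = (unitExt η x)⁻¹ := by
  obtain ⟨u, rfl⟩ := exists_unit hx
  simp [unitExt_coe]

lemma unitExt_resUnits (μ : Fˣ →* ℂˣ) {x : F} (hx : ‖x‖ = 1) :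
    unitExt (resUnits μ) x = mulExt μ x := by
  obtain ⟨u, rfl⟩ := exists_unit hx
  rw [unitExt_coe, mulExt_coe]
  rfl

lemma unitExt_eq_one_iff : (∀ x : F, ‖x‖ = 1 → unitExt η x = 1) ↔ η = 1 := by
  constructor
  · intro h
    ext u
    have := h _ u.2
    rw [unitExt_coe] at this
    simpa using this
  · rintro rfl x hx
    obtain ⟨u, rfl⟩ := exists_unit hx
    simp [unitExt_coe]

end unitExt

end Char

/-! ### Local triviality and conductors of characters -/

section Conductor

variable {F : Type*} [NontriviallyNormedField F] [IsUltrametricDist F]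

lemma continuous_resUnits {μ : Fˣ →* ℂˣ} (hμ : Continuous μ) : Continuous (resUnits μ) :=
  hμ.comp continuous_subtype_val

lemma etaK_eq (η : unitsInt F →* ℂˣ) {k : SL(2, F)} (h : ‖k.1 1 1‖ = 1) :
    etaK η k = unitExt η (k.1 1 1) := by
  have hex := exists_unit h
  rw [etaK, dif_pos hex, ← unitExt_coe η hex.choose, hex.choose_spec]

lemma etaK_one_char (k : SL(2, F)) : etaK 1 k = 1 := by
  rw [etaK]; split_ifs <;> simp

namespace IsOddUniformizer

variable {ϖ : F} (hU : IsOddUniformizer ϖ)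

include hU

lemma exists_zpow_lt {δ : ℝ} (hδ : 0 < δ) : ∃ n : ℕ, (resCard F : ℝ) ^ (-(n : ℤ)) < δ := by
  obtain ⟨n, hn⟩ := exists_pow_lt_of_lt_one hδ (inv_lt_one_of_one_lt₀ hU.one_lt)
  exact ⟨n, by rwa [zpow_neg, zpow_natCast, ← inv_pow]⟩

lemma exists_lt_zpow (r : ℝ) : ∃ n : ℕ, r < (resCard F : ℝ) ^ (n : ℤ) := by
  obtain ⟨n, hn⟩ := pow_unbounded_of_one_lt r hU.one_lt
  exact ⟨n, by rwa [zpow_natCast]⟩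

/-- By continuity some 1 + 𝔭^n is mapped close to 1. It is stable under powers, so
`eq_one_of_forall_pow_near` makes its image trivial. -/
lemma exists_unitExt_eq_one {η : unitsInt F →* ℂˣ} (hη : Continuous η) :
    ∃ n : ℕ, 0 < n ∧ ∀ x : F, ‖x - 1‖ ≤ (resCard F : ℝ) ^ (-(n : ℤ)) → unitExt η x = 1 := by
  have hcont : Continuous fun u : unitsInt F => (η u : ℂ) := Units.continuous_val.comp hη
  have hnear : ∀ᶠ u : unitsInt F in 𝓝 1, ‖(η u : ℂ) - 1‖ < 1 / 2 := by
    have h := (hcont.sub (continuous_const (y := (1 : ℂ)))).norm.tendsto' 1 0 (by simp)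
    exact h.eventually (gt_mem_nhds (by norm_num))
  have hemb : Topology.IsEmbedding fun u : unitsInt F => ((u : Fˣ) : F) :=
    Units.isEmbedding_val₀.comp Topology.IsEmbedding.subtypeVal
  rw [hemb.nhds_eq_comap, eventually_comap] at hnear
  obtain ⟨δ, hδ, hball⟩ := Metric.eventually_nhds_iff.1 hnear
  obtain ⟨n, hn⟩ := hU.exists_zpow_lt hδ
  -- The exponent n + 1 is used instead of n so that it is positive, and elements that close to 1
  -- are automatically units.
  have hlt1 : (resCard F : ℝ) ^ (-((n + 1 : ℕ) : ℤ)) < 1 := by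
    rw [← zpow_zero (resCard F : ℝ), hU.zpow_lt]; push_cast; omega
  have hle : (resCard F : ℝ) ^ (-((n + 1 : ℕ) : ℤ)) ≤ (resCard F : ℝ) ^ (-(n : ℤ)) := by
    rw [hU.zpow_le]; push_cast; omega
  refine ⟨n + 1, n.succ_pos, fun x hx => ?_⟩
  have hx1 := norm_eq_one_of_sub_one_lt (hx.trans_lt hlt1)
  obtain ⟨u, rfl⟩ := exists_unit hx1
  rw [unitExt_coe]
  apply eq_one_of_forall_pow_near
  intro k
  rw [← Units.val_pow_eq_pow_val, ← map_pow]
  refine (hball ?_ _ rfl).le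
  simp only [OneMemClass.coe_one, Units.val_one, dist_eq_norm]
  refine lt_of_le_of_lt ?_ (hle.trans_lt hn)
  have hpow : ∀ k : ℕ, ‖((u : Fˣ) : F) ^ k - 1‖ ≤ (resCard F : ℝ) ^ (-((n + 1 : ℕ) : ℤ)) := by
    intro k
    induction k with
    | zero => simpa using zpow_nonneg hU.card_pos.le _
    | succ k ih =>
      have e : ((u : Fˣ) : F) ^ (k + 1) - 1 = ((u : Fˣ) : F) * (((u : Fˣ) : F) ^ k - 1) +
        (((u : Fˣ) : F) - 1) := by ring
      rw [e]
      refine norm_add_le_of ?_ hx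
      rwa [norm_mul, hx1, one_mul]
  simpa using hpow (2 ^ k)

/-- Continuity makes the set of admissible exponents nonempty, so its infimum is attained; moreover
the set is upward closed. -/
lemma unitCond_le_iff {η : unitsInt F →* ℂˣ} (hη : Continuous η) {n : ℕ} :
    unitCond η ≤ n ↔ ∀ x : F, ‖x‖ = 1 → ‖x - 1‖ ≤ (resCard F : ℝ) ^ (-(n : ℤ)) →
      unitExt η x = 1 := by
  set S := {c : ℕ | ∀ u : unitsInt F, ((u : Fˣ) : F) - 1 ∈ primePow F c → η u = 1} with hS
  have hmem : ∀ n : ℕ, n ∈ S ↔ ∀ x : F, ‖x‖ = 1 → ‖x - 1‖ ≤ (resCard F : ℝ) ^ (-(n : ℤ)) →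
      unitExt η x = 1 := by
    intro n
    constructor
    · intro h x hx hx1
      obtain ⟨u, rfl⟩ := exists_unit hx
      rw [unitExt_coe, h u hx1, Units.val_one]
    · intro h u hu
      have := h _ u.2 hu
      rw [unitExt_coe] at this
      exact Units.ext this
  rw [← hmem]
  have hne : S.Nonempty := by
    obtain ⟨n, -, hn⟩ := hU.exists_unitExt_eq_one hη
    exact ⟨n, (hmem n).2 fun x _ hx => hn x hx⟩
  constructor
  · intro h
    rw [hmem]
    intro x hx hx1
    refine (hmem _).1 (Nat.sInf_mem hne) x hx (hx1.trans ?_)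
    rw [hU.zpow_le]
    have : sInf S ≤ n := h
    omega
  · exact fun h => Nat.sInf_le h

lemma unitCond_eq_zero_iff {η : unitsInt F →* ℂˣ} (hη : Continuous η) :
    unitCond η = 0 ↔ η = 1 := by
  rw [← Nat.le_zero, hU.unitCond_le_iff hη, ← unitExt_eq_one_iff]
  refine ⟨fun h x hx => h x hx ?_, fun h x hx _ => h x hx⟩
  simpa using norm_sub_le_of hx.le (norm_one (α := F)).le

/-! ### Additive characters -/

/-- The cardinality of the residue field annihilates its additive group. -/
lemma norm_card_lt_one : ‖((resCard F : ℕ) : F)‖ < 1 := by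
  have hfin := hU.finite_residueField
  rw [← red_eq_zero_iff (IsUltrametricDist.norm_natCast_le_one F _)]
  have h1 : ∀ n : ℕ, red (n : F) = (n : IsLocalRing.ResidueField (ringInt F)) := by
    intro n
    induction n with
    | zero =>
      rw [Nat.cast_zero, Nat.cast_zero, red_eq_zero_iff (by simp)]; simp
    | succ n ih =>
      rw [Nat.cast_succ, red_add (IsUltrametricDist.norm_natCast_le_one F n) (by simp), ih, red_one,
        Nat.cast_succ]
  rw [h1, ← nsmul_one]
  exact card_nsmul_eq_zero'

lemma exists_addChar_eq_one {Ψ : AddChar F ℂ} (hΨ : Continuous Ψ) :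
    ∃ n : ℕ, ∀ x : F, ‖x‖ ≤ (resCard F : ℝ) ^ (-(n : ℤ)) → Ψ x = 1 := by
  have hnear : ∀ᶠ x : F in 𝓝 0, ‖Ψ x - 1‖ < 1 / 2 := by
    have h := (hΨ.sub (continuous_const (y := (1 : ℂ)))).norm.tendsto' 0 0 (by simp)
    exact h.eventually (gt_mem_nhds (by norm_num))
  obtain ⟨δ, hδ, hball⟩ := Metric.eventually_nhds_iff.1 hnear
  obtain ⟨n, hn⟩ := hU.exists_zpow_lt hδ
  refine ⟨n, fun x hx => eq_one_of_forall_pow_near fun k => ?_⟩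
  rw [← AddChar.map_nsmul_eq_pow]
  refine (hball ?_).le
  rw [dist_zero_right, nsmul_eq_mul, norm_mul]
  exact (mul_le_of_le_one_left (norm_nonneg _)
    (IsUltrametricDist.norm_natCast_le_one F _)).trans_lt (hx.trans_lt hn)

/-- Since |q| < 1 in F, the multiples q^k x tend to 0, where the character is trivial; so Ψ(x) is a
root of unity. Unitarity is thus not an extra assumption on additive characters. -/
lemma norm_addChar {Ψ : AddChar F ℂ} (hΨ : Continuous Ψ) (x : F) : ‖Ψ x‖ = 1 := by
  obtain ⟨n, hn⟩ := hU.exists_addChar_eq_one hΨ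
  have ht : Tendsto (fun k : ℕ => ‖((resCard F : ℕ) : F)‖ ^ k * ‖x‖) atTop (𝓝 (0 * ‖x‖)) :=
    (tendsto_pow_atTop_nhds_zero_of_lt_one (norm_nonneg _) hU.norm_card_lt_one).mul_const _
  rw [zero_mul] at ht
  obtain ⟨k, hk⟩ := (ht.eventually (gt_mem_nhds (zpow_pos hU.card_pos (-(n : ℤ))))).exists
  apply Complex.norm_eq_one_of_pow_eq_one (n := resCard F ^ k)
  · rw [← AddChar.map_nsmul_eq_pow]
    apply hn
    rw [nsmul_eq_mul, norm_mul, Nat.cast_pow, norm_pow]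
    exact hk.le
  · exact pow_ne_zero _ (by have := hU.two_le_card; omega)

lemma conj_addChar {Ψ : AddChar F ℂ} (hΨ : Continuous Ψ) (x : F) :
    starRingEnd ℂ (Ψ x) = Ψ (-x) := by
  have h1 : Ψ (-x) * Ψ x = 1 := by
    rw [← AddChar.map_add_eq_mul, neg_add_cancel, AddChar.map_zero_eq_one]
  have h2 : Ψ x * starRingEnd ℂ (Ψ x) = 1 := by
    rw [Complex.mul_conj, Complex.normSq_eq_norm_sq, hU.norm_addChar hΨ]; simp
  calc starRingEnd ℂ (Ψ x) = Ψ (-x) * Ψ x * starRingEnd ℂ (Ψ x) := by rw [h1, one_mul]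
    _ = Ψ (-x) := by rw [mul_assoc, h2, mul_one]

/-- The infimum in `addCond` is meaningful: continuity makes the set of exponents nonempty and
nontriviality bounds it below. -/
lemma addCond_spec {Ψ : AddChar F ℂ} (hΨ : Continuous Ψ) (hne : Ψ ≠ 1) :
    (∀ x : F, ‖x‖ ≤ (resCard F : ℝ) ^ (-addCond Ψ) → Ψ x = 1) ∧
      ∃ x : F, ‖x‖ ≤ (resCard F : ℝ) ^ (-addCond Ψ + 1) ∧ Ψ x ≠ 1 := by
  set S := {c : ℤ | ∀ x ∈ primePow F c, Ψ x = 1} with hS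
  have hSne : S.Nonempty := by
    obtain ⟨n, hn⟩ := hU.exists_addChar_eq_one hΨ
    exact ⟨n, fun x hx => hn x hx⟩
  obtain ⟨x₀, hx₀⟩ : ∃ x, Ψ x ≠ 1 := by
    by_contra hcon
    push Not at hcon
    exact hne (by ext x; simp [hcon x])
  have hbdd : BddBelow S := by
    obtain ⟨n, hn⟩ := hU.exists_lt_zpow ‖x₀‖
    refine ⟨-n, fun c hc => ?_⟩
    by_contra hlt
    push Not at hlt
    refine hx₀ (hc x₀ (hn.le.trans ?_))
    rw [hU.zpow_le]; omega
  refine ⟨fun x hx => Int.csInf_mem hSne hbdd x hx, ?_⟩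
  by_contra hcon
  push Not at hcon
  have : addCond Ψ - 1 ∈ S := fun x hx => hcon x (by
    rw [mem_primePow] at hx
    convert hx using 2; ring)
  have h2 : addCond Ψ ≤ addCond Ψ - 1 := csInf_le hbdd this
  omega

lemma addCond_eq {Ψ : AddChar F ℂ} {c : ℤ}
    (h1 : ∀ x : F, ‖x‖ ≤ (resCard F : ℝ) ^ (-c) → Ψ x = 1)
    (h2 : ∃ x : F, ‖x‖ ≤ (resCard F : ℝ) ^ (-c + 1) ∧ Ψ x ≠ 1) : addCond Ψ = c := by
  refine IsLeast.csInf_eq ⟨fun x hx => h1 x hx, fun d hd => ?_⟩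
  by_contra hlt
  push Not at hlt
  obtain ⟨x, hx, hx1⟩ := h2
  refine hx1 (hd x (hx.trans ?_))
  rw [hU.zpow_le]; omega

/-- A character which is nontrivial on `𝔭 ^ (c - 1)`, restricted to a dilate. -/
lemma exists_addChar_mul_ne_one {Ψ : AddChar F ℂ} {c : ℤ}
    (h2 : ∃ x : F, ‖x‖ ≤ (resCard F : ℝ) ^ (-c + 1) ∧ Ψ x ≠ 1) {a : F} {r : ℤ}
    (ha : (resCard F : ℝ) ^ (-c + 1 - r) ≤ ‖a‖) :
    ∃ x : F, ‖x‖ ≤ (resCard F : ℝ) ^ r ∧ Ψ (a * x) ≠ 1 := by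
  obtain ⟨x, hx, hx1⟩ := h2
  have ha0 : 0 < ‖a‖ := (zpow_pos hU.card_pos _).trans_le ha
  refine ⟨x / a, ?_, by rwa [mul_div_cancel₀ _ (norm_pos_iff.1 ha0)]⟩
  rw [norm_div, div_le_iff₀ ha0]
  calc ‖x‖ ≤ (resCard F : ℝ) ^ (-c + 1) := hx
    _ = (resCard F : ℝ) ^ r * (resCard F : ℝ) ^ (-c + 1 - r) := by
      rw [← zpow_add₀ hU.card_pos.ne']; congr 1; ring
    _ ≤ _ := mul_le_mul_of_nonneg_left ha (zpow_nonneg hU.card_pos.le _)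

lemma addCond_mulShift {Ψ : AddChar F ℂ} (hΨ : Continuous Ψ) (hne : Ψ ≠ 1) {a : F} (ha : a ≠ 0) :
    addCond (Ψ.mulShift a) = addCond Ψ - ord a := by
  obtain ⟨h1, h2⟩ := hU.addCond_spec hΨ hne
  apply hU.addCond_eq
  · intro x hx
    rw [AddChar.mulShift_apply]
    apply h1
    rw [norm_mul, hU.norm_eq_ord ha]
    calc (resCard F : ℝ) ^ (-ord a) * ‖x‖ ≤ (resCard F : ℝ) ^ (-ord a) *
          (resCard F : ℝ) ^ (-(addCond Ψ - ord a)) :=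
          mul_le_mul_of_nonneg_left hx (zpow_nonneg hU.card_pos.le _)
      _ = _ := by rw [← zpow_add₀ hU.card_pos.ne']; congr 1; ring
  · obtain ⟨x, hx, hx1⟩ := hU.exists_addChar_mul_ne_one h2 (a := a)
      (r := -(addCond Ψ - ord a) + 1) (by
        rw [hU.norm_eq_ord ha, hU.zpow_le]; omega)
    exact ⟨x, hx, by rwa [AddChar.mulShift_apply]⟩

end IsOddUniformizer

end Conductor

/-! ## Integration on the local field -/

section Measure

variable {F : Type*} [NontriviallyNormedField F] [IsUltrametricDist F]

variable (F) in
/-- The ball `𝔭 ^ (-n)`. -/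
def zball (n : ℤ) : Set F := primePow F (-n)

variable (F) in
/-- The sphere `𝔭 ^ (-n) \ 𝔭 ^ (1 - n)`. -/
def zsphere (n : ℤ) : Set F := {x | ‖x‖ = (resCard F : ℝ) ^ n}

lemma mem_zball {n : ℤ} {x : F} : x ∈ zball F n ↔ ‖x‖ ≤ (resCard F : ℝ) ^ n := by
  rw [zball, mem_primePow, neg_neg]

lemma mem_zsphere {n : ℤ} {x : F} : x ∈ zsphere F n ↔ ‖x‖ = (resCard F : ℝ) ^ n := Iff.rfl

lemma zball_eq (n : ℤ) : zball F n = Metric.closedBall 0 ((resCard F : ℝ) ^ n) := by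
  ext x; rw [mem_zball, mem_closedBall_zero_iff]

lemma zsphere_eq (n : ℤ) : zsphere F n = Metric.sphere 0 ((resCard F : ℝ) ^ n) := by
  ext x; rw [mem_zsphere, mem_sphere_zero_iff_norm]

lemma zball_add {n : ℤ} {x y : F} (hy : y ∈ zball F n) : x + y ∈ zball F n ↔ x ∈ zball F n := by
  rw [mem_zball] at *
  rw [mem_zball]
  refine ⟨fun h => ?_, fun h => norm_add_le_of h hy⟩
  simpa using norm_sub_le_of h hy

section

variable [ProperSpace F] [MeasurableSpace F] [BorelSpace F]

instance instIsAddHaarMeasureHaarF : (haarF F).IsAddHaarMeasure := by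
  unfold haarF; infer_instance

lemma isCompact_zball (n : ℤ) : IsCompact (zball F n) := by
  rw [zball_eq]; exact isCompact_closedBall _ _

lemma isCompact_zsphere (n : ℤ) : IsCompact (zsphere F n) := by
  rw [zsphere_eq]; exact isCompact_sphere _ _

lemma measurableSet_zball (n : ℤ) : MeasurableSet (zball F n) :=
  (isCompact_zball n).isClosed.measurableSet

lemma measurableSet_zsphere (n : ℤ) : MeasurableSet (zsphere F n) :=
  (isCompact_zsphere n).isClosed.measurableSet

lemma integrableOn_of_compact {f : F → ℂ} (hf : Continuous f) {S : Set F} (hS : IsCompact S) :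
    IntegrableOn f S (haarF F) := hf.continuousOn.integrableOn_compact hS

lemma setIntegral_shift {S : Set F} (hS : MeasurableSet S) {t : F}
    (ht : ∀ x, x + t ∈ S ↔ x ∈ S) (f : F → ℂ) :
    ∫ x in S, f (x + t) ∂haarF F = ∫ x in S, f x ∂haarF F := by
  rw [← integral_indicator hS, ← integral_indicator hS,
    ← integral_add_right_eq_self (S.indicator f) t]
  congr 1
  ext x
  by_cases hx : x ∈ S
  · rw [Set.indicator_of_mem hx, Set.indicator_of_mem ((ht x).2 hx)]
  · rw [Set.indicator_of_notMem hx, Set.indicator_of_notMem (mt (ht x).1 hx)]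

/-- Substituting x + t for x shows that the integral equals c times itself. -/
lemma setIntegral_eq_zero_of_shift {S : Set F} (hS : MeasurableSet S) {t : F}
    (ht : ∀ x, x + t ∈ S ↔ x ∈ S) {f : F → ℂ} {c : ℂ} (hc : c ≠ 1)
    (hf : ∀ x ∈ S, f (x + t) = c * f x) : ∫ x in S, f x ∂haarF F = 0 := by
  have h : ∫ x in S, f x ∂haarF F = c * ∫ x in S, f x ∂haarF F := by
    rw [← integral_const_mul]
    rw [← setIntegral_congr_fun hS hf, setIntegral_shift hS ht]
  have h2 : (1 - c) * ∫ x in S, f x ∂haarF F = 0 := by linear_combination h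
  exact (mul_eq_zero.1 h2).resolve_left (sub_ne_zero.2 hc.symm)

lemma haarF_closedBall_one : haarF F (Metric.closedBall 0 1) = 1 :=
  Measure.addHaarMeasure_self

/-- The pushforward is again a Haar measure, so uniqueness makes it a multiple of `haarF`; the
factor is its value on the unit ball. It is identified with |c|⁻¹ only in `integral_comp_mul`. -/
lemma map_mul_left_haarF {c : F} (hc : c ≠ 0) :
    (haarF F).map (c * ·) = haarF F {x | ‖c * x‖ ≤ 1} • haarF F := by
  let e : F ≃ₜ+ F := { AddAut.mulLeft (Units.mk0 c hc) with
    continuous_toFun := continuous_const_mul c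
    continuous_invFun := continuous_const_mul c⁻¹ }
  have he : (e : F → F) = (c * ·) := rfl
  have hH : ((haarF F).map (c * ·)).IsAddHaarMeasure := by
    rw [← he]; exact e.isAddHaarMeasure_map (haarF F)
  have := Measure.addHaarMeasure_unique ((haarF F).map (c * ·))
    ({ carrier := Metric.closedBall (0 : F) 1
       isCompact' := isCompact_closedBall 0 1
       interior_nonempty' :=
         ⟨0, Metric.ball_subset_interior_closedBall (Metric.mem_ball_self one_pos)⟩ })
  rw [this]
  congr 1
  change (haarF F).map (c * ·) (Metric.closedBall 0 1) = _
  rw [Measure.map_apply (measurable_const_mul c) Metric.isClosed_closedBall.measurableSet]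
  congr 1
  ext x
  simp

lemma integral_comp_mul_left' {c : F} (hc : c ≠ 0) (f : F → ℂ) :
    ∫ x, f (c * x) ∂haarF F = ((haarF F).real {x | ‖c * x‖ ≤ 1} : ℂ) * ∫ x, f x ∂haarF F := by
  have hemb : MeasurableEmbedding (c * · : F → F) :=
    (Homeomorph.mulLeft₀ c hc).measurableEmbedding
  rw [← hemb.integral_map, map_mul_left_haarF hc, integral_smul_measure]
  rfl

lemma setIntegral_unit_mul {S : Set F} (hS : MeasurableSet S) {u : F} (hu : ‖u‖ = 1)
    (huS : ∀ x, u * x ∈ S ↔ x ∈ S) (f : F → ℂ) :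
    ∫ x in S, f (u * x) ∂haarF F = ∫ x in S, f x ∂haarF F := by
  have h1 : {x : F | ‖u * x‖ ≤ 1} = Metric.closedBall 0 1 := by
    ext x; simp [hu]
  have key := integral_comp_mul_left' (ne_zero_of_norm_one hu) (S.indicator f)
  rw [h1, Measure.real, haarF_closedBall_one] at key
  simp only [ENNReal.toReal_one, Complex.ofReal_one, one_mul] at key
  rw [← integral_indicator hS, ← integral_indicator hS, ← key]
  congr 1
  ext x
  by_cases hx : x ∈ S
  · rw [Set.indicator_of_mem hx, Set.indicator_of_mem ((huS x).2 hx)]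
  · rw [Set.indicator_of_notMem hx, Set.indicator_of_notMem (mt (huS x).1 hx)]

lemma zball_unit_mul {n : ℤ} {u : F} (hu : ‖u‖ = 1) (x : F) : u * x ∈ zball F n ↔ x ∈ zball F n := by
  rw [mem_zball, mem_zball, norm_mul, hu, one_mul]

lemma zsphere_unit_mul {n : ℤ} {u : F} (hu : ‖u‖ = 1) (x : F) :
    u * x ∈ zsphere F n ↔ x ∈ zsphere F n := by
  rw [mem_zsphere, mem_zsphere, norm_mul, hu, one_mul]

lemma setIntegral_eq_zero_of_unit_mul {S : Set F} (hS : MeasurableSet S) {u : F} (hu : ‖u‖ = 1)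
    (huS : ∀ x, u * x ∈ S ↔ x ∈ S) {f : F → ℂ} {c : ℂ} (hc : c ≠ 1)
    (hf : ∀ x ∈ S, f (u * x) = c * f x) : ∫ x in S, f x ∂haarF F = 0 := by
  have h : ∫ x in S, f x ∂haarF F = c * ∫ x in S, f x ∂haarF F := by
    rw [← integral_const_mul]
    rw [← setIntegral_congr_fun hS hf, setIntegral_unit_mul hS hu huS]
  have h2 : (1 - c) * ∫ x in S, f x ∂haarF F = 0 := by linear_combination h
  exact (mul_eq_zero.1 h2).resolve_left (sub_ne_zero.2 hc.symm)

/-- Fubini's theorem for continuous functions on a product of compact sets. -/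
lemma setIntegral_swap {f : F → F → ℂ} (hf : Continuous (Function.uncurry f)) {S T : Set F}
    (hS : IsCompact S) (hT : IsCompact T) :
    ∫ x in S, ∫ y in T, f x y ∂haarF F ∂haarF F = ∫ y in T, ∫ x in S, f x y ∂haarF F ∂haarF F := by
  apply integral_integral_swap
  rw [Measure.prod_restrict]
  exact hf.continuousOn.integrableOn_compact (hS.prod hT)

lemma measureReal_pos_of_isOpen {S : Set F} (hS : IsOpen S) (hne : S.Nonempty)
    (hfin : haarF F S ≠ ⊤) : 0 < (haarF F).real S :=
  ENNReal.toReal_pos (hS.measure_pos _ hne).ne' hfin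

namespace IsOddUniformizer

variable {ϖ : F} (hU : IsOddUniformizer ϖ)

include hU

lemma isOpen_zball (n : ℤ) : IsOpen (zball F n) := by
  rw [zball_eq]
  exact IsUltrametricDist.isOpen_closedBall _ (zpow_pos hU.card_pos _).ne'

lemma measureReal_zball_pos (n : ℤ) : 0 < (haarF F).real (zball F n) :=
  measureReal_pos_of_isOpen (hU.isOpen_zball n)
    ⟨0, mem_zball.2 (by simpa using zpow_nonneg hU.card_pos.le _)⟩
    (isCompact_zball n).measure_ne_top

/-- If all averages of `f` over the cosets of `𝔭 ^ (-e)` in `S` vanish, so does its integral. -/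
lemma setIntegral_eq_zero_of_average {f : F → ℂ} (hf : Continuous f) {S : Set F} (hS : IsCompact S)
    (e : ℤ) (hinv : ∀ t ∈ zball F e, ∀ x, x + t ∈ S ↔ x ∈ S)
    (hzero : ∀ x ∈ S, ∫ t in zball F e, f (x + t) ∂haarF F = 0) : ∫ x in S, f x ∂haarF F = 0 := by
  -- The double integral over t and x is evaluated in both orders: integrating first over t gives 0
  -- by hypothesis, integrating first over x gives the desired integral for every t.
  have h1 : ∫ t in zball F e, ∫ x in S, f (x + t) ∂haarF F ∂haarF F = 0 := by
    rw [setIntegral_swap (f := fun t x => f (x + t))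
      (hf.comp (continuous_snd.add continuous_fst)) (isCompact_zball e) hS,
      setIntegral_congr_fun hS.isClosed.measurableSet hzero]
    simp
  rw [setIntegral_congr_fun (measurableSet_zball e) (fun t ht =>
    setIntegral_shift hS.isClosed.measurableSet (hinv t ht) f), setIntegral_const,
    smul_eq_zero] at h1
  exact h1.resolve_left (hU.measureReal_zball_pos e).ne'

lemma setIntegral_addChar_eq_zero {Ψ : AddChar F ℂ} {n : ℤ} {a : F}
    (h : ∃ t : F, ‖t‖ ≤ (resCard F : ℝ) ^ n ∧ Ψ (a * t) ≠ 1) :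
    ∫ x in zball F n, Ψ (a * x) ∂haarF F = 0 := by
  obtain ⟨t, ht, h1⟩ := h
  refine setIntegral_eq_zero_of_shift (measurableSet_zball n) (t := t)
    (fun x => zball_add (mem_zball.2 ht)) h1 fun x _ => ?_
  rw [mul_add, AddChar.map_add_eq_mul, mul_comm]

/-- A function whose Fourier coefficients of sufficiently high level vanish is zero. -/
lemma eq_zero_of_fourier {Ψ : AddChar F ℂ} (hΨ : Continuous Ψ) {θ : F → ℂ} (hθ : Continuous θ)
    {N E R : ℤ} (hEN : E ≤ N) (htriv : ∀ x : F, ‖x‖ ≤ (resCard F : ℝ) ^ (R + E) → Ψ x = 1)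
    (hnon : ∃ x : F, ‖x‖ ≤ (resCard F : ℝ) ^ (R + E + 1) ∧ Ψ x ≠ 1)
    (hzero : ∀ κ : F, ‖κ‖ ≤ (resCard F : ℝ) ^ R →
      ∫ t in zball F N, θ t * Ψ (κ * t) ∂haarF F = 0)
    {t₀ : F} (ht₀ : ‖t₀‖ ≤ (resCard F : ℝ) ^ N)
    (hinv : ∀ s : F, ‖s‖ ≤ (resCard F : ℝ) ^ E → θ (t₀ + s) = θ t₀) : θ t₀ = 0 := by
  -- Fourier inversion at t₀: the coefficients, twisted by Ψ(-κt₀), are summed over |κ| ≤ q^R. After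
  -- exchanging the integrals the one over κ is a multiple of the indicator of |t - t₀| ≤ q^E, where
  -- θ is constant, so a positive multiple of θ(t₀) remains.
  have h0 : ∫ κ in zball F R, ∫ t in zball F N, θ t * Ψ (κ * (t - t₀)) ∂haarF F ∂haarF F = 0 := by
    rw [setIntegral_congr_fun (g := fun _ => (0 : ℂ)) (measurableSet_zball R)]
    · simp
    · intro κ hκ
      have e : ∀ t, θ t * Ψ (κ * (t - t₀)) = Ψ (-(κ * t₀)) * (θ t * Ψ (κ * t)) := by
        intro t
        rw [mul_sub, sub_eq_add_neg, AddChar.map_add_eq_mul]; ring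
      simp only [e]
      rw [integral_const_mul, hzero κ (mem_zball.1 hκ), mul_zero]
  rw [setIntegral_swap (f := fun κ t => θ t * Ψ (κ * (t - t₀))) (by
    refine (hθ.comp continuous_snd).mul (hΨ.comp ?_)
    exact continuous_fst.mul (continuous_snd.sub continuous_const)) (isCompact_zball R)
    (isCompact_zball N)] at h0
  set B := Metric.closedBall t₀ ((resCard F : ℝ) ^ E) with hB
  have hsub : B ⊆ zball F N := by
    intro t ht
    rw [hB, mem_closedBall_iff_norm] at ht
    rw [mem_zball]
    have hle : (resCard F : ℝ) ^ E ≤ (resCard F : ℝ) ^ N := hU.zpow_le.2 hEN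
    simpa using norm_add_le_of (ht.trans hle) ht₀
  rw [setIntegral_congr_fun (g := B.indicator fun _ => (haarF F).real (zball F R) * θ t₀)
    (measurableSet_zball N), setIntegral_indicator Metric.isClosed_closedBall.measurableSet,
    Set.inter_eq_right.2 hsub, setIntegral_const, smul_eq_zero, mul_eq_zero] at h0
  · rcases h0 with h0 | h0 | h0
    · exfalso
      refine (measureReal_pos_of_isOpen (S := B) (IsUltrametricDist.isOpen_closedBall _
        (zpow_pos hU.card_pos _).ne') ⟨t₀, Metric.mem_closedBall_self
        (zpow_nonneg hU.card_pos.le _)⟩ (isCompact_closedBall _ _).measure_ne_top).ne' h0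
    · exact absurd h0 (by exact_mod_cast (hU.measureReal_zball_pos R).ne')
    · exact h0
  · intro t _
    beta_reduce
    rw [integral_const_mul]
    by_cases ht : t ∈ B
    · rw [Set.indicator_of_mem ht]
      rw [hB, mem_closedBall_iff_norm] at ht
      have e : θ t = θ t₀ := by rw [← hinv _ ht]; congr 1; ring
      rw [e, mul_comm, setIntegral_congr_fun (g := fun _ => (1 : ℂ)) (measurableSet_zball R)]
      · rw [setIntegral_const]; simp
      · intro κ hκ
        apply htriv
        rw [norm_mul, zpow_add₀ hU.card_pos.ne']
        exact mul_le_mul (mem_zball.1 hκ) ht (norm_nonneg _) (zpow_nonneg hU.card_pos.le _)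
    · rw [Set.indicator_of_notMem ht]
      have hlt : (resCard F : ℝ) ^ E < ‖t - t₀‖ := by
        rwa [hB, mem_closedBall_iff_norm, not_le] at ht
      have hge : (resCard F : ℝ) ^ (-(-(R + E)) + 1 - R) ≤ ‖t - t₀‖ := by
        by_contra hcon
        push Not at hcon
        rw [hU.norm_lt_zpow] at hcon
        refine absurd (hlt.trans_le hcon) ?_
        rw [hU.zpow_lt]; omega
      have := hU.setIntegral_addChar_eq_zero (n := R) (Ψ := Ψ) (a := t - t₀)
        (hU.exists_addChar_mul_ne_one (c := -(R + E)) (by simpa using hnon) hge)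
      simp only [mul_comm _ (t - t₀)]
      rw [this, mul_zero]

lemma setIntegral_zball_succ {f : F → ℂ} (hf : Continuous f) (n : ℤ) :
    ∫ x in zball F n, f x ∂haarF F =
      ∫ x in zball F (n - 1), f x ∂haarF F + ∫ x in zsphere F n, f x ∂haarF F := by
  have hU' : zball F n = zball F (n - 1) ∪ zsphere F n := by
    ext x
    rw [Set.mem_union, mem_zball, mem_zball, mem_zsphere, ← hU.norm_lt_zpow, le_iff_lt_or_eq]
  have hd : Disjoint (zball F (n - 1)) (zsphere F n) := by
    rw [Set.disjoint_left]
    intro x h1 h2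
    rw [mem_zball, ← hU.norm_lt_zpow] at h1
    exact h1.ne h2
  rw [hU', setIntegral_union hd (measurableSet_zsphere n)
    (integrableOn_of_compact hf (isCompact_zball _))
    (integrableOn_of_compact hf (isCompact_zsphere _))]

lemma setIntegral_zball_eq {f : F → ℂ} (hf : Continuous f) {N n : ℤ} (hNn : N ≤ n)
    (hzero : ∀ k : ℤ, N < k → ∫ x in zsphere F k, f x ∂haarF F = 0) :
    ∫ x in zball F n, f x ∂haarF F = ∫ x in zball F N, f x ∂haarF F := by
  induction n, hNn using Int.leInduction with
  | base => rfl
  | succ k hk ih =>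
    rw [hU.setIntegral_zball_succ hf, hzero (k + 1) (by omega), add_zero, add_sub_cancel_right, ih]

/-- Integrals over the ring of integers of functions of the residue class. -/
lemma setIntegral_red [Fintype (IsLocalRing.ResidueField (ringInt F))]
    (G : IsLocalRing.ResidueField (ringInt F) → ℂ) :
    ∫ x in zball F 0, G (red x) ∂haarF F = (resCard F : ℂ)⁻¹ * ∑ a, G a := by
  classical
  choose lift hlift hred using fun a : IsLocalRing.ResidueField (ringInt F) => exists_red_eq a
  have hgen : ∀ G : IsLocalRing.ResidueField (ringInt F) → ℂ,
      ∫ x in zball F 0, G (red x) ∂haarF F =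
        ((haarF F).real (Metric.ball 0 1) : ℂ) * ∑ a, G a := by
    intro G
    have hball : ∀ a, Metric.ball (lift a) 1 ⊆ zball F 0 := by
      intro a x hx
      rw [mem_ball_iff_norm] at hx
      rw [mem_zball, zpow_zero]
      simpa using norm_add_le_of hx.le (hlift a)
    have e : ∀ x ∈ zball F 0, G (red x) =
        ∑ a, (Metric.ball (lift a) 1).indicator (fun _ => G a) x := by
      intro x hx
      rw [mem_zball, zpow_zero] at hx
      have hiff : ∀ a, x ∈ Metric.ball (lift a) 1 ↔ red x = a := by
        intro a
        rw [mem_ball_iff_norm, ← red_eq_iff hx (hlift a), hred]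
      rw [Finset.sum_eq_single (red x)]
      · rw [Set.indicator_of_mem ((hiff _).2 rfl)]
      · intro b _ hb
        rw [Set.indicator_of_notMem fun h => hb ((hiff b).1 h).symm]
      · simp
    have hfin : ∀ a : F, haarF F (Metric.ball a 1) ≠ ⊤ := fun a =>
      ((measure_mono Metric.ball_subset_closedBall).trans_lt
        (isCompact_closedBall a 1).measure_lt_top).ne
    have htrans : ∀ a : F, (haarF F).real (Metric.ball a 1) = (haarF F).real (Metric.ball 0 1) := by
      intro a
      rw [Measure.real, Measure.real, ← measure_preimage_add_right (haarF F) a]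
      congr 2
      ext x; simp
    rw [setIntegral_congr_fun (measurableSet_zball 0) e, integral_finsetSum, Finset.mul_sum]
    · refine Finset.sum_congr rfl fun a _ => ?_
      rw [setIntegral_indicator Metric.isOpen_ball.measurableSet, Set.inter_eq_right.2 (hball a),
        setIntegral_const, htrans]
      simp
    · intro a _
      refine (integrable_indicator_iff Metric.isOpen_ball.measurableSet).2 ?_
      refine integrableOn_const (hs := ?_)
      exact ((Measure.restrict_apply_le _ _).trans_lt (hfin _).lt_top).ne
  -- The constant function 1 determines the common volume of the residue classes, because the whole
  -- ring of integers has volume one.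
  have h1 := hgen fun _ => 1
  have hcard : (Finset.univ : Finset (IsLocalRing.ResidueField (ringInt F))).card = resCard F := by
    rw [Finset.card_univ, resCard, Nat.card_eq_fintype_card]
  rw [setIntegral_const, Finset.sum_const, hcard] at h1
  have hz : zball F 0 = Metric.closedBall 0 1 := by rw [zball_eq, zpow_zero]
  rw [hz, Measure.real, haarF_closedBall_one] at h1
  simp only [ENNReal.toReal_one, one_smul, nsmul_eq_mul, mul_one] at h1
  rw [hgen, eq_inv_of_mul_eq_one_left h1.symm]

lemma measureReal_zball_neg_one : (haarF F).real (zball F (-1)) = (resCard F : ℝ)⁻¹ := by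
  classical
  have := hU.finite_residueField
  let _ := Fintype.ofFinite (IsLocalRing.ResidueField (ringInt F))
  have h := hU.setIntegral_red fun a => if a = 0 then 1 else 0
  rw [Finset.sum_ite_eq' Finset.univ 0, if_pos (Finset.mem_univ _), mul_one,
    setIntegral_congr_fun (g := (zball F (-1)).indicator fun _ => (1 : ℂ)) (measurableSet_zball 0),
    setIntegral_indicator (measurableSet_zball _), Set.inter_eq_right.2, setIntegral_const] at h
  · have h2 : (((haarF F).real (zball F (-1)) : ℝ) : ℂ) = (((resCard F : ℝ)⁻¹ : ℝ) : ℂ) := by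
      simpa using h
    exact_mod_cast h2
  · intro x hx
    rw [mem_zball] at *
    exact hx.trans (hU.zpow_le.2 (by norm_num))
  · intro x hx
    rw [mem_zball, zpow_zero] at hx
    have hiff : x ∈ zball F (-1) ↔ red x = 0 := by
      rw [red_eq_zero_iff hx, mem_zball]
      have := hU.norm_lt_zpow (x := x) (n := 0)
      rw [zpow_zero] at this
      rw [this]; norm_num
    beta_reduce
    by_cases h0 : x ∈ zball F (-1)
    · rw [Set.indicator_of_mem h0, if_pos (hiff.1 h0)]
    · rw [Set.indicator_of_notMem h0, if_neg (mt hiff.2 h0)]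

/-- The scaling behaviour of the Haar measure. -/
lemma integral_comp_mul {c : F} (hc : c ≠ 0) (f : F → ℂ) :
    ∫ x, f (c * x) ∂haarF F = (‖c‖⁻¹ : ℝ) * ∫ x, f x ∂haarF F := by
  -- V is the modulus. It is multiplicative and trivial on units, and counting residue classes gives
  -- its value at ϖ⁻¹; hence V(c) = |c|⁻¹.
  set V : F → ℝ := fun c => (haarF F).real {x | ‖c * x‖ ≤ 1} with hV
  have hint : ∀ c : F, c ≠ 0 → ∫ x, (Metric.closedBall (0 : F) 1).indicator (fun _ => (1 : ℂ)) (c * x)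
      ∂haarF F = V c := by
    intro c hc
    have e : ∀ x : F, (Metric.closedBall (0 : F) 1).indicator (fun _ => (1 : ℂ)) (c * x) =
        {x | ‖c * x‖ ≤ 1}.indicator (fun _ => (1 : ℂ)) x := by
      intro x
      simp [Set.indicator]
    simp only [e]
    rw [integral_indicator, setIntegral_const]
    · simp [hV]
    · exact (isClosed_le (continuous_const_mul c).norm continuous_const).measurableSet
  have hmul : ∀ a b : F, a ≠ 0 → b ≠ 0 → V (a * b) = V b * V a := by
    intro a b ha hb
    have h := hint (a * b) (mul_ne_zero ha hb)
    simp only [mul_assoc] at h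
    rw [integral_comp_mul_left' hb (fun y => (Metric.closedBall (0 : F) 1).indicator
      (fun _ => (1 : ℂ)) (a * y)), hint a ha] at h
    exact_mod_cast h.symm
  have hunit : ∀ u : F, ‖u‖ = 1 → V u = 1 := by
    intro u hu
    have h1 : {x : F | ‖u * x‖ ≤ 1} = Metric.closedBall 0 1 := by ext x; simp [hu]
    simp only [hV]
    rw [h1, Measure.real, haarF_closedBall_one, ENNReal.toReal_one]
  have hinv : V ϖ⁻¹ = (resCard F : ℝ)⁻¹ := by
    rw [← hU.measureReal_zball_neg_one]
    simp only [hV]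
    congr 1
    ext x
    rw [mem_zball, Set.mem_ofPred_eq, norm_mul, norm_inv, hU.norm_eq, inv_inv, zpow_neg_one,
      ← le_div_iff₀' hU.card_pos, one_div]
  have hϖ : V ϖ = (resCard F : ℝ) := by
    have h := hmul ϖ ϖ⁻¹ hU.ne_zero (inv_ne_zero hU.ne_zero)
    rw [mul_inv_cancel₀ hU.ne_zero, hunit 1 norm_one, hinv] at h
    field_simp [hU.card_pos.ne'] at h
    linarith
  have hnat : ∀ n : ℕ, V (ϖ ^ n) = (resCard F : ℝ) ^ n := by
    intro n
    induction n with
    | zero => simpa using hunit 1 norm_one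
    | succ n ih =>
      rw [pow_succ, hmul _ _ (pow_ne_zero _ hU.ne_zero) hU.ne_zero, ih, hϖ, pow_succ, mul_comm]
  have hzpow : ∀ n : ℤ, V (ϖ ^ n) = (resCard F : ℝ) ^ n := by
    intro n
    rcases n.eq_nat_or_neg with ⟨k, rfl | rfl⟩
    · rw [zpow_natCast, zpow_natCast, hnat]
    · have h0 : ϖ ^ (-(k : ℤ)) ≠ 0 := zpow_ne_zero _ hU.ne_zero
      have h := hmul (ϖ ^ k) (ϖ ^ (-(k : ℤ))) (pow_ne_zero _ hU.ne_zero) h0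
      rw [← zpow_natCast, ← zpow_add₀ hU.ne_zero, add_neg_cancel, zpow_zero, hunit 1 norm_one,
        zpow_natCast, hnat] at h
      rw [show (resCard F : ℝ) ^ (-(k : ℤ)) = ((resCard F : ℝ) ^ k)⁻¹ by
        rw [zpow_neg, zpow_natCast]]
      exact eq_inv_of_mul_eq_one_left h.symm
  rw [integral_comp_mul_left' hc]
  congr 2
  have hpart := hU.norm_unit_part hc
  have e : c = c * ϖ ^ (-ord c) * ϖ ^ ord c := by
    rw [mul_assoc, ← zpow_add₀ hU.ne_zero]; simp
  change V c = _
  rw [e, hmul _ _ (ne_zero_of_norm_one hpart) (zpow_ne_zero _ hU.ne_zero), hunit _ hpart, mul_one,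
    hzpow, ← e, hU.norm_eq_ord hc, ← zpow_neg, neg_neg]

lemma setIntegral_zball_scale {c : F} {n : ℤ} (hc : ‖c‖ = (resCard F : ℝ) ^ n) (k : ℤ) (f : F → ℂ) :
    ∫ x in zball F (n + k), f x ∂haarF F =
      ((resCard F : ℝ) ^ n : ℝ) * ∫ x in zball F k, f (c * x) ∂haarF F := by
  have hpos : 0 < ‖c‖ := by rw [hc]; exact zpow_pos hU.card_pos _
  have hc0 : c ≠ 0 := norm_pos_iff.1 hpos
  have h := hU.integral_comp_mul hc0 ((zball F (n + k)).indicator f)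
  have e : ∀ x, (zball F (n + k)).indicator f (c * x) =
      (zball F k).indicator (fun x => f (c * x)) x := by
    intro x
    have hiff : c * x ∈ zball F (n + k) ↔ x ∈ zball F k := by
      rw [mem_zball, mem_zball, norm_mul, hc, zpow_add₀ hU.card_pos.ne']
      exact mul_le_mul_iff_right₀ (zpow_pos hU.card_pos _)
    by_cases hx : x ∈ zball F k
    · rw [Set.indicator_of_mem hx, Set.indicator_of_mem (hiff.2 hx)]
    · rw [Set.indicator_of_notMem hx, Set.indicator_of_notMem (mt hiff.1 hx)]
  simp only [e] at h
  rw [integral_indicator (measurableSet_zball _), integral_indicator (measurableSet_zball _)] at h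
  rw [h, ← hc, ← mul_assoc, ← Complex.ofReal_mul, mul_inv_cancel₀ hpos.ne', Complex.ofReal_one,
    one_mul]

lemma measureReal_zball (n : ℤ) : (haarF F).real (zball F n) = (resCard F : ℝ) ^ n := by
  have h := hU.setIntegral_zball_scale (c := ϖ ^ (-n)) (n := n) (by rw [hU.norm_zpow, neg_neg]) 0
    fun _ => 1
  have hz : zball F 0 = Metric.closedBall 0 1 := by rw [zball_eq, zpow_zero]
  rw [add_zero, setIntegral_const, setIntegral_const, hz, Measure.real, Measure.real,
    haarF_closedBall_one] at h
  simp only [ENNReal.toReal_one, one_smul, mul_one, Complex.real_smul] at h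
  rw [Measure.real]
  exact_mod_cast h

end IsOddUniformizer

end

end Measure

/-! ## Quadratic Gauss sums and the Weil index -/

section FiniteGauss

variable {k : Type*} [Field k] [Fintype k] [DecidableEq k]

/-- The quadratic character of a finite field with complex values. -/
noncomputable def quadC (k : Type*) [Field k] [Fintype k] [DecidableEq k] : MulChar k ℂ :=
  (quadraticChar k).ringHomComp (Int.castRingHom ℂ)

lemma quadC_apply (a : k) : quadC k a = (quadraticChar k a : ℂ) := rfl

/-- An element t has 1 + (t/k) square roots, where (·/k) is the quadratic character. The constant 1
contributes a complete character sum, which vanishes, and the rest is a Gauss sum. -/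
lemma sum_addChar_sq (hk : ringChar k ≠ 2) {χ : AddChar k ℂ} (hχ : χ ≠ 1) (a : kˣ) :
    ∑ b, χ (a * b ^ 2) = quadC k a * gaussSum (quadC k) χ := by
  have h1 : ∑ b, χ (a * b ^ 2) = ∑ t, ((quadraticChar k t : ℂ) + 1) * χ (a * t) := by
    rw [← Finset.sum_fiberwise (s := Finset.univ) (g := fun b : k => b ^ 2)]
    refine Finset.sum_congr rfl fun t _ => ?_
    have h2 : ∀ b ∈ Finset.univ.filter (fun b : k => b ^ 2 = t), χ (a * b ^ 2) = χ (a * t) := by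
      intro b hb
      rw [(Finset.mem_filter.1 hb).2]
    rw [Finset.sum_congr rfl h2, Finset.sum_const, nsmul_eq_mul]
    congr 1
    have h3 := quadraticChar_card_sqrts hk t
    have h4 : ({x : k | x ^ 2 = t} : Set k).toFinset = Finset.univ.filter fun b : k => b ^ 2 = t := by
      ext b; simp
    rw [h4] at h3
    exact_mod_cast congrArg (Int.cast : ℤ → ℂ) h3
  have h5 : ∑ t, χ (a * t) = 0 := by
    have := AddChar.sum_eq_zero_of_ne_one hχ
    rw [← this]
    exact Fintype.sum_equiv (Units.mulLeft a) _ _ fun t => rfl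
  have h6 := gaussSum_mulShift_eq (quadC k) χ a
  have hq : (quadC k)⁻¹ = quadC k := by
    have hquad : (quadC k).IsQuadratic := (quadraticChar_isQuadratic k).comp _
    exact hquad.inv
  rw [hq] at h6
  rw [h1, ← h6, gaussSum]
  simp only [add_mul, one_mul, Finset.sum_add_distrib, h5, add_zero, AddChar.mulShift_apply,
    quadC_apply]

lemma gaussSum_quadC_sq (hk : ringChar k ≠ 2) {χ : AddChar k ℂ} (hχ : χ ≠ 1) :
    gaussSum (quadC k) χ ^ 2 = quadC k (-1) * Fintype.card k := by
  refine gaussSum_sq ?_ ((quadraticChar_isQuadratic k).comp _) (AddChar.IsPrimitive.of_ne_one hχ)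
  intro h
  obtain ⟨a, ha⟩ := quadraticChar_exists_neg_one' hk
  have h2 : quadC k (a : k) = 1 := by unfold quadC; rw [h, MulChar.one_apply_coe]
  rw [quadC_apply, ha] at h2
  norm_num at h2

end FiniteGauss

/-! ### Fresnel integrals and the Weil indices of the dilates of ψ -/

section WeilIndex

variable {F : Type*} [NontriviallyNormedField F] [IsUltrametricDist F]

namespace IsOddUniformizer

variable {ϖ : F} (hU : IsOddUniformizer ϖ)

include hU

lemma leg_eq_quadraticChar [ProperSpace F] [Fintype (IsLocalRing.ResidueField (ringInt F))]
    [DecidableEq (IsLocalRing.ResidueField (ringInt F))] {u : F} (hu : ‖u‖ = 1) :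
    ((leg ϖ u : ℤˣ) : ℤ) = quadraticChar _ (red u) := by
  have h0 : red u ≠ 0 := by rw [ne_eq, red_eq_zero_iff hu.le, hu]; exact lt_irrefl _
  by_cases h : IsSquare u
  · rw [(hU.leg_unit hu).2 h, (quadraticChar_one_iff_isSquare h0).2
      ((isSquare_iff_red hU.norm_two hu).1 h)]
    rfl
  · rw [quadraticChar_neg_one_iff_not_isSquare.2 (mt (isSquare_iff_red hU.norm_two hu).2 h)]
    have h1 : leg ϖ u ≠ 1 := mt (hU.leg_unit hu).1 h
    have h2 : ∀ x : ℤˣ, x ≠ 1 → (x : ℤ) = -1 := by decide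
    exact h2 _ h1

/-- A character trivial on 𝔭 depends on x in 𝒪 only through its residue; the descended character is
defined through chosen lifts and does not depend on them. -/
lemma exists_resChar {Ψ : AddChar F ℂ} (h : ∀ x : F, ‖x‖ < 1 → Ψ x = 1) :
    ∃ χ : AddChar (IsLocalRing.ResidueField (ringInt F)) ℂ, ∀ x : F, ‖x‖ ≤ 1 → χ (red x) = Ψ x := by
  choose lift hlift hred using fun a : IsLocalRing.ResidueField (ringInt F) => exists_red_eq a
  have hwell : ∀ x y : F, ‖x‖ ≤ 1 → ‖y‖ ≤ 1 → red x = red y → Ψ x = Ψ y := by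
    intro x y hx hy hxy
    rw [red_eq_iff hx hy] at hxy
    have e : x = (x - y) + y := by ring
    rw [e, AddChar.map_add_eq_mul, h _ hxy, one_mul]
  have h0 : ‖(0 : F)‖ ≤ 1 := by simp
  have hr0 : red (0 : F) = 0 := by rw [red_eq_zero_iff h0]; simp
  refine ⟨{ toFun := fun a => Ψ (lift a), map_zero_eq_one' := ?_, map_add_eq_mul' := ?_ }, ?_⟩
  · rw [hwell _ 0 (hlift _) h0 (by rw [hred, hr0]), AddChar.map_zero_eq_one]
  · intro a b
    rw [← AddChar.map_add_eq_mul]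
    refine hwell _ _ (hlift _) (norm_add_le_of (hlift _) (hlift _)) ?_
    rw [red_add (hlift _) (hlift _), hred, hred, hred]
  · intro x hx
    exact hwell _ _ (hlift _) hx (hred _)

section

variable [ProperSpace F] [MeasurableSpace F] [BorelSpace F]

/-- Outside of a ball, the Fresnel integral vanishes. -/
lemma fresnel_zsphere {Ψ : AddChar F ℂ} (hΨ : Continuous Ψ) (hne : Ψ ≠ 1) {e n : ℤ}
    (he : addCond Ψ ≤ 2 * e) (hn : e - addCond Ψ < n) :
    ∫ x in zsphere F n, Ψ (x ^ 2) ∂haarF F = 0 := by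
  obtain ⟨h1, h2⟩ := hU.addCond_spec hΨ hne
  refine hU.setIntegral_eq_zero_of_average (f := fun x => Ψ (x ^ 2)) (hΨ.comp (continuous_pow 2))
    (isCompact_zsphere n) (-e) ?_ ?_
  · intro t ht x
    have htn : ‖t‖ < (resCard F : ℝ) ^ n :=
      (mem_zball.1 ht).trans_lt (hU.zpow_lt.2 (by omega))
    rw [mem_zsphere, mem_zsphere]
    constructor <;> intro h
    · rw [← norm_add_eq_left (x := x + t) (y := -t) (by rwa [norm_neg, h])] at h
      simpa using h
    · rw [norm_add_eq_left (by rwa [h]), h]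
  · intro x hx
    -- In (x + t)² the term t² is killed because 2e is at least the conductor. What remains is the
    -- character t ↦ Ψ(2xt), nontrivial on 𝔭^e because x is large.
    have e1 : ∀ t ∈ zball F (-e), Ψ ((x + t) ^ 2) = Ψ (x ^ 2) * Ψ (2 * x * t) := by
      intro t ht
      have e2 : (x + t) ^ 2 = x ^ 2 + 2 * x * t + t ^ 2 := by ring
      rw [e2, AddChar.map_add_eq_mul, AddChar.map_add_eq_mul, h1 (t ^ 2), mul_one]
      rw [norm_pow]
      calc ‖t‖ ^ 2 ≤ ((resCard F : ℝ) ^ (-e)) ^ 2 :=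
            pow_le_pow_left₀ (norm_nonneg _) (mem_zball.1 ht) 2
        _ = (resCard F : ℝ) ^ (-e + -e) := by rw [sq, zpow_add₀ hU.card_pos.ne']
        _ ≤ _ := hU.zpow_le.2 (by omega)
    rw [setIntegral_congr_fun (measurableSet_zball _) e1, integral_const_mul,
      hU.setIntegral_addChar_eq_zero, mul_zero]
    refine hU.exists_addChar_mul_ne_one h2 ?_
    rw [norm_mul, hU.norm_two, one_mul, mem_zsphere.1 hx, hU.zpow_le]
    omega

lemma fresnel_eq {Ψ : AddChar F ℂ} (hΨ : Continuous Ψ) (hne : Ψ ≠ 1) {e : ℤ}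
    (he : addCond Ψ ≤ 2 * e) :
    limUnder atTop (fun r : ℕ => ∫ x in primePow F (-(r : ℤ)), Ψ (x ^ 2) ∂(haarF F)) =
      ∫ x in zball F (e - addCond Ψ), Ψ (x ^ 2) ∂(haarF F) := by
  apply Tendsto.limUnder_eq
  refine tendsto_const_nhds.congr' ?_
  filter_upwards [eventually_ge_atTop (e - addCond Ψ).toNat] with r hr
  have hle : e - addCond Ψ ≤ r := by omega
  exact (hU.setIntegral_zball_eq (hΨ.comp (continuous_pow 2)) hle fun k hk =>
    hU.fresnel_zsphere hΨ hne he hk).symm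

/-- For conductor 2k the Fresnel integral is the volume q^(-k) of a ball on which the integrand is
1, and this cancels the self-dual factor q^k. -/
lemma weilIndex_even {Ψ : AddChar F ℂ} (hΨ : Continuous Ψ) (hne : Ψ ≠ 1) {k : ℤ}
    (hk : addCond Ψ = 2 * k) : weilIndex Ψ = 1 := by
  obtain ⟨h1, -⟩ := hU.addCond_spec hΨ hne
  rw [weilIndex, hU.fresnel_eq hΨ hne (e := k) hk.le,
    setIntegral_congr_fun (g := fun _ => (1 : ℂ)) (measurableSet_zball _), setIntegral_const,
    hU.measureReal_zball, hk]
  · have e : ((2 * k : ℤ) : ℝ) / 2 = (k : ℝ) := by push_cast; ring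
    rw [e, Real.rpow_intCast, Complex.real_smul, mul_one, ← Complex.ofReal_mul,
      ← zpow_add₀ hU.card_pos.ne']
    simp; 
    ring_nf
    simp
  · intro x hx
    apply h1
    rw [norm_pow]
    have hx' := mem_zball.1 hx
    calc ‖x‖ ^ 2 ≤ ((resCard F : ℝ) ^ (k - addCond Ψ)) ^ 2 :=
          pow_le_pow_left₀ (norm_nonneg _) hx' 2
      _ = (resCard F : ℝ) ^ (k - addCond Ψ + (k - addCond Ψ)) := by
          rw [sq, zpow_add₀ hU.card_pos.ne']
      _ ≤ _ := hU.zpow_le.2 (by omega)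

/-- For conductor 2k + 1 the integral runs over 𝔭^k; the substitution of ϖ^k x for x moves it to 𝒪
and leaves the factor q^(1/2). -/
lemma weilIndex_odd {Ψ : AddChar F ℂ} (hΨ : Continuous Ψ) (hne : Ψ ≠ 1) {k : ℤ}
    (hk : addCond Ψ = 2 * k + 1) : weilIndex Ψ =
      ((resCard F : ℝ) ^ (1 / 2 : ℝ) : ℝ) * ∫ x in zball F 0, Ψ (ϖ ^ (2 * k) * x ^ 2) ∂(haarF F) := by
  rw [weilIndex, hU.fresnel_eq hΨ hne (e := k + 1) (by omega)]
  have e1 : k + 1 - addCond Ψ = -k + 0 := by omega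
  rw [e1, hU.setIntegral_zball_scale (c := ϖ ^ k) (by rw [hU.norm_zpow]), ← mul_assoc,
    ← Complex.ofReal_mul, hk]
  congr 1
  · congr 1
    have e : ((2 * k + 1 : ℤ) : ℝ) / 2 = (1 / 2 : ℝ) + (k : ℝ) := by push_cast; ring
    rw [e, Real.rpow_add hU.card_pos, Real.rpow_intCast, mul_assoc, ← zpow_add₀ hU.card_pos.ne']
    simp
  · congr 1
    ext x
    rw [mul_pow, ← zpow_natCast (ϖ ^ k), ← zpow_mul]
    congr 3
    push_cast; ring

variable {ε : ℕ} {ψ : AddChar F ℂ} (hψ : Continuous ψ) (hψ_ne : ψ ≠ 1)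
  (hψ_cond : addCond ψ = -(ε : ℤ))

include hψ hψ_ne

lemma mulShift_facts {a : F} (ha : a ≠ 0) : Continuous (ψ.mulShift a) ∧ ψ.mulShift a ≠ 1 := by
  refine ⟨?_, fun h => hψ_ne ?_⟩
  · have : (ψ.mulShift a : F → ℂ) = fun x => ψ (a * x) := by ext x; rw [AddChar.mulShift_apply]
    rw [this]
    exact hψ.comp (continuous_const_mul a)
  · ext x
    have := DFunLike.congr_fun h (a⁻¹ * x)
    rw [AddChar.mulShift_apply, mul_inv_cancel_left₀ ha] at this
    rw [this]; simp

include hψ_cond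

/-- The Weil indices of all dilates of `ψ`. -/
lemma exists_weilIndex_eq : ∃ g : ℂ, g ^ 2 = ((leg ϖ (-1 : F) : ℤ) : ℂ) ∧
    ∀ a : F, a ≠ 0 → weilIndex (ψ.mulShift a) =
      if Even ((ε : ℤ) + ord a) then 1 else ((leg ϖ a : ℤ) : ℂ) * g := by
  classical
  have hfin := hU.finite_residueField
  let _ := Fintype.ofFinite (IsLocalRing.ResidueField (ringInt F))
  obtain ⟨h1, x₀, hx₀, hx₀'⟩ := hU.addCond_spec hψ hψ_ne
  rw [hψ_cond, neg_neg] at h1 hx₀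
  -- The dilate of ψ by d has conductor one, so on 𝒪 it comes from a nontrivial character of the
  -- residue field.
  set d : F := ϖ ^ (-1 - (ε : ℤ)) with hd
  have hdn : ‖d‖ = (resCard F : ℝ) ^ ((ε : ℤ) + 1) := by rw [hd, hU.norm_zpow]; congr 1; ring
  have hd0 : d ≠ 0 := zpow_ne_zero _ hU.ne_zero
  obtain ⟨χ, hχ⟩ := hU.exists_resChar (Ψ := ψ.mulShift d) (by
    intro x hx
    rw [AddChar.mulShift_apply]
    apply h1
    rw [← zpow_zero (resCard F : ℝ), hU.norm_lt_zpow] at hx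
    rw [norm_mul, hdn]
    calc (resCard F : ℝ) ^ ((ε : ℤ) + 1) * ‖x‖ ≤ (resCard F : ℝ) ^ ((ε : ℤ) + 1) *
          (resCard F : ℝ) ^ ((0 : ℤ) - 1) :=
          mul_le_mul_of_nonneg_left hx (zpow_nonneg hU.card_pos.le _)
      _ = _ := by rw [← zpow_add₀ hU.card_pos.ne']; congr 1; ring)
  have hχ1 : χ ≠ 1 := by
    intro h
    have hle : ‖x₀ / d‖ ≤ 1 := by
      rw [norm_div, hdn]
      exact (div_le_one (zpow_pos hU.card_pos _)).2 hx₀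
    have := hχ _ hle
    rw [AddChar.mulShift_apply, mul_div_cancel₀ _ hd0, h] at this
    exact hx₀' (by rw [← this]; simp)
  set q2 : ℂ := (((resCard F : ℝ) ^ (1 / 2 : ℝ) : ℝ) : ℂ) with hq2
  have hq2sq : q2 ^ 2 = (resCard F : ℂ) := by
    rw [hq2, ← Complex.ofReal_pow, ← Real.sqrt_eq_rpow, Real.sq_sqrt hU.card_pos.le]
    simp
  have hqC : (resCard F : ℂ) ≠ 0 := by exact_mod_cast hU.card_pos.ne'
  have hcard : (Fintype.card (IsLocalRing.ResidueField (ringInt F)) : ℂ) = resCard F := by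
    rw [resCard, Nat.card_eq_fintype_card]
  have hchar := hU.ringChar_residueField_ne_two
  have hredu : ∀ u : F, ‖u‖ = 1 → quadC _ (red u) = ((leg ϖ u : ℤ) : ℂ) := fun u hu => by
    rw [quadC_apply, hU.leg_eq_quadraticChar hu]
  -- The constant g is the quadratic Gauss sum divided by √q, so that g² is the quadratic character
  -- at -1.
  refine ⟨q2 * ((resCard F : ℂ)⁻¹ * gaussSum (quadC _) χ), ?_, ?_⟩
  · rw [mul_pow, mul_pow, gaussSum_quadC_sq hchar hχ1, hq2sq, hcard]
    have hm1 : red (-1 : F) = -1 := by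
      have := red_add (F := F) (x := -1) (y := 1) (by simp) (by simp)
      rw [neg_add_cancel, red_one, (red_eq_zero_iff (by simp)).2 (by simp)] at this
      exact (neg_eq_of_add_eq_zero_left this.symm).symm
    rw [← hm1, hredu _ (by simp)]
    field_simp
  · intro a ha
    obtain ⟨hc, hn⟩ := hU.mulShift_facts hψ hψ_ne ha
    have hcond := hU.addCond_mulShift hψ hψ_ne ha
    rw [hψ_cond] at hcond
    split_ifs with hpar
    · obtain ⟨k, hk⟩ := hpar
      exact hU.weilIndex_even hc hn (k := -k) (by omega)
    · rw [Int.not_even_iff_odd] at hpar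
      obtain ⟨k, hk⟩ := hpar
      rw [hU.weilIndex_odd hc hn (k := -k - 1) (by omega), ← hq2]
      have hu := hU.norm_unit_part ha
      have hu0 : red (a * ϖ ^ (-ord a)) ≠ 0 := by
        rw [ne_eq, red_eq_zero_iff hu.le, hu]; exact lt_irrefl _
      have e1 : ∀ x ∈ zball F 0, ψ.mulShift a (ϖ ^ (2 * (-k - 1)) * x ^ 2) =
          (fun b => χ (red (a * ϖ ^ (-ord a)) * b ^ 2)) (red x) := by
        intro x hx
        have hx' : ‖x‖ ≤ 1 := by simpa using mem_zball.1 hx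
        have hxx : ‖x * x‖ ≤ 1 := by
          rw [norm_mul]; exact mul_le_one₀ hx' (norm_nonneg _) hx'
        beta_reduce
        rw [sq, sq, ← red_mul hx' hx', ← red_mul hu.le hxx, hχ _ (by
          rw [norm_mul, hu, one_mul]; exact hxx), AddChar.mulShift_apply, AddChar.mulShift_apply]
        congr 1
        have e2 : ϖ ^ (2 * (-k - 1)) = d * ϖ ^ (-ord a) := by
          rw [hd, ← zpow_add₀ hU.ne_zero]; congr 1; omega
        rw [e2]; ring
      rw [setIntegral_congr_fun (measurableSet_zball 0) e1,
        hU.setIntegral_red (fun b => χ (red (a * ϖ ^ (-ord a)) * b ^ 2))]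
      have h3 := sum_addChar_sq hchar hχ1 (Units.mk0 _ hu0)
      rw [Units.val_mk0] at h3
      rw [h3, hredu _ hu, hU.leg_mul ha (zpow_ne_zero _ hU.ne_zero), hU.leg_zpow, mul_one]
      ring

/-- The Fourier transform of `y ↦ weilIndex ψ_y` on the first sphere on which `ψ` is nontrivial. -/
lemma integral_weilIndex {κ : F} (hκ : ‖κ‖ = 1) :
    ∫ y in zsphere F ((ε : ℤ) + 1), weilIndex (ψ.mulShift y) * ψ (-(κ * y)) ∂haarF F =
      ((resCard F : ℝ) ^ (1 / 2 : ℝ) : ℝ) * (resCard F : ℂ) ^ (ε : ℤ) * ((leg ϖ κ : ℤ) : ℂ) := by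
  classical
  have hfin := hU.finite_residueField
  let _ := Fintype.ofFinite (IsLocalRing.ResidueField (ringInt F))
  obtain ⟨h1, h2⟩ := hU.addCond_spec hψ hψ_ne
  rw [hψ_cond] at h1 h2
  have hqC : (resCard F : ℂ) ≠ 0 := by exact_mod_cast hU.card_pos.ne'
  -- On this sphere ψ_y has conductor one, so its Weil index is √q times the integral of ψ(yx²) over
  -- 𝒪.
  have e1 : ∀ y ∈ zsphere F ((ε : ℤ) + 1), weilIndex (ψ.mulShift y) * ψ (-(κ * y)) =
      (((resCard F : ℝ) ^ (1 / 2 : ℝ) : ℝ) : ℂ) *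
        ∫ x in zball F 0, ψ (y * (x ^ 2 - κ)) ∂haarF F := by
    intro y hy
    have hy0 : y ≠ 0 := by
      rw [← norm_pos_iff, mem_zsphere.1 hy]; exact zpow_pos hU.card_pos _
    obtain ⟨hc, hn⟩ := hU.mulShift_facts hψ hψ_ne hy0
    have hord : ord y = -((ε : ℤ) + 1) := hU.ord_eq (by rw [neg_neg]; exact hy)
    rw [hU.weilIndex_odd hc hn (k := 0) (by
      rw [hU.addCond_mulShift hψ hψ_ne hy0, hψ_cond, hord]; ring), mul_assoc,
      ← integral_mul_const]
    congr 2
    ext x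
    rw [AddChar.mulShift_apply, ← AddChar.map_add_eq_mul]
    congr 1
    simp
    ring
  rw [setIntegral_congr_fun (measurableSet_zsphere _) e1, integral_const_mul, mul_assoc]
  congr 1
  rw [setIntegral_swap (f := fun y x => ψ (y * (x ^ 2 - κ)))
    (hψ.comp (continuous_fst.mul ((continuous_snd.pow 2).sub continuous_const)))
    (isCompact_zsphere _) (isCompact_zball 0)]
  have hκ2 : ∀ x : F, ‖x‖ ≤ 1 → ‖x ^ 2 - κ‖ ≤ 1 := fun x hx =>
    norm_sub_le_of (by rw [norm_pow]; exact pow_le_one₀ (norm_nonneg _) hx) hκ.le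
  -- A sphere is a difference of two balls. On the smaller one ψ(y(x² - κ)) is 1; on the larger one
  -- the integral vanishes unless x² ≡ κ modulo 𝔭. Averaging over x then counts the square roots of
  -- the residue of κ.
  have e2 : ∀ x ∈ zball F 0, ∫ y in zsphere F ((ε : ℤ) + 1), ψ (y * (x ^ 2 - κ)) ∂haarF F =
      (fun b => (if b ^ 2 = red κ then (resCard F : ℂ) ^ ((ε : ℤ) + 1) else 0) -
        (resCard F : ℂ) ^ (ε : ℤ)) (red x) := by
    intro x hx
    have hx' : ‖x‖ ≤ 1 := by simpa using mem_zball.1 hx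
    set s := x ^ 2 - κ with hs
    have hs1 : ‖s‖ ≤ 1 := hκ2 x hx'
    have hcont : Continuous fun y => ψ (y * s) := hψ.comp (continuous_mul_const s)
    have hsplit := hU.setIntegral_zball_succ hcont ((ε : ℤ) + 1)
    have hsmall : ∫ y in zball F ((ε : ℤ) + 1 - 1), ψ (y * s) ∂haarF F =
        (resCard F : ℂ) ^ (ε : ℤ) := by
      rw [setIntegral_congr_fun (g := fun _ => (1 : ℂ)) (measurableSet_zball _), setIntegral_const,
        hU.measureReal_zball]
      · simp
      · intro y hy
        apply h1
        rw [norm_mul, neg_neg]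
        have := mem_zball.1 hy
        rw [add_sub_cancel_right] at this
        calc ‖y‖ * ‖s‖ ≤ ‖y‖ * 1 := mul_le_mul_of_nonneg_left hs1 (norm_nonneg _)
          _ ≤ _ := by rwa [mul_one]
    have hiff : red x ^ 2 = red κ ↔ ‖s‖ < 1 := by
      rw [sq, ← red_mul hx' hx', red_eq_iff (by
        rw [norm_mul]; exact mul_le_one₀ hx' (norm_nonneg _) hx') hκ.le, hs, sq]
    beta_reduce
    rw [eq_sub_iff_add_eq, ← hsmall, add_comm, ← hsplit]
    split_ifs with hb
    · rw [hiff] at hb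
      rw [setIntegral_congr_fun (g := fun _ => (1 : ℂ)) (measurableSet_zball _), setIntegral_const,
        hU.measureReal_zball]
      · simp
      · intro y hy
        apply h1
        rw [← zpow_zero (resCard F : ℝ), hU.norm_lt_zpow] at hb
        rw [norm_mul, neg_neg]
        calc ‖y‖ * ‖s‖ ≤ (resCard F : ℝ) ^ ((ε : ℤ) + 1) * (resCard F : ℝ) ^ ((0 : ℤ) - 1) :=
              mul_le_mul (mem_zball.1 hy) hb (norm_nonneg _) (zpow_nonneg hU.card_pos.le _)
          _ = _ := by rw [← zpow_add₀ hU.card_pos.ne']; congr 1; ring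
    · have hs1' : ‖s‖ = 1 := le_antisymm hs1 (not_lt.1 (mt hiff.2 hb))
      simp only [mul_comm _ s]
      apply hU.setIntegral_addChar_eq_zero
      apply hU.exists_addChar_mul_ne_one h2
      rw [hs1', ← zpow_zero (resCard F : ℝ), hU.zpow_le]
      omega
  rw [setIntegral_congr_fun (measurableSet_zball 0) e2,
    hU.setIntegral_red (fun b => (if b ^ 2 = red κ then (resCard F : ℂ) ^ ((ε : ℤ) + 1) else 0) -
        (resCard F : ℂ) ^ (ε : ℤ)),
    Finset.sum_sub_distrib, ← Finset.sum_filter, Finset.sum_const, Finset.sum_const,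
    hU.leg_eq_quadraticChar hκ]
  have h3 := quadraticChar_card_sqrts hU.ringChar_residueField_ne_two (red κ)
  have h4 : ({x | x ^ 2 = red κ} : Set (IsLocalRing.ResidueField (ringInt F))).toFinset =
      Finset.univ.filter fun b => b ^ 2 = red κ := by
    ext b; simp
  rw [h4] at h3
  have h5 : ((Finset.univ.filter fun b => b ^ 2 = red κ).card : ℂ) =
      (quadraticChar (IsLocalRing.ResidueField (ringInt F)) (red κ) : ℂ) + 1 := by
    exact_mod_cast congrArg (Int.cast : ℤ → ℂ) h3
  have hcard : ((Finset.univ : Finset (IsLocalRing.ResidueField (ringInt F))).card : ℂ) =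
      resCard F := by
    rw [Finset.card_univ, resCard, Nat.card_eq_fintype_card]
  rw [nsmul_eq_mul, nsmul_eq_mul, h5, hcard, zpow_add₀ hqC, zpow_one]
  field_simp
  ring

end

end IsOddUniformizer

end WeilIndex

/-! ## The character of the torus -/

section Torus

variable {F : Type*} [NontriviallyNormedField F] [IsUltrametricDist F] [ProperSpace F]
  [MeasurableSpace F] [BorelSpace F]

/-- The value `|a| μ(a) γ_F(a, ψ)⁻¹` by which `t(a)` acts from the left on the principal series. -/
noncomputable def torusChar (ψ : AddChar F ℂ) (μ : Fˣ →* ℂˣ) (a : F) : ℂ :=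
  ((‖a‖ : ℝ) : ℂ) * mulExt μ a * (weilRatio a ψ)⁻¹

/-- A sign as a complex number. -/
def sgnC (x : ℤˣ) : ℂ := ((x : ℤ) : ℂ)

lemma sgnC_mul (x y : ℤˣ) : sgnC (x * y) = sgnC x * sgnC y := by simp [sgnC]

lemma sgnC_one : sgnC 1 = 1 := by simp [sgnC]

lemma sgnC_mul_self (x : ℤˣ) : sgnC x * sgnC x = 1 := by
  rw [← sgnC_mul, Int.units_mul_self, sgnC_one]

lemma sgnC_ne_zero (x : ℤˣ) : sgnC x ≠ 0 := fun h => by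
  have := sgnC_mul_self x
  rw [h] at this
  simp at this

lemma sgnC_inv (x : ℤˣ) : (sgnC x)⁻¹ = sgnC x := inv_eq_of_mul_eq_one_left (sgnC_mul_self x)

/-- The standing hypotheses. -/
structure IsDatum (ϖ : F) (ε : ℕ) (ψ : AddChar F ℂ) (μ : Fˣ →* ℂˣ) (η : unitsInt F →* ℂˣ) :
    Prop where
  unif : IsOddUniformizer ϖ
  cont_ψ : Continuous ψ
  ψ_ne : ψ ≠ 1
  cond : addCond ψ = -(ε : ℤ)
  cont_μ : Continuous μ
  cont_η : Continuous η
  agree : unitExt η (-1) = mulExt μ (-1)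

lemma units_zpow (x : ℤˣ) (n : ℤ) : x ^ n = if Even n then 1 else x := by
  split_ifs with h
  · obtain ⟨k, rfl⟩ := h
    rw [zpow_add, Int.units_mul_self]
  · obtain ⟨k, rfl⟩ := Int.not_even_iff_odd.1 h
    rw [zpow_add, zpow_one, two_mul, zpow_add, Int.units_mul_self, one_mul]

namespace IsDatum

variable {ϖ : F} {ε : ℕ} {ψ : AddChar F ℂ} {μ : Fˣ →* ℂˣ} {η : unitsInt F →* ℂˣ}
  (hD : IsDatum ϖ ε ψ μ η)

include hD

lemma exists_weilRatio_eq : ∃ g : ℂ, g * g = sgnC (leg ϖ (-1 : F)) ∧ g ≠ 0 ∧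
    ∀ a : F, a ≠ 0 → weilRatio a ψ =
      (if Even ((ε : ℤ) + ord a) then 1 else sgnC (leg ϖ a) * g) /
        (if Even (ε : ℤ) then 1 else g) := by
  obtain ⟨g, hg, h⟩ := hD.unif.exists_weilIndex_eq hD.cont_ψ hD.ψ_ne hD.cond
  have hg' : g * g = sgnC (leg ϖ (-1 : F)) := by rw [← sq, hg]; rfl
  refine ⟨g, hg', fun h0 => ?_, fun a ha => ?_⟩
  · rw [h0, zero_mul] at hg'
    exact sgnC_ne_zero _ hg'.symm
  · have h1 := h 1 one_ne_zero
    rw [AddChar.mulShift_one, hD.unif.ord_of_norm_one norm_one, hD.unif.leg_one, add_zero] at h1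
    rw [weilRatio, h a ha, h1]
    simp [sgnC]

lemma weilRatio_ne_zero {a : F} (ha : a ≠ 0) : weilRatio a ψ ≠ 0 := by
  obtain ⟨g, -, hg0, h⟩ := hD.exists_weilRatio_eq
  rw [h a ha]
  have := sgnC_ne_zero (leg ϖ a)
  split_ifs <;> simp [*]

/-- Each Weil index is 1 or a sign times g according to the parity of ε + ord. The eight parity
cases of ε, ord a, ord b reproduce the tame formula, with g² = `leg ϖ (-1)` accounting for its first
factor. -/
lemma weilRatio_mul {a b : F} (ha : a ≠ 0) (hb : b ≠ 0) :
    weilRatio (a * b) ψ = weilRatio a ψ * weilRatio b ψ * sgnC (hilbert a b) := by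
  obtain ⟨g, hg, hg0, h⟩ := hD.exists_weilRatio_eq
  have hab := mul_ne_zero ha hb
  have hla := sgnC_mul_self (leg ϖ a)
  have hlb := sgnC_mul_self (leg ϖ b)
  have hl1 := sgnC_mul_self (leg ϖ (-1 : F))
  rw [h a ha, h b hb, h _ hab, hD.unif.ord_mul ha hb, hD.unif.leg_mul ha hb,
    hD.unif.hilbert_eq ha hb, sgnC_mul]
  by_cases he : Even (ε : ℤ) <;> by_cases hoa : Even (ord a) <;> by_cases hob : Even (ord b) <;>
    simp only [he, hoa, hob, Int.even_add, Int.even_mul, units_zpow, if_true, if_false, true_or,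
      or_true, or_false, sgnC_mul, sgnC_one, iff_true, iff_false, not_true, not_false_iff]
  all_goals
    generalize sgnC (leg ϖ a) = x at *
    generalize sgnC (leg ϖ b) = y at *
    generalize sgnC (leg ϖ (-1 : F)) = z at *
    clear h
    grind

/-- This sign is also the one carried by the lift of t(u) to the splitting over K_0. The two cancel,
so that t(u) acts through μ(u) alone. -/
lemma weilRatio_unit {u : F} (hu : ‖u‖ = 1) :
    weilRatio u ψ = sgnC (hilbert (ϖ ^ ε) u) := by
  obtain ⟨g, -, hg0, h⟩ := hD.exists_weilRatio_eq
  have hu0 := ne_zero_of_norm_one hu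
  have e1 : ord (ϖ ^ ε) = ε := by rw [← zpow_natCast, hD.unif.ord_zpow]
  rw [h u hu0, hD.unif.hilbert_eq (pow_ne_zero _ hD.unif.ne_zero) hu0,
    hD.unif.ord_of_norm_one hu, e1, mul_zero, zpow_zero, zpow_zero, one_mul, one_mul, add_zero,
    units_zpow]
  split_ifs
  · simp [sgnC_one]
  · field_simp

lemma torusChar_ne_zero {a : F} (ha : a ≠ 0) : torusChar ψ μ a ≠ 0 := by
  refine mul_ne_zero (mul_ne_zero ?_ (mulExt_ne_zero μ ha)) (inv_ne_zero (hD.weilRatio_ne_zero ha))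
  exact_mod_cast norm_ne_zero_iff.2 ha

lemma torusChar_mul {a b : F} (ha : a ≠ 0) (hb : b ≠ 0) :
    torusChar ψ μ (a * b) = torusChar ψ μ a * torusChar ψ μ b * sgnC (hilbert a b) := by
  rw [torusChar, torusChar, torusChar, hD.weilRatio_mul ha hb, norm_mul, mulExt_mul, mul_inv,
    mul_inv, sgnC_inv]
  push_cast
  ring

lemma torusChar_unit {u : F} (hu : ‖u‖ = 1) :
    torusChar ψ μ u = mulExt μ u * sgnC (hilbert (ϖ ^ ε) u) := by
  rw [torusChar, hD.weilRatio_unit hu, sgnC_inv, hu]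
  simp

lemma torusChar_one : torusChar ψ μ 1 = 1 := by
  rw [hD.torusChar_unit norm_one, mulExt_one, hilbert_one_right, sgnC_one, one_mul]

lemma torusChar_inv_unit {u : F} (hu : ‖u‖ = 1) :
    torusChar ψ μ u⁻¹ = (mulExt μ u)⁻¹ * sgnC (hilbert (ϖ ^ ε) u) := by
  rw [hD.torusChar_unit (by rw [norm_inv, hu, inv_one]), mulExt_inv,
    IsOddUniformizer.hilbert_inv_right (ne_zero_of_norm_one hu)]

/-- Principal units are squares, so both the Weil factor of s and the symbol (a, s) are trivial. -/
lemma torusChar_mul_of_sub_one_lt {a s : F} (ha : a ≠ 0) (hs : ‖s - 1‖ < 1) :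
    torusChar ψ μ (a * s) = torusChar ψ μ a * mulExt μ s := by
  have hs1 := norm_eq_one_of_sub_one_lt hs
  rw [hD.torusChar_mul ha (ne_zero_of_norm_one hs1), hD.torusChar_unit hs1, hilbert_comm a,
    hilbert_comm _ s, hD.unif.hilbert_of_sub_one_lt hs, hD.unif.hilbert_of_sub_one_lt hs, sgnC_one,
    mul_one, mul_one]

lemma torusChar_mul_sq {a u : F} (ha : a ≠ 0) (hu : ‖u‖ = 1) :
    torusChar ψ μ (a * u ^ 2) = torusChar ψ μ a * mulExt μ u ^ 2 := by
  have hu0 := ne_zero_of_norm_one hu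
  have hu2 : ‖u ^ 2‖ = 1 := by rw [norm_pow, hu, one_pow]
  rw [hD.torusChar_mul ha (pow_ne_zero 2 hu0), hD.torusChar_unit hu2,
    hilbert_comm a, hilbert_comm _ (u ^ 2), hilbert_sq_left, hilbert_sq_left, sgnC_one, mul_one,
    mul_one, sq, sq, mulExt_mul]

end IsDatum

end Torus

/-! ## Genuine functions on the metaplectic group -/

section Genuine

variable {F : Type*} [NontriviallyNormedField F] [IsUltrametricDist F] [ProperSpace F]
  [MeasurableSpace F] [BorelSpace F]

/-- A matrix with lower row `(1, y)`. -/
def rOp {F : Type*} [Field F] (y : F) : SL(2, F) := ⟨!![0, -1; 1, y], by simp⟩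

@[simp] lemma rOp_00 (y : F) : (rOp y).1 0 0 = 0 := rfl
@[simp] lemma rOp_01 (y : F) : (rOp y).1 0 1 = -1 := rfl
@[simp] lemma rOp_10 (y : F) : (rOp y).1 1 0 = 1 := rfl
@[simp] lemma rOp_11 (y : F) : (rOp y).1 1 1 = y := rfl

lemma kubotaX_rOp (y : F) : kubotaX (rOp y) = 1 := by
  rw [kubotaX_eq, rOp_10, rowX_of_ne _ one_ne_zero]

lemma rOp_mul_nMat (y b : F) : rOp y * nMat b = rOp (y + b) := by
  apply sl2_ext <;> simp [mul_entry, add_comm]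

/-- The transformation law of the principal series. -/
def IsGenuine (ψ : AddChar F ℂ) (μ : Fˣ →* ℂˣ) (f : Mp F → ℂ) : Prop :=
  ∀ (a : Fˣ) (e : ℤˣ) (b : F) (g : Mp F),
    f ((⟨tMat a, e⟩ : Mp F) * ⟨nMat b, 1⟩ * g) =
      ((‖(a : F)‖ : ℝ) : ℂ) * (μ a : ℂ) * chiPsi ψ a e * f g

lemma mem_principalSeries {ψ : AddChar F ℂ} {μ : Fˣ →* ℂˣ} {f : Mp F → ℂ} :
    f ∈ principalSeries ψ μ ↔ IsLocallyConstant f ∧ IsGenuine ψ μ f := Iff.rfl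

lemma isLocallyConstant_mp_iff {f : Mp F → ℂ} : IsLocallyConstant f ↔
    ∀ x, ∀ᶠ k in 𝓝 (1 : SL(2, F)), f (x * (⟨k, 1⟩ : Mp F)) = f x := by
  constructor
  · intro h x
    exact (h {f x}) x rfl
  · intro h S g hg
    filter_upwards [h g] with k hk
    show f _ ∈ S
    rw [hk]
    exact hg

lemma tMat_mul_nMat_mp (a : Fˣ) (b : F) (e : ℤˣ) :
    (⟨tMat a, e⟩ : Mp F) * ⟨nMat b, 1⟩ = ⟨tMat a * nMat b, e⟩ := by
  apply Mp.ext
  · rw [Mp.mul_mat]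
  · rw [Mp.mul_sgn, kubota_mul_nMat, mul_one, mul_one]

/-- Elements with proportional lower rows differ by an element of the Borel subgroup. -/
lemma exists_borel_mul {g h : SL(2, F)} (a : Fˣ) (h10 : h.1 1 0 = (a : F)⁻¹ * g.1 1 0)
    (h11 : h.1 1 1 = (a : F)⁻¹ * g.1 1 1) : ∃ b : F, h = tMat a * nMat b * g := by
  have e : (tMat a⁻¹ * h) = nMat _ * g := eq_nMat_mul_of_row
    (by rw [mul_entry]; simp [h10]) (by rw [mul_entry]; simp [h11])
  exact ⟨_, by rw [mul_assoc, ← e, ← mul_assoc, tMat_mul, mul_inv_cancel, tMat_one, one_mul]⟩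

lemma exists_borel_mul_mp {g h : SL(2, F)} (a : Fˣ) (h10 : h.1 1 0 = (a : F)⁻¹ * g.1 1 0)
    (h11 : h.1 1 1 = (a : F)⁻¹ * g.1 1 1) (s : ℤˣ) : ∃ (b : F) (e : ℤˣ),
      (⟨h, s⟩ : Mp F) = (⟨tMat a, e⟩ : Mp F) * ⟨nMat b, 1⟩ * ⟨g, 1⟩ := by
  obtain ⟨b, hb⟩ := exists_borel_mul a h10 h11
  refine ⟨b, s * kubota (tMat a * nMat b) g, ?_⟩
  rw [tMat_mul_nMat_mp]
  apply Mp.ext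
  · rw [Mp.mul_mat, hb]
  · rw [Mp.mul_sgn, mul_one, mul_assoc, Int.units_mul_self, mul_one]

/-- Every element is, up to the Borel subgroup, one of the matrices `rOp y` or the identity. -/
lemma exists_rOp_or_one (x : Mp F) :
    (∃ (a : Fˣ) (b : F) (e : ℤˣ) (y : F), x = (⟨tMat a, e⟩ : Mp F) * ⟨nMat b, 1⟩ * ⟨rOp y, 1⟩) ∨
    ∃ (a : Fˣ) (b : F) (e : ℤˣ), x = (⟨tMat a, e⟩ : Mp F) * ⟨nMat b, 1⟩ * ⟨1, 1⟩ := by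
  obtain ⟨g, s⟩ := x
  by_cases hc : g.1 1 0 = 0
  · right
    have hd := det_entries g
    rw [hc, mul_zero, sub_zero] at hd
    have hd0 : g.1 1 1 ≠ 0 := right_ne_zero_of_mul_eq_one hd
    obtain ⟨b, e, h⟩ := exists_borel_mul_mp (g := 1) (h := g) (Units.mk0 _ hd0)⁻¹
      (by simp [hc]) (by simp) s
    exact ⟨_, b, e, h⟩
  · left
    obtain ⟨b, e, h⟩ := exists_borel_mul_mp (g := rOp (g.1 1 1 / g.1 1 0)) (h := g)
      (Units.mk0 _ hc)⁻¹ (by simp) (by simp; field_simp) s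
    exact ⟨_, b, e, _, h⟩

lemma exists_nOp_or_rOp (x : Mp F) :
    (∃ (a : Fˣ) (b : F) (e : ℤˣ) (y : F), x = (⟨tMat a, e⟩ : Mp F) * ⟨nMat b, 1⟩ * ⟨nOp y, 1⟩) ∨
    ∃ (a : Fˣ) (b : F) (e : ℤˣ), x = (⟨tMat a, e⟩ : Mp F) * ⟨nMat b, 1⟩ * ⟨rOp 0, 1⟩ := by
  obtain ⟨g, s⟩ := x
  by_cases hd0 : g.1 1 1 = 0
  · right
    have hd := det_entries g
    rw [hd0, mul_zero, zero_sub, ← neg_mul] at hd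
    have hc0 : g.1 1 0 ≠ 0 := right_ne_zero_of_mul_eq_one hd
    obtain ⟨b, e, h⟩ := exists_borel_mul_mp (g := rOp 0) (h := g) (Units.mk0 _ hc0)⁻¹
      (by simp) (by simp [hd0]) s
    exact ⟨_, b, e, h⟩
  · left
    obtain ⟨b, e, h⟩ := exists_borel_mul_mp (g := nOp (g.1 1 0 / g.1 1 1)) (h := g)
      (Units.mk0 _ hd0)⁻¹ (by simp; field_simp) (by simp) s
    exact ⟨_, b, e, _, h⟩

namespace IsDatum

variable {ϖ : F} {ε : ℕ} {ψ : AddChar F ℂ} {μ : Fˣ →* ℂˣ} {η : unitsInt F →* ℂˣ}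
  (hD : IsDatum ϖ ε ψ μ η)

include hD

lemma coeff_eq (a : Fˣ) (e : ℤˣ) : ((‖(a : F)‖ : ℝ) : ℂ) * (μ a : ℂ) * chiPsi ψ a e =
    sgnC e * torusChar ψ μ a := by
  rw [chiPsi, torusChar, mulExt_coe, sgnC]; ring

/-- The left product by a Borel element, written out: the only cocycle contribution is (x(g), a),
since unipotent factors contribute nothing. -/
lemma isGenuine_iff {f : Mp F → ℂ} : IsGenuine ψ μ f ↔
    ∀ (a : Fˣ) (e s : ℤˣ) (b : F) (g : SL(2, F)),
      f ⟨tMat a * nMat b * g, e * s * hilbert (kubotaX g) a⟩ =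
        sgnC e * torusChar ψ μ a * f ⟨g, s⟩ := by
  have key : ∀ (a : Fˣ) (e s : ℤˣ) (b : F) (g : SL(2, F)),
      (⟨tMat a, e⟩ : Mp F) * ⟨nMat b, 1⟩ * ⟨g, s⟩ =
        ⟨tMat a * nMat b * g, e * s * hilbert (kubotaX g) a⟩ := by
    intro a e s b g
    rw [hD.unif.mp_mul_assoc]
    apply Mp.ext
    · rw [Mp.mul_mat, Mp.mul_mat, mul_assoc]
    · rw [Mp.mul_sgn, Mp.mul_sgn, Mp.mul_mat, kubota_nMat_mul, hD.unif.kubota_tMat_mul,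
        kubotaX_nMat_mul, one_mul, mul_one]
  constructor
  · intro h a e s b g
    rw [← key, h, hD.coeff_eq]
  · intro h a e b g
    obtain ⟨g, s⟩ := g
    rw [key, h, hD.coeff_eq]

section

variable {f : Mp F → ℂ} (hf : IsGenuine ψ μ f)

include hf

lemma genuine_sgn (g : SL(2, F)) (s : ℤˣ) : f ⟨g, s⟩ = sgnC s * f ⟨g, 1⟩ := by
  have h := hD.isGenuine_iff.1 hf 1 s 1 0 g
  rw [tMat_one, nMat_zero, one_mul, one_mul, Units.val_one, hilbert_one_right, mul_one, mul_one,
    hD.torusChar_one, mul_one] at h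
  exact h

lemma genuine_borel (a : Fˣ) (b : F) (g : SL(2, F)) : f ⟨tMat a * nMat b * g, 1⟩ =
    sgnC (hilbert (kubotaX g) a) * torusChar ψ μ a * f ⟨g, 1⟩ := by
  have h := hD.isGenuine_iff.1 hf a (hilbert (kubotaX g) a) 1 b g
  rwa [mul_one, Int.units_mul_self] at h

lemma genuine_of_row {g h : SL(2, F)} {a : F} (ha : a ≠ 0) (h10 : h.1 1 0 = a⁻¹ * g.1 1 0)
    (h11 : h.1 1 1 = a⁻¹ * g.1 1 1) :
    f ⟨h, 1⟩ = sgnC (hilbert (kubotaX g) a) * torusChar ψ μ a * f ⟨g, 1⟩ := by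
  obtain ⟨b, hb⟩ := exists_borel_mul (Units.mk0 a ha) h10 h11
  rw [hb, hD.genuine_borel hf]
  rfl

lemma genuine_of_ne {h : SL(2, F)} (hc : h.1 1 0 ≠ 0) :
    f ⟨h, 1⟩ = torusChar ψ μ (h.1 1 0)⁻¹ * f ⟨rOp (h.1 1 1 / h.1 1 0), 1⟩ := by
  rw [hD.genuine_of_row hf (g := rOp (h.1 1 1 / h.1 1 0)) (inv_ne_zero hc) (by simp)
    (by simp; field_simp), kubotaX_rOp, hilbert_one_left, sgnC_one, one_mul]

lemma genuine_of_eq {h : SL(2, F)} (hc : h.1 1 0 = 0) :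
    f ⟨h, 1⟩ = torusChar ψ μ (h.1 1 1)⁻¹ * f ⟨1, 1⟩ := by
  have hd := det_entries h
  rw [hc, mul_zero, sub_zero] at hd
  rw [hD.genuine_of_row hf (g := 1) (inv_ne_zero (right_ne_zero_of_mul_eq_one hd)) (by simp [hc])
    (by simp), kubotaX_one, hilbert_one_left, sgnC_one, one_mul]

/-- The two families of values are related by `t ↦ 1 / t`. -/
lemma genuine_nOp {t : F} (ht : t ≠ 0) :
    f ⟨nOp t, 1⟩ = torusChar ψ μ t⁻¹ * f ⟨rOp t⁻¹, 1⟩ := by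
  rw [hD.genuine_of_ne hf (h := nOp t) (by simpa using ht)]
  simp

lemma genuine_rOp {y : F} (hy : y ≠ 0) :
    f ⟨rOp y, 1⟩ = (torusChar ψ μ y)⁻¹ * f ⟨nOp y⁻¹, 1⟩ := by
  rw [hD.genuine_nOp hf (inv_ne_zero hy), inv_inv,
    inv_mul_cancel_left₀ (hD.torusChar_ne_zero hy)]

lemma genuine_wMat_nMat (y : F) :
    f ⟨wMat * nMat y, 1⟩ = torusChar ψ μ (-1) * f ⟨rOp y, 1⟩ := by
  rw [hD.genuine_of_ne hf (by simp [mul_entry])]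
  simp [mul_entry, inv_neg]

lemma genuine_eq_zero (h0 : f ⟨1, 1⟩ = 0) (h1 : ∀ y, f ⟨rOp y, 1⟩ = 0) : f = 0 := by
  funext x
  obtain ⟨a, b, e, y, rfl⟩ | ⟨a, b, e, rfl⟩ := exists_rOp_or_one x
  · rw [hf, h1, mul_zero]; rfl
  · rw [hf, h0, mul_zero]; rfl

/-- Equivariance under right translation by `k` need only be checked modulo the Borel subgroup. -/
lemma genuine_right_of_rOp {k : Mp F} {c : ℂ} (h0 : f (⟨1, 1⟩ * k) = c * f ⟨1, 1⟩)
    (h1 : ∀ y, f (⟨rOp y, 1⟩ * k) = c * f ⟨rOp y, 1⟩) (x : Mp F) : f (x * k) = c * f x := by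
  obtain ⟨a, b, e, y, rfl⟩ | ⟨a, b, e, rfl⟩ := exists_rOp_or_one x
  · rw [hD.unif.mp_mul_assoc, hf, hf, h1]; ring
  · rw [hD.unif.mp_mul_assoc, hf, hf, h0]; ring

lemma genuine_right_of_nOp {k : Mp F} {c : ℂ} (h0 : f (⟨rOp 0, 1⟩ * k) = c * f ⟨rOp 0, 1⟩)
    (h1 : ∀ y, f (⟨nOp y, 1⟩ * k) = c * f ⟨nOp y, 1⟩) (x : Mp F) : f (x * k) = c * f x := by
  obtain ⟨a, b, e, y, rfl⟩ | ⟨a, b, e, rfl⟩ := exists_nOp_or_rOp x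
  · rw [hD.unif.mp_mul_assoc, hf, hf, h1]; ring
  · rw [hD.unif.mp_mul_assoc, hf, hf, h0]; ring

end

end IsDatum

open Classical in
/-- The dependence of a genuine function on the lower row. -/
noncomputable def genuineRow (ψ : AddChar F ℂ) (μ : Fˣ →* ℂˣ) (φ : F → ℂ) (z : ℂ) (c d : F) : ℂ :=
  if c ≠ 0 then torusChar ψ μ c⁻¹ * φ (d / c) else torusChar ψ μ d⁻¹ * z

/-- The genuine function with prescribed values at the matrices `rOp y` and at the identity. -/
noncomputable def genuineFun (ψ : AddChar F ℂ) (μ : Fˣ →* ℂˣ) (φ : F → ℂ) (z : ℂ) (x : Mp F) : ℂ :=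
  sgnC x.sgn * genuineRow ψ μ φ z (x.mat.1 1 0) (x.mat.1 1 1)

namespace IsDatum

variable {ϖ : F} {ε : ℕ} {ψ : AddChar F ℂ} {μ : Fˣ →* ℂˣ} {η : unitsInt F →* ℂˣ}
  (hD : IsDatum ϖ ε ψ μ η)

include hD

lemma genuineFun_rOp (φ : F → ℂ) (z : ℂ) (y : F) : genuineFun ψ μ φ z ⟨rOp y, 1⟩ = φ y := by
  simp [genuineFun, genuineRow, sgnC_one, hD.torusChar_one]

lemma genuineFun_one (φ : F → ℂ) (z : ℂ) : genuineFun ψ μ φ z ⟨1, 1⟩ = z := by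
  simp [genuineFun, genuineRow, sgnC_one, hD.torusChar_one]

/-- The cocycle factor (x(g), a) is exactly the failure of `torusChar` to be multiplicative, so
arbitrary values at the representatives extend. -/
lemma isGenuine_genuineFun (φ : F → ℂ) (z : ℂ) : IsGenuine ψ μ (genuineFun ψ μ φ z) := by
  rw [hD.isGenuine_iff]
  intro a e s b g
  have h10 : (tMat a * nMat b * g).1 1 0 = (a : F)⁻¹ * g.1 1 0 := by simp [mul_entry]
  have h11 : (tMat a * nMat b * g).1 1 1 = (a : F)⁻¹ * g.1 1 1 := by simp [mul_entry]
  have ha : (a : F) ≠ 0 := a.ne_zero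
  have ha' : (a : F)⁻¹ ≠ 0 := inv_ne_zero ha
  simp only [genuineFun, h10, h11, sgnC_mul]
  by_cases hc : g.1 1 0 = 0
  · have hd := det_entries g
    rw [hc, mul_zero, sub_zero] at hd
    have hd0 := right_ne_zero_of_mul_eq_one hd
    rw [genuineRow, genuineRow, if_neg (by simp [hc]), if_neg (by simp [hc]), kubotaX_eq, hc, rowX_zero, mul_inv, inv_inv,
      hD.torusChar_mul ha (inv_ne_zero hd0), IsOddUniformizer.hilbert_inv_right hd0,
      hilbert_comm (g.1 1 1)]
    linear_combination sgnC e * sgnC s * torusChar ψ μ a * torusChar ψ μ (g.1 1 1)⁻¹ * z *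
      sgnC_mul_self (hilbert (a : F) (g.1 1 1))
  · rw [genuineRow, genuineRow, if_pos (mul_ne_zero ha' hc), if_pos hc, kubotaX_eq, rowX_of_ne _ hc, mul_inv, inv_inv,
      hD.torusChar_mul ha (inv_ne_zero hc), IsOddUniformizer.hilbert_inv_right hc,
      hilbert_comm (g.1 1 0), mul_div_mul_left _ _ ha']
    linear_combination sgnC e * sgnC s * torusChar ψ μ a * torusChar ψ μ (g.1 1 0)⁻¹ *
      φ (g.1 1 1 / g.1 1 0) * sgnC_mul_self (hilbert (a : F) (g.1 1 0))

end IsDatum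

end Genuine

/-! ## Equivariant vectors in terms of their values at representatives -/

section Level

variable {F : Type*} [NontriviallyNormedField F] [IsUltrametricDist F] [ProperSpace F]
  [MeasurableSpace F] [BorelSpace F]

lemma continuous_entry (i j : Fin 2) : Continuous fun k : SL(2, F) => k.1 i j :=
  (continuous_apply j).comp ((continuous_apply i).comp continuous_subtype_val)

/-- Equivariance under `K_m` and genuineness, expressed by the values at `rOp y`, `nOp t` and
`1`. -/
structure IsLevel (ψ : AddChar F ℂ) (μ : Fˣ →* ℂˣ) (η : unitsInt F →* ℂˣ) (ε m : ℕ)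
    (f : Mp F → ℂ) : Prop where
  genuine : IsGenuine ψ μ f
  add : ∀ b : F, ‖b‖ ≤ (resCard F : ℝ) ^ (ε : ℤ) → ∀ y, f ⟨rOp (y + b), 1⟩ = f ⟨rOp y, 1⟩
  sq : ∀ u : F, ‖u‖ = 1 → ∀ y,
    f ⟨rOp (u ^ 2 * y), 1⟩ = unitExt (η * (resUnits μ)⁻¹) u * f ⟨rOp y, 1⟩
  one : ∀ u : F, ‖u‖ = 1 → unitExt (η * resUnits μ) u * f ⟨1, 1⟩ = f ⟨1, 1⟩
  op : ∀ z : F, ‖z‖ ≤ (resCard F : ℝ) ^ (-((m : ℤ) + ε)) → ∀ t,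
    f ⟨nOp (t + z), 1⟩ = f ⟨nOp t, 1⟩

namespace IsOddUniformizer

variable {ϖ : F} (hU : IsOddUniformizer ϖ)

include hU

lemma liftK_nMat {ε : ℕ} {b : F} (hb : ‖b‖ ≤ (resCard F : ℝ) ^ (ε : ℤ)) :
    liftK ε (nMat b) = ⟨nMat b, 1⟩ := by
  rw [liftK, hU.splitting_eq (hU.nMat_mem_levelSet hb)]
  simp [splitVal_zero, hilbert_one_right]

lemma liftK_tMat {ε : ℕ} {a : Fˣ} (ha : ‖(a : F)‖ = 1) :
    liftK ε (tMat a) = ⟨tMat a, hilbert (ϖ ^ ε) (a : F)⟩ := by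
  rw [liftK, hU.splitting_eq (hU.tMat_mem_levelSet ha)]
  simp [splitVal_zero, hilbert_inv_right]

lemma liftK_nOp {ε m : ℕ} {c : F} (hc : ‖c‖ ≤ (resCard F : ℝ) ^ (-((m : ℤ) + ε))) :
    liftK ε (nOp c) = ⟨nOp c, 1⟩ := by
  have hle : ‖c‖ ≤ ‖ϖ ^ ε‖ := by
    rw [hU.norm_pow_eq]
    exact hc.trans (hU.zpow_le.2 (by omega))
  rw [liftK, hU.splitting_eq (hU.levelSet_antitone (Nat.zero_le m) (hU.nOp_mem_levelSet hc))]
  congr 1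
  show splitVal _ c 1 = 1
  by_cases h0 : c = 0
  · rw [h0, splitVal_zero, hilbert_one_right]
  · obtain h | h := hle.lt_or_eq
    · rw [splitVal_of_lt _ h0 h, hilbert_one_right]
    · exact splitVal_of_eq _ (pow_ne_zero _ hU.ne_zero) h

/-- Close to the identity d is a principal unit, so the splitting is trivial and η(d) = 1. This is
what makes equivariant functions locally constant for the metaplectic topology. -/
lemma eventually_liftK (η : unitsInt F →* ℂˣ) (hη : Continuous η) (ε m : ℕ) :
    ∀ᶠ k in 𝓝 (1 : SL(2, F)), k ∈ levelSet F ε m ∧ liftK ε k = ⟨k, 1⟩ ∧ etaK η k = 1 := by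
  obtain ⟨n, hn, hη1⟩ := hU.exists_unitExt_eq_one hη
  have h00 := Metric.tendsto_nhds.1 ((continuous_entry (F := F) 0 0).tendsto 1) 1 one_pos
  have h11 := Metric.tendsto_nhds.1 ((continuous_entry (F := F) 1 1).tendsto 1)
    ((resCard F : ℝ) ^ (-(n : ℤ))) (zpow_pos hU.card_pos _)
  have h01 := Metric.tendsto_nhds.1 ((continuous_entry (F := F) 0 1).tendsto 1) 1 one_pos
  have h10 := Metric.tendsto_nhds.1 ((continuous_entry (F := F) 1 0).tendsto 1)
    ((resCard F : ℝ) ^ (-((m : ℤ) + ε))) (zpow_pos hU.card_pos _)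
  filter_upwards [h00, h11, h01, h10] with k k00 k11 k01 k10
  rw [dist_eq_norm] at k00 k11 k01 k10
  simp only [one_00, one_11, one_01, one_10, sub_zero] at k00 k11 k01 k10
  have k11' : ‖k.1 1 1 - 1‖ < 1 := k11.trans_le (by
    rw [← zpow_zero (resCard F : ℝ), hU.zpow_le]; omega)
  have hd := norm_eq_one_of_sub_one_lt k11'
  have hmem : k ∈ levelSet F ε m := by
    refine mem_levelSet.2 ⟨(norm_eq_one_of_sub_one_lt k00).le, hd.le, k01.le.trans ?_, k10.le⟩
    rw [← zpow_zero (resCard F : ℝ), hU.zpow_le]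
    omega
  refine ⟨hmem, ?_, ?_⟩
  · rw [liftK, hU.splitting_eq (hU.levelSet_antitone (Nat.zero_le m) hmem)]
    congr 1
    by_cases h0 : k.1 1 0 = 0
    · rw [h0, splitVal_zero, hilbert_comm, hU.hilbert_of_sub_one_lt k11']
    · rw [splitVal_of_lt _ h0, hilbert_comm, hU.hilbert_of_sub_one_lt k11']
      rw [hU.norm_pow_eq]
      exact k10.trans_le (hU.zpow_le.2 (by omega))
  · rw [etaK_eq η hd, hη1 _ k11.le]

end IsOddUniformizer

namespace IsDatum

variable {ϖ : F} {ε : ℕ} {ψ : AddChar F ℂ} {μ : Fˣ →* ℂˣ} {η : unitsInt F →* ℂˣ}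
  (hD : IsDatum ϖ ε ψ μ η)

include hD

lemma eqSpace_of_lt {m : ℕ} (hm : m < unitCond η) : eqSpace ψ μ η ε m = ⊥ := by
  rw [eqSpace, if_neg (by omega)]

lemma mem_eqSpace {m : ℕ} (hm : unitCond η ≤ m) {f : Mp F → ℂ} : f ∈ eqSpace ψ μ η ε m ↔
    f ∈ principalSeries ψ μ ∧
      ∀ k ∈ levelSet F ε m, ∀ x : Mp F, f (x * liftK ε k) = etaK η k * f x := by
  rw [eqSpace, if_pos hm]; rfl

lemma alpha_eq {u : F} (hu : ‖u‖ = 1) :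
    unitExt (η * (resUnits μ)⁻¹) u = unitExt η u * (mulExt μ u)⁻¹ := by
  rw [mul_unitExt _ _ hu, inv_unitExt _ hu, unitExt_resUnits μ hu]

lemma beta_eq {u : F} (hu : ‖u‖ = 1) :
    unitExt (η * resUnits μ) u = unitExt η u * mulExt μ u := by
  rw [mul_unitExt _ _ hu, unitExt_resUnits μ hu]

section Translates

variable {f : Mp F → ℂ} (hf : IsGenuine ψ μ f)

include hf

lemma translate_nMat_iff (b : F) : (∀ x, f (x * (⟨nMat b, 1⟩ : Mp F)) = f x) ↔
    ∀ y, f ⟨rOp (y + b), 1⟩ = f ⟨rOp y, 1⟩ := by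
  have key : ∀ y, (⟨rOp y, 1⟩ : Mp F) * ⟨nMat b, 1⟩ = ⟨rOp (y + b), 1⟩ := by
    intro y
    apply Mp.ext
    · rw [Mp.mul_mat, rOp_mul_nMat]
    · rw [Mp.mul_sgn, kubota_mul_nMat, mul_one, mul_one]
  constructor
  · intro h y
    rw [← key, h]
  · intro h x
    have := hD.genuine_right_of_rOp hf (k := ⟨nMat b, 1⟩) (c := 1) ?_ (fun y => by
      rw [key, h, one_mul]) x
    · rw [this, one_mul]
    · have e : (⟨1, 1⟩ : Mp F) * ⟨nMat b, 1⟩ = ⟨nMat b, 1⟩ := by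
        apply Mp.ext
        · rw [Mp.mul_mat, one_mul]
        · rw [Mp.mul_sgn, kubota_mul_nMat, mul_one, mul_one]
      rw [e, hD.genuine_of_eq hf (h := nMat b) (by simp)]
      simp [hD.torusChar_one]

/-- The section is multiplicative on lower unipotents: the cocycle is (t/(t+z), z/(t+z)), whose
arguments add up to 1. At the remaining point `rOp 0` the translation changes nothing modulo the
Borel subgroup. -/
lemma translate_nOp_iff (z : F) : (∀ x, f (x * (⟨nOp z, 1⟩ : Mp F)) = f x) ↔
    ∀ t, f ⟨nOp (t + z), 1⟩ = f ⟨nOp t, 1⟩ := by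
  have key : ∀ t, (⟨nOp t, 1⟩ : Mp F) * ⟨nOp z, 1⟩ = ⟨nOp (t + z), 1⟩ := by
    intro t
    apply Mp.ext
    · rw [Mp.mul_mat, nOp_mul]
    · rw [Mp.mul_sgn, one_mul, one_mul, kubota, nOp_mul]
      by_cases ht : t = 0
      · rw [ht, zero_add, nOp_zero, kubotaX_one, div_self (kubotaX_ne_zero _), hilbert_one_right]
      by_cases hz : z = 0
      · rw [hz, add_zero, nOp_zero, kubotaX_one, div_self (kubotaX_ne_zero _), hilbert_one_left]
      have e : ∀ s : F, s ≠ 0 → kubotaX (nOp s) = s := fun s hs => by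
        rw [kubotaX_eq, nOp_10, rowX_of_ne _ hs]
      rw [e t ht, e z hz]
      by_cases htz : t + z = 0
      · rw [htz, nOp_zero, kubotaX_one, div_one, div_one, eq_neg_of_add_eq_zero_right htz,
          hilbert_self_neg]
      · rw [e _ htz]
        apply hilbert_of_add_eq_one
        field_simp
  constructor
  · intro h t
    rw [← key, h]
  · intro h x
    have := hD.genuine_right_of_nOp hf (k := ⟨nOp z, 1⟩) (c := 1) ?_ (fun y => by
      rw [key, h, one_mul]) x
    · rw [this, one_mul]
    · rw [one_mul]
      have e : (⟨rOp 0, 1⟩ : Mp F) * ⟨nOp z, 1⟩ = ⟨rOp 0 * nOp z, 1⟩ := by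
        apply Mp.ext
        · rw [Mp.mul_mat]
        · have h1 : kubotaX (rOp 0 * nOp z) = 1 := by
            rw [kubotaX_eq]
            simp [mul_entry, rowX_of_ne]
          rw [Mp.mul_sgn, kubota, h1, kubotaX_rOp, div_one, hilbert_one_left, mul_one, mul_one]
      rw [e, hD.genuine_of_ne hf (h := rOp 0 * nOp z) (by simp [mul_entry])]
      simp [mul_entry, hD.torusChar_one]

/-- Translation by the lift of t(a) multiplies f(1) by μ(a), and at `rOp y` it yields μ(a)⁻¹ f(`rOp
(y a⁻²)`). Compared with the eigenvalue η(a)⁻¹ this produces the two characters ημ and ημ⁻¹. -/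
lemma translate_tMat_iff (a : Fˣ) (ha : ‖(a : F)‖ = 1) :
    (∀ x, f (x * (⟨tMat a, hilbert (ϖ ^ ε) (a : F)⟩ : Mp F)) = unitExt η (a : F)⁻¹ * f x) ↔
    (∀ y, f ⟨rOp ((a : F) ^ 2 * y), 1⟩ = unitExt (η * (resUnits μ)⁻¹) a * f ⟨rOp y, 1⟩) ∧
      unitExt (η * resUnits μ) a * f ⟨1, 1⟩ = f ⟨1, 1⟩ := by
  have ha0 : (a : F) ≠ 0 := a.ne_zero
  have hμ0 := mulExt_ne_zero μ ha0
  have hη0 := unitExt_ne_zero η ha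
  have hs := sgnC_mul_self (hilbert (ϖ ^ ε) (a : F))
  have h1 : f ((⟨1, 1⟩ : Mp F) * ⟨tMat a, hilbert (ϖ ^ ε) (a : F)⟩) = mulExt μ a * f ⟨1, 1⟩ := by
    have e : (⟨1, 1⟩ : Mp F) * ⟨tMat a, hilbert (ϖ ^ ε) (a : F)⟩ =
        ⟨tMat a, hilbert (ϖ ^ ε) (a : F)⟩ := by
      apply Mp.ext
      · rw [Mp.mul_mat, one_mul]
      · rw [Mp.mul_sgn, kubota_one_left, mul_one, one_mul]
    rw [e, hD.genuine_sgn hf, hD.genuine_of_eq hf (h := tMat a) (by simp), tMat_11, inv_inv,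
      hD.torusChar_unit ha]
    linear_combination mulExt μ a * f ⟨1, 1⟩ * hs
  have h2 : ∀ y, f ((⟨rOp y, 1⟩ : Mp F) * ⟨tMat a, hilbert (ϖ ^ ε) (a : F)⟩) =
      (mulExt μ a)⁻¹ * f ⟨rOp (y * ((a : F) ^ 2)⁻¹), 1⟩ := by
    intro y
    have e : (⟨rOp y, 1⟩ : Mp F) * ⟨tMat a, hilbert (ϖ ^ ε) (a : F)⟩ =
        ⟨rOp y * tMat a, hilbert (ϖ ^ ε) (a : F)⟩ := by
      apply Mp.ext
      · rw [Mp.mul_mat]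
      · rw [Mp.mul_sgn, hD.unif.kubota_mul_tMat, kubotaX_rOp, hilbert_one_left, mul_one, one_mul]
    have e10 : (rOp y * tMat a).1 1 0 = (a : F) := by simp [mul_entry]
    have e11 : (rOp y * tMat a).1 1 1 = y * (a : F)⁻¹ := by simp [mul_entry]
    rw [e, hD.genuine_sgn hf, hD.genuine_of_ne hf (h := rOp y * tMat a) (by rw [e10]; exact ha0),
      e10, e11, hD.torusChar_inv_unit ha]
    have e3 : y * (a : F)⁻¹ / (a : F) = y * ((a : F) ^ 2)⁻¹ := by field_simp
    rw [e3]
    linear_combination (mulExt μ a)⁻¹ * f ⟨rOp (y * ((a : F) ^ 2)⁻¹), 1⟩ * hs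
  rw [hD.alpha_eq ha, hD.beta_eq ha]
  constructor
  · intro h
    constructor
    · intro y
      have h3 := h ⟨rOp ((a : F) ^ 2 * y), 1⟩
      rw [h2, unitExt_inv η ha] at h3
      have e : (a : F) ^ 2 * y * ((a : F) ^ 2)⁻¹ = y := by field_simp
      rw [e] at h3
      field_simp at h3 ⊢
      linear_combination -h3
    · have h3 := h ⟨1, 1⟩
      rw [h1, unitExt_inv η ha] at h3
      field_simp at h3 ⊢
      linear_combination h3
  · rintro ⟨h3, h4⟩ x
    refine hD.genuine_right_of_rOp hf ?_ (fun y => ?_) x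
    · rw [h1, unitExt_inv η ha]
      field_simp
      linear_combination h4
    · rw [h2, unitExt_inv η ha]
      have h5 := h3 (y * ((a : F) ^ 2)⁻¹)
      have e : (a : F) ^ 2 * (y * ((a : F) ^ 2)⁻¹) = y := by field_simp
      rw [e] at h5
      rw [h5]
      field_simp

end Translates

/-- If d is a unit, k is a product n(b) t(u) nᵒᵖ(z) inside K_m. Otherwise m = 0, c generates 𝔭^ε,
and k = n(b) nᵒᵖ(c) n(b'). So equivariance need only be tested on the three types of generators;
local constancy follows from it and is not part of `IsLevel`. -/
lemma mem_eqSpace_iff {m : ℕ} (hm : unitCond η ≤ m) {f : Mp F → ℂ} :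
    f ∈ eqSpace ψ μ η ε m ↔ IsLevel ψ μ η ε m f := by
  rw [hD.mem_eqSpace hm, mem_principalSeries]
  have hU := hD.unif
  constructor
  · rintro ⟨⟨-, hf⟩, h⟩
    have ht : ∀ u : F, ‖u‖ = 1 →
        (∀ y, f ⟨rOp (u ^ 2 * y), 1⟩ = unitExt (η * (resUnits μ)⁻¹) u * f ⟨rOp y, 1⟩) ∧
          unitExt (η * resUnits μ) u * f ⟨1, 1⟩ = f ⟨1, 1⟩ := fun u hu => by
      have hu0 := ne_zero_of_norm_one hu
      refine (hD.translate_tMat_iff hf (Units.mk0 u hu0) hu).1 fun x => ?_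
      have hu' : ‖((Units.mk0 u hu0 : Fˣ) : F)‖ = 1 := hu
      rw [← hU.liftK_tMat hu', h _ (hU.tMat_mem_levelSet hu'), etaK_eq]
      · simp
      · simp [hu]
    refine ⟨hf, fun b hb => ?_, fun u hu => (ht u hu).1, fun u hu => (ht u hu).2, fun z hz => ?_⟩
    · refine (hD.translate_nMat_iff hf b).1 fun x => ?_
      rw [← hU.liftK_nMat hb, h _ (hU.nMat_mem_levelSet hb), etaK_eq _ (by simp)]
      simp [unitExt_one]
    · refine (hD.translate_nOp_iff hf z).1 fun x => ?_
      rw [← hU.liftK_nOp hz, h _ (hU.nOp_mem_levelSet hz), etaK_eq _ (by simp)]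
      simp [unitExt_one]
  · rintro ⟨hf, h1, h2, h3, h4⟩
    have hN : ∀ b : F, ‖b‖ ≤ (resCard F : ℝ) ^ (ε : ℤ) → ∀ x, f (x * liftK ε (nMat b)) = f x := by
      intro b hb
      rw [hU.liftK_nMat hb]
      exact (hD.translate_nMat_iff hf b).2 (h1 b hb)
    have hO : ∀ z : F, ‖z‖ ≤ (resCard F : ℝ) ^ (-((m : ℤ) + ε)) →
        ∀ x, f (x * liftK ε (nOp z)) = f x := by
      intro z hz
      rw [hU.liftK_nOp hz]
      exact (hD.translate_nOp_iff hf z).2 (h4 z hz)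
    have hT : ∀ a : Fˣ, ‖(a : F)‖ = 1 →
        ∀ x, f (x * liftK ε (tMat a)) = unitExt η (a : F)⁻¹ * f x := by
      intro a ha
      rw [hU.liftK_tMat ha]
      exact (hD.translate_tMat_iff hf a ha).2 ⟨h2 a ha, h3 a ha⟩
    have h0 : ∀ k : SL(2, F), k ∈ levelSet F ε m → k ∈ levelSet F ε 0 := fun k hk =>
      hU.levelSet_antitone (Nat.zero_le m) hk
    have hK : ∀ k ∈ levelSet F ε m, ∀ x : Mp F, f (x * liftK ε k) = etaK η k * f x := by
      intro k hk x
      obtain ⟨ka, kd, kb, kc⟩ := mem_levelSet.1 hk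
      obtain hd | hd := kd.lt_or_eq
      · obtain ⟨rfl, hc⟩ := hU.primitive_row hk hd
        -- A nonunit d occurs only at level 0, where c(η) ≤ m forces η = 1, in accordance with the
        -- default value of `etaK`.
        have hη1 : η = 1 := (hU.unitCond_eq_zero_iff hD.cont_η).1 (by omega)
        have hc0 : k.1 1 0 ≠ 0 := by
          rw [← norm_pos_iff, hc]; exact zpow_pos hU.card_pos _
        have hδ : ‖(k.1 1 1 - 1) / k.1 1 0‖ ≤ (resCard F : ℝ) ^ (ε : ℤ) := by
          rw [norm_div, hc, zpow_neg, div_inv_eq_mul]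
          exact mul_le_of_le_one_left (zpow_nonneg hU.card_pos.le _)
            (norm_sub_le_of hd.le norm_one.le)
        have e := eq_nMat_mul_of_row (g := k) (h := nOp (k.1 1 0) * nMat ((k.1 1 1 - 1) / k.1 1 0))
          (by simp [mul_entry]) (by simp [mul_entry]; field_simp; ring)
        set β := k.1 0 1 * (nOp (k.1 1 0) * nMat ((k.1 1 1 - 1) / k.1 1 0)).1 0 0 -
          k.1 0 0 * (nOp (k.1 1 0) * nMat ((k.1 1 1 - 1) / k.1 1 0)).1 0 1 with hβ
        have hβ' : ‖β‖ ≤ (resCard F : ℝ) ^ (ε : ℤ) := by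
          rw [hβ]
          refine norm_sub_le_of (by simpa [mul_entry] using kb) ?_
          simp only [mul_entry, nOp_00, nOp_01, nMat_01, nMat_11, zero_mul, one_mul, add_zero,
            norm_mul]
          exact (mul_le_of_le_one_left (norm_nonneg _) ka).trans hδ
        have hc' : ‖k.1 1 0‖ ≤ (resCard F : ℝ) ^ (-(((0 : ℕ) : ℤ) + ε)) := kc
        have m1 := hU.nMat_mem_levelSet (m := 0) hβ'
        have m2 := hU.nOp_mem_levelSet hc'
        have m3 := hU.nMat_mem_levelSet (m := 0) hδ
        rw [hη1, etaK_one_char, one_mul, e, ← hU.liftK_mul m1 (hU.levelSet_mul m2 m3),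
          ← hU.liftK_mul m2 m3, ← hU.mp_mul_assoc, ← hU.mp_mul_assoc, hN _ hδ, hO _ hc', hN _ hβ']
      · have hd0 := ne_zero_of_norm_one hd
        set a : Fˣ := (Units.mk0 _ hd0)⁻¹ with ha
        have hav : (a : F) = (k.1 1 1)⁻¹ := by simp [ha]
        have ha1 : ‖(a : F)‖ = 1 := by rw [hav, norm_inv, hd, inv_one]
        have hγ : ‖k.1 1 0 / k.1 1 1‖ ≤ (resCard F : ℝ) ^ (-((m : ℤ) + ε)) := by
          rwa [norm_div, hd, div_one]
        have e := eq_nMat_mul_of_row (g := k) (h := tMat a * nOp (k.1 1 0 / k.1 1 1))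
          (by simp [mul_entry, hav]; field_simp) (by simp [mul_entry, hav])
        set β := k.1 0 1 * (tMat a * nOp (k.1 1 0 / k.1 1 1)).1 0 0 -
          k.1 0 0 * (tMat a * nOp (k.1 1 0 / k.1 1 1)).1 0 1 with hβ
        have hβ' : ‖β‖ ≤ (resCard F : ℝ) ^ (ε : ℤ) := by
          rw [hβ]
          simp only [mul_entry]
          simpa [ha1] using kb
        have m1 := hU.nMat_mem_levelSet (m := m) hβ'
        have m2 := hU.tMat_mem_levelSet (ε := ε) (m := m) ha1
        have m3 := hU.nOp_mem_levelSet hγ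
        have e2 : f (x * liftK ε k) =
            f (x * liftK ε (nMat β * (tMat a * nOp (k.1 1 0 / k.1 1 1)))) := by rw [← e]
        rw [e2, ← hU.liftK_mul (h0 _ m1) (h0 _ (hU.levelSet_mul m2 m3)),
          ← hU.liftK_mul (h0 _ m2) (h0 _ m3), ← hU.mp_mul_assoc, ← hU.mp_mul_assoc, hO _ hγ,
          hT _ ha1, hN _ hβ', hav, inv_inv, etaK_eq η hd]
    refine ⟨⟨isLocallyConstant_mp_iff.2 fun x => ?_, hf⟩, hK⟩
    filter_upwards [hU.eventually_liftK η hD.cont_η ε m] with k hk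
    rw [← hk.2.1, hK k hk.1, hk.2.2, one_mul]

end IsDatum

end Level

/-! ## Vectors supported on double cosets -/

section Cosets

variable {F : Type*} [NontriviallyNormedField F] [IsUltrametricDist F]

lemma one_add_sub_one_norm (t z : F) : ‖1 + z / t - 1‖ = ‖z‖ / ‖t‖ := by
  rw [add_sub_cancel_left, norm_div]

lemma mul_one_add_div {t : F} (ht : t ≠ 0) (z : F) : t * (1 + z / t) = t + z := by
  field_simp

/-- The function `t₀ u² ↦ θ(u)` (`u` a unit), extended by zero. -/
noncomputable def sqFun (θ : unitsInt F →* ℂˣ) (t₀ t : F) : ℂ :=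
  open Classical in if h : ∃ u : F, ‖u‖ = 1 ∧ t = t₀ * u ^ 2 then unitExt θ h.choose else 0

/-- The chosen square root is determined up to sign, and θ(-1) = 1 makes the value independent of
it. -/
lemma sqFun_eq {θ : unitsInt F →* ℂˣ} (hθ : unitExt θ (-1) = 1) {t₀ u : F} (ht₀ : t₀ ≠ 0)
    (hu : ‖u‖ = 1) : sqFun θ t₀ (t₀ * u ^ 2) = unitExt θ u := by
  have h : ∃ v : F, ‖v‖ = 1 ∧ t₀ * u ^ 2 = t₀ * v ^ 2 := ⟨u, hu, rfl⟩
  rw [sqFun, dif_pos h]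
  obtain ⟨hv, e⟩ := h.choose_spec
  obtain e | e := sq_eq_sq_iff_eq_or_eq_neg.1 (mul_left_cancel₀ ht₀ e)
  · exact congrArg _ e.symm
  · refine Eq.trans ?_ (congrArg _ e.symm)
    rw [← neg_one_mul, unitExt_mul θ (by simp) hv, hθ, one_mul]

lemma sqFun_self {θ : unitsInt F →* ℂˣ} (hθ : unitExt θ (-1) = 1) {t₀ : F} (ht₀ : t₀ ≠ 0) :
    sqFun θ t₀ t₀ = 1 := by
  have := sqFun_eq hθ ht₀ (u := 1) norm_one
  rwa [one_pow, mul_one, unitExt_one] at this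

lemma sqFun_of_not {θ : unitsInt F →* ℂˣ} {t₀ t : F} (h : ¬∃ u : F, ‖u‖ = 1 ∧ t = t₀ * u ^ 2) :
    sqFun θ t₀ t = 0 := dif_neg h

lemma exists_of_sqFun_ne_zero {θ : unitsInt F →* ℂˣ} {t₀ t : F} (h : sqFun θ t₀ t ≠ 0) :
    ∃ u : F, ‖u‖ = 1 ∧ t = t₀ * u ^ 2 := by
  by_contra hn
  exact h (sqFun_of_not hn)

lemma sqFun_mul_sq {θ : unitsInt F →* ℂˣ} (hθ : unitExt θ (-1) = 1) {t₀ v : F} (ht₀ : t₀ ≠ 0)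
    (hv : ‖v‖ = 1) (t : F) : sqFun θ t₀ (v ^ 2 * t) = unitExt θ v * sqFun θ t₀ t := by
  have hv0 := ne_zero_of_norm_one hv
  by_cases h : ∃ u : F, ‖u‖ = 1 ∧ t = t₀ * u ^ 2
  · obtain ⟨u, hu, rfl⟩ := h
    have e : v ^ 2 * (t₀ * u ^ 2) = t₀ * (v * u) ^ 2 := by ring
    rw [e, sqFun_eq hθ ht₀ hu, sqFun_eq hθ ht₀ (by rw [norm_mul, hv, hu, one_mul]),
      unitExt_mul θ hv hu]
  · rw [sqFun_of_not h, mul_zero, sqFun_of_not]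
    rintro ⟨u, hu, e⟩
    refine h ⟨v⁻¹ * u, by rw [norm_mul, norm_inv, hv, hu, inv_one, one_mul], ?_⟩
    field_simp
    rw [mul_comm, e]

lemma wMat_mul_10 (k : SL(2, F)) : (wMat * k).1 1 0 = -k.1 0 0 := by simp [mul_entry]

lemma wMat_mul_11 (k : SL(2, F)) : (wMat * k).1 1 1 = -k.1 0 1 := by simp [mul_entry]

namespace IsOddUniformizer

variable [ProperSpace F] [MeasurableSpace F] [BorelSpace F] {ϖ : F} (hU : IsOddUniformizer ϖ)

include hU

lemma exists_sq_near {x : F} {n : ℕ} (hn : 0 < n) (hx : ‖x - 1‖ ≤ (resCard F : ℝ) ^ (-(n : ℤ))) :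
    ∃ v : F, v ^ 2 = x ∧ ‖v‖ = 1 ∧ ‖v - 1‖ ≤ (resCard F : ℝ) ^ (-(n : ℤ)) := by
  have h1 : (resCard F : ℝ) ^ (-(n : ℤ)) < 1 := by
    rw [← zpow_zero (resCard F : ℝ), hU.zpow_lt]; omega
  obtain ⟨v, hv, hv1⟩ := exists_sq_eq hU.norm_two (hx.trans_lt h1)
  exact ⟨v, hv, norm_eq_one_of_sub_one_lt (hv1.trans_lt (hx.trans_lt h1)), hv1.trans hx⟩

/-- The function `sqFun` is invariant under small additive translations. -/
lemma sqFun_add {θ : unitsInt F →* ℂˣ} (hθ : Continuous θ) (hθ1 : unitExt θ (-1) = 1) {t₀ : F}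
    (ht₀ : t₀ ≠ 0) {n : ℕ} (hn : 0 < n) (hc : unitCond θ ≤ n) {b : F}
    (hb : ‖b‖ ≤ ‖t₀‖ * (resCard F : ℝ) ^ (-(n : ℤ))) (t : F) :
    sqFun θ t₀ (t + b) = sqFun θ t₀ t := by
  have key : ∀ t b : F, ‖b‖ ≤ ‖t₀‖ * (resCard F : ℝ) ^ (-(n : ℤ)) →
      (∃ u : F, ‖u‖ = 1 ∧ t = t₀ * u ^ 2) → sqFun θ t₀ (t + b) = sqFun θ t₀ t := by
    rintro t b hb ⟨u, hu, rfl⟩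
    have hu0 := ne_zero_of_norm_one hu
    have ht : t₀ * u ^ 2 ≠ 0 := mul_ne_zero ht₀ (pow_ne_zero 2 hu0)
    obtain ⟨v, hv, hv1, hv2⟩ := hU.exists_sq_near hn (x := 1 + b / (t₀ * u ^ 2)) (by
      rw [one_add_sub_one_norm, norm_mul, norm_pow, hu, one_pow, mul_one,
        div_le_iff₀ (norm_pos_iff.2 ht₀), mul_comm]
      exact hb)
    rw [← mul_one_add_div ht, ← hv, mul_comm, sqFun_mul_sq hθ1 ht₀ hv1,
      (hU.unitCond_le_iff hθ).1 hc v hv1 hv2, one_mul]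
  by_cases h : ∃ u : F, ‖u‖ = 1 ∧ t = t₀ * u ^ 2
  · exact key t b hb h
  · by_cases h' : ∃ u : F, ‖u‖ = 1 ∧ t + b = t₀ * u ^ 2
    · have := key (t + b) (-b) (by rwa [norm_neg]) h'
      rw [add_neg_cancel_right] at this
      exact this.symm
    · rw [sqFun_of_not h, sqFun_of_not h']

/-- The preimage of the Borel subgroup contains both signs and can adjust the upper row, so
membership is a condition on the lower row up to scaling. -/
lemma mem_doubleCoset {ε m : ℕ} {x g : SL(2, F)} {s : ℤˣ} :
    (⟨g, s⟩ : Mp F) ∈ doubleCoset ε m x ↔ ∃ k ∈ levelSet F ε m, ∃ a : Fˣ,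
      g.1 1 0 = (a : F)⁻¹ * (x * k).1 1 0 ∧ g.1 1 1 = (a : F)⁻¹ * (x * k).1 1 1 := by
  constructor
  · rintro ⟨a, b, e, k, hk, h⟩
    have h1 : g = tMat a * nMat b * (x * k) := by
      have := congrArg Mp.mat h
      rwa [Mp.mul_mat, Mp.mul_mat, mul_assoc] at this
    refine ⟨k, hk, a, ?_, ?_⟩
    · rw [h1]; simp [mul_entry]
    · rw [h1]; simp [mul_entry]
  · rintro ⟨k, hk, a, h10, h11⟩
    obtain ⟨b, hb⟩ := exists_borel_mul a h10 h11
    refine ⟨a, b, s * (splitting F ε k * kubota (tMat a * nMat b) x *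
      kubota (tMat a * nMat b * x) k), k, hk, ?_⟩
    apply Mp.ext
    · rw [Mp.mul_mat, Mp.mul_mat, hb, mul_assoc, mul_assoc, mul_assoc]
      rfl
    · rw [Mp.mul_sgn, Mp.mul_sgn, Mp.mul_mat]
      show s = s * (splitting F ε k * kubota (tMat a * nMat b) x * kubota (tMat a * nMat b * x) k) *
        1 * kubota (tMat a * nMat b) x * splitting F ε k * kubota (tMat a * nMat b * x) k
      have e : ∀ p q r s : ℤˣ, s = s * (p * q * r) * 1 * q * p * r := by decide
      exact e _ _ _ _

/-- The lower row of wk is minus the upper row of k. For m > 0 the product of the off-diagonal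
entries lies in 𝔭, so the upper left entry of k is a unit. -/
lemma mem_doubleCoset_wMat {ε m : ℕ} (hm : 0 < m) {g : SL(2, F)} {s : ℤˣ} :
    (⟨g, s⟩ : Mp F) ∈ doubleCoset ε m wMat ↔
      ‖g.1 1 1‖ ≤ (resCard F : ℝ) ^ (ε : ℤ) * ‖g.1 1 0‖ := by
  rw [hU.mem_doubleCoset]
  constructor
  · rintro ⟨k, hk, a, h10, h11⟩
    obtain ⟨ka, kd, kb, kc⟩ := mem_levelSet.1 hk
    have hbc : ‖k.1 0 1 * k.1 1 0‖ < 1 := by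
      rw [norm_mul]
      calc _ ≤ (resCard F : ℝ) ^ (ε : ℤ) * (resCard F : ℝ) ^ (-((m : ℤ) + ε)) :=
            mul_le_mul kb kc (norm_nonneg _) (zpow_nonneg hU.card_pos.le _)
        _ = (resCard F : ℝ) ^ (-(m : ℤ)) := by rw [← zpow_add₀ hU.card_pos.ne']; congr 1; ring
        _ < 1 := by rw [← zpow_zero (resCard F : ℝ), hU.zpow_lt]; omega
    have had : ‖k.1 0 0 * k.1 1 1‖ = 1 := by
      have := det_entries k
      rw [sub_eq_iff_eq_add] at this
      rw [this]
      exact norm_one_add_eq_one hbc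
    have ha : 1 ≤ ‖k.1 0 0‖ := by
      rw [← had, norm_mul]
      exact mul_le_of_le_one_right (norm_nonneg _) kd
    rw [h10, h11, wMat_mul_10, wMat_mul_11, norm_mul, norm_mul, norm_neg, norm_neg, mul_left_comm]
    refine mul_le_mul_of_nonneg_left (kb.trans ?_) (norm_nonneg _)
    exact le_mul_of_one_le_right (zpow_nonneg hU.card_pos.le _) ha
  · intro h
    have hc0 : g.1 1 0 ≠ 0 := by
      intro h0
      rw [h0, norm_zero, mul_zero, norm_le_zero_iff] at h
      have := det_entries g
      rw [h0, h] at this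
      simp at this
    refine ⟨nMat (g.1 1 1 / g.1 1 0), hU.nMat_mem_levelSet ?_, (Units.mk0 _ hc0)⁻¹ * -1, ?_, ?_⟩
    · rwa [norm_div, div_le_iff₀ (norm_pos_iff.2 hc0)]
    · simp [mul_entry]
    · simp [mul_entry]; field_simp

/-- At level 0 there is a single orbit. Points outside the coset of level one have t = c/d in 𝔭^ε
and are reached by an explicit k whose upper row is proportional to (t, 1). -/
lemma mem_doubleCoset_zero_wMat {ε : ℕ} (x : Mp F) : x ∈ doubleCoset ε 0 wMat := by
  obtain ⟨g, s⟩ := x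
  rw [hU.mem_doubleCoset]
  by_cases h : ‖g.1 1 1‖ ≤ (resCard F : ℝ) ^ (ε : ℤ) * ‖g.1 1 0‖
  · obtain ⟨k, hk, h⟩ := hU.mem_doubleCoset.1 ((hU.mem_doubleCoset_wMat one_pos (s := s)).2 h)
    exact ⟨k, hU.levelSet_antitone zero_le_one hk, h⟩
  · rw [not_le] at h
    have hd0 : g.1 1 1 ≠ 0 := norm_pos_iff.1 ((by positivity : (0 : ℝ) ≤ _).trans_lt h)
    set t := g.1 1 0 / g.1 1 1 with ht
    have htn : ‖t‖ ≤ (resCard F : ℝ) ^ (-(ε : ℤ)) := by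
      rw [ht, norm_div, div_le_iff₀ (norm_pos_iff.2 hd0), zpow_neg, ← div_eq_inv_mul,
        le_div_iff₀ (zpow_pos hU.card_pos _), mul_comm]
      exact h.le
    have hϖ := pow_ne_zero ε hU.ne_zero
    have hϖn := hU.norm_pow_eq ε
    -- a matrix with upper row proportional to `(t, 1)`
    obtain ⟨k, k00, k01, k10, k11⟩ : ∃ k : SL(2, F), k.1 0 0 = t * (ϖ ^ ε)⁻¹ ∧
        k.1 0 1 = (ϖ ^ ε)⁻¹ ∧ k.1 1 0 = -(ϖ ^ ε) ∧ k.1 1 1 = 0 :=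
      ⟨⟨!![t * (ϖ ^ ε)⁻¹, (ϖ ^ ε)⁻¹; -(ϖ ^ ε), 0], by
        rw [Matrix.det_fin_two_of]; field_simp; ring⟩, rfl, rfl, rfl, rfl⟩
    refine ⟨k, mem_levelSet.2 ⟨?_, ?_, ?_, ?_⟩,
      Units.mk0 (-((g.1 1 1)⁻¹ * (ϖ ^ ε)⁻¹)) (neg_ne_zero.2
        (mul_ne_zero (inv_ne_zero hd0) (inv_ne_zero hϖ))), ?_, ?_⟩
    · rw [k00, norm_mul, norm_inv, hϖn, ← div_eq_mul_inv]
      exact div_le_one_of_le₀ htn (zpow_nonneg hU.card_pos.le _)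
    · rw [k11, norm_zero]
      exact zero_le_one
    · rw [k01, norm_inv, hϖn, zpow_neg, inv_inv]
    · rw [k10, norm_neg, hϖn]
      simp
    · rw [wMat_mul_10, Units.val_mk0, k00, ht]
      field_simp
    · rw [wMat_mul_11, Units.val_mk0, k01]
      field_simp

lemma norm_unit_entry {ε m : ℕ} (hm : 0 < m) {k : SL(2, F)} (hk : k ∈ levelSet F ε m) :
    ‖k.1 1 1‖ = 1 := by
  by_contra h
  have := (hU.primitive_row hk (lt_of_le_of_ne (mem_levelSet.1 hk).2.1 h)).1
  omega

lemma mem_doubleCoset_one {ε m : ℕ} (hm : 0 < m) {g : SL(2, F)} {s : ℤˣ} :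
    (⟨g, s⟩ : Mp F) ∈ doubleCoset ε m 1 ↔
      ‖g.1 1 0‖ ≤ (resCard F : ℝ) ^ (-((m : ℤ) + ε)) * ‖g.1 1 1‖ := by
  rw [hU.mem_doubleCoset]
  constructor
  · rintro ⟨k, hk, a, h10, h11⟩
    rw [one_mul] at h10 h11
    rw [h10, h11, norm_mul, norm_mul, hU.norm_unit_entry hm hk, mul_one, mul_comm]
    exact mul_le_mul_of_nonneg_right (mem_levelSet.1 hk).2.2.2 (norm_nonneg _)
  · intro h
    have hd0 : g.1 1 1 ≠ 0 := by
      intro h0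
      rw [h0, norm_zero, mul_zero, norm_le_zero_iff] at h
      have := det_entries g
      rw [h0, h] at this
      simp at this
    refine ⟨nOp (g.1 1 0 / g.1 1 1), hU.nOp_mem_levelSet ?_, (Units.mk0 _ hd0)⁻¹, ?_, ?_⟩
    · rwa [norm_div, div_le_iff₀ (norm_pos_iff.2 hd0)]
    · simp; field_simp
    · simp

/-- K_m acts on the chart by t₀ ↦ (t₀a + c)/(t₀b + d). With D the denominator, a unit, ad - bc = 1
makes the quotient of the image by t₀ congruent to D⁻² modulo 𝔭. Principal units being squares, the
orbit consists of the t₀u². -/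
lemma mem_doubleCoset_nOp {ε m j : ℕ} (hj : 0 < j) (hjm : j < m) {t₀ : F}
    (ht₀ : ‖t₀‖ = (resCard F : ℝ) ^ (-((j : ℤ) + ε))) {g : SL(2, F)} {s : ℤˣ} :
    (⟨g, s⟩ : Mp F) ∈ doubleCoset ε m (nOp t₀) ↔
      ∃ u : F, ‖u‖ = 1 ∧ g.1 1 0 = t₀ * u ^ 2 * g.1 1 1 := by
  have ht₀' : t₀ ≠ 0 := by
    rw [← norm_pos_iff, ht₀]; exact zpow_pos hU.card_pos _
  rw [hU.mem_doubleCoset]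
  constructor
  · rintro ⟨k, hk, a, h10, h11⟩
    obtain ⟨ka, kd, kb, kc⟩ := mem_levelSet.1 hk
    have hd := hU.norm_unit_entry (by omega) hk
    have hd0 := ne_zero_of_norm_one hd
    have hlt : ∀ n : ℤ, n < 0 → (resCard F : ℝ) ^ n < 1 := fun n hn => by
      rw [← zpow_zero (resCard F : ℝ), hU.zpow_lt]; omega
    have h1 : ‖t₀ * k.1 0 1‖ < 1 := by
      rw [norm_mul, ht₀]
      refine (mul_le_mul_of_nonneg_left kb (zpow_nonneg hU.card_pos.le _)).trans_lt ?_
      rw [← zpow_add₀ hU.card_pos.ne']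
      exact hlt _ (by omega)
    have h2 : ‖k.1 1 0 / t₀‖ < 1 := by
      rw [norm_div, ht₀, div_lt_one (zpow_pos hU.card_pos _)]
      exact kc.trans_lt (hU.zpow_lt.2 (by omega))
    have h3 : ‖k.1 0 1 * k.1 1 0‖ < 1 := by
      have e : k.1 0 1 * k.1 1 0 = (t₀ * k.1 0 1) * (k.1 1 0 / t₀) := by field_simp
      rw [e, norm_mul]
      exact mul_lt_one_of_nonneg_of_lt_one_left (norm_nonneg _) h1 h2.le
    have hdet := det_entries k
    set D := t₀ * k.1 0 1 + k.1 1 1 with hD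
    have hD1 : ‖D‖ = 1 := by
      rw [hD, add_comm, norm_add_eq_left (by rwa [hd]), hd]
    have hD0 := ne_zero_of_norm_one hD1
    -- the ratio of the entries of the lower row, divided by `t₀`, is near to the square of `1 / D`
    have h4 : ‖(k.1 0 0 + k.1 1 0 / t₀) * D - 1‖ < 1 := by
      have e : (k.1 0 0 + k.1 1 0 / t₀) * D - 1 = k.1 0 0 * (t₀ * k.1 0 1) +
          (k.1 0 1 * k.1 1 0 + k.1 1 0 / t₀ * D) := by
        rw [hD]
        linear_combination hdet
      rw [e]
      refine norm_add_lt_of ?_ (norm_add_lt_of h3 ?_)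
      · rw [norm_mul]
        exact mul_lt_one_of_nonneg_of_lt_one_right ka (norm_nonneg _) h1
      · rw [norm_mul, hD1, mul_one]
        exact h2
    obtain ⟨v, hv, hv1⟩ := exists_sq_eq hU.norm_two h4
    have hvn := norm_eq_one_of_sub_one_lt (hv1.trans_lt h4)
    refine ⟨v / D, by rw [norm_div, hvn, hD1, div_one], ?_⟩
    have e0 : (nOp t₀ * k).1 1 0 = t₀ * k.1 0 0 + k.1 1 0 := by simp [mul_entry]
    have e1 : (nOp t₀ * k).1 1 1 = D := by simp [mul_entry, hD]
    rw [h10, h11, e0, e1, div_pow, hv]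
    field_simp
  · rintro ⟨u, hu, h⟩
    have hu0 := ne_zero_of_norm_one hu
    have hd0 : g.1 1 1 ≠ 0 := by
      intro h0
      rw [h0, mul_zero] at h
      have := det_entries g
      rw [h0, h] at this
      simp at this
    refine ⟨tMat (Units.mk0 u hu0), hU.tMat_mem_levelSet hu,
      Units.mk0 (u⁻¹ * (g.1 1 1)⁻¹) (mul_ne_zero (inv_ne_zero hu0) (inv_ne_zero hd0)), ?_, ?_⟩
    · simp [mul_entry, h]
      field_simp
    · simp [mul_entry]
      field_simp

end IsOddUniformizer

end Cosets

/-! ## Existence of vectors supported on one double coset -/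

section Existence

variable {F : Type*} [NontriviallyNormedField F] [IsUltrametricDist F] [ProperSpace F]
  [MeasurableSpace F] [BorelSpace F]

namespace IsDatum

variable {ϖ : F} {ε : ℕ} {ψ : AddChar F ℂ} {μ : Fˣ →* ℂˣ} {η : unitsInt F →* ℂˣ}
  (hD : IsDatum ϖ ε ψ μ η)

include hD

lemma cont_alpha : Continuous (η * (resUnits μ)⁻¹) :=
  hD.cont_η.mul (continuous_resUnits hD.cont_μ).inv

lemma cont_beta : Continuous (η * resUnits μ) := hD.cont_η.mul (continuous_resUnits hD.cont_μ)

lemma alpha_neg_one : unitExt (η * (resUnits μ)⁻¹) (-1) = 1 := by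
  rw [hD.alpha_eq (by simp), hD.agree, mul_inv_cancel₀ (mulExt_ne_zero μ (by simp))]

lemma beta_neg_one : unitExt (η * resUnits μ) (-1) = 1 := by
  rw [hD.beta_eq (by simp), hD.agree, ← mulExt_mul, neg_one_mul, neg_neg, mulExt_one]

lemma mulExt_eq_one {m : ℕ} (h : unitCond (resUnits μ) ≤ m) {x : F} (hx : ‖x‖ = 1)
    (hx1 : ‖x - 1‖ ≤ (resCard F : ℝ) ^ (-(m : ℤ))) : mulExt μ x = 1 := by
  rw [← unitExt_resUnits μ hx]
  exact (hD.unif.unitCond_le_iff (continuous_resUnits hD.cont_μ)).1 h x hx hx1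

/-- The values at `nOp t` of a genuine function given by its values at `rOp y`. -/
lemma isLevel_genuineFun {m : ℕ} {φ Φ : F → ℂ}
    (hΦ : ∀ t ≠ 0, Φ t = torusChar ψ μ t⁻¹ * φ t⁻¹)
    (add : ∀ b : F, ‖b‖ ≤ (resCard F : ℝ) ^ (ε : ℤ) → ∀ y, φ (y + b) = φ y)
    (sq : ∀ u : F, ‖u‖ = 1 → ∀ y, φ (u ^ 2 * y) = unitExt (η * (resUnits μ)⁻¹) u * φ y)
    (one : ∀ u : F, ‖u‖ = 1 → unitExt (η * resUnits μ) u * Φ 0 = Φ 0)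
    (op : ∀ z : F, ‖z‖ ≤ (resCard F : ℝ) ^ (-((m : ℤ) + ε)) → ∀ t, Φ (t + z) = Φ t) :
    IsLevel ψ μ η ε m (genuineFun ψ μ φ (Φ 0)) := by
  have hg := hD.isGenuine_genuineFun (μ := μ) φ (Φ 0)
  have hn : ∀ t, genuineFun ψ μ φ (Φ 0) ⟨nOp t, 1⟩ = Φ t := by
    intro t
    by_cases ht : t = 0
    · rw [ht, nOp_zero, hD.genuineFun_one]
    · rw [hD.genuine_nOp hg ht, hD.genuineFun_rOp, hΦ t ht]
  refine ⟨hg, fun b hb y => ?_, fun u hu y => ?_, fun u hu => ?_, fun z hz t => ?_⟩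
  · rw [hD.genuineFun_rOp, hD.genuineFun_rOp, add b hb]
  · rw [hD.genuineFun_rOp, hD.genuineFun_rOp, sq u hu]
  · rw [hD.genuineFun_one, one u hu]
  · rw [hn, hn, op z hz]

lemma genuineRow_ne_zero {φ : F → ℂ} {z : ℂ} {x : Mp F} (h : genuineFun ψ μ φ z x ≠ 0) :
    (x.mat.1 1 0 ≠ 0 ∧ φ (x.mat.1 1 1 / x.mat.1 1 0) ≠ 0) ∨ (x.mat.1 1 0 = 0 ∧ z ≠ 0) := by
  rw [genuineFun, genuineRow] at h
  have h1 := right_ne_zero_of_mul h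
  by_cases hc : x.mat.1 1 0 = 0
  · rw [if_neg (by simpa using hc)] at h1
    exact Or.inr ⟨hc, right_ne_zero_of_mul h1⟩
  · rw [if_pos hc] at h1
    exact Or.inl ⟨hc, right_ne_zero_of_mul h1⟩

lemma level_ne_zero_of_rOp {f : Mp F → ℂ} {x : Mp F} (h : f x ≠ 0) : f ≠ 0 := fun h0 =>
  h (by rw [h0]; rfl)

/-- Invariance of `t ↦ χ(t⁻¹)` under multiplication by elements near to one. -/
lemma torusChar_inv_near {m : ℕ} (hm : 0 < m) (hμ : unitCond (resUnits μ) ≤ m) {t z : F}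
    (ht : t ≠ 0) (hz : ‖z‖ ≤ ‖t‖ * (resCard F : ℝ) ^ (-(m : ℤ))) :
    ‖t + z‖ = ‖t‖ ∧ torusChar ψ μ (t + z)⁻¹ = torusChar ψ μ t⁻¹ ∧
      torusChar ψ μ (t + z) = torusChar ψ μ t := by
  have h1 : (resCard F : ℝ) ^ (-(m : ℤ)) < 1 := by
    rw [← zpow_zero (resCard F : ℝ), hD.unif.zpow_lt]; omega
  have htn := norm_pos_iff.2 ht
  have hs : ‖1 + z / t - 1‖ ≤ (resCard F : ℝ) ^ (-(m : ℤ)) := by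
    rwa [one_add_sub_one_norm, div_le_iff₀ htn, mul_comm]
  have hs1 := norm_eq_one_of_sub_one_lt (hs.trans_lt h1)
  have hsi : ‖(1 + z / t)⁻¹ - 1‖ < 1 := by
    have e : (1 + z / t)⁻¹ - 1 = -((1 + z / t)⁻¹ * (1 + z / t - 1)) := by
      have := ne_zero_of_norm_one hs1
      rw [mul_sub, inv_mul_cancel₀ this]; ring
    rw [e, norm_neg, norm_mul, norm_inv, hs1, inv_one, one_mul]
    exact hs.trans_lt h1
  have hμ1 := hD.mulExt_eq_one hμ hs1 hs
  refine ⟨?_, ?_, ?_⟩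
  · rw [← mul_one_add_div ht, norm_mul, hs1, mul_one]
  · rw [← mul_one_add_div ht, mul_inv, hD.torusChar_mul_of_sub_one_lt (inv_ne_zero ht) hsi,
      mulExt_inv, hμ1, inv_one, mul_one]
  · rw [← mul_one_add_div ht, hD.torusChar_mul_of_sub_one_lt ht (hs.trans_lt h1), hμ1, mul_one]

lemma eq_one_iff_unitExt {θ : unitsInt F →* ℂˣ} (h : θ = 1) {u : F} (hu : ‖u‖ = 1) :
    unitExt θ u = 1 := (unitExt_eq_one_iff θ).2 h u hu

lemma zpow_mul_zpow (a b : ℤ) :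
    (resCard F : ℝ) ^ a * (resCard F : ℝ) ^ b = (resCard F : ℝ) ^ (a + b) :=
  (zpow_add₀ hD.unif.card_pos.ne' _ _).symm

/-- φ is the indicator of the ball |y| ≤ q^ε, compatible with homogeneity because α = 1. In the
other chart Φ(t) = χ(t⁻¹) for |t| ≥ q^(-ε), and 𝔭^(m+ε)-invariance holds because c(μ) ≤ m. -/
lemma exists_cosetVector_wMat {m : ℕ} (hm : 0 < m) (hη : unitCond η ≤ m)
    (hα : η * (resUnits μ)⁻¹ = 1) (hμ : unitCond (resUnits μ) ≤ m) :
    ∃ f, IsCosetVector ψ μ η ε m wMat f := by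
  classical
  have hU := hD.unif
  set φ : F → ℂ := fun y => if ‖y‖ ≤ (resCard F : ℝ) ^ (ε : ℤ) then 1 else 0 with hφ
  set Φ : F → ℂ := fun t => if (resCard F : ℝ) ^ (-(ε : ℤ)) ≤ ‖t‖ then torusChar ψ μ t⁻¹ else 0
    with hΦ
  have hpos : (0 : ℝ) < (resCard F : ℝ) ^ (-(ε : ℤ)) := zpow_pos hU.card_pos _
  have hΦ0 : Φ 0 = 0 := by
    rw [hΦ]; beta_reduce
    rw [norm_zero, if_neg (not_le.2 hpos)]
  have hL : IsLevel ψ μ η ε m (genuineFun ψ μ φ (Φ 0)) := by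
    apply hD.isLevel_genuineFun
    · intro t ht
      have hiff : (resCard F : ℝ) ^ (-(ε : ℤ)) ≤ ‖t‖ ↔ ‖t⁻¹‖ ≤ (resCard F : ℝ) ^ (ε : ℤ) := by
        rw [norm_inv, zpow_neg, inv_le_comm₀ (zpow_pos hU.card_pos _) (norm_pos_iff.2 ht)]
      simp only [hΦ, hφ, hiff]
      split_ifs <;> simp
    · intro b hb y
      have := zball_add (F := F) (n := (ε : ℤ)) (x := y) (y := b) (mem_zball.2 hb)
      simp only [mem_zball] at this
      simp only [hφ, this]
    · intro u hu y
      rw [hD.eq_one_iff_unitExt hα hu, one_mul]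
      simp only [hφ, norm_mul, norm_pow, hu, one_pow, one_mul]
    · intro u hu
      rw [hΦ0, mul_zero]
    · intro z hz t
      simp only [hΦ]
      by_cases ht : (resCard F : ℝ) ^ (-(ε : ℤ)) ≤ ‖t‖
      · have ht0 : t ≠ 0 := norm_pos_iff.1 (hpos.trans_le ht)
        obtain ⟨h1, h2, -⟩ := hD.torusChar_inv_near hm hμ ht0 (z := z) (by
          refine (hz.trans ?_).trans (mul_le_mul_of_nonneg_right ht (zpow_nonneg hU.card_pos.le _))
          rw [hD.zpow_mul_zpow, hU.zpow_le]; omega)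
        rw [h1, h2]
      · rw [if_neg ht, if_neg]
        rw [not_le] at ht ⊢
        exact norm_add_lt_of ht (hz.trans_lt (hU.zpow_lt.2 (by omega)))
  refine ⟨_, (hD.mem_eqSpace_iff hη).2 hL, hD.level_ne_zero_of_rOp (x := ⟨rOp 0, 1⟩) ?_, ?_⟩
  · rw [hD.genuineFun_rOp]
    simp only [hφ, norm_zero]
    rw [if_pos (zpow_nonneg hU.card_pos.le _)]
    exact one_ne_zero
  · intro x hx
    obtain ⟨hc, h⟩ | ⟨-, h⟩ := hD.genuineRow_ne_zero hx
    · refine (hU.mem_doubleCoset_wMat hm).2 ?_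
      simp only [hφ] at h
      rw [norm_div] at h
      have := (ite_ne_right_iff.1 h).1
      rwa [div_le_iff₀ (norm_pos_iff.2 hc)] at this
    · exact absurd hΦ0 h

/-- The mirror image in the chart Φ, with the indicator of 𝔭^(m+ε). Homogeneity of φ = χ⁻¹ on its
support is the condition α = μ⁻², that is β = 1. -/
lemma exists_cosetVector_one {m : ℕ} (hm : 0 < m) (hη : unitCond η ≤ m)
    (hβ : η * resUnits μ = 1) (hμ : unitCond (resUnits μ) ≤ m) :
    ∃ f, IsCosetVector ψ μ η ε m 1 f := by
  classical
  have hU := hD.unif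
  set φ : F → ℂ := fun y =>
    if (resCard F : ℝ) ^ ((m : ℤ) + ε) ≤ ‖y‖ then (torusChar ψ μ y)⁻¹ else 0 with hφ
  set Φ : F → ℂ := fun t => if ‖t‖ ≤ (resCard F : ℝ) ^ (-((m : ℤ) + ε)) then 1 else 0 with hΦ
  have hpos : (0 : ℝ) < (resCard F : ℝ) ^ ((m : ℤ) + ε) := zpow_pos hU.card_pos _
  have hΦ0 : Φ 0 = 1 := by
    rw [hΦ]; beta_reduce
    rw [norm_zero, if_pos (zpow_nonneg hU.card_pos.le _)]
  have hL : IsLevel ψ μ η ε m (genuineFun ψ μ φ (Φ 0)) := by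
    apply hD.isLevel_genuineFun
    · intro t ht
      have hiff : ‖t‖ ≤ (resCard F : ℝ) ^ (-((m : ℤ) + ε)) ↔
          (resCard F : ℝ) ^ ((m : ℤ) + ε) ≤ ‖t⁻¹‖ := by
        rw [norm_inv, zpow_neg, le_inv_comm₀ (norm_pos_iff.2 ht) (zpow_pos hU.card_pos _)]
      simp only [hΦ, hφ, hiff]
      split_ifs
      · rw [mul_inv_cancel₀ (hD.torusChar_ne_zero (inv_ne_zero ht))]
      · rw [mul_zero]
    · intro b hb y
      simp only [hφ]
      by_cases hy : (resCard F : ℝ) ^ ((m : ℤ) + ε) ≤ ‖y‖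
      · have hy0 : y ≠ 0 := norm_pos_iff.1 (hpos.trans_le hy)
        obtain ⟨h1, -, h2⟩ := hD.torusChar_inv_near hm hμ hy0 (z := b) (by
          refine (hb.trans ?_).trans (mul_le_mul_of_nonneg_right hy (zpow_nonneg hU.card_pos.le _))
          rw [hD.zpow_mul_zpow, hU.zpow_le]; omega)
        rw [h1, h2]
      · rw [if_neg hy, if_neg]
        rw [not_le] at hy ⊢
        exact norm_add_lt_of hy (hb.trans_lt (hU.zpow_lt.2 (by omega)))
    · intro u hu y
      have hαu : unitExt (η * (resUnits μ)⁻¹) u = (mulExt μ u ^ 2)⁻¹ := by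
        have h1 := hD.eq_one_iff_unitExt hβ hu
        rw [hD.beta_eq hu] at h1
        rw [hD.alpha_eq hu, eq_inv_of_mul_eq_one_left h1, sq, mul_inv]
      simp only [hφ, norm_mul, norm_pow, hu, one_pow, one_mul]
      split_ifs with h
      · rw [mul_comm, hD.torusChar_mul_sq (norm_pos_iff.1 (hpos.trans_le h)) hu, hαu, mul_inv,
          mul_comm]
      · rw [mul_zero]
    · intro u hu
      rw [hD.eq_one_iff_unitExt hβ hu, one_mul]
    · intro z hz t
      have := zball_add (F := F) (n := -((m : ℤ) + ε)) (x := t) (y := z) (mem_zball.2 hz)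
      simp only [mem_zball] at this
      simp only [hΦ, this]
  refine ⟨_, (hD.mem_eqSpace_iff hη).2 hL, hD.level_ne_zero_of_rOp (x := ⟨1, 1⟩) ?_, ?_⟩
  · rw [hD.genuineFun_one, hΦ0]
    exact one_ne_zero
  · intro x hx
    refine (hU.mem_doubleCoset_one hm).2 ?_
    obtain ⟨hc, h⟩ | ⟨hc, -⟩ := hD.genuineRow_ne_zero hx
    · simp only [hφ] at h
      rw [norm_div] at h
      have := (ite_ne_right_iff.1 h).1
      rwa [le_div_iff₀ (norm_pos_iff.2 hc), ← le_inv_mul_iff₀ (zpow_pos hU.card_pos _),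
        ← zpow_neg] at this
    · rw [hc, norm_zero]
      exact mul_nonneg (zpow_nonneg hU.card_pos.le _) (norm_nonneg _)

/-- The spherical vector. -/
lemma exists_cosetVector_zero (hη : η = 1) (hμ : resUnits μ = 1) :
    ∃ f, IsCosetVector ψ μ η ε 0 wMat f := by
  classical
  have hU := hD.unif
  have hμ0 : unitCond (resUnits μ) ≤ 1 := by
    rw [(hU.unitCond_eq_zero_iff (continuous_resUnits hD.cont_μ)).2 hμ]; exact zero_le_one
  have hη0 : unitCond η ≤ 0 := ((hU.unitCond_eq_zero_iff hD.cont_η).2 hη).le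
  -- The charts overlap on |y| = q^ε, where φ = 1, which forces the value at the identity. On this
  -- sphere χ is constant: μ is unramified, and the Weil factor of a unit u cancels the symbol
  -- (ϖ^(-ε), u).
  set c : ℂ := torusChar ψ μ (ϖ ^ (-(ε : ℤ))) with hc
  set φ : F → ℂ := fun y => if ‖y‖ ≤ (resCard F : ℝ) ^ (ε : ℤ) then 1 else
    (torusChar ψ μ y)⁻¹ * c with hφ
  set Φ : F → ℂ := fun t => if ‖t‖ ≤ (resCard F : ℝ) ^ (-(ε : ℤ)) then c else torusChar ψ μ t⁻¹
    with hΦ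
  have hpos : (0 : ℝ) < (resCard F : ℝ) ^ (-(ε : ℤ)) := zpow_pos hU.card_pos _
  have hfar : ∀ {y : F} {n : ℤ}, ¬‖y‖ ≤ (resCard F : ℝ) ^ n → (resCard F : ℝ) ^ (n + 1) ≤ ‖y‖ := by
    intro y n h
    rwa [← not_lt, hU.norm_lt_zpow, add_sub_cancel_right]
  have hfar0 : ∀ {y : F} {n : ℤ}, ¬‖y‖ ≤ (resCard F : ℝ) ^ n → y ≠ 0 := by
    rintro y n h rfl
    exact h (by rw [norm_zero]; exact zpow_nonneg hU.card_pos.le _)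
  have hμ1 : ∀ u : F, ‖u‖ = 1 → mulExt μ u = 1 := fun u hu => by
    rw [← unitExt_resUnits μ hu, hD.eq_one_iff_unitExt hμ hu]
  have hηu : ∀ u : F, ‖u‖ = 1 → unitExt η u = 1 := fun u hu => hD.eq_one_iff_unitExt hη hu
  have hL : IsLevel ψ μ η ε 0 (genuineFun ψ μ φ (Φ 0)) := by
    apply hD.isLevel_genuineFun
    · intro t ht
      have hiff : ‖t⁻¹‖ ≤ (resCard F : ℝ) ^ (ε : ℤ) ↔ (resCard F : ℝ) ^ (-(ε : ℤ)) ≤ ‖t‖ := by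
        rw [norm_inv, zpow_neg, inv_le_comm₀ (zpow_pos hU.card_pos _) (norm_pos_iff.2 ht)]
      simp only [hΦ, hφ, hiff]
      obtain h | h | h := lt_trichotomy ‖t‖ ((resCard F : ℝ) ^ (-(ε : ℤ)))
      · rw [if_pos h.le, if_neg (not_le.2 h),
          mul_inv_cancel_left₀ (hD.torusChar_ne_zero (inv_ne_zero ht))]
      · rw [if_pos h.le, if_pos h.ge, mul_one, hc]
        have hϖ0 : ϖ ^ (-(ε : ℤ)) ≠ 0 := zpow_ne_zero _ hU.ne_zero
        have hu : ‖t⁻¹ * ϖ ^ (ε : ℤ)‖ = 1 := by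
          rw [norm_mul, norm_inv, h, hU.norm_zpow, inv_mul_cancel₀ hpos.ne']
        have e : t⁻¹ = ϖ ^ (-(ε : ℤ)) * (t⁻¹ * ϖ ^ (ε : ℤ)) := by
          rw [mul_left_comm, ← zpow_add₀ hU.ne_zero, neg_add_cancel, zpow_zero, mul_one]
        rw [e, hD.torusChar_mul hϖ0 (ne_zero_of_norm_one hu), hD.torusChar_unit hu, hμ1 _ hu,
          zpow_neg, IsOddUniformizer.hilbert_inv_left (zpow_ne_zero _ hU.ne_zero), zpow_natCast,
          mul_assoc, one_mul, sgnC_mul_self, mul_one]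
      · rw [if_neg (not_le.2 h), if_pos h.le, mul_one]
    · intro b hb y
      have hz := zball_add (F := F) (n := (ε : ℤ)) (x := y) (y := b) (mem_zball.2 hb)
      simp only [mem_zball] at hz
      simp only [hφ, hz]
      split_ifs with hy
      · rfl
      · have hy' := hfar hy
        rw [(hD.torusChar_inv_near one_pos hμ0 (hfar0 hy) (z := b) ?_).2.2]
        refine (hb.trans ?_).trans (mul_le_mul_of_nonneg_right hy' (zpow_nonneg hU.card_pos.le _))
        rw [hD.zpow_mul_zpow, hU.zpow_le]
        simp
    · intro u hu y
      rw [hD.alpha_eq hu, hμ1 u hu, hηu u hu, inv_one, one_mul, one_mul]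
      simp only [hφ, norm_mul, norm_pow, hu, one_pow, one_mul]
      split_ifs with h
      · rfl
      · rw [mul_comm (u ^ 2), hD.torusChar_mul_sq (hfar0 h) hu, hμ1 u hu, one_pow, mul_one]
    · intro u hu
      rw [hD.beta_eq hu, hμ1 u hu, hηu u hu, one_mul, one_mul]
    · intro z hz t
      have hz' : ‖z‖ ≤ (resCard F : ℝ) ^ (-(ε : ℤ)) := by simpa using hz
      have hb := zball_add (F := F) (n := -(ε : ℤ)) (x := t) (y := z) (mem_zball.2 hz')
      simp only [mem_zball] at hb
      simp only [hΦ, hb]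
      split_ifs with ht
      · rfl
      · have ht' := hfar ht
        rw [(hD.torusChar_inv_near one_pos hμ0 (hfar0 ht) (z := z) ?_).2.1]
        refine (hz'.trans ?_).trans (mul_le_mul_of_nonneg_right ht' (zpow_nonneg hU.card_pos.le _))
        rw [hD.zpow_mul_zpow, hU.zpow_le]
        simp
  refine ⟨_, (hD.mem_eqSpace_iff hη0).2 hL, hD.level_ne_zero_of_rOp (x := ⟨rOp 0, 1⟩) ?_,
    fun x _ => hU.mem_doubleCoset_zero_wMat x⟩
  rw [hD.genuineFun_rOp]
  simp only [hφ, norm_zero]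
  rw [if_pos (zpow_nonneg hU.card_pos.le _)]
  exact one_ne_zero

/-- φ is t₀⁻¹u² ↦ α(u), and Φ is a multiple of t₀u² ↦ β(u)⁻¹. Translation by 𝔭^(-ε) is a relative
perturbation of y in 𝔭^j, harmless when c(α) ≤ j; translation by 𝔭^(m+ε) is one of t in 𝔭^(m-j),
harmless when c(β) ≤ m - j. -/
lemma exists_cosetVector_nOp {m j : ℕ} (hj : 0 < j) (hjm : j < m) (hη : unitCond η ≤ m)
    (hα : unitCond (η * (resUnits μ)⁻¹) ≤ j) (hβ : j + unitCond (η * resUnits μ) ≤ m) {t₀ : F}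
    (ht₀ : ‖t₀‖ = (resCard F : ℝ) ^ (-((j : ℤ) + ε))) :
    ∃ f, IsCosetVector ψ μ η ε m (nOp t₀) f := by
  have hU := hD.unif
  have ht₀' : t₀ ≠ 0 := by
    rw [← norm_pos_iff, ht₀]; exact zpow_pos hU.card_pos _
  have hy₀ := inv_ne_zero ht₀'
  have hβ1 : unitExt (η * resUnits μ)⁻¹ (-1) = 1 := by
    rw [inv_unitExt _ (by simp), hD.beta_neg_one, inv_one]
  set φ : F → ℂ := sqFun (η * (resUnits μ)⁻¹) t₀⁻¹ with hφ
  set Φ : F → ℂ := fun t => torusChar ψ μ t₀⁻¹ * sqFun (η * resUnits μ)⁻¹ t₀ t with hΦ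
  have hΦ0 : Φ 0 = 0 := by
    simp only [hΦ]
    rw [sqFun_of_not, mul_zero]
    rintro ⟨u, hu, h⟩
    exact mul_ne_zero ht₀' (pow_ne_zero 2 (ne_zero_of_norm_one hu)) h.symm
  have hL : IsLevel ψ μ η ε m (genuineFun ψ μ φ (Φ 0)) := by
    apply hD.isLevel_genuineFun
    · intro t ht
      by_cases h : ∃ u : F, ‖u‖ = 1 ∧ t = t₀ * u ^ 2
      · obtain ⟨u, hu, rfl⟩ := h
        have hu' : ‖u⁻¹‖ = 1 := by rw [norm_inv, hu, inv_one]
        have e : (t₀ * u ^ 2)⁻¹ = t₀⁻¹ * u⁻¹ ^ 2 := by rw [mul_inv, inv_pow]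
        simp only [hΦ]
        rw [sqFun_eq hβ1 ht₀' hu, e, hφ, sqFun_eq hD.alpha_neg_one hy₀ hu',
          hD.torusChar_mul_sq hy₀ hu', hD.alpha_eq hu', inv_unitExt _ hu, hD.beta_eq hu,
          unitExt_inv η hu, mulExt_inv]
        have := mulExt_ne_zero μ (ne_zero_of_norm_one hu)
        have := unitExt_ne_zero η hu
        field_simp
      · simp only [hΦ]
        rw [sqFun_of_not h, hφ, sqFun_of_not, mul_zero, mul_zero]
        rintro ⟨u, hu, e⟩
        refine h ⟨u⁻¹, by rw [norm_inv, hu, inv_one], ?_⟩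
        rw [← inv_inj, e, mul_inv, inv_pow, inv_inv]
    · intro b hb y
      refine hU.sqFun_add hD.cont_alpha hD.alpha_neg_one hy₀ hj hα ?_ y
      rw [norm_inv, ht₀, ← zpow_neg, hD.zpow_mul_zpow]
      exact hb.trans (hU.zpow_le.2 (by omega))
    · exact fun u hu y => sqFun_mul_sq hD.alpha_neg_one hy₀ hu y
    · intro u hu
      rw [hΦ0, mul_zero]
    · intro z hz t
      simp only [hΦ]
      rw [hU.sqFun_add (n := m - j) hD.cont_beta.inv hβ1 ht₀' (by omega)]
      · rw [hU.unitCond_le_iff hD.cont_beta.inv]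
        intro x hx hx1
        rw [inv_unitExt _ hx, (hU.unitCond_le_iff hD.cont_beta).1 (by omega) x hx hx1, inv_one]
      · rw [ht₀, hD.zpow_mul_zpow]
        exact hz.trans (hU.zpow_le.2 (by omega))
  refine ⟨_, (hD.mem_eqSpace_iff hη).2 hL, hD.level_ne_zero_of_rOp (x := ⟨rOp t₀⁻¹, 1⟩) ?_, ?_⟩
  · rw [hD.genuineFun_rOp, hφ, sqFun_self hD.alpha_neg_one hy₀]
    exact one_ne_zero
  · intro x hx
    refine (hU.mem_doubleCoset_nOp hj hjm ht₀).2 ?_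
    obtain ⟨hc, h⟩ | ⟨-, h⟩ := hD.genuineRow_ne_zero hx
    · obtain ⟨u, hu, e⟩ := exists_of_sqFun_ne_zero h
      have hu0 := ne_zero_of_norm_one hu
      refine ⟨u⁻¹, by rw [norm_inv, hu, inv_one], ?_⟩
      rw [div_eq_iff hc] at e
      rw [e]
      field_simp
    · exact absurd hΦ0 h

end IsDatum

end Existence

/-! ## Bases of the spaces of equivariant vectors -/

/-- Evaluation at the points `pt` is injective on V, and the matrix of values of the candidates is
triangular with nonzero diagonal. Triangularity, rather than diagonality, allows a vector of lower
level whose support contains later points. -/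
lemma isBasisFor_of_eval {F : Type*} [NontriviallyNormedField F] [IsUltrametricDist F]
    [ProperSpace F] [MeasurableSpace F] [BorelSpace F] {n : ℕ} {V : Submodule ℂ (Mp F → ℂ)}
    {P : Fin n → (Mp F → ℂ) → Prop} (pt : Fin n → Mp F) (hex : ∀ j, ∃ f, P j f)
    (hV : ∀ j f, P j f → f ∈ V) (hinj : ∀ f ∈ V, (∀ j, f (pt j) = 0) → f = 0)
    (hne : ∀ j f, P j f → f (pt j) ≠ 0) (hoff : ∀ i j f, i < j → P j f → f (pt i) = 0) :
    IsBasisFor V P := by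
  refine ⟨hex, fun f hf => ?_⟩
  set A : Matrix (Fin n) (Fin n) ℂ := Matrix.of fun i j => f j (pt i) with hA
  have hdet : A.det ≠ 0 := by
    rw [Matrix.det_of_isLowerTriangular A fun i j hij => hoff i j _ hij (hf j)]
    exact Finset.prod_ne_zero_iff.2 fun i _ => hne i _ (hf i)
  have hsum : ∀ (c : Fin n → ℂ) (i : Fin n), (∑ j, c j • f j) (pt i) = A.mulVec c i := by
    intro c i
    rw [Finset.sum_apply, Matrix.mulVec, dotProduct]
    exact Finset.sum_congr rfl fun j _ => mul_comm _ _
  constructor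
  · rw [Fintype.linearIndependent_iff]
    intro c hc
    have : A.mulVec c = 0 := by
      ext i
      rw [← hsum, hc]; rfl
    exact congrFun (Matrix.eq_zero_of_mulVec_eq_zero hdet this)
  · apply le_antisymm
    · rw [Submodule.span_le]
      rintro _ ⟨j, rfl⟩
      exact hV j _ (hf j)
    · intro v hv
      set c := A⁻¹.mulVec fun i => v (pt i) with hc
      have hAc : A.mulVec c = fun i => v (pt i) := by
        rw [hc, Matrix.mulVec_mulVec, Matrix.mul_nonsing_inv _ (isUnit_iff_ne_zero.2 hdet),
          Matrix.one_mulVec]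
      have h0 : v - ∑ j, c j • f j = 0 := by
        refine hinj _ (V.sub_mem hv (V.sum_mem fun j _ => V.smul_mem _ (hV j _ (hf j)))) fun i => ?_
        rw [Pi.sub_apply, hsum, hAc, sub_self]
      rw [sub_eq_zero.1 h0]
      exact Submodule.sum_mem _ fun j _ =>
        Submodule.smul_mem _ _ (Submodule.subset_span ⟨j, rfl⟩)

section Bases

variable {F : Type*} [NontriviallyNormedField F] [IsUltrametricDist F] [ProperSpace F]
  [MeasurableSpace F] [BorelSpace F]

lemma IsOddUniformizer.exists_sq_class {ϖ : F} (hU : IsOddUniformizer ϖ) {x : F} (hx : ‖x‖ = 1)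
    (hxs : ¬IsSquare x) {t : F} (ht : t ≠ 0) : ∃ u : F, ‖u‖ = 1 ∧
      (t = u ^ 2 * ϖ ^ ord t ∨ t = u ^ 2 * (x * ϖ ^ ord t)) := by
  have hs := hU.norm_unit_part ht
  have hϖ := zpow_ne_zero (ord t) hU.ne_zero
  have e : t = t * ϖ ^ (-ord t) * ϖ ^ ord t := by
    rw [mul_assoc, ← zpow_add₀ hU.ne_zero, neg_add_cancel, zpow_zero, mul_one]
  have hn : ∀ {r s : F}, ‖s‖ = 1 → s = r * r → ‖r‖ = 1 := by
    rintro r s h rfl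
    rw [norm_mul, ← sq] at h
    exact (pow_eq_one_iff_of_nonneg (norm_nonneg _) (by norm_num)).1 h
  by_cases h : IsSquare (t * ϖ ^ (-ord t))
  · obtain ⟨r, hr⟩ := h
    refine ⟨r, hn hs hr, Or.inl ?_⟩
    rw [sq, ← hr]; exact e
  · obtain ⟨r, hr⟩ := (hU.isSquare_mul_iff hs hx).2 (iff_of_false h hxs)
    have hx0 := ne_zero_of_norm_one hx
    have hr1 : ‖r‖ = 1 := hn (by rw [norm_mul, hs, hx, one_mul]) hr
    refine ⟨r / x, by rw [norm_div, hr1, hx, div_one], Or.inr ?_⟩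
    rw [div_pow, sq r, ← hr]
    field_simp
    rw [zpow_neg]
    field_simp

namespace IsDatum

variable {ϖ : F} {ε : ℕ} {ψ : AddChar F ℂ} {μ : Fˣ →* ℂˣ} {η : unitsInt F →* ℂˣ}
  (hD : IsDatum ϖ ε ψ μ η)

include hD

lemma eqSpace_mono {m m' : ℕ} (h : m ≤ m') : eqSpace ψ μ η ε m ≤ eqSpace ψ μ η ε m' := by
  by_cases hm : unitCond η ≤ m
  · intro f hf
    rw [hD.mem_eqSpace hm] at hf
    rw [hD.mem_eqSpace (hm.trans h)]
    exact ⟨hf.1, fun k hk => hf.2 k (hD.unif.levelSet_antitone h hk)⟩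
  · rw [hD.eqSpace_of_lt (not_le.1 hm)]
    exact bot_le

section CosetVector

variable {m : ℕ} {x : SL(2, F)} {f : Mp F → ℂ} (h : IsCosetVector ψ μ η ε m x f)

include h

lemma cosetVector_cond : unitCond η ≤ m := by
  by_contra hm
  have h1 := h.1
  rw [hD.eqSpace_of_lt (not_le.1 hm), Submodule.mem_bot] at h1
  exact h.2.1 h1

lemma cosetVector_isLevel : IsLevel ψ μ η ε m f := (hD.mem_eqSpace_iff (hD.cosetVector_cond h)).1 h.1

lemma cosetVector_ne_zero : f ⟨x, 1⟩ ≠ 0 := by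
  intro h0
  obtain ⟨h1, h2, h3⟩ := h
  rw [hD.mem_eqSpace (hD.cosetVector_cond ⟨h1, h2, h3⟩)] at h1
  apply h2
  funext g
  by_contra hg
  obtain ⟨a, b, e, k, hk, rfl⟩ := h3 hg
  apply hg
  rw [h1.2 k hk, ← tMat_mul_nMat_mp, h1.1.2, h0, mul_zero, mul_zero]
  rfl

lemma cosetVector_eq_zero {g : Mp F} (hg : g ∉ doubleCoset ε m x) : f g = 0 := by
  by_contra h0
  exact hg (h.2.2 h0)

end CosetVector

/-- Passing to the chart t = y⁻¹ multiplies the homogeneity α(u)⁻¹ by χ(u⁻²) = μ(u)⁻², which gives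
β(u)⁻¹. -/
lemma level_nOp_sq {m : ℕ} {f : Mp F → ℂ} (hf : IsLevel ψ μ η ε m f) {u t : F} (hu : ‖u‖ = 1)
    (ht : t ≠ 0) : f ⟨nOp (u ^ 2 * t), 1⟩ = (unitExt (η * resUnits μ) u)⁻¹ * f ⟨nOp t, 1⟩ := by
  have hu0 := ne_zero_of_norm_one hu
  have hu' : ‖u⁻¹‖ = 1 := by rw [norm_inv, hu, inv_one]
  have e : (u ^ 2 * t)⁻¹ = u⁻¹ ^ 2 * t⁻¹ := by rw [mul_inv, inv_pow]
  rw [hD.genuine_nOp hf.genuine (mul_ne_zero (pow_ne_zero 2 hu0) ht), e, hf.sq _ hu',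
    hD.genuine_nOp hf.genuine ht, mul_comm (u⁻¹ ^ 2), hD.torusChar_mul_sq (inv_ne_zero ht) hu',
    hD.alpha_eq hu', hD.beta_eq hu, unitExt_inv η hu, mulExt_inv]
  have := mulExt_ne_zero μ hu0
  have := unitExt_ne_zero η hu
  field_simp

lemma exists_near_of_lt {θ : unitsInt F →* ℂˣ} (hθ : Continuous θ) {n : ℕ} (h : n < unitCond θ) :
    ∃ v : F, ‖v‖ = 1 ∧ ‖v - 1‖ ≤ (resCard F : ℝ) ^ (-(n : ℤ)) ∧ unitExt θ v ≠ 1 := by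
  by_contra! hn
  exact absurd ((hD.unif.unitCond_le_iff hθ).2 hn) (by omega)

lemma norm_sq_sub_one_le {v : F} {r : ℝ} (hv : ‖v‖ = 1) (h : ‖v - 1‖ ≤ r) : ‖v ^ 2 - 1‖ ≤ r := by
  have e : v ^ 2 - 1 = (v - 1) * (v + 1) := by ring
  rw [e, norm_mul]
  exact (mul_le_of_le_one_right (norm_nonneg _) (norm_add_le_of hv.le norm_one.le)).trans h

lemma exists_unitExt_ne_one {θ : unitsInt F →* ℂˣ} (h : θ ≠ 1) :
    ∃ u : F, ‖u‖ = 1 ∧ unitExt θ u ≠ 1 := by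
  by_contra! hn
  exact h ((unitExt_eq_one_iff θ).1 hn)

lemma eq_zero_of_eq_mul {a b : ℂ} (ha : a ≠ 1) (h : b = a * b) : b = 0 := by
  by_contra hb
  exact ha (mul_right_cancel₀ hb (by rw [one_mul]; exact h.symm))

/-- Choose v in 1 + 𝔭^j with α(v) ≠ 1, respectively v in 1 + 𝔭^(m-j) with β(v) ≠ 1. Multiplication
by v² moves y = t⁻¹ within its coset of 𝔭^(-ε), respectively t within its coset of 𝔭^(m+ε), yet
multiplies the value by a factor different from 1. -/
lemma level_nOp_eq_zero {m j : ℕ} {f : Mp F → ℂ} (hf : IsLevel ψ μ η ε m f) (hjm : j < m) {t : F}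
    (ht : ‖t‖ = (resCard F : ℝ) ^ (-((j : ℤ) + ε)))
    (h : j < unitCond (η * (resUnits μ)⁻¹) ∨ m < j + unitCond (η * resUnits μ)) :
    f ⟨nOp t, 1⟩ = 0 := by
  have ht0 : t ≠ 0 := by
    rw [← norm_pos_iff, ht]; exact zpow_pos hD.unif.card_pos _
  obtain h | h := h
  · obtain ⟨v, hv, hv1, hv2⟩ := hD.exists_near_of_lt hD.cont_alpha h
    rw [hD.genuine_nOp hf.genuine ht0, hD.eq_zero_of_eq_mul hv2 (b := f ⟨rOp t⁻¹, 1⟩), mul_zero]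
    rw [← hf.sq v hv]
    have e : v ^ 2 * t⁻¹ = t⁻¹ + (v ^ 2 - 1) * t⁻¹ := by ring
    rw [e, hf.add]
    rw [norm_mul, norm_inv, ht, ← zpow_neg]
    refine (mul_le_mul_of_nonneg_right (hD.norm_sq_sub_one_le hv hv1)
      (zpow_nonneg hD.unif.card_pos.le _)).trans ?_
    rw [hD.zpow_mul_zpow, hD.unif.zpow_le]
    omega
  · obtain ⟨v, hv, hv1, hv2⟩ := hD.exists_near_of_lt (n := m - j) hD.cont_beta (by omega)
    refine hD.eq_zero_of_eq_mul (inv_ne_one.2 hv2) ?_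
    rw [← hD.level_nOp_sq hf hv ht0]
    have e : v ^ 2 * t = t + (v ^ 2 - 1) * t := by ring
    rw [e, hf.op]
    rw [norm_mul, ht]
    refine (mul_le_mul_of_nonneg_right (hD.norm_sq_sub_one_le hv hv1)
      (zpow_nonneg hD.unif.card_pos.le _)).trans ?_
    rw [hD.zpow_mul_zpow, hD.unif.zpow_le]
    omega

/-- An equivariant vector is determined by its values at the representatives of the double cosets
that support equivariant vectors. -/
lemma level_eq_zero {m : ℕ} {f : Mp F → ℂ} (hf : IsLevel ψ μ η ε m f) {x : F} (hx : ‖x‖ = 1)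
    (hxs : ¬IsSquare x) (hw : η * (resUnits μ)⁻¹ = 1 → f ⟨wMat, 1⟩ = 0)
    (h1 : 0 < m → η * resUnits μ = 1 → f ⟨1, 1⟩ = 0)
    (hj : ∀ j : ℕ, 0 < j → j < m → unitCond (η * (resUnits μ)⁻¹) ≤ j →
      j + unitCond (η * resUnits μ) ≤ m →
        f ⟨nOp (ϖ ^ (j + ε)), 1⟩ = 0 ∧ f ⟨nOp (x * ϖ ^ (j + ε)), 1⟩ = 0) : f = 0 := by
  have hU := hD.unif
  have hr0 : f ⟨rOp 0, 1⟩ = 0 := by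
    by_cases hα : η * (resUnits μ)⁻¹ = 1
    · have h := hD.genuine_wMat_nMat hf.genuine 0
      rw [nMat_zero, mul_one, hw hα] at h
      exact (mul_eq_zero.1 h.symm).resolve_left (hD.torusChar_ne_zero (by simp))
    · obtain ⟨u, hu, hu1⟩ := hD.exists_unitExt_ne_one hα
      have := hf.sq u hu 0
      rw [mul_zero] at this
      exact hD.eq_zero_of_eq_mul hu1 this
  have hr : ∀ y, ‖y‖ ≤ (resCard F : ℝ) ^ (ε : ℤ) → f ⟨rOp y, 1⟩ = 0 := by
    intro y hy
    rw [← zero_add y, hf.add y hy, hr0]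
  have h10 : f ⟨1, 1⟩ = 0 := by
    obtain rfl | hm := Nat.eq_zero_or_pos m
    -- At level 0 the invariance of Φ under 𝔭^ε joins t = 0 to t = ϖ^ε, which lies in the ball |y| ≤
    -- q^ε already treated.
    · have hϖ := pow_ne_zero ε hU.ne_zero
      have h := hf.op (ϖ ^ ε) (by rw [hU.norm_pow_eq]; simp) 0
      rw [zero_add, nOp_zero, hD.genuine_nOp hf.genuine hϖ, hr, mul_zero] at h
      · exact h.symm
      · rw [norm_inv, hU.norm_pow_eq, zpow_neg, inv_inv]
    · by_cases hβ : η * resUnits μ = 1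
      · exact h1 hm hβ
      · obtain ⟨u, hu, hu1⟩ := hD.exists_unitExt_ne_one hβ
        exact hD.eq_zero_of_eq_mul hu1 (hf.one u hu).symm
  have hn : ∀ t, t ≠ 0 → f ⟨nOp t, 1⟩ = 0 := by
    intro t ht
    have htn := hU.norm_eq_ord ht
    by_cases c1 : (m : ℤ) + ε ≤ ord t
    · have := hf.op t (by rw [htn, hU.zpow_le]; omega) 0
      rw [zero_add] at this
      rw [this, nOp_zero, h10]
    · by_cases c2 : ord t ≤ ε
      · rw [hD.genuine_nOp hf.genuine ht, hr, mul_zero]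
        rw [norm_inv, htn, ← zpow_neg, hU.zpow_le]
        omega
      · obtain ⟨j, hjt⟩ : ∃ j : ℕ, ord t = ((j + ε : ℕ) : ℤ) := ⟨(ord t - ε).toNat, by omega⟩
        obtain ⟨u, hu, h⟩ := hU.exists_sq_class hx hxs ht
        have hjn : ‖ϖ ^ (j + ε)‖ = (resCard F : ℝ) ^ (-((j : ℤ) + ε)) := by
          rw [hU.norm_pow_eq]; push_cast; rfl
        have hϖ := pow_ne_zero (j + ε) hU.ne_zero
        have hx0 := ne_zero_of_norm_one hx
        have hxn : ‖x * ϖ ^ (j + ε)‖ = (resCard F : ℝ) ^ (-((j : ℤ) + ε)) := by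
          rw [norm_mul, hx, one_mul, hjn]
        have hz : f ⟨nOp (ϖ ^ (j + ε)), 1⟩ = 0 ∧ f ⟨nOp (x * ϖ ^ (j + ε)), 1⟩ = 0 := by
          by_cases c3 : j < unitCond (η * (resUnits μ)⁻¹) ∨ m < j + unitCond (η * resUnits μ)
          · exact ⟨hD.level_nOp_eq_zero hf (by omega) hjn c3,
              hD.level_nOp_eq_zero hf (by omega) hxn c3⟩
          · rw [not_or, not_lt, not_lt] at c3
            exact hj j (by omega) (by omega) c3.1 c3.2
        rw [hjt, zpow_natCast] at h
        obtain h | h := h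
        · rw [h, hD.level_nOp_sq hf hu hϖ, hz.1, mul_zero]
        · rw [h, hD.level_nOp_sq hf hu (mul_ne_zero hx0 hϖ), hz.2, mul_zero]
  refine hD.genuine_eq_zero hf.genuine h10 fun y => ?_
  by_cases hy : y = 0
  · rw [hy, hr0]
  · rw [hD.genuine_rOp hf.genuine hy, hn _ (inv_ne_zero hy), mul_zero]

lemma etaConductor_eq {M : ℕ} (h : ∃ f ∈ eqSpace ψ μ η ε M, f ≠ 0)
    (h' : ∀ m < M, eqSpace ψ μ η ε m = ⊥) : etaConductor ψ μ η ε = M := by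
  rw [etaConductor]
  apply le_antisymm
  · obtain ⟨f, hf, hf0⟩ := h
    exact iInf₂_le M fun hb => hf0 (by rw [hb] at hf; exact (Submodule.mem_bot ℂ).1 hf)
  · refine le_iInf₂ fun m hm => ?_
    rw [Nat.cast_le]
    by_contra hlt
    exact hm (h' m (not_le.1 hlt))

/-! ### The representatives lie in different double cosets -/

section Off

lemma wMat_not_mem_one {m : ℕ} (hm : 0 < m) : (⟨wMat, 1⟩ : Mp F) ∉ doubleCoset ε m 1 := by
  rw [hD.unif.mem_doubleCoset_one hm]
  simp

variable {m j : ℕ} (hj : 0 < j) (hjm : j < m) {t : F}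
  (ht : ‖t‖ = (resCard F : ℝ) ^ (-((j : ℤ) + ε)))

include hj hjm ht

lemma wMat_not_mem_nOp : (⟨wMat, 1⟩ : Mp F) ∉ doubleCoset ε m (nOp t) := by
  rw [hD.unif.mem_doubleCoset_nOp hj hjm ht]
  simp

lemma one_not_mem_nOp : (⟨1, 1⟩ : Mp F) ∉ doubleCoset ε m (nOp t) := by
  rw [hD.unif.mem_doubleCoset_nOp hj hjm ht]
  rintro ⟨u, hu, h⟩
  simp only [one_10, one_11, mul_one] at h
  refine mul_ne_zero ?_ (pow_ne_zero 2 (ne_zero_of_norm_one hu)) h.symm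
  rw [← norm_pos_iff, ht]
  exact zpow_pos hD.unif.card_pos _

lemma nOp_not_mem_nOp_of_norm {s : F} (hs : ‖s‖ ≠ ‖t‖) :
    (⟨nOp s, 1⟩ : Mp F) ∉ doubleCoset ε m (nOp t) := by
  rw [hD.unif.mem_doubleCoset_nOp hj hjm ht]
  rintro ⟨u, hu, h⟩
  apply hs
  simp only [nOp_10, nOp_11, mul_one] at h
  rw [h, norm_mul, norm_pow, hu, one_pow, mul_one]

lemma nOp_not_mem_nOp {x : F} (hx : ‖x‖ = 1) (hxs : ¬IsSquare x) :
    (⟨nOp t, 1⟩ : Mp F) ∉ doubleCoset ε m (nOp (x * t)) := by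
  rw [hD.unif.mem_doubleCoset_nOp hj hjm (by rw [norm_mul, hx, one_mul, ht])]
  rintro ⟨u, hu, h⟩
  have ht0 : t ≠ 0 := by
    rw [← norm_pos_iff, ht]
    exact zpow_pos hD.unif.card_pos _
  have hu0 := ne_zero_of_norm_one hu
  simp only [nOp_10, nOp_11, mul_one] at h
  have h1 : x * u ^ 2 = 1 := mul_left_cancel₀ ht0 (by linear_combination -h)
  exact hxs ⟨u⁻¹, by field_simp; exact h1⟩

end Off

end IsDatum

end Bases

/-! ### The decompositions at each level, from the conductors of α and β -/

section CaseBases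

variable {F : Type*} [NontriviallyNormedField F] [IsUltrametricDist F] [ProperSpace F]
  [MeasurableSpace F] [BorelSpace F]

/-- For n > 0 squaring maps 1 + 𝔭^n onto itself, so θ and θ² are trivial on the same of these
groups. -/
lemma IsOddUniformizer.unitCond_le_of_mul_self {ϖ : F} (hU : IsOddUniformizer ϖ)
    {θ : unitsInt F →* ℂˣ} (hθ : Continuous θ) {n : ℕ} (hn : 0 < n) (h : unitCond (θ * θ) ≤ n) :
    unitCond θ ≤ n := by
  rw [hU.unitCond_le_iff hθ]
  intro u _ hu1
  obtain ⟨v, hv, hv1, hv2⟩ := hU.exists_sq_near hn hu1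
  have := (hU.unitCond_le_iff (hθ.mul hθ)).1 h v hv1 hv2
  rwa [← hv, sq, unitExt_mul θ hv1 hv1, ← mul_unitExt θ θ hv1]

lemma IsOddUniformizer.unitCond_mul_le {ϖ : F} (hU : IsOddUniformizer ϖ)
    {θ χ : unitsInt F →* ℂˣ} (hθ : Continuous θ) (hχ : Continuous χ) {n : ℕ} (h : unitCond θ ≤ n)
    (h' : unitCond χ ≤ n) : unitCond (θ * χ) ≤ n := by
  rw [hU.unitCond_le_iff (hθ.mul hχ)]
  intro u hu hu1
  rw [mul_unitExt θ χ hu, (hU.unitCond_le_iff hθ).1 h u hu hu1,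
    (hU.unitCond_le_iff hχ).1 h' u hu hu1, one_mul]

namespace IsDatum

variable {ϖ : F} {ε : ℕ} {ψ : AddChar F ℂ} {μ : Fˣ →* ℂˣ} {η : unitsInt F →* ℂˣ}
  (hD : IsDatum ϖ ε ψ μ η)

include hD

lemma norm_rep {x : F} (hx : ‖x‖ = 1) (j : ℕ) :
    ‖x * ϖ ^ (j + ε)‖ = (resCard F : ℝ) ^ (-((j : ℤ) + ε)) := by
  rw [norm_mul, hx, one_mul, hD.unif.norm_pow_eq]; push_cast; rfl

lemma norm_rep_one (j : ℕ) : ‖ϖ ^ (j + ε)‖ = (resCard F : ℝ) ^ (-((j : ℤ) + ε)) := by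
  rw [← hD.norm_rep norm_one, one_mul]

section

variable {x : F} (hx : ‖x‖ = 1) (hxs : ¬IsSquare x)

include hx hxs

lemma isBasisFor_zero (hη : η = 1) (hμ : resUnits μ = 1) :
    IsBasisFor (eqSpace ψ μ η ε 0) ![IsCosetVector ψ μ η ε 0 wMat] := by
  refine isBasisFor_of_eval ![⟨wMat, 1⟩] (fun j => ?_) (fun j f h => ?_) (fun f hf h => ?_)
    (fun j f h => ?_) (fun i j f hij h => ?_)
  · fin_cases j
    exact hD.exists_cosetVector_zero hη hμ
  · fin_cases j
    exact h.1
  · refine hD.level_eq_zero ((hD.mem_eqSpace_iff ?_).1 hf) hx hxs (fun _ => h 0)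
      (fun h => absurd h (lt_irrefl _)) fun j _ hj => absurd hj (Nat.not_lt_zero j)
    exact ((hD.unif.unitCond_eq_zero_iff hD.cont_η).2 hη).le
  · fin_cases j
    exact hD.cosetVector_ne_zero h
  · omega

/-- No index j > 0 satisfies j + c(β) ≤ m, and β ≠ 1 excludes the coset of 1. -/
lemma isBasisFor_w {m : ℕ} (hm : 0 < m) (hη : unitCond η ≤ m) (hα : η * (resUnits μ)⁻¹ = 1)
    (hμ : unitCond (resUnits μ) ≤ m) (hβ : η * resUnits μ ≠ 1)
    (hβm : m ≤ unitCond (η * resUnits μ)) :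
    IsBasisFor (eqSpace ψ μ η ε m) ![IsCosetVector ψ μ η ε m wMat] := by
  refine isBasisFor_of_eval ![⟨wMat, 1⟩] (fun j => ?_) (fun j f h => ?_) (fun f hf h => ?_)
    (fun j f h => ?_) (fun i j f hij h => ?_)
  · fin_cases j
    exact hD.exists_cosetVector_wMat hm hη hα hμ
  · fin_cases j
    exact h.1
  · exact hD.level_eq_zero ((hD.mem_eqSpace_iff hη).1 hf) hx hxs (fun _ => h 0)
      (fun _ h => absurd h hβ) fun j _ _ _ hj' => by omega
  · fin_cases j
    exact hD.cosetVector_ne_zero h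
  · omega

lemma isBasisFor_w_one (hη : unitCond η ≤ 1) (hα : η * (resUnits μ)⁻¹ = 1)
    (hμ : unitCond (resUnits μ) ≤ 1) (hβ : η * resUnits μ = 1) :
    IsBasisFor (eqSpace ψ μ η ε 1)
      ![IsCosetVector ψ μ η ε 1 wMat, IsCosetVector ψ μ η ε 1 1] := by
  refine isBasisFor_of_eval ![⟨wMat, 1⟩, ⟨1, 1⟩] (fun j => ?_) (fun j f h => ?_)
    (fun f hf h => ?_) (fun j f h => ?_) (fun i j f hij h => ?_)
  · fin_cases j
    exacts [hD.exists_cosetVector_wMat one_pos hη hα hμ, hD.exists_cosetVector_one one_pos hη hβ hμ]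
  · fin_cases j
    exacts [h.1, h.1]
  · exact hD.level_eq_zero ((hD.mem_eqSpace_iff hη).1 hf) hx hxs (fun _ => h 0)
      (fun _ _ => h 1) fun j _ _ _ hj' => by omega
  · fin_cases j
    exacts [hD.cosetVector_ne_zero h, hD.cosetVector_ne_zero h]
  · fin_cases j
    · exact absurd hij (Fin.not_lt_zero _)
    · fin_cases i
      · exact hD.cosetVector_eq_zero h (hD.wMat_not_mem_one one_pos)
      · exact absurd hij (lt_irrefl _)

/-- One level above c(β) the only admissible index is j = 1. -/
lemma isBasisFor_w_nOp {m : ℕ} (hm : 0 < m) (hη : unitCond η ≤ m) (hα : η * (resUnits μ)⁻¹ = 1)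
    (hμ : unitCond (resUnits μ) ≤ m) (hβ : η * resUnits μ ≠ 1)
    (hβm : m = unitCond (η * resUnits μ)) :
    IsBasisFor (eqSpace ψ μ η ε (m + 1))
      ![IsCosetVector ψ μ η ε (m + 1) wMat, IsCosetVector ψ μ η ε (m + 1) (nOp (ϖ ^ (1 + ε))),
        IsCosetVector ψ μ η ε (m + 1) (nOp (x * ϖ ^ (1 + ε)))] := by
  have hα0 : unitCond (η * (resUnits μ)⁻¹) ≤ 1 := by
    rw [(hD.unif.unitCond_eq_zero_iff hD.cont_alpha).2 hα]; exact zero_le_one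
  have n1 := hD.norm_rep_one 1
  have nx := hD.norm_rep hx 1
  have hm1 : 1 < m + 1 := by omega
  refine isBasisFor_of_eval ![⟨wMat, 1⟩, ⟨nOp (ϖ ^ (1 + ε)), 1⟩, ⟨nOp (x * ϖ ^ (1 + ε)), 1⟩]
    (fun j => ?_) (fun j f h => ?_) (fun f hf h => ?_) (fun j f h => ?_) (fun i j f hij h => ?_)
  · fin_cases j
    exacts [hD.exists_cosetVector_wMat (by omega) (by omega) hα (by omega),
      hD.exists_cosetVector_nOp one_pos hm1 (by omega) hα0 (by omega) n1,
      hD.exists_cosetVector_nOp one_pos hm1 (by omega) hα0 (by omega) nx]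
  · fin_cases j
    exacts [h.1, h.1, h.1]
  · refine hD.level_eq_zero ((hD.mem_eqSpace_iff (by omega)).1 hf) hx hxs (fun _ => h 0)
      (fun _ h => absurd h hβ) fun j hj _ _ hj' => ?_
    obtain rfl : j = 1 := by omega
    exact ⟨h 1, h 2⟩
  · fin_cases j
    exacts [hD.cosetVector_ne_zero h, hD.cosetVector_ne_zero h, hD.cosetVector_ne_zero h]
  · fin_cases j
    · exact absurd hij (Fin.not_lt_zero _)
    · fin_cases i
      · exact hD.cosetVector_eq_zero h (hD.wMat_not_mem_nOp one_pos hm1 n1)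
      · exact absurd hij (by decide)
      · exact absurd hij (by decide)
    · fin_cases i
      · exact hD.cosetVector_eq_zero h (hD.wMat_not_mem_nOp one_pos hm1 nx)
      · exact hD.cosetVector_eq_zero h (hD.nOp_not_mem_nOp one_pos hm1 n1 hx hxs)
      · exact absurd hij (by decide)

/-- The level m' of the vector on the coset of 1 is kept free. For m' = 1 its coset contains the
points nᵒᵖ of index 1, and this is why the representatives are ordered with 1 before them. -/
lemma isBasisFor_w_one_nOp (hη : unitCond η ≤ 1) (hα : η * (resUnits μ)⁻¹ = 1)
    (hμ : unitCond (resUnits μ) ≤ 1) (hβ : η * resUnits μ = 1) {m' : ℕ} (hm' : 0 < m')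
    (hm2 : m' ≤ 2) :
    IsBasisFor (eqSpace ψ μ η ε 2)
      ![IsCosetVector ψ μ η ε 2 wMat, IsCosetVector ψ μ η ε m' 1,
        IsCosetVector ψ μ η ε 2 (nOp (ϖ ^ (1 + ε))),
        IsCosetVector ψ μ η ε 2 (nOp (x * ϖ ^ (1 + ε)))] := by
  have hα0 : unitCond (η * (resUnits μ)⁻¹) ≤ 1 := by
    rw [(hD.unif.unitCond_eq_zero_iff hD.cont_alpha).2 hα]; exact zero_le_one
  have hβ0 : unitCond (η * resUnits μ) = 0 := (hD.unif.unitCond_eq_zero_iff hD.cont_beta).2 hβ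
  have n1 := hD.norm_rep_one 1
  have nx := hD.norm_rep hx 1
  refine isBasisFor_of_eval
    ![⟨wMat, 1⟩, ⟨1, 1⟩, ⟨nOp (ϖ ^ (1 + ε)), 1⟩, ⟨nOp (x * ϖ ^ (1 + ε)), 1⟩]
    (fun j => ?_) (fun j f h => ?_) (fun f hf h => ?_) (fun j f h => ?_) (fun i j f hij h => ?_)
  · fin_cases j
    exacts [hD.exists_cosetVector_wMat (by omega) (by omega) hα (by omega),
      hD.exists_cosetVector_one hm' (by omega) hβ (by omega),
      hD.exists_cosetVector_nOp one_pos one_lt_two (by omega) hα0 (by omega) n1,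
      hD.exists_cosetVector_nOp one_pos one_lt_two (by omega) hα0 (by omega) nx]
  · fin_cases j
    exacts [h.1, hD.eqSpace_mono hm2 h.1, h.1, h.1]
  · refine hD.level_eq_zero ((hD.mem_eqSpace_iff (by omega)).1 hf) hx hxs (fun _ => h 0)
      (fun _ _ => h 1) fun j hj hj2 _ _ => ?_
    obtain rfl : j = 1 := by omega
    exact ⟨h 2, h 3⟩
  · fin_cases j
    exacts [hD.cosetVector_ne_zero h, hD.cosetVector_ne_zero h, hD.cosetVector_ne_zero h,
      hD.cosetVector_ne_zero h]
  · fin_cases j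
    · exact absurd hij (Fin.not_lt_zero _)
    · fin_cases i
      · exact hD.cosetVector_eq_zero h (hD.wMat_not_mem_one hm')
      · exact absurd hij (by decide)
      · exact absurd hij (by decide)
      · exact absurd hij (by decide)
    · fin_cases i
      · exact hD.cosetVector_eq_zero h (hD.wMat_not_mem_nOp one_pos one_lt_two n1)
      · exact hD.cosetVector_eq_zero h (hD.one_not_mem_nOp one_pos one_lt_two n1)
      · exact absurd hij (by decide)
      · exact absurd hij (by decide)
    · fin_cases i
      · exact hD.cosetVector_eq_zero h (hD.wMat_not_mem_nOp one_pos one_lt_two nx)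
      · exact hD.cosetVector_eq_zero h (hD.one_not_mem_nOp one_pos one_lt_two nx)
      · exact hD.cosetVector_eq_zero h (hD.nOp_not_mem_nOp one_pos one_lt_two n1 hx hxs)
      · exact absurd hij (by decide)

/-- With m = c(α) + c(β) the interval c(α) ≤ j ≤ m - c(β) is a single point. -/
lemma isBasisFor_nOp {j m : ℕ} (hη : unitCond η ≤ m) (hα : 0 < unitCond (η * (resUnits μ)⁻¹))
    (hαj : unitCond (η * (resUnits μ)⁻¹) = j) (hβ : 0 < unitCond (η * resUnits μ))
    (hm : j + unitCond (η * resUnits μ) = m) :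
    IsBasisFor (eqSpace ψ μ η ε m)
      ![IsCosetVector ψ μ η ε m (nOp (ϖ ^ (j + ε))),
        IsCosetVector ψ μ η ε m (nOp (x * ϖ ^ (j + ε)))] := by
  have hα1 : η * (resUnits μ)⁻¹ ≠ 1 := fun h => by
    have := (hD.unif.unitCond_eq_zero_iff hD.cont_alpha).2 h; omega
  have hβ1 : η * resUnits μ ≠ 1 := fun h => by
    have := (hD.unif.unitCond_eq_zero_iff hD.cont_beta).2 h; omega
  have n1 := hD.norm_rep_one j
  have nx := hD.norm_rep hx j
  have hj : 0 < j := by omega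
  have hjm : j < m := by omega
  refine isBasisFor_of_eval ![⟨nOp (ϖ ^ (j + ε)), 1⟩, ⟨nOp (x * ϖ ^ (j + ε)), 1⟩]
    (fun j => ?_) (fun j f h => ?_) (fun f hf h => ?_) (fun j f h => ?_) (fun i l f hij h => ?_)
  · fin_cases j
    exacts [hD.exists_cosetVector_nOp hj hjm hη hαj.le hm.le n1,
      hD.exists_cosetVector_nOp hj hjm hη hαj.le hm.le nx]
  · fin_cases j
    exacts [h.1, h.1]
  · refine hD.level_eq_zero ((hD.mem_eqSpace_iff hη).1 hf) hx hxs (fun h => absurd h hα1)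
      (fun _ h => absurd h hβ1) fun j' hj' _ _ _ => ?_
    obtain rfl : j' = j := by omega
    exact ⟨h 0, h 1⟩
  · fin_cases j
    exacts [hD.cosetVector_ne_zero h, hD.cosetVector_ne_zero h]
  · fin_cases l
    · exact absurd hij (Fin.not_lt_zero _)
    · fin_cases i
      · exact hD.cosetVector_eq_zero h (hD.nOp_not_mem_nOp hj hjm n1 hx hxs)
      · exact absurd hij (lt_irrefl _)

/-- One level higher the interval of admissible indices has the two points c(α) and c(α) + 1.
Representatives of different indices are separated by their norms, those of equal index by the
nonsquare x. -/
lemma isBasisFor_nOp_nOp {j m : ℕ} (hη : unitCond η ≤ m)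
    (hα : 0 < unitCond (η * (resUnits μ)⁻¹)) (hαj : unitCond (η * (resUnits μ)⁻¹) = j)
    (hβ : 0 < unitCond (η * resUnits μ)) (hm : j + unitCond (η * resUnits μ) = m) :
    IsBasisFor (eqSpace ψ μ η ε (m + 1))
      ![IsCosetVector ψ μ η ε (m + 1) (nOp (ϖ ^ (j + ε))),
        IsCosetVector ψ μ η ε (m + 1) (nOp (x * ϖ ^ (j + ε))),
        IsCosetVector ψ μ η ε (m + 1) (nOp (ϖ ^ (j + 1 + ε))),
        IsCosetVector ψ μ η ε (m + 1) (nOp (x * ϖ ^ (j + 1 + ε)))] := by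
  have hα1 : η * (resUnits μ)⁻¹ ≠ 1 := fun h => by
    have := (hD.unif.unitCond_eq_zero_iff hD.cont_alpha).2 h; omega
  have hβ1 : η * resUnits μ ≠ 1 := fun h => by
    have := (hD.unif.unitCond_eq_zero_iff hD.cont_beta).2 h; omega
  have n1 := hD.norm_rep_one j
  have nx := hD.norm_rep hx j
  have n1' := hD.norm_rep_one (j + 1)
  have nx' := hD.norm_rep hx (j + 1)
  have hj : 0 < j := by omega
  have hjm : j < m + 1 := by omega
  have hj1 : 0 < j + 1 := by omega
  have hjm1 : j + 1 < m + 1 := by omega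
  have hne : (resCard F : ℝ) ^ (-((j : ℤ) + ε)) ≠ (resCard F : ℝ) ^ (-(((j + 1 : ℕ) : ℤ) + ε)) := by
    rw [ne_eq, hD.unif.zpow_inj]; push_cast; omega
  refine isBasisFor_of_eval ![⟨nOp (ϖ ^ (j + ε)), 1⟩, ⟨nOp (x * ϖ ^ (j + ε)), 1⟩,
      ⟨nOp (ϖ ^ (j + 1 + ε)), 1⟩, ⟨nOp (x * ϖ ^ (j + 1 + ε)), 1⟩]
    (fun j => ?_) (fun j f h => ?_) (fun f hf h => ?_) (fun j f h => ?_) (fun i l f hij h => ?_)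
  · fin_cases j
    exacts [hD.exists_cosetVector_nOp hj hjm (by omega) hαj.le (by omega) n1,
      hD.exists_cosetVector_nOp hj hjm (by omega) hαj.le (by omega) nx,
      hD.exists_cosetVector_nOp hj1 hjm1 (by omega) (by omega) (by omega) n1',
      hD.exists_cosetVector_nOp hj1 hjm1 (by omega) (by omega) (by omega) nx']
  · fin_cases j
    exacts [h.1, h.1, h.1, h.1]
  · refine hD.level_eq_zero ((hD.mem_eqSpace_iff (by omega)).1 hf) hx hxs (fun h => absurd h hα1)
      (fun _ h => absurd h hβ1) fun j' hj' _ _ _ => ?_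
    obtain rfl | rfl : j' = j ∨ j' = j + 1 := by omega
    exacts [⟨h 0, h 1⟩, ⟨h 2, h 3⟩]
  · fin_cases j
    exacts [hD.cosetVector_ne_zero h, hD.cosetVector_ne_zero h, hD.cosetVector_ne_zero h,
      hD.cosetVector_ne_zero h]
  · fin_cases l
    · exact absurd hij (Fin.not_lt_zero _)
    · fin_cases i
      · exact hD.cosetVector_eq_zero h (hD.nOp_not_mem_nOp hj hjm n1 hx hxs)
      · exact absurd hij (by decide)
      · exact absurd hij (by decide)
      · exact absurd hij (by decide)
    · fin_cases i
      · exact hD.cosetVector_eq_zero h (hD.nOp_not_mem_nOp_of_norm hj1 hjm1 n1'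
          (by rw [n1, n1']; exact hne))
      · exact hD.cosetVector_eq_zero h (hD.nOp_not_mem_nOp_of_norm hj1 hjm1 n1'
          (by rw [nx, n1']; exact hne))
      · exact absurd hij (by decide)
      · exact absurd hij (by decide)
    · fin_cases i
      · exact hD.cosetVector_eq_zero h (hD.nOp_not_mem_nOp_of_norm hj1 hjm1 nx'
          (by rw [n1, nx']; exact hne))
      · exact hD.cosetVector_eq_zero h (hD.nOp_not_mem_nOp_of_norm hj1 hjm1 nx'
          (by rw [nx, nx']; exact hne))
      · exact hD.cosetVector_eq_zero h (hD.nOp_not_mem_nOp hj1 hjm1 n1' hx hxs)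
      · exact absurd hij (by decide)

/-- Below c(α) + c(β) the interval of admissible indices is empty, and positivity of both conductors
excludes the cosets of w and 1. -/
lemma eqSpace_eq_bot {m : ℕ} (hα : 0 < unitCond (η * (resUnits μ)⁻¹))
    (hβ : 0 < unitCond (η * resUnits μ))
    (hm : m < unitCond (η * (resUnits μ)⁻¹) + unitCond (η * resUnits μ)) :
    eqSpace ψ μ η ε m = ⊥ := by
  have hα1 : η * (resUnits μ)⁻¹ ≠ 1 := fun h => by
    have := (hD.unif.unitCond_eq_zero_iff hD.cont_alpha).2 h; omega
  have hβ1 : η * resUnits μ ≠ 1 := fun h => by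
    have := (hD.unif.unitCond_eq_zero_iff hD.cont_beta).2 h; omega
  by_cases hη : unitCond η ≤ m
  · rw [Submodule.eq_bot_iff]
    intro f hf
    exact hD.level_eq_zero ((hD.mem_eqSpace_iff hη).1 hf) hx hxs (fun h => absurd h hα1)
      (fun _ h => absurd h hβ1) fun j' hj' _ _ _ => by omega
  · exact hD.eqSpace_of_lt (not_le.1 hη)

end

end IsDatum

end CaseBases

/-! ## Whittaker functionals -/

section Whittaker

variable {F : Type*} [NontriviallyNormedField F] [IsUltrametricDist F] [ProperSpace F]
  [MeasurableSpace F] [BorelSpace F]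

lemma tendsto_of_entries {f : F → SL(2, F)} {t : F} (h : ∀ i j, Continuous fun b => (f b).1 i j)
    (ht : f t = 1) : Tendsto f (𝓝 t) (𝓝 1) := by
  have hc : Continuous f :=
    Continuous.subtype_mk (continuous_pi fun i => continuous_pi fun j => h i j) _
  rw [← ht]
  exact hc.tendsto t

lemma tendsto_nMat : Tendsto (nMat : F → SL(2, F)) (𝓝 0) (𝓝 1) := by
  refine tendsto_of_entries (fun i j => ?_) nMat_zero
  fin_cases i <;> fin_cases j <;> simp [nMat] <;> fun_prop

lemma tendsto_nOp : Tendsto (nOp : F → SL(2, F)) (𝓝 0) (𝓝 1) := by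
  refine tendsto_of_entries (fun i j => ?_) nOp_zero
  fin_cases i <;> fin_cases j <;> simp [nOp] <;> fun_prop

lemma locallyConstant_rOp {f : Mp F → ℂ} (hf : IsLocallyConstant f) :
    IsLocallyConstant fun y => f ⟨rOp y, 1⟩ := by
  rw [IsLocallyConstant.iff_eventually_eq]
  intro y
  have h := tendsto_nMat.eventually (isLocallyConstant_mp_iff.1 hf ⟨rOp y, 1⟩)
  have h2 : Tendsto (fun x : F => x - y) (𝓝 y) (𝓝 0) := by
    have : Continuous fun x : F => x - y := by fun_prop
    simpa using this.tendsto y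
  filter_upwards [h2.eventually h] with x hx
  rw [← hx]
  congr 1
  apply Mp.ext
  · rw [Mp.mul_mat, rOp_mul_nMat, add_sub_cancel]
  · rw [Mp.mul_sgn, kubota_mul_nMat, mul_one, mul_one]

lemma eventually_nOp {f : Mp F → ℂ} (hf : IsLocallyConstant f) :
    ∀ᶠ t in 𝓝 (0 : F), f ⟨nOp t, 1⟩ = f ⟨1, 1⟩ := by
  filter_upwards [tendsto_nOp.eventually (isLocallyConstant_mp_iff.1 hf ⟨1, 1⟩)] with t ht
  rw [← ht]
  congr 1
  apply Mp.ext
  · rw [Mp.mul_mat, one_mul]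
  · rw [Mp.mul_sgn, kubota_one_left, mul_one, mul_one]

namespace IsDatum

variable {ϖ : F} {ε : ℕ} {ψ : AddChar F ℂ} {μ : Fˣ →* ℂˣ} {η : unitsInt F →* ℂˣ}
  (hD : IsDatum ϖ ε ψ μ η)

include hD

lemma continuous_integrand {Ψ : AddChar F ℂ} (hΨ : Continuous Ψ) {f : Mp F → ℂ}
    (hf : f ∈ principalSeries ψ μ) : Continuous fun x => f ⟨rOp x, 1⟩ * Ψ (-x) :=
  (locallyConstant_rOp hf.1).continuous.mul (hΨ.comp continuous_neg)

/-- If the shells beyond radius q^N contribute nothing, the partial integrals are eventually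
constant. The factor χ(-1) comes from replacing w n(x) by `rOp x`. -/
lemma tendsto_whittakerPartial {Ψ : AddChar F ℂ} (hΨ : Continuous Ψ) {f : Mp F → ℂ}
    (hf : f ∈ principalSeries ψ μ) {N : ℤ}
    (h : ∀ k, N < k → ∫ x in zsphere F k, f ⟨rOp x, 1⟩ * Ψ (-x) ∂haarF F = 0) :
    Tendsto (whittakerPartial Ψ f) atTop
      (𝓝 (torusChar ψ μ (-1) * ∫ x in zball F N, f ⟨rOp x, 1⟩ * Ψ (-x) ∂haarF F)) := by
  refine tendsto_const_nhds.congr' ?_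
  filter_upwards [eventually_ge_atTop N.toNat] with r hr
  have hle : N ≤ r := by omega
  rw [← hD.unif.setIntegral_zball_eq (hD.continuous_integrand hΨ hf) hle h, whittakerPartial,
    ← integral_const_mul]
  refine integral_congr_ae (Eventually.of_forall fun x => ?_)
  beta_reduce
  rw [hD.genuine_wMat_nMat hf.2, hD.unif.conj_addChar hΨ, mul_assoc]

lemma whittaker_eq {Ψ : AddChar F ℂ} (hΨ : Continuous Ψ) {f : Mp F → ℂ}
    (hf : f ∈ principalSeries ψ μ) {N : ℤ}
    (h : ∀ k, N < k → ∫ x in zsphere F k, f ⟨rOp x, 1⟩ * Ψ (-x) ∂haarF F = 0) :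
    whittaker Ψ f = torusChar ψ μ (-1) * ∫ x in zball F N, f ⟨rOp x, 1⟩ * Ψ (-x) ∂haarF F :=
  (hD.tendsto_whittakerPartial hΨ hf h).limUnder_eq

/-- A shell does not contribute if the function is invariant under a translation by an element on
which the additive character is nontrivial. -/
lemma shell_eq_zero {Ψ : AddChar F ℂ} {f : Mp F → ℂ} {k : ℤ} {t : F} (ht : Ψ t ≠ 1)
    (htk : ‖t‖ < (resCard F : ℝ) ^ k)
    (h : ∀ y ∈ zsphere F k, f ⟨rOp (y - t), 1⟩ = f ⟨rOp y, 1⟩) :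
    ∫ x in zsphere F k, f ⟨rOp x, 1⟩ * Ψ (-x) ∂haarF F = 0 := by
  refine setIntegral_eq_zero_of_shift (t := -t) (c := Ψ t) (measurableSet_zsphere k) (fun x => ?_)
    ht fun x hx => ?_
  · rw [mem_zsphere, mem_zsphere]
    constructor <;> intro hx
    · rw [← hx, ← norm_add_eq_left (x := x + -t) (y := t) (by rwa [hx])]
      simp
    · rw [← hx, norm_add_eq_left (by rwa [norm_neg, hx])]
  · rw [← sub_eq_add_neg, h x hx, neg_sub, sub_eq_add_neg, AddChar.map_add_eq_mul]
    ring

/-- Far away from the origin the values at `rOp y` are given by the character of the torus. -/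
lemma shell_eq_zero_of_far {Ψ : AddChar F ℂ} {f : Mp F → ℂ} (hf : IsGenuine ψ μ f) {m : ℕ}
    (hm : 0 < m) (hμ : unitCond (resUnits μ) ≤ m) {N : ℤ}
    (h1 : ∀ t : F, ‖t‖ ≤ (resCard F : ℝ) ^ (-N) → f ⟨nOp t, 1⟩ = f ⟨1, 1⟩) {k : ℤ} (hk : N ≤ k)
    {t : F} (ht : Ψ t ≠ 1) (htk : ‖t‖ ≤ (resCard F : ℝ) ^ (k - m)) :
    ∫ x in zsphere F k, f ⟨rOp x, 1⟩ * Ψ (-x) ∂haarF F = 0 := by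
  refine hD.shell_eq_zero ht (htk.trans_lt (hD.unif.zpow_lt.2 (by omega))) fun y hy => ?_
  have hyn := mem_zsphere.1 hy
  have hy0 : y ≠ 0 := by
    rw [← norm_pos_iff, hyn]; exact zpow_pos hD.unif.card_pos _
  obtain ⟨e1, -, e2⟩ := hD.torusChar_inv_near hm hμ hy0 (z := -t) (by
    rw [norm_neg, hyn, hD.zpow_mul_zpow]
    exact htk)
  have hy1 : y - t ≠ 0 := by
    rw [← norm_pos_iff, sub_eq_add_neg, e1, hyn]; exact zpow_pos hD.unif.card_pos _
  rw [hD.genuine_rOp hf hy1, hD.genuine_rOp hf hy0, sub_eq_add_neg, e2, h1, h1]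
  · rw [norm_inv, hyn, ← zpow_neg, hD.unif.zpow_le]; omega
  · rw [norm_inv, e1, hyn, ← zpow_neg, hD.unif.zpow_le]; omega

/-- The limits defining the Whittaker functionals exist. -/
lemma exists_whittaker {Ψ : AddChar F ℂ} (hΨ : Continuous Ψ) (hΨ1 : Ψ ≠ 1) {f : Mp F → ℂ}
    (hf : f ∈ principalSeries ψ μ) :
    Tendsto (whittakerPartial Ψ f) atTop (𝓝 (whittaker Ψ f)) := by
  have hU := hD.unif
  obtain ⟨δ, hδ, h1⟩ := Metric.eventually_nhds_iff.1 (eventually_nOp hf.1)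
  obtain ⟨n₁, hn₁⟩ := hU.exists_zpow_lt hδ
  obtain ⟨t, ht⟩ : ∃ t, Ψ t ≠ 1 := by
    by_contra! h
    exact hΨ1 (by ext x; rw [h x]; simp)
  obtain ⟨n₃, hn₃⟩ := hU.exists_lt_zpow ‖t‖
  -- Far out φ is a multiple of χ⁻¹, which is invariant under relative perturbations in 𝔭^m. Once
  -- |y| ≥ q^(n₃+m) these include translation by t, where Ψ is nontrivial; n₁ measures how near to 0
  -- the function Φ is constant.
  set m := unitCond (resUnits μ) + 1 with hm
  have key := hD.tendsto_whittakerPartial hΨ hf (N := n₁ + n₃ + m) fun k hk =>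
    hD.shell_eq_zero_of_far hf.2 (m := m) (by omega) (by omega) (N := n₁) (fun t ht => h1 (by
      rw [dist_zero_right]; exact ht.trans_lt hn₁)) (by omega) ht
      (hn₃.le.trans (hU.zpow_le.2 (by omega)))
  rwa [whittaker, key.limUnder_eq]

lemma coset_mem {m : ℕ} {x : SL(2, F)} {f : Mp F → ℂ} (h : IsCosetVector ψ μ η ε m x f) :
    f ∈ principalSeries ψ μ := ((hD.mem_eqSpace (hD.cosetVector_cond h)).1 h.1).1

lemma continuous_mulShift (κ : F) : Continuous (ψ.mulShift κ) := by
  have : (ψ.mulShift κ : F → ℂ) = fun x => ψ (κ * x) := by ext x; rw [AddChar.mulShift_apply]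
  rw [this]
  exact hD.cont_ψ.comp (continuous_const_mul κ)

lemma psi_eq_one {x : F} (h : ‖x‖ ≤ (resCard F : ℝ) ^ (ε : ℤ)) : ψ x = 1 := by
  have := (hD.unif.addCond_spec hD.cont_ψ hD.ψ_ne).1
  rw [hD.cond, neg_neg] at this
  exact this x h

lemma exists_psi_ne_one {κ : F} (hκ : ‖κ‖ = 1) :
    ∃ t : F, ‖t‖ ≤ (resCard F : ℝ) ^ ((ε : ℤ) + 1) ∧ ψ (κ * t) ≠ 1 := by
  have h := (hD.unif.addCond_spec hD.cont_ψ hD.ψ_ne).2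
  apply hD.unif.exists_addChar_mul_ne_one h
  rw [hκ, hD.cond, ← zpow_zero (resCard F : ℝ), hD.unif.zpow_le]
  omega

lemma integral_zball_psi {κ : F} (hκ : ‖κ‖ ≤ 1) :
    ∫ x in zball F ε, ψ (-(κ * x)) ∂haarF F = (resCard F : ℂ) ^ (ε : ℤ) := by
  rw [setIntegral_congr_fun (g := fun _ => (1 : ℂ)) (measurableSet_zball _), setIntegral_const,
    hD.unif.measureReal_zball]
  · simp
  · intro x hx
    apply hD.psi_eq_one
    rw [norm_neg, norm_mul]
    exact (mul_le_of_le_one_left (norm_nonneg _) hκ).trans (mem_zball.1 hx)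

lemma cardC_ne_zero : (resCard F : ℂ) ≠ 0 := by exact_mod_cast hD.unif.card_pos.ne'

lemma torusChar_neg_one_ne_zero : torusChar ψ μ (-1) ≠ 0 := hD.torusChar_ne_zero (by simp)

/-- On the ball of radius `q ^ ε` an equivariant vector is constant. -/
lemma level_zball {m : ℕ} {f : Mp F → ℂ} (hf : IsLevel ψ μ η ε m f) {y : F}
    (hy : ‖y‖ ≤ (resCard F : ℝ) ^ (ε : ℤ)) : f ⟨rOp y, 1⟩ = f ⟨rOp 0, 1⟩ := by
  rw [← zero_add y, hf.add y hy]

lemma rOp_zero_ne_zero {m : ℕ} {f : Mp F → ℂ} (h : IsCosetVector ψ μ η ε m wMat f) :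
    f ⟨rOp 0, 1⟩ ≠ 0 := by
  have h1 := hD.cosetVector_ne_zero h
  have h2 := hD.genuine_wMat_nMat (hD.coset_mem h).2 0
  rw [nMat_zero, mul_one] at h2
  rw [h2] at h1
  exact right_ne_zero_of_mul h1

/-- At positive level φ is a nonzero constant on the ball |y| ≤ q^ε, where ψ is trivial, and
vanishes outside it. -/
lemma whittaker_wMat_ne_zero {m : ℕ} (hm : 0 < m) {f : Mp F → ℂ}
    (h : IsCosetVector ψ μ η ε m wMat f) {κ : F} (hκ : ‖κ‖ = 1) :
    whittaker (ψ.mulShift κ) f ≠ 0 := by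
  have hf := hD.coset_mem h
  rw [hD.whittaker_eq (hD.continuous_mulShift κ) hf (N := ε)]
  · refine mul_ne_zero hD.torusChar_neg_one_ne_zero ?_
    rw [setIntegral_congr_fun (g := fun x => f ⟨rOp 0, 1⟩ * ψ (-(κ * x))) (measurableSet_zball _),
      integral_const_mul, hD.integral_zball_psi hκ.le]
    · exact mul_ne_zero (hD.rOp_zero_ne_zero h) (zpow_ne_zero _ hD.cardC_ne_zero)
    · intro x hx
      beta_reduce
      rw [hD.level_zball (hD.cosetVector_isLevel h) (mem_zball.1 hx), AddChar.mulShift_apply, mul_neg]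
  · intro k hk
    rw [setIntegral_congr_fun (g := fun _ => (0 : ℂ)) (measurableSet_zsphere _), integral_zero]
    intro x hx
    beta_reduce
    rw [hD.cosetVector_eq_zero h, zero_mul]
    rw [hD.unif.mem_doubleCoset_wMat hm, rOp_10, rOp_11, norm_one, mul_one, mem_zsphere.1 hx,
      hD.unif.zpow_le]
    omega

end IsDatum

end Whittaker

/-! ### Whittaker values on the coset of 1 at level one and of the spherical vector -/

section WhittakerOne

variable {F : Type*} [NontriviallyNormedField F] [IsUltrametricDist F] [ProperSpace F]
  [MeasurableSpace F] [BorelSpace F]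

namespace IsDatum

variable {ϖ : F} {ε : ℕ} {ψ : AddChar F ℂ} {μ : Fˣ →* ℂˣ} {η : unitsInt F →* ℂˣ}
  (hD : IsDatum ϖ ε ψ μ η)

include hD

/-- Homogeneity of the character of the torus on spheres. -/
lemma torusChar_unit_mul {u y y₁ : F} (hu : ‖u‖ = 1) (hy₁ : y₁ ≠ 0) (hy : ‖y‖ = ‖y₁‖) :
    (torusChar ψ μ (u * y))⁻¹ =
      (torusChar ψ μ (u * y₁))⁻¹ * torusChar ψ μ y₁ * (torusChar ψ μ y)⁻¹ := by
  have hU := hD.unif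
  have hu0 := ne_zero_of_norm_one hu
  have hy0 : y ≠ 0 := by rw [← norm_pos_iff, hy]; exact norm_pos_iff.2 hy₁
  have hv : ‖y / y₁‖ = 1 := by rw [norm_div, hy, div_self (norm_ne_zero_iff.2 hy₁)]
  have e : hilbert u y = hilbert u y₁ := by
    have : y = y / y₁ * y₁ := by field_simp
    rw [this, hU.hilbert_mul_right hu0 (ne_zero_of_norm_one hv) hy₁, hU.hilbert_unit_unit hu hv,
      one_mul]
  have h1 := hD.torusChar_ne_zero (μ := μ) hy₁
  have h2 := hD.torusChar_ne_zero (μ := μ) hy0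
  rw [hD.torusChar_mul hu0 hy0, hD.torusChar_mul hu0 hy₁, e]
  have h3 := hD.torusChar_ne_zero (μ := μ) hu0
  have h4 := sgnC_ne_zero (hilbert u y₁)
  field_simp

lemma integral_zsphere_psi {κ : F} (hκ : ‖κ‖ = 1) :
    ∫ x in zsphere F ((ε : ℤ) + 1), ψ (-(κ * x)) ∂haarF F = -(resCard F : ℂ) ^ (ε : ℤ) := by
  have hcont : Continuous fun x : F => ψ (-(κ * x)) :=
    hD.cont_ψ.comp (continuous_const_mul κ).neg
  have h := hD.unif.setIntegral_zball_succ hcont ((ε : ℤ) + 1)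
  rw [add_sub_cancel_right, hD.integral_zball_psi hκ.le] at h
  have h0 : ∫ x in zball F ((ε : ℤ) + 1), ψ (-(κ * x)) ∂haarF F = 0 := by
    simp only [← neg_mul]
    exact hD.unif.setIntegral_addChar_eq_zero (hD.exists_psi_ne_one (by rwa [norm_neg]))
  rw [h0] at h
  linear_combination -h

/-- φ vanishes on |y| ≤ q^ε and equals a multiple of χ⁻¹ beyond. As c(μ) ≤ 1, the shells beyond |y|
= q^(ε+1) cancel, and the integral over this one shell is a Gauss sum of χ⁻¹ against ψ_κ. It is
shown nonzero without being computed when χ⁻¹ is not constant there. -/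
lemma whittaker_one_ne_zero (hμ : unitCond (resUnits μ) ≤ 1) {f : Mp F → ℂ}
    (h : IsCosetVector ψ μ η ε 1 1 f) {κ : F} (hκ : ‖κ‖ = 1) :
    whittaker (ψ.mulShift κ) f ≠ 0 := by
  have hU := hD.unif
  have hf := hD.coset_mem h
  have hL := hD.cosetVector_isLevel h
  have hop : ∀ t : F, ‖t‖ ≤ (resCard F : ℝ) ^ (-((ε : ℤ) + 1)) → f ⟨nOp t, 1⟩ = f ⟨1, 1⟩ := by
    intro t ht
    have := hL.op t (ht.trans_eq (by congr 2; push_cast; ring)) 0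
    rwa [zero_add, nOp_zero] at this
  have h1 := hD.cosetVector_ne_zero h
  obtain ⟨t, ht, ht1⟩ := hD.exists_psi_ne_one hκ
  set φ : F → ℂ := fun y => f ⟨rOp y, 1⟩ with hφ
  have hφc : Continuous φ := (locallyConstant_rOp hf.1).continuous
  have hφ0 : ∀ y, ‖y‖ ≤ (resCard F : ℝ) ^ (ε : ℤ) → φ y = 0 := by
    intro y hy
    apply hD.cosetVector_eq_zero h
    rw [hU.mem_doubleCoset_one one_pos, rOp_10, rOp_11, norm_one, not_le]
    refine (mul_le_mul_of_nonneg_left hy (zpow_nonneg hU.card_pos.le _)).trans_lt ?_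
    rw [hD.zpow_mul_zpow, ← zpow_zero (resCard F : ℝ), hU.zpow_lt]
    push_cast
    omega
  have hφ1 : ∀ y, ‖y‖ = (resCard F : ℝ) ^ ((ε : ℤ) + 1) →
      φ y = (torusChar ψ μ y)⁻¹ * f ⟨1, 1⟩ := by
    intro y hy
    have hy0 : y ≠ 0 := by
      rw [← norm_pos_iff, hy]; exact zpow_pos hU.card_pos _
    simp only [hφ]
    rw [hD.genuine_rOp hf.2 hy0, hop]
    rw [norm_inv, hy, ← zpow_neg]
  set N : ℤ := (ε : ℤ) + 1 with hN
  rw [hD.whittaker_eq (hD.continuous_mulShift κ) hf (N := N)]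
  swap
  · intro k hk
    refine hD.shell_eq_zero_of_far hf.2 one_pos hμ hop (k := k) hk.le (t := t)
      (by rwa [AddChar.mulShift_apply]) ?_
    exact ht.trans (hU.zpow_le.2 (by push_cast; omega))
  refine mul_ne_zero hD.torusChar_neg_one_ne_zero ?_
  set I : F → ℂ := fun κ => ∫ x in zball F N, φ x * ψ (κ * x) ∂haarF F with hI
  have hgoal : ∫ x in zball F N, f ⟨rOp x, 1⟩ * ψ.mulShift κ (-x) ∂haarF F = I (-κ) := by
    simp only [hI, hφ, AddChar.mulShift_apply, mul_neg, neg_mul]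
  rw [hgoal]
  have hcont : ∀ κ : F, Continuous fun x => φ x * ψ (κ * x) := fun κ =>
    hφc.mul (hD.cont_ψ.comp (continuous_const_mul κ))
  set y₁ : F := ϖ ^ (-N) with hy₁
  have hy₁n : ‖y₁‖ = (resCard F : ℝ) ^ N := by rw [hy₁, hU.norm_zpow, neg_neg]
  have hy₁0 : y₁ ≠ 0 := zpow_ne_zero _ hU.ne_zero
  have hφy₁ : φ y₁ ≠ 0 := by
    rw [hφ1 _ hy₁n]
    exact mul_ne_zero (inv_ne_zero (hD.torusChar_ne_zero hy₁0)) h1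
  have hIs : ∀ κ : F, I κ = ∫ x in zsphere F N, φ x * ψ (κ * x) ∂haarF F := by
    intro κ
    simp only [hI]
    rw [hU.setIntegral_zball_succ (hcont κ),
      setIntegral_congr_fun (g := fun _ => (0 : ℂ)) (measurableSet_zball _), integral_zero,
      zero_add]
    intro x hx
    beta_reduce
    rw [hφ0, zero_mul]
    rw [hN, add_sub_cancel_right] at hx
    exact mem_zball.1 hx
  have hmul : ∀ u : F, ‖u‖ = 1 → ∀ y ∈ zsphere F N,
      φ (u * y) = (torusChar ψ μ (u * y₁))⁻¹ * torusChar ψ μ y₁ * φ y := by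
    intro u hu y hy
    rw [hφ1 _ hy, hφ1 _ (by rw [norm_mul, hu, one_mul]; exact hy),
      hD.torusChar_unit_mul hu hy₁0 (hy.trans hy₁n.symm)]
    ring
  set δ : F → ℂ := fun u => (torusChar ψ μ (u * y₁))⁻¹ * torusChar ψ μ y₁ with hδ
  -- δ(u) is the factor by which φ changes under multiplication by the unit u on the shell. If it is
  -- always 1, then φ is constant there and only the integral of ψ over the shell is needed.
  by_cases hall : ∀ u : F, ‖u‖ = 1 → δ u = 1
  · have hconst : ∀ y ∈ zsphere F N, φ y = φ y₁ := by
      intro y hy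
      have hu : ‖y / y₁‖ = 1 := by
        rw [norm_div, hy₁n, mem_zsphere.1 hy, div_self (zpow_pos hU.card_pos _).ne']
      have := hmul _ hu y₁ hy₁n
      rw [div_mul_cancel₀ _ hy₁0] at this
      rw [this]
      have := hall _ hu
      simp only [hδ, div_mul_cancel₀ _ hy₁0] at this
      rw [this, one_mul]
    rw [hIs, setIntegral_congr_fun (g := fun x => φ y₁ * ψ (-(κ * x))) (measurableSet_zsphere _),
      integral_const_mul, hD.integral_zsphere_psi hκ]
    · exact mul_ne_zero hφy₁ (neg_ne_zero.2 (zpow_ne_zero _ hD.cardC_ne_zero))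
    · intro x hx
      beta_reduce
      rw [hconst x hx, neg_mul]
  · push Not at hall
    obtain ⟨u₀, hu₀, hδ₀⟩ := hall
    intro hzero
    apply hφy₁
    have hspec := hU.addCond_spec hD.cont_ψ hD.ψ_ne
    rw [hD.cond, neg_neg] at hspec
    refine hU.eq_zero_of_fourier hD.cont_ψ hφc (N := N) (E := ε) (R := 0) (by omega)
      (by simpa using hspec.1) (by simpa using hspec.2) (fun κ' hκ' => ?_) hy₁n.le
      (fun s hs => hL.add s hs y₁)
    rw [zpow_zero] at hκ'
    show I κ' = 0
    -- For |κ'| < 1 the character is trivial on the shell and δ(u₀) ≠ 1 kills the integral. For |κ'|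
    -- = 1 the coefficient is a multiple of the one at -κ, assumed zero. All coefficients with |κ'|
    -- ≤ 1 then vanish, and Fourier inversion contradicts φ(y₁) ≠ 0.
    obtain hlt | heq := hκ'.lt_or_eq
    · rw [hIs]
      refine setIntegral_eq_zero_of_unit_mul (measurableSet_zsphere _) hu₀
        (zsphere_unit_mul hu₀) hδ₀ fun x hx => ?_
      have hone : ∀ x ∈ zsphere F N, ψ (κ' * x) = 1 := by
        intro x hx
        apply hD.psi_eq_one
        rw [← zpow_zero (resCard F : ℝ), hU.norm_lt_zpow] at hlt
        rw [norm_mul, mem_zsphere.1 hx]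
        refine (mul_le_mul_of_nonneg_right hlt (zpow_nonneg hU.card_pos.le _)).trans ?_
        rw [hD.zpow_mul_zpow, hU.zpow_le]
        omega
      rw [hone _ hx, hone _ ((zsphere_unit_mul hu₀ x).2 hx), hmul u₀ hu₀ x hx, mul_one, mul_one]
    · have hu : ‖-κ / κ'‖ = 1 := by rw [norm_div, norm_neg, hκ, heq, div_one]
      have hκ'0 := ne_zero_of_norm_one heq
      rw [hIs, ← setIntegral_unit_mul (measurableSet_zsphere _) hu (zsphere_unit_mul hu),
        setIntegral_congr_fun (g := fun x => δ (-κ / κ') * (φ x * ψ (-κ * x)))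
          (measurableSet_zsphere _), integral_const_mul, ← hIs, hzero, mul_zero]
      intro x hx
      beta_reduce
      rw [hmul _ hu x hx, mul_assoc]
      have e : κ' * (-κ / κ' * x) = -κ * x := by field_simp
      rw [e]

/-- Both sides are unramified characters, hence determined by their values at ϖ, where |ϖ|^(-1/2) =
q^(1/2). -/
lemma isHalfTwist_iff (hμ : resUnits μ = 1) {a : F} (ha : ‖a‖ = 1) : IsHalfTwist μ a ↔
    mulExt μ ϖ = sgnC (leg ϖ a) * (((resCard F : ℝ) ^ (1 / 2 : ℝ) : ℝ) : ℂ) := by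
  have hU := hD.unif
  have ha0 := ne_zero_of_norm_one ha
  have hval : ∀ x : F, x ≠ 0 → sgnC (hilbert x a) * ((‖x‖ ^ (-(1 / 2) : ℝ) : ℝ) : ℂ) =
      (sgnC (leg ϖ a) * (((resCard F : ℝ) ^ (1 / 2 : ℝ) : ℝ) : ℂ)) ^ ord x := by
    intro x hx
    have e1 : sgnC (leg ϖ a ^ ord x) = sgnC (leg ϖ a) ^ ord x := by
      rw [units_zpow]
      obtain h | h := Int.even_or_odd' (ord x) |>.choose_spec
      · rw [h, if_pos (even_two_mul _), zpow_mul, zpow_ofNat, sq, sgnC_mul_self, one_zpow, sgnC_one]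
      · rw [h, if_neg (by simp [Int.even_add_one]), zpow_add₀ (sgnC_ne_zero _), zpow_mul, zpow_ofNat,
          sq, sgnC_mul_self, one_zpow, one_mul, zpow_one]
    rw [hU.hilbert_eq hx ha0, hU.ord_of_norm_one ha, mul_zero, zpow_zero, zpow_zero, one_mul,
      one_mul, e1, mul_zpow, hU.norm_eq_ord hx]
    congr 1
    rw [← Complex.ofReal_zpow, ← Real.rpow_intCast, ← Real.rpow_intCast, ← Real.rpow_mul
      hU.card_pos.le, ← Real.rpow_mul hU.card_pos.le]
    congr 2
    push_cast
    ring
  have hμ1 : ∀ u : F, ‖u‖ = 1 → mulExt μ u = 1 := fun u hu => by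
    rw [← unitExt_resUnits μ hu, hD.eq_one_iff_unitExt hμ hu]
  have hμx : ∀ x : F, x ≠ 0 → mulExt μ x = mulExt μ ϖ ^ ord x := by
    intro x hx
    have h := hμ1 _ (hU.norm_unit_part hx)
    rw [mulExt_mul, mulExt_zpow, zpow_neg] at h
    exact (mul_inv_eq_one₀ (zpow_ne_zero _ (mulExt_ne_zero μ hU.ne_zero))).1 h
  constructor
  · intro h
    have h1 := h (Units.mk0 ϖ hU.ne_zero)
    have h2 := hval ϖ hU.ne_zero
    have h3 : ord ϖ = 1 := by simpa using hU.ord_zpow 1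
    rw [h3, zpow_one] at h2
    rw [← h2, ← Units.val_mk0 hU.ne_zero, mulExt_coe, h1]
    rfl
  · intro h x
    rw [← mulExt_coe, hμx _ x.ne_zero, h, ← hval _ x.ne_zero]
    rfl

/-- The ball |y| ≤ q^ε contributes f(`rOp 0`) q^ε. On the next shell χ⁻¹ is a constant times y ↦
γ(ψ_y), whose Fourier transform is a multiple of `leg ϖ κ`. All further shells vanish. -/
lemma whittaker_zero_ne_zero_iff (hμ : resUnits μ = 1) {f : Mp F → ℂ}
    (h : IsCosetVector ψ μ η ε 0 wMat f) {κ : F} (hκ : ‖κ‖ = 1) :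
    whittaker (ψ.mulShift κ) f ≠ 0 ↔
      mulExt μ ϖ ≠ -sgnC (leg ϖ κ) * (((resCard F : ℝ) ^ (1 / 2 : ℝ) : ℝ) : ℂ) := by
  have hU := hD.unif
  have hf := hD.coset_mem h
  have hL := hD.cosetVector_isLevel h
  have hqC := hD.cardC_ne_zero
  have hμ0 : unitCond (resUnits μ) ≤ 1 := by
    rw [(hU.unitCond_eq_zero_iff (continuous_resUnits hD.cont_μ)).2 hμ]; exact zero_le_one
  have hμ1 : ∀ u : F, ‖u‖ = 1 → mulExt μ u = 1 := fun u hu => by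
    rw [← unitExt_resUnits μ hu, hD.eq_one_iff_unitExt hμ hu]
  have hop : ∀ t : F, ‖t‖ ≤ (resCard F : ℝ) ^ (-(ε : ℤ)) → f ⟨nOp t, 1⟩ = f ⟨1, 1⟩ := by
    intro t ht
    have := hL.op t (by simpa using ht) 0
    rwa [zero_add, nOp_zero] at this
  have hop' : ∀ t : F, ‖t‖ ≤ (resCard F : ℝ) ^ (-((ε : ℤ) + 1)) → f ⟨nOp t, 1⟩ = f ⟨1, 1⟩ :=
    fun t ht => hop t (ht.trans (hU.zpow_le.2 (by omega)))
  have h0 := hD.rOp_zero_ne_zero h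
  have hϖn : ‖ϖ ^ (-(ε : ℤ))‖ = (resCard F : ℝ) ^ (ε : ℤ) := by rw [hU.norm_zpow, neg_neg]
  have hϖ0 : ϖ ^ (-(ε : ℤ)) ≠ 0 := zpow_ne_zero _ hU.ne_zero
  have h1 : f ⟨1, 1⟩ = torusChar ψ μ (ϖ ^ (-(ε : ℤ))) * f ⟨rOp 0, 1⟩ := by
    have h2 := hD.genuine_rOp hf.2 hϖ0
    rw [hop, hD.level_zball hL hϖn.le] at h2
    · rw [h2, mul_inv_cancel_left₀ (hD.torusChar_ne_zero hϖ0)]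
    · rw [norm_inv, hϖn, ← zpow_neg]
  obtain ⟨t, ht, ht1⟩ := hD.exists_psi_ne_one hκ
  rw [hD.whittaker_eq (hD.continuous_mulShift κ) hf (N := (ε : ℤ) + 1)]
  swap
  · intro k hk
    refine hD.shell_eq_zero_of_far hf.2 one_pos hμ0 hop' (k := k) hk.le (t := t)
      (by rwa [AddChar.mulShift_apply]) ?_
    exact ht.trans (hU.zpow_le.2 (by push_cast; omega))
  have hW : weilIndex ψ ≠ 0 := by
    have := hD.weilRatio_ne_zero one_ne_zero
    rw [weilRatio] at this
    intro h
    rw [h, div_zero] at this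
    exact this rfl
  -- The dilate of ψ by ϖ^(-ε) has conductor 0, so its Weil index is 1.
  have hW1 : weilIndex (ψ.mulShift (ϖ ^ (-(ε : ℤ)))) = 1 := by
    obtain ⟨g, -, hg⟩ := hU.exists_weilIndex_eq hD.cont_ψ hD.ψ_ne hD.cond
    rw [hg _ hϖ0, hU.ord_zpow, add_neg_cancel, if_pos (by simp)]
  set X : ℂ := mulExt μ ϖ with hX
  have hX0 : X ≠ 0 := mulExt_ne_zero μ hU.ne_zero
  set s : ℂ := (((resCard F : ℝ) ^ (1 / 2 : ℝ) : ℝ) : ℂ) with hs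
  have hs2 : s * s = (resCard F : ℂ) := by
    rw [hs, ← Complex.ofReal_mul, ← Real.sqrt_eq_rpow, Real.mul_self_sqrt hU.card_pos.le]
    simp
  have hs0 : s ≠ 0 := fun h => hqC (by rw [← hs2, h, zero_mul])
  have hchi : torusChar ψ μ (ϖ ^ (-(ε : ℤ))) =
      (resCard F : ℂ) ^ (ε : ℤ) * X ^ (-(ε : ℤ)) * weilIndex ψ := by
    rw [torusChar, weilRatio, hW1, hϖn, mulExt_zpow, one_div, inv_inv]
    push_cast
    rfl
  have hball : ∫ x in zball F (ε : ℤ), f ⟨rOp x, 1⟩ * ψ.mulShift κ (-x) ∂haarF F =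
      f ⟨rOp 0, 1⟩ * (resCard F : ℂ) ^ (ε : ℤ) := by
    rw [setIntegral_congr_fun (g := fun x => f ⟨rOp 0, 1⟩ * ψ (-(κ * x))) (measurableSet_zball _),
      integral_const_mul, hD.integral_zball_psi hκ.le]
    intro x hx
    beta_reduce
    rw [hD.level_zball hL (mem_zball.1 hx), AddChar.mulShift_apply, mul_neg]
  have hsphere : ∫ x in zsphere F ((ε : ℤ) + 1), f ⟨rOp x, 1⟩ * ψ.mulShift κ (-x) ∂haarF F =
      f ⟨1, 1⟩ * ((resCard F : ℂ) ^ (-((ε : ℤ) + 1)) * X ^ ((ε : ℤ) + 1) * (weilIndex ψ)⁻¹) *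
        (s * (resCard F : ℂ) ^ (ε : ℤ) * sgnC (leg ϖ κ)) := by
    have := hU.integral_weilIndex hD.cont_ψ hD.ψ_ne hD.cond hκ
    rw [setIntegral_congr_fun (g := fun y => f ⟨1, 1⟩ * ((resCard F : ℂ) ^ (-((ε : ℤ) + 1)) *
      X ^ ((ε : ℤ) + 1) * (weilIndex ψ)⁻¹) * (weilIndex (ψ.mulShift y) * ψ (-(κ * y))))
      (measurableSet_zsphere _), integral_const_mul, this]
    · rfl
    · intro y hy
      have hyn := mem_zsphere.1 hy
      have hy0 : y ≠ 0 := by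
        rw [← norm_pos_iff, hyn]; exact zpow_pos hU.card_pos _
      have hord : ord y = -((ε : ℤ) + 1) := hU.ord_eq (by rw [neg_neg]; exact hyn)
      have hμy : mulExt μ y = (X ^ ((ε : ℤ) + 1))⁻¹ := by
        have h := hμ1 _ (hU.norm_unit_part hy0)
        rw [mulExt_mul, mulExt_zpow, hord, neg_neg] at h
        exact eq_inv_of_mul_eq_one_left h
      beta_reduce
      rw [hD.genuine_rOp hf.2 hy0, hop', AddChar.mulShift_apply, mul_neg, torusChar, weilRatio,
        hyn, hμy, zpow_neg]
      · push_cast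
        rw [mul_inv, mul_inv, inv_inv, inv_inv, div_eq_mul_inv]
        ring
      · rw [norm_inv, hyn, ← zpow_neg]
  rw [hU.setIntegral_zball_succ (hD.continuous_integrand (hD.continuous_mulShift κ) hf),
    add_sub_cancel_right, hball, hsphere, h1, hchi]
  -- The sum of ball and shell factors as a nonzero constant times μ(ϖ) + `leg ϖ κ` √q, using (√q)²
  -- = q and that the sign squares to 1.
  have hfac : f ⟨rOp 0, 1⟩ * (resCard F : ℂ) ^ (ε : ℤ) +
      (resCard F : ℂ) ^ (ε : ℤ) * X ^ (-(ε : ℤ)) * weilIndex ψ * f ⟨rOp 0, 1⟩ *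
        ((resCard F : ℂ) ^ (-((ε : ℤ) + 1)) * X ^ ((ε : ℤ) + 1) * (weilIndex ψ)⁻¹) *
        (s * (resCard F : ℂ) ^ (ε : ℤ) * sgnC (leg ϖ κ)) =
      f ⟨rOp 0, 1⟩ * (resCard F : ℂ) ^ (ε : ℤ) * s⁻¹ * sgnC (leg ϖ κ) *
        (X + sgnC (leg ϖ κ) * s) := by
    have hl := sgnC_mul_self (leg ϖ κ)
    rw [neg_add, zpow_add₀ hqC, zpow_add₀ hX0, zpow_neg, zpow_neg, zpow_neg, zpow_one, zpow_one]
    have hqe := zpow_ne_zero (ε : ℤ) hqC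
    have hXe := zpow_ne_zero (ε : ℤ) hX0
    generalize (resCard F : ℂ) ^ (ε : ℤ) = Q at *
    generalize X ^ (ε : ℤ) = Y at *
    generalize sgnC (leg ϖ κ) = l at *
    rw [← hs2]
    field_simp
    linear_combination -s * hl
  rw [hfac, mul_ne_zero_iff, mul_ne_zero_iff]
  have hl0 := sgnC_ne_zero (leg ϖ κ)
  have hnz : f ⟨rOp 0, 1⟩ * (resCard F : ℂ) ^ (ε : ℤ) * s⁻¹ * sgnC (leg ϖ κ) ≠ 0 :=
    mul_ne_zero (mul_ne_zero (mul_ne_zero h0 (zpow_ne_zero _ hqC)) (inv_ne_zero hs0)) hl0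
  constructor
  · rintro ⟨-, -, h⟩ e
    exact h (by rw [e]; ring)
  · intro h
    exact ⟨hD.torusChar_neg_one_ne_zero, hnz, fun e => h (by linear_combination e)⟩

end IsDatum

end WhittakerOne

/-! ### Cross-nonvanishing for the pairs of vectors on the intermediate cosets -/

section Cross

variable {F : Type*} [NontriviallyNormedField F] [IsUltrametricDist F] [ProperSpace F]
  [MeasurableSpace F] [BorelSpace F]

namespace IsDatum

variable {ϖ : F} {ε : ℕ} {ψ : AddChar F ℂ} {μ : Fˣ →* ℂˣ} {η : unitsInt F →* ℂˣ}
  (hD : IsDatum ϖ ε ψ μ η)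

include hD

section

variable {m j : ℕ} (hj : 0 < j) (hjm : j < m) {t : F}
  (ht : ‖t‖ = (resCard F : ℝ) ^ (-((j : ℤ) + ε))) {f : Mp F → ℂ}
  (h : IsCosetVector ψ μ η ε m (nOp t) f)

include hj hjm ht h

lemma rOp_eq_zero_of_not {y : F} (hy : ¬∃ u : F, ‖u‖ = 1 ∧ y = u ^ 2 * t⁻¹) :
    f ⟨rOp y, 1⟩ = 0 := by
  apply hD.cosetVector_eq_zero h
  rw [hD.unif.mem_doubleCoset_nOp hj hjm ht]
  rintro ⟨u, hu, e⟩
  have ht0 : t ≠ 0 := by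
    rw [← norm_pos_iff, ht]; exact zpow_pos hD.unif.card_pos _
  have hu0 := ne_zero_of_norm_one hu
  refine hy ⟨u⁻¹, by rw [norm_inv, hu, inv_one], ?_⟩
  rw [rOp_10, rOp_11] at e
  field_simp
  linear_combination -e

lemma rOp_inv_ne_zero : f ⟨rOp t⁻¹, 1⟩ ≠ 0 := by
  have ht0 : t ≠ 0 := by
    rw [← norm_pos_iff, ht]; exact zpow_pos hD.unif.card_pos _
  have h1 := hD.cosetVector_ne_zero h
  rw [hD.genuine_nOp (hD.coset_mem h).2 ht0] at h1
  exact right_ne_zero_of_mul h1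

lemma whittaker_nOp_eq (κ : F) : whittaker (ψ.mulShift κ) f =
    torusChar ψ μ (-1) * ∫ y in zball F ((j : ℤ) + ε), f ⟨rOp y, 1⟩ * ψ (-κ * y) ∂haarF F := by
  rw [hD.whittaker_eq (hD.continuous_mulShift κ) (hD.coset_mem h) (N := (j : ℤ) + ε)]
  · simp only [AddChar.mulShift_apply, mul_neg, neg_mul]
  · intro k hk
    rw [setIntegral_congr_fun (g := fun _ => (0 : ℂ)) (measurableSet_zsphere _), integral_zero]
    intro x hx
    beta_reduce
    rw [hD.rOp_eq_zero_of_not hj hjm ht h, zero_mul]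
    rintro ⟨u, hu, rfl⟩
    rw [mem_zsphere, norm_mul, norm_pow, hu, one_pow, one_mul, norm_inv, ht, ← zpow_neg,
      hD.unif.zpow_inj] at hx
    omega

/-- Homogeneity of φ under unit squares passes to its Fourier transform, which is therefore
determined on each sphere by the two square classes. -/
lemma fourier_mul_sq (κ : F) {b : F} (hb : ‖b‖ = 1) :
    unitExt (η * (resUnits μ)⁻¹) b *
      ∫ y in zball F ((j : ℤ) + ε), f ⟨rOp y, 1⟩ * ψ (κ * b ^ 2 * y) ∂haarF F =
      ∫ y in zball F ((j : ℤ) + ε), f ⟨rOp y, 1⟩ * ψ (κ * y) ∂haarF F := by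
  have hb2 : ‖b ^ 2‖ = 1 := by rw [norm_pow, hb, one_pow]
  rw [← setIntegral_unit_mul (measurableSet_zball _) hb2 (zball_unit_mul hb2)
    (fun y => f ⟨rOp y, 1⟩ * ψ (κ * y)), ← integral_const_mul]
  refine integral_congr_ae (Eventually.of_forall fun y => ?_)
  beta_reduce
  rw [(hD.cosetVector_isLevel h).sq b hb, ← mul_assoc κ]
  ring

/-- The Fourier transforms at representatives of the two classes of the right norm do not both
vanish. -/
lemma fourier_ne_zero {i : ℕ} (hi : j = unitCond (η * (resUnits μ)⁻¹) + i) {x : F} (hx : ‖x‖ = 1)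
    (hxs : ¬IsSquare x)
    (h1 : ∫ y in zball F ((j : ℤ) + ε), f ⟨rOp y, 1⟩ * ψ (-ϖ ^ i * y) ∂haarF F = 0)
    (h2 : ∫ y in zball F ((j : ℤ) + ε), f ⟨rOp y, 1⟩ * ψ (-(x * ϖ ^ i) * y) ∂haarF F = 0) :
    False := by
  have hU := hD.unif
  have hL := hD.cosetVector_isLevel h
  have ht0 : t ≠ 0 := by
    rw [← norm_pos_iff, ht]; exact zpow_pos hU.card_pos _
  have hlc : IsLocallyConstant fun y => f ⟨rOp y, 1⟩ := locallyConstant_rOp (hD.coset_mem h).1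
  have hne := hD.rOp_inv_ne_zero hj hjm ht h
  have htn : ‖t⁻¹‖ = (resCard F : ℝ) ^ ((j : ℤ) + ε) := by rw [norm_inv, ht, ← zpow_neg, neg_neg]
  -- If c(α) = 0, then i = j and ψ(-ϖ^i y) is 1 on the support of φ. Since α = 1, φ is constant on
  -- its open support, and the coefficient is a nonzero multiple of a positive volume.
  obtain hc | hc := Nat.eq_zero_or_pos (unitCond (η * (resUnits μ)⁻¹))
  · have hα := (hU.unitCond_eq_zero_iff hD.cont_alpha).1 hc
    set S : Set F := {y | f ⟨rOp y, 1⟩ = f ⟨rOp t⁻¹, 1⟩} with hS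
    have hSo : IsOpen S := hlc.isOpen_fiber _
    have hSm : S ⊆ zball F ((j : ℤ) + ε) := by
      intro y hy
      by_contra hyn
      apply hne
      rw [← show f ⟨rOp y, 1⟩ = f ⟨rOp t⁻¹, 1⟩ from hy]
      apply hD.rOp_eq_zero_of_not hj hjm ht h
      rintro ⟨u, hu, rfl⟩
      apply hyn
      rw [mem_zball, norm_mul, norm_pow, hu, one_pow, one_mul, htn]
    have hpos := measureReal_pos_of_isOpen hSo ⟨t⁻¹, rfl⟩
      ((measure_mono hSm).trans_lt (isCompact_zball _).measure_lt_top).ne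
    rw [setIntegral_congr_fun (g := S.indicator fun _ => f ⟨rOp t⁻¹, 1⟩) (measurableSet_zball _),
      setIntegral_indicator hSo.measurableSet, Set.inter_eq_right.2 hSm, setIntegral_const,
      Complex.real_smul] at h1
    · exact mul_ne_zero (Complex.ofReal_ne_zero.2 hpos.ne') hne h1
    · intro y hy
      have hψ1 : ψ (-ϖ ^ i * y) = 1 := by
        apply hD.psi_eq_one
        rw [norm_mul, norm_neg, hU.norm_pow_eq]
        refine (mul_le_mul_of_nonneg_left (mem_zball.1 hy) (zpow_nonneg hU.card_pos.le _)).trans ?_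
        rw [hD.zpow_mul_zpow, hU.zpow_le]
        omega
      beta_reduce
      rw [hψ1, mul_one]
      by_cases hy1 : ∃ u : F, ‖u‖ = 1 ∧ y = u ^ 2 * t⁻¹
      · obtain ⟨u, hu, rfl⟩ := hy1
        have e : f ⟨rOp (u ^ 2 * t⁻¹), 1⟩ = f ⟨rOp t⁻¹, 1⟩ := by
          rw [hL.sq u hu, hD.eq_one_iff_unitExt hα hu, one_mul]
        rw [Set.indicator_of_mem (show u ^ 2 * t⁻¹ ∈ S from e), e]
      · have e := hD.rOp_eq_zero_of_not hj hjm ht h hy1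
        rw [Set.indicator_of_notMem, e]
        intro hyS
        exact hne ((show f ⟨rOp y, 1⟩ = f ⟨rOp t⁻¹, 1⟩ from hyS).symm.trans e)
  · apply hne
    have hspec := hU.addCond_spec hD.cont_ψ hD.ψ_ne
    rw [hD.cond, neg_neg] at hspec
    have eR : -(i : ℤ) + (ε + i) = ε := by ring
    refine hU.eq_zero_of_fourier hD.cont_ψ hlc.continuous (N := (j : ℤ) + ε) (E := (ε : ℤ) + i)
      (R := -(i : ℤ)) (by omega) (by rw [eR]; exact hspec.1) (by rw [eR]; exact hspec.2)
      (fun κ hκ => ?_) htn.le (fun s hs => ?_)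
    · obtain hlt | heq := hκ.lt_or_eq
      -- For |κ| < q^(-i), take v in 1 + 𝔭^(c(α)-1) with α(v) ≠ 1. Then κ(v² - 1)y has norm at most
      -- q^ε on the support, so the coefficients at κ and κv² agree, although they differ by the
      -- factor α(v).
      · obtain ⟨v, hv, hv1, hv2⟩ := hD.exists_near_of_lt
          (n := unitCond (η * (resUnits μ)⁻¹) - 1) hD.cont_alpha (by omega)
        have e1 : ∫ y in zball F ((j : ℤ) + ε), f ⟨rOp y, 1⟩ * ψ (κ * v ^ 2 * y) ∂haarF F =
            ∫ y in zball F ((j : ℤ) + ε), f ⟨rOp y, 1⟩ * ψ (κ * y) ∂haarF F := by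
          refine setIntegral_congr_fun (measurableSet_zball _) fun y hy => ?_
          have e : κ * v ^ 2 * y = κ * y + κ * (v ^ 2 - 1) * y := by ring
          rw [e, AddChar.map_add_eq_mul, hD.psi_eq_one (x := κ * (v ^ 2 - 1) * y), mul_one]
          rw [hU.norm_lt_zpow] at hlt
          rw [norm_mul, norm_mul]
          refine (mul_le_mul (mul_le_mul hlt (hD.norm_sq_sub_one_le hv hv1) (norm_nonneg _)
            (zpow_nonneg hU.card_pos.le _)) (mem_zball.1 hy) (norm_nonneg _)
            (mul_nonneg (zpow_nonneg hU.card_pos.le _) (zpow_nonneg hU.card_pos.le _))).trans ?_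
          rw [hD.zpow_mul_zpow, hD.zpow_mul_zpow, hU.zpow_le]
          omega
        have e2 := hD.fourier_mul_sq hj hjm ht h κ hv
        rw [e1] at e2
        exact hD.eq_zero_of_eq_mul hv2 e2.symm
      · have hκ0 : -κ ≠ 0 := by
          rw [neg_ne_zero, ← norm_pos_iff, heq]; exact zpow_pos hU.card_pos _
        have hord : ord (-κ) = i := hU.ord_eq (by rw [norm_neg]; exact heq)
        -- For |κ| = q^(-i), -κ lies in the class of ϖ^i or of xϖ^i modulo unit squares, and the
        -- coefficient is a multiple of one of the two assumed zero.
        obtain ⟨u, hu, e⟩ := hU.exists_sq_class hx hxs hκ0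
        rw [hord, zpow_natCast] at e
        have hα := unitExt_ne_zero (η * (resUnits μ)⁻¹) hu
        obtain e | e := e
        · have := hD.fourier_mul_sq hj hjm ht h (-ϖ ^ i) hu
          rw [h1] at this
          have e2 : κ = -ϖ ^ i * u ^ 2 := by linear_combination -e
          rw [e2]
          exact (mul_eq_zero.1 this).resolve_left hα
        · have := hD.fourier_mul_sq hj hjm ht h (-(x * ϖ ^ i)) hu
          rw [h2] at this
          have e2 : κ = -(x * ϖ ^ i) * u ^ 2 := by linear_combination -e
          rw [e2]
          exact (mul_eq_zero.1 this).resolve_left hα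
    -- Adding s with |s| ≤ q^(ε+i) multiplies t⁻¹ by an element of 1 + 𝔭^(c(α)), the square of some
    -- v in the same group, where α is trivial.
    · obtain ⟨v, hv, hv1, hv2⟩ := hU.exists_sq_near hc (x := 1 + s / t⁻¹) (by
        rw [one_add_sub_one_norm, htn, div_le_iff₀ (zpow_pos hU.card_pos _), hD.zpow_mul_zpow]
        exact hs.trans (hU.zpow_le.2 (by omega)))
      rw [← mul_one_add_div (inv_ne_zero ht0), ← hv, mul_comm, hL.sq v hv1,
        (hU.unitCond_le_iff hD.cont_alpha).1 le_rfl v hv1 hv2, one_mul]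

end

/-- Up to nonzero factors the four values are I(-ϖ^i) on the diagonal and I(-xϖ^i) off it, with I
the Fourier transform of the first vector. Every row and column contains both numbers, and at least
one of them is nonzero. -/
lemma crossNonvanishing {m j i : ℕ} (hj : 0 < j) (hjm : j < m)
    (hi : j = unitCond (η * (resUnits μ)⁻¹) + i) {x : F} (hx : ‖x‖ = 1) (hxs : ¬IsSquare x)
    {f₁ f₂ : Mp F → ℂ} (h₁ : IsCosetVector ψ μ η ε m (nOp (ϖ ^ (j + ε))) f₁)
    (h₂ : IsCosetVector ψ μ η ε m (nOp (x * ϖ ^ (j + ε))) f₂) :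
    CrossNonvanishing (ψ.mulShift (ϖ ^ i)) (ψ.mulShift (x * ϖ ^ i)) f₁ f₂ := by
  have hU := hD.unif
  have n₁ := hD.norm_rep_one j
  have n₂ := hD.norm_rep hx j
  set t := ϖ ^ (j + ε) with ht
  have ht0 : t ≠ 0 := pow_ne_zero _ hU.ne_zero
  have hx0 := ne_zero_of_norm_one hx
  have hL₁ := hD.cosetVector_isLevel h₁
  have hL₂ := hD.cosetVector_isLevel h₂
  have ne₁ := hD.rOp_inv_ne_zero hj hjm n₁ h₁
  have ne₂ := hD.rOp_inv_ne_zero hj hjm n₂ h₂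
  set I : F → ℂ := fun κ => ∫ y in zball F ((j : ℤ) + ε), f₁ ⟨rOp y, 1⟩ * ψ (κ * y) ∂haarF F with hI
  set C : ℂ := f₂ ⟨rOp (x * t)⁻¹, 1⟩ * (f₁ ⟨rOp t⁻¹, 1⟩)⁻¹ with hC
  have hC0 : C ≠ 0 := mul_ne_zero ne₂ (inv_ne_zero ne₁)
  -- The supports are the classes of t⁻¹ and (xt)⁻¹ modulo unit squares, and both functions have the
  -- same homogeneity; so one is a multiple of a dilate of the other by x.
  have h12 : ∀ y, f₂ ⟨rOp y, 1⟩ = C * f₁ ⟨rOp (x * y), 1⟩ := by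
    intro y
    by_cases hy : ∃ u : F, ‖u‖ = 1 ∧ y = u ^ 2 * (x * t)⁻¹
    · obtain ⟨u, hu, rfl⟩ := hy
      have e : x * (u ^ 2 * (x * t)⁻¹) = u ^ 2 * t⁻¹ := by field_simp
      rw [e, hL₂.sq u hu, hL₁.sq u hu, hC]
      linear_combination (-(unitExt (η * (resUnits μ)⁻¹) u * f₂ ⟨rOp (x * t)⁻¹, 1⟩)) *
        inv_mul_cancel₀ ne₁
    · rw [hD.rOp_eq_zero_of_not hj hjm n₂ h₂ hy, hD.rOp_eq_zero_of_not hj hjm n₁ h₁, mul_zero]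
      rintro ⟨u, hu, e⟩
      refine hy ⟨u, hu, ?_⟩
      rw [mul_inv, mul_left_comm, ← e, inv_mul_cancel_left₀ hx0]
  have w₁ : ∀ κ, whittaker (ψ.mulShift κ) f₁ = torusChar ψ μ (-1) * I (-κ) := fun κ =>
    hD.whittaker_nOp_eq hj hjm n₁ h₁ κ
  have w₂ : ∀ κ, whittaker (ψ.mulShift (x * κ)) f₂ = torusChar ψ μ (-1) * (C * I (-κ)) := by
    intro κ
    rw [hD.whittaker_nOp_eq hj hjm n₂ h₂]
    congr 1
    simp only [hI]
    rw [← setIntegral_unit_mul (measurableSet_zball _) hx (zball_unit_mul hx)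
      (fun y => f₁ ⟨rOp y, 1⟩ * ψ (-κ * y)), ← integral_const_mul]
    refine integral_congr_ae (Eventually.of_forall fun y => ?_)
    beta_reduce
    have e : -(x * κ) * y = -κ * (x * y) := by ring
    rw [h12, e, mul_assoc]
  have hχ := hD.torusChar_neg_one_ne_zero
  have key : I (-ϖ ^ i) ≠ 0 ∨ I (-(x * ϖ ^ i)) ≠ 0 := by
    by_contra! hcon
    exact hD.fourier_ne_zero hj hjm n₁ h₁ hi hx hxs hcon.1 hcon.2
  have a₁ : whittaker (ψ.mulShift (ϖ ^ i)) f₁ ≠ 0 ↔ I (-ϖ ^ i) ≠ 0 := by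
    rw [w₁]; simp [hχ]
  have b₁ : whittaker (ψ.mulShift (x * ϖ ^ i)) f₁ ≠ 0 ↔ I (-(x * ϖ ^ i)) ≠ 0 := by
    rw [w₁]; simp [hχ]
  have b₂ : whittaker (ψ.mulShift (x * ϖ ^ i)) f₂ ≠ 0 ↔ I (-ϖ ^ i) ≠ 0 := by
    rw [w₂]; simp [hχ, hC0]
  have a₂ : whittaker (ψ.mulShift (ϖ ^ i)) f₂ ≠ 0 ↔ I (-(x * ϖ ^ i)) ≠ 0 := by
    -- Undoing the dilation yields the coefficient at -x⁻¹ϖ^i, which lies in the class of -xϖ^i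
    -- because the two differ by x².
    have e : ϖ ^ i = x * (x⁻¹ * ϖ ^ i) := by field_simp
    have e2 : -(x⁻¹ * ϖ ^ i) * x ^ 2 = -(x * ϖ ^ i) := by field_simp
    have h3 := hD.fourier_mul_sq hj hjm n₁ h₁ (-(x⁻¹ * ϖ ^ i)) hx
    rw [e2] at h3
    have h4 : I (-(x⁻¹ * ϖ ^ i)) = unitExt (η * (resUnits μ)⁻¹) x * I (-(x * ϖ ^ i)) := h3.symm
    rw [e, w₂, h4, ← e]
    simp [hχ, hC0, unitExt_ne_zero (η * (resUnits μ)⁻¹) hx]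
  rw [CrossNonvanishing, a₁, a₂, b₁, b₂]
  exact ⟨key, key, key.symm, key.symm⟩

end IsDatum

end Cross

/-! ### Nonsquare units and identities between characters -/

lemma not_isSquare_coe {F : Type*} [NontriviallyNormedField F] {ξ : unitsInt F}
    (hξ : ¬IsSquare ξ) : ¬IsSquare ((ξ : Fˣ) : F) := by
  rintro ⟨y, hy⟩
  have hn : ‖y‖ = 1 := by
    have h : ‖((ξ : Fˣ) : F)‖ = 1 := ξ.2
    rw [hy, norm_mul, ← sq] at h
    exact (pow_eq_one_iff_of_nonneg (norm_nonneg _) two_ne_zero).1 h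
  obtain ⟨v, rfl⟩ := exists_unit hn
  exact hξ ⟨v, Subtype.ext (Units.ext hy)⟩

lemma IsOddUniformizer.leg_of_not_isSquare {F : Type*} [NontriviallyNormedField F]
    [IsUltrametricDist F] [ProperSpace F] {ϖ : F} (hU : IsOddUniformizer ϖ) {x : F}
    (hx : ‖x‖ = 1) (hxs : ¬IsSquare x) : leg ϖ x = -1 :=
  (Int.units_eq_one_or _).resolve_left fun h => hxs ((hU.leg_unit hx).1 h)

lemma sgnC_neg_one_mul (z : ℂ) : sgnC (-1) * z = -z := by simp [sgnC]

section CharGroup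

variable {G : Type*} [Group G] {η θ : G →* ℂˣ}

lemma mul_inv_eq_one_of_eq (h : η = θ) : η * θ⁻¹ = 1 := by
  subst h; ext u; simp

lemma mul_eq_one_of_sq_eq_one (h : η = θ) (h2 : θ ^ 2 = 1) : η * θ = 1 := by
  subst h; ext u
  have := congrArg Units.val (DFunLike.congr_fun h2 u)
  simpa [sq] using this

lemma eq_inv_of_mul_eq_one (h : η * θ = 1) : η = θ⁻¹ := by
  ext u
  have := DFunLike.congr_fun h u
  simp only [MonoidHom.mul_apply, MonoidHom.one_apply] at this
  simp [eq_inv_of_mul_eq_one_left this]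

lemma mul_inv_mul_mul (η θ : G →* ℂˣ) : η * θ⁻¹ * (η * θ) = η * η := by
  refine MonoidHom.ext fun u => ?_
  simp only [MonoidHom.mul_apply, MonoidHom.inv_apply]
  rw [mul_mul_mul_comm, inv_mul_cancel, mul_one]

end CharGroup

end MetaplecticSL2

/-! ### Assembly of the four cases -/

theorem mainTheorem10 {F : Type*} [NontriviallyNormedField F] [IsUltrametricDist F]
    [ProperSpace F] [CharZero F] [MeasurableSpace F] [BorelSpace F]
    -- the residual characteristic is an odd prime `p`
    (p : ℕ) (hp : p.Prime) (hp_odd : Odd p) (hp_res : ‖(p : F)‖ < 1)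
    -- `ϖ` is a prime element, the norm is normalized, and `ξ` is a non-square unit
    (ϖ : ringInt F) (hϖ : Irreducible ϖ) (hnorm : ‖(ϖ : F)‖ = (resCard F : ℝ)⁻¹)
    (ξ : unitsInt F) (hξ : ¬ IsSquare ξ)
    -- `ψ` is a nontrivial additive character of conductor `-ε`, with `ε = 0` or `1`
    (ε : ℕ) (hε : ε = 0 ∨ ε = 1)
    (ψ : AddChar F ℂ) (hψ : Continuous ψ) (hψ_ne : ψ ≠ 1) (hψ_cond : addCond ψ = -(ε : ℤ))
    -- characters `μ` of `Fˣ` and `η` of the unit group, which agree at `-1`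
    (μ : Fˣ →* ℂˣ) (hμ : Continuous μ) (η : unitsInt F →* ℂˣ) (hη : Continuous η)
    (hημ : η (negOneUnit F) = μ (-1)) :
    -- the limits that define the Whittaker functionals exist
    (∀ Ψ : AddChar F ℂ, Continuous Ψ → Ψ ≠ 1 → ∀ f ∈ principalSeries ψ μ,
      Tendsto (whittakerPartial Ψ f) atTop (𝓝 (whittaker Ψ f))) ∧
    -- (1)
    (unitCond (resUnits μ) = 0 → unitCond η = 0 →
      etaConductor ψ μ η ε = 0 ∧
      IsBasisFor (eqSpace ψ μ η ε 0) ![IsCosetVector ψ μ η ε 0 wMat] ∧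
      IsBasisFor (eqSpace ψ μ η ε 1)
        ![IsCosetVector ψ μ η ε 1 wMat, IsCosetVector ψ μ η ε 1 1] ∧
      IsBasisFor (eqSpace ψ μ η ε 2)
        ![IsCosetVector ψ μ η ε 2 wMat, IsCosetVector ψ μ η ε 2 1,
          IsCosetVector ψ μ η ε 2 (opRep μ η ε ϖ 1 1),
          IsCosetVector ψ μ η ε 2 (opRep μ η ε ϖ ξ 1)] ∧
      (∀ f, IsCosetVector ψ μ η ε 0 wMat f →
        (whittaker ψ f ≠ 0 ↔ ¬ IsHalfTwist μ ((ξ : Fˣ) : F)) ∧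
        (whittaker (ψ.mulShift ((ξ : Fˣ) : F)) f ≠ 0 ↔ ¬ IsHalfTwist μ 1)) ∧
      (∀ f, IsCosetVector ψ μ η ε 1 wMat f →
        whittaker ψ f ≠ 0 ∧ whittaker (ψ.mulShift ((ξ : Fˣ) : F)) f ≠ 0) ∧
      (∀ f, IsCosetVector ψ μ η ε 1 1 f →
        whittaker ψ f ≠ 0 ∧ whittaker (ψ.mulShift ((ξ : Fˣ) : F)) f ≠ 0) ∧
      (∀ f₁ f₂, IsCosetVector ψ μ η ε 2 (opRep μ η ε ϖ 1 1) f₁ →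
        IsCosetVector ψ μ η ε 2 (opRep μ η ε ϖ ξ 1) f₂ →
        CrossNonvanishing (ψ.mulShift (ϖ : F)) (ψ.mulShift (((ξ : Fˣ) : F) * (ϖ : F))) f₁ f₂)) ∧
    -- (2)
    (resUnits μ ≠ 1 → resUnits μ ^ 2 = 1 → η = resUnits μ →
      etaConductor ψ μ η ε = 1 ∧
      IsBasisFor (eqSpace ψ μ η ε 1)
        ![IsCosetVector ψ μ η ε 1 wMat, IsCosetVector ψ μ η ε 1 1] ∧
      -- at level 2 both the vector on the coset of `1` of level 1 and that of level 2 can be used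
      IsBasisFor (eqSpace ψ μ η ε 2)
        ![IsCosetVector ψ μ η ε 2 wMat, IsCosetVector ψ μ η ε 1 1,
          IsCosetVector ψ μ η ε 2 (opRep μ η ε ϖ 1 1),
          IsCosetVector ψ μ η ε 2 (opRep μ η ε ϖ ξ 1)] ∧
      IsBasisFor (eqSpace ψ μ η ε 2)
        ![IsCosetVector ψ μ η ε 2 wMat, IsCosetVector ψ μ η ε 2 1,
          IsCosetVector ψ μ η ε 2 (opRep μ η ε ϖ 1 1),
          IsCosetVector ψ μ η ε 2 (opRep μ η ε ϖ ξ 1)] ∧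
      (∀ f, IsCosetVector ψ μ η ε 1 wMat f →
        whittaker ψ f ≠ 0 ∧ whittaker (ψ.mulShift ((ξ : Fˣ) : F)) f ≠ 0) ∧
      (∀ f, IsCosetVector ψ μ η ε 1 1 f →
        whittaker ψ f ≠ 0 ∧ whittaker (ψ.mulShift ((ξ : Fˣ) : F)) f ≠ 0) ∧
      (∀ f₁ f₂, IsCosetVector ψ μ η ε 2 (opRep μ η ε ϖ 1 1) f₁ →
        IsCosetVector ψ μ η ε 2 (opRep μ η ε ϖ ξ 1) f₂ →
        CrossNonvanishing (ψ.mulShift (ϖ : F)) (ψ.mulShift (((ξ : Fˣ) : F) * (ϖ : F))) f₁ f₂)) ∧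
    -- (3)
    (η = resUnits μ → resUnits μ ≠ (resUnits μ)⁻¹ →
      ∃ M : ℕ, etaConductor ψ μ η ε = M ∧ M = unitCond (resUnits μ) ∧
      IsBasisFor (eqSpace ψ μ η ε M) ![IsCosetVector ψ μ η ε M wMat] ∧
      IsBasisFor (eqSpace ψ μ η ε (M + 1))
        ![IsCosetVector ψ μ η ε (M + 1) wMat,
          IsCosetVector ψ μ η ε (M + 1) (opRep μ η ε ϖ 1 1),
          IsCosetVector ψ μ η ε (M + 1) (opRep μ η ε ϖ ξ 1)] ∧
      (∀ f, IsCosetVector ψ μ η ε M wMat f →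
        whittaker ψ f ≠ 0 ∧ whittaker (ψ.mulShift ((ξ : Fˣ) : F)) f ≠ 0) ∧
      (∀ f₁ f₂, IsCosetVector ψ μ η ε (M + 1) (opRep μ η ε ϖ 1 1) f₁ →
        IsCosetVector ψ μ η ε (M + 1) (opRep μ η ε ϖ ξ 1) f₂ →
        CrossNonvanishing (ψ.mulShift (ϖ : F)) (ψ.mulShift (((ξ : Fˣ) : F) * (ϖ : F))) f₁ f₂)) ∧
    -- (4)
    (0 < unitCond (η * (resUnits μ)⁻¹) →
      unitCond (η * (resUnits μ)⁻¹) ≤ unitCond (η * resUnits μ) →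
      ∃ M : ℕ, etaConductor ψ μ η ε = M ∧
      IsBasisFor (eqSpace ψ μ η ε M)
        ![IsCosetVector ψ μ η ε M (opRep μ η ε ϖ 1 0),
          IsCosetVector ψ μ η ε M (opRep μ η ε ϖ ξ 0)] ∧
      IsBasisFor (eqSpace ψ μ η ε (M + 1))
        ![IsCosetVector ψ μ η ε (M + 1) (opRep μ η ε ϖ 1 0),
          IsCosetVector ψ μ η ε (M + 1) (opRep μ η ε ϖ ξ 0),
          IsCosetVector ψ μ η ε (M + 1) (opRep μ η ε ϖ 1 1),
          IsCosetVector ψ μ η ε (M + 1) (opRep μ η ε ϖ ξ 1)] ∧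
      (∀ i : ℕ, i ≤ 1 →
        ∀ f₁ f₂, IsCosetVector ψ μ η ε (M + i) (opRep μ η ε ϖ 1 i) f₁ →
          IsCosetVector ψ μ η ε (M + i) (opRep μ η ε ϖ ξ i) f₂ →
          CrossNonvanishing (ψ.mulShift ((ϖ : F) ^ i))
            (ψ.mulShift (((ξ : Fˣ) : F) * (ϖ : F) ^ i)) f₁ f₂)) := by
  have hU : IsOddUniformizer (ϖ : F) :=
    isOddUniformizer_of_irreducible p hp_odd hp_res ϖ hϖ hnorm
  have hD : IsDatum (ϖ : F) ε ψ μ η := by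
    refine ⟨hU, hψ, hψ_ne, hψ_cond, hμ, hη, ?_⟩
    have e1 := unitExt_coe η (negOneUnit F)
    have e2 := mulExt_coe μ (-1)
    rw [hημ, ← e2] at e1
    simpa [negOneUnit] using e1
  have hx : ‖((ξ : Fˣ) : F)‖ = 1 := ξ.2
  have hxs : ¬IsSquare ((ξ : Fˣ) : F) := not_isSquare_coe hξ
  have hθ : Continuous (resUnits μ) := continuous_resUnits hμ
  have r1 : ∀ i, opRep μ η ε ϖ 1 i =
      nOp ((ϖ : F) ^ (unitCond (η * (resUnits μ)⁻¹) + i + ε)) := fun i => by simp [opRep]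
  have rx : ∀ i, opRep μ η ε ϖ ξ i =
      nOp (((ξ : Fˣ) : F) * (ϖ : F) ^ (unitCond (η * (resUnits μ)⁻¹) + i + ε)) := fun i => rfl
  have hw : ∀ {m : ℕ}, 0 < m → ∀ f, IsCosetVector ψ μ η ε m wMat f →
      whittaker ψ f ≠ 0 ∧ whittaker (ψ.mulShift ((ξ : Fˣ) : F)) f ≠ 0 := fun hm f h =>
    ⟨by simpa using hD.whittaker_wMat_ne_zero hm h norm_one, hD.whittaker_wMat_ne_zero hm h hx⟩
  have h1 : unitCond (resUnits μ) ≤ 1 → ∀ f, IsCosetVector ψ μ η ε 1 1 f →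
      whittaker ψ f ≠ 0 ∧ whittaker (ψ.mulShift ((ξ : Fˣ) : F)) f ≠ 0 := fun hμ1 f h =>
    ⟨by simpa using hD.whittaker_one_ne_zero hμ1 h norm_one, hD.whittaker_one_ne_zero hμ1 h hx⟩
  have hcross : ∀ {m i : ℕ}, 0 < unitCond (η * (resUnits μ)⁻¹) + i →
      unitCond (η * (resUnits μ)⁻¹) + i < m → ∀ f₁ f₂,
      IsCosetVector ψ μ η ε m (opRep μ η ε ϖ 1 i) f₁ →
      IsCosetVector ψ μ η ε m (opRep μ η ε ϖ ξ i) f₂ →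
      CrossNonvanishing (ψ.mulShift ((ϖ : F) ^ i)) (ψ.mulShift (((ξ : Fˣ) : F) * (ϖ : F) ^ i))
        f₁ f₂ := by
    intro m i hj hjm f₁ f₂ h₁ h₂
    rw [r1] at h₁
    rw [rx] at h₂
    exact hD.crossNonvanishing hj hjm rfl hx hxs h₁ h₂
  have hcross1 : ∀ {m : ℕ}, 1 < m → η * (resUnits μ)⁻¹ = 1 → ∀ f₁ f₂,
      IsCosetVector ψ μ η ε m (opRep μ η ε ϖ 1 1) f₁ →
      IsCosetVector ψ μ η ε m (opRep μ η ε ϖ ξ 1) f₂ →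
      CrossNonvanishing (ψ.mulShift (ϖ : F)) (ψ.mulShift (((ξ : Fˣ) : F) * (ϖ : F))) f₁ f₂ := by
    intro m hm hα
    have := hcross (m := m) (i := 1)
    rw [(hU.unitCond_eq_zero_iff hD.cont_alpha).2 hα, zero_add, pow_one] at this
    exact this one_pos hm
  have hrep : η * (resUnits μ)⁻¹ = 1 → opRep μ η ε ϖ 1 1 = nOp ((ϖ : F) ^ (1 + ε)) ∧
      opRep μ η ε ϖ ξ 1 = nOp (((ξ : Fˣ) : F) * (ϖ : F) ^ (1 + ε)) := by
    intro hα
    rw [r1, rx, (hU.unitCond_eq_zero_iff hD.cont_alpha).2 hα, zero_add]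
    exact ⟨rfl, rfl⟩
  have hM : ∀ {M : ℕ} {x : SL(2, F)}, (∃ f, IsCosetVector ψ μ η ε M x f) →
      (∀ m < M, eqSpace ψ μ η ε m = ⊥) → etaConductor ψ μ η ε = M := fun ⟨f, hf⟩ h' =>
    hD.etaConductor_eq ⟨f, hf.1, hf.2.1⟩ h'
  refine ⟨fun Ψ hΨ hΨ1 f hf => hD.exists_whittaker hΨ hΨ1 hf, fun hμ0 hη0 => ?_,
    fun hne hsq hηθ => ?_, fun hηθ hne => ?_, fun hα hαβ => ?_⟩
  · have hμ1 := (hU.unitCond_eq_zero_iff hθ).1 hμ0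
    have hη1 := (hU.unitCond_eq_zero_iff hη).1 hη0
    have hα : η * (resUnits μ)⁻¹ = 1 := mul_inv_eq_one_of_eq (hη1.trans hμ1.symm)
    have hβ : η * resUnits μ = 1 := mul_eq_one_of_sq_eq_one (hη1.trans hμ1.symm) (by
      rw [hμ1]; ext u; simp)
    have e := hrep hα
    rw [e.1, e.2]
    refine ⟨mod_cast hM (hD.exists_cosetVector_zero hη1 hμ1) fun m hm => absurd hm m.not_lt_zero,
      hD.isBasisFor_zero hx hxs hη1 hμ1, hD.isBasisFor_w_one hx hxs (by omega) hα (by omega) hβ,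
      hD.isBasisFor_w_one_nOp hx hxs (by omega) hα (by omega) hβ two_pos le_rfl,
      fun f h => ⟨?_, ?_⟩, hw one_pos, h1 (by omega), ?_⟩
    -- The value vanishes when μ(ϖ) = -`leg ϖ κ` √q. Because of the minus sign, and since `leg` is
    -- -1 at ξ, κ = 1 is matched with the twist by ξ and κ = ξ with the trivial one.
    · have h3 := hD.whittaker_zero_ne_zero_iff hμ1 h norm_one
      rw [AddChar.mulShift_one] at h3
      rw [h3, hD.isHalfTwist_iff hμ1 hx, hU.leg_one, hU.leg_of_not_isSquare hx hxs, sgnC_neg_one_mul, sgnC_one, neg_mul, one_mul]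
    · rw [hD.whittaker_zero_ne_zero_iff hμ1 h hx, hD.isHalfTwist_iff hμ1 norm_one, hU.leg_one,
        hU.leg_of_not_isSquare hx hxs, neg_mul, sgnC_neg_one_mul, neg_neg, sgnC_one, one_mul]
    · have := hcross1 (m := 2) one_lt_two hα
      rwa [e.1, e.2] at this
  · have hα : η * (resUnits μ)⁻¹ = 1 := mul_inv_eq_one_of_eq hηθ
    have hβ : η * resUnits μ = 1 := mul_eq_one_of_sq_eq_one hηθ hsq
    have hμ1 : unitCond (resUnits μ) ≤ 1 := by
      apply hU.unitCond_le_of_mul_self hθ one_pos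
      rw [mul_eq_one_of_sq_eq_one rfl hsq, (hU.unitCond_eq_zero_iff continuous_one).2 rfl]
      exact zero_le_one
    have hη1 : unitCond η ≤ 1 := hηθ ▸ hμ1
    have hη0 : unitCond η ≠ 0 := fun h0 => hne (hηθ ▸ (hU.unitCond_eq_zero_iff hη).1 h0)
    have e := hrep hα
    rw [e.1, e.2]
    refine ⟨mod_cast hM (hD.exists_cosetVector_wMat one_pos hη1 hα hμ1) fun m hm =>
        hD.eqSpace_of_lt (by omega),
      hD.isBasisFor_w_one hx hxs hη1 hα hμ1 hβ,
      hD.isBasisFor_w_one_nOp hx hxs hη1 hα hμ1 hβ one_pos one_le_two,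
      hD.isBasisFor_w_one_nOp hx hxs hη1 hα hμ1 hβ two_pos le_rfl, hw one_pos, h1 hμ1, ?_⟩
    have := hcross1 (m := 2) one_lt_two hα
    rwa [e.1, e.2] at this
  · have hα : η * (resUnits μ)⁻¹ = 1 := mul_inv_eq_one_of_eq hηθ
    have hβ : η * resUnits μ ≠ 1 := fun h =>
      hne (hηθ.symm.trans (eq_inv_of_mul_eq_one h))
    have hβ0 : unitCond (η * resUnits μ) ≠ 0 := fun h =>
      hβ ((hU.unitCond_eq_zero_iff hD.cont_beta).1 h)
    have hle : unitCond (η * resUnits μ) ≤ unitCond (resUnits μ) :=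
      hU.unitCond_mul_le hη hθ (by rw [hηθ]) le_rfl
    -- Here β = μ² on units, and squaring preserves positive conductors, so that c(β) = c(μ).
    have hge : unitCond (resUnits μ) ≤ unitCond (η * resUnits μ) :=
      hU.unitCond_le_of_mul_self hθ (Nat.pos_of_ne_zero hβ0) (by rw [hηθ])
    have hη1 : unitCond η = unitCond (resUnits μ) := by rw [hηθ]
    have hpos : 0 < unitCond (resUnits μ) := by omega
    have e := hrep hα
    refine ⟨unitCond (resUnits μ), hM (hD.exists_cosetVector_wMat hpos hη1.le hα le_rfl)
        fun m hm => hD.eqSpace_of_lt (by omega), rfl,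
      hD.isBasisFor_w hx hxs hpos hη1.le hα le_rfl hβ hge, ?_, hw hpos,
      hcross1 (by omega) hα⟩
    rw [e.1, e.2]
    exact hD.isBasisFor_w_nOp hx hxs hpos hη1.le hα le_rfl hβ (le_antisymm hge hle)
  · have hβ : 0 < unitCond (η * resUnits μ) := hα.trans_le hαβ
    -- Since αβ = η², the conductor of η is bounded by those of α and β, and hence by M = c(α) +
    -- c(β), the least m for which some j satisfies c(α) ≤ j ≤ m - c(β).
    have hη1 : unitCond η ≤ unitCond (η * (resUnits μ)⁻¹) + unitCond (η * resUnits μ) := by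
      apply hU.unitCond_le_of_mul_self hη (by omega)
      rw [← mul_inv_mul_mul η (resUnits μ)]
      exact hU.unitCond_mul_le hD.cont_alpha hD.cont_beta (by omega) (by omega)
    refine ⟨unitCond (η * (resUnits μ)⁻¹) + unitCond (η * resUnits μ),
      hM (hD.exists_cosetVector_nOp hα (by omega) hη1 le_rfl le_rfl (hD.norm_rep_one _))
        fun m hm => hD.eqSpace_eq_bot hx hxs hα hβ hm, ?_, ?_,
      fun i _ => hcross (by omega) (by omega)⟩
    · rw [r1, rx, add_zero]
      exact hD.isBasisFor_nOp hx hxs hη1 hα rfl hβ rfl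
    · rw [r1, rx, r1, rx, add_zero]
      exact hD.isBasisFor_nOp_nOp hx hxs hη1 hα rfl hβ rfl
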